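/- All polygons are in the Euclidean plane. A quadrilateral is \emph{nice} if all four of its interior angles lie in $[60^\circ,120^\circ]$; its \emph{eccentricity} $\mathcal E(Q)$ is the length of its longest side divided by the length of its shortest side. A \emph{nice mesh} of a simple polygon $P$ (including its interior) is a planar straight line graph $\Gamma$ that contains $P$, has all vertices of $P$ among its vertices, is contained in the union of $P$ and its interior, and each of whose bounded complementary components (its \emph{elements}) is the interior of a nice quadrilateral whose four corners are the only vertices of $\Gamma$ on its boundary. It \emph{extends} $P$ if the only vertices of $\Gamma$ on $P$ are the vertices of $P$. A simple polygon $P$ is a \emph{sink} if, whenever an even number of new vertices is added to the edges of $P$ to form a polygon $P'$, there is a nice mesh that extends $P'$. There is an absolute constant $C>0$ such that the following holds for every nice quadrilateral $Q$. One can add $N\le C\,\mathcal E(Q)$ vertices to the sides of $Q$ so that the resulting polygon $Q'$ is a sink. Moreover, if $M$ further vertices are added to the edges of $Q'$, where $M\ge 0$ is even, giving a polygon $Q''$, then there is a nice mesh that extends $Q''$ and has at most $C(N+M^2)$ elements; more precisely, whenever $M_1,M_2\ge 1$ are integers such that at most $M_1$ of the $M$ further vertices lie on one pair of opposite sides of $Q$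 and at most $M_2$ lie on the other pair, the number of elements of this mesh is at most $C(N+M_1M_2)$. -/

import Mathlib

open Set EuclideanGeometry

namespace SinkMesh

/-- The `i`-th open edge of the closed polygon with vertices `z 0, …, z (n-1)`: the open segment
from `z i` to the cyclically next vertex. -/
def polyEdge {n : ℕ} (z : Fin n → ℂ) (i : Fin n) : Set ℂ :=
  openSegment ℝ (z i) (z (finRotate n i))

/-- The polygon as a subset of the plane: all vertices and all open edges. -/
def polyCurve {n : ℕ} (z : Fin n → ℂ) : Set ℂ :=
  range z ∪ ⋃ i, polyEdge z i

/-- Simple polygons: distinct vertices, pairwise disjoint open edges, and no vertex lies on an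
open edge. -/
structure IsSimplePolygon {n : ℕ} (z : Fin n → ℂ) : Prop where
  three_le : 3 ≤ n
  injective : Function.Injective z
  edges_disjoint : ∀ i j, i ≠ j → Disjoint (polyEdge z i) (polyEdge z j)
  vertex_notMem_edge : ∀ i j, z i ∉ polyEdge z j

/-- The bounded connected components of the complement of `K`. -/
def boundedComponents (K : Set ℂ) : Set (Set ℂ) :=
  {F | (∃ x ∈ Kᶜ, F = connectedComponentIn Kᶜ x) ∧ Bornology.IsBounded F}

/-- The interior of a simple polygon (by the Jordan curve theorem, the union has one member). -/
def polyInterior {n : ℕ} (z : Fin n → ℂ) : Set ℂ :=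
  ⋃₀ boundedComponents (polyCurve z)

/-- The polynomial hull: `K` together with all bounded components of its complement. -/
def polynomialHull (K : Set ℂ) : Set ℂ :=
  K ∪ ⋃₀ boundedComponents K

/-- `w` is a simple polygon obtained from `z` by adding vertices on the edges of `z`.
For `z : Fin n → ℂ` and `w : Fin (n + k) → ℂ`, exactly `k` vertices are added. -/
structure AddsVertices {n m : ℕ} (z : Fin n → ℂ) (w : Fin m → ℂ) : Prop where
  simple : IsSimplePolygon w
  curve_eq : polyCurve w = polyCurve z
  subset : range z ⊆ range w

/-- A nice quadrilateral: all angles lie between `60°` and `120°`. The angles `∠` are unoriented;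
since the interior angles of a simple quadrilateral sum to `360°`, these bounds at all
four vertices exclude a reflex interior angle (it would be at least `240°`, the others at least
`60°`), so the quadrilateral is convex and the `∠` are its interior angles. -/
structure IsNiceQuad (q : Fin 4 → ℂ) : Prop where
  simple : IsSimplePolygon q
  angle_mem : ∀ i, ∠ (q i) (q (i + 1)) (q (i + 2)) ∈ Icc (Real.pi / 3) (2 * Real.pi / 3)

/-- Longest side length divided by shortest side length. -/
noncomputable def eccentricity (q : Fin 4 → ℂ) : ℝ :=
  (⨆ i, dist (q i) (q (i + 1))) / (⨅ i, dist (q i) (q (i + 1)))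

/-- A planar straight line graph: a finite set of vertices and a finite set of pairwise disjoint
open segments (given by their endpoints) that end at vertices and contain no vertex. -/
structure PSLG where
  verts : Finset ℂ
  edges : Finset (ℂ × ℂ)
  edge_ne : ∀ e ∈ edges, e.1 ≠ e.2
  left_mem : ∀ e ∈ edges, e.1 ∈ verts
  right_mem : ∀ e ∈ edges, e.2 ∈ verts
  vert_notMem_edge : ∀ e ∈ edges, ∀ v ∈ verts, v ∉ openSegment ℝ e.1 e.2
  edges_disjoint : ∀ e ∈ edges, ∀ f ∈ edges, e ≠ f →
    Disjoint (openSegment ℝ e.1 e.2) (openSegment ℝ f.1 f.2)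

/-- The compact planar set underlying a PSLG. -/
def PSLG.carrier (Γ : PSLG) : Set ℂ :=
  (Γ.verts : Set ℂ) ∪ ⋃ e ∈ Γ.edges, openSegment ℝ e.1 e.2

/-- The faces of a PSLG: the bounded complementary components. -/
def PSLG.faces (Γ : PSLG) : Set (Set ℂ) :=
  boundedComponents Γ.carrier

/-- `Γ` is a mesh of the polygon `w` by nice quadrilaterals: it refines `w`, stays in the
polynomial hull of `w`, and every face is the interior of a nice quadrilateral, the only vertices
of `Γ` on the boundary of the face being the four corners. -/
structure PSLG.IsNiceQuadMesh (Γ : PSLG) {n : ℕ} (w : Fin n → ℂ) : Prop where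
  verts_subset : range w ⊆ (Γ.verts : Set ℂ)
  curve_subset : polyCurve w ⊆ Γ.carrier
  carrier_subset : Γ.carrier ⊆ polynomialHull (polyCurve w)
  faces_nice : ∀ F ∈ Γ.faces, ∃ q : Fin 4 → ℂ, IsNiceQuad q ∧ polyInterior q = F ∧
    (Γ.verts : Set ℂ) ∩ polyCurve q = range q

/-- `Γ` has no vertices on the polygon `w` other than those of `w`. -/
def PSLG.Extends (Γ : PSLG) {n : ℕ} (w : Fin n → ℂ) : Prop :=
  (Γ.verts : Set ℂ) ∩ polyCurve w = range w

/-- A sink: however an even number of vertices is added to the edges, the resulting polygon is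
extended by a nice quadrilateral mesh of its interior. -/
def IsSink {n : ℕ} (z : Fin n → ℂ) : Prop :=
  IsSimplePolygon z ∧ ∀ (k : ℕ) (w : Fin (n + k) → ℂ), Even k → AddsVertices z w →
    ∃ Γ : PSLG, Γ.IsNiceQuadMesh w ∧ Γ.Extends w

/-- The vertices of `w` that are not vertices of `z` and lie on the `i`-th or the `j`-th side
of `q`. -/
def addedOnSides {n m : ℕ} (q : Fin 4 → ℂ) (z : Fin n → ℂ) (w : Fin m → ℂ) (i j : Fin 4) :
    Set ℂ :=
  (range w \ range z) ∩ (polyEdge q i ∪ polyEdge q j)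

end SinkMesh

open SinkMesh

/-! Parity turns out to be the only obstruction to extending a subdivided boundary, as soon as the
boundary carries enough prescribed vertices. Sinks are built from explicit gadgets and then glued.

The basic gadget is a square whose sides may have any numbers of edges, each at least 7 and with
even sum, provided that the vertices sit in standard positions (`RM.core`). Next to each of its
sides lies half of a regular hexagon, cut into four smaller half hexagons: strips of quadrilaterals
that enter at one end of the side are folded back and leave at the other end (`QS.fold`). This
reduces the side to one or two free edges. If opposite sides still disagree, a single strip turning
a corner repairs this (`RM.turn`, `RM.center`).

Standard positions are reached by moving points. Two segments make a nice angle if their deviations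
from the two axes add up to at most 30° (`niceDir_of_slopes`). Hence in a strip about five times as
long as wide, any subdivision of one end can be joined to any other one of the same size at the
opposite end (`QS.connector`). A trapezoid with two vertical sides is crossed by a column and a row
of such squares. The four blocks that remain connect groups of points on the sides to these squares.
A group is short compared with a block, so all segments of a block stay nearly parallel to the axes
or to the base, and two crossing families of them cut the block into nice pieces (`QM.block`,
`QS.trap`). Thus the trapezoid is a sink with controlled cost: the number of elements is at most a
constant times the product of the numbers of vertices on the two pairs of opposite sides (`CSink`,
`CSink.trap`).

Sinks can be glued, because the common side of two pieces can be given a subdivision of bounded size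
that refines both requirements and has the parity needed (`exists_parity`). A parallelogram with
comparable sides and angles between 60° and 120° can be rotated so that its sides are within about
15° of the axes. It then splits into a central square, four trapezoids and four nice corner pieces
(`CSink.cross`). Small perturbations are harmless, and a sufficiently fine grid cuts a nice
quadrilateral into almost parallelograms, so bounded eccentricity gives sinks with a uniform
constant (`CSink.of_bounded_eccentricity`).

A general nice quadrilateral is sliced across its long direction into pieces of bounded
eccentricity; their number is linear in the eccentricity (`exists_chain`). The interfaces of the
chain have boundedly many vertices. Therefore additional vertices on the long sides are charged to
the slices that they meet, and those on the two end sides only to the first and the last slice. With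
`a` and `b` additional vertices on the two pairs of sides this costs a constant times `N + (1 + a)
(1 + b)`.

All of this is done with tilings by convex quadrilaterals. They are turned into planar straight line
graphs at the end (`boundedComponents_tiling`, `IsMesh.exists_pslg`), using that nice quadrilaterals
are convex (`IsNiceQuad.nq_or_nq`). -/

namespace SinkMesh

/-! ### Signed areas and strictly convex quadrilaterals. -/

/-- Cross product of plane vectors. -/
def cr (x y : ℂ) : ℝ := x.re * y.im - x.im * y.re

/-- Dot product of plane vectors. -/
def dt (x y : ℂ) : ℝ := x.re * y.re + x.im * y.im

/-- Position of `z` relative to the oriented line through `p` and `q`: positive on the left. -/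
def el (p q z : ℂ) : ℝ := cr (q - p) (z - p)

lemma el_def (p q z : ℂ) :
    el p q z = (q.re - p.re) * (z.im - p.im) - (q.im - p.im) * (z.re - p.re) := by
  simp [el, cr]

lemma el_rot (p q z : ℂ) : el p q z = el q z p := by
  simp only [el_def]; ring

lemma el_swap (p q z : ℂ) : el q p z = -el p q z := by
  simp only [el_def]; ring

lemma el_self_left (p q : ℂ) : el p q p = 0 := by simp only [el_def]; ring
lemma el_self_right (p q : ℂ) : el p q q = 0 := by simp only [el_def]; ring

lemma el_comb (p q x y : ℂ) (a b : ℝ) (h : a + b = 1) :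
    el p q (a • x + b • y) = a * el p q x + b * el p q y := by
  obtain rfl : b = 1 - a := by linarith
  simp only [el_def, Complex.add_re, Complex.add_im, Complex.smul_re, Complex.smul_im, smul_eq_mul]
  ring

lemma el_add_smul (p q z v : ℂ) (t : ℝ) : el p q (z + t • v) = el p q z + t * cr (q - p) v := by
  simp only [el_def, cr, Complex.add_re, Complex.add_im, Complex.smul_re, Complex.smul_im,
    smul_eq_mul, Complex.sub_re, Complex.sub_im]
  ring

lemma continuous_el (p q : ℂ) : Continuous (el p q) := by
  have : el p q = fun z : ℂ =>
      (q.re - p.re) * (z.im - p.im) - (q.im - p.im) * (z.re - p.re) := funext (el_def p q)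
  rw [this]; fun_prop

/-- The intersection of the left half-planes of the four sides of a quadrilateral. -/
def quad (p₀ p₁ p₂ p₃ : ℂ) : Set ℂ :=
  {z | 0 ≤ el p₀ p₁ z ∧ 0 ≤ el p₁ p₂ z ∧ 0 ≤ el p₂ p₃ z ∧ 0 ≤ el p₃ p₀ z}

/-- Strictly convex, positively oriented quadrilaterals. -/
structure Ccw (p₀ p₁ p₂ p₃ : ℂ) : Prop where
  c₀ : 0 < el p₀ p₁ p₂
  c₁ : 0 < el p₁ p₂ p₃
  c₂ : 0 < el p₂ p₃ p₀
  c₃ : 0 < el p₃ p₀ p₁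

lemma Ccw.rot {p₀ p₁ p₂ p₃ : ℂ} (h : Ccw p₀ p₁ p₂ p₃) : Ccw p₁ p₂ p₃ p₀ :=
  ⟨h.c₁, h.c₂, h.c₃, h.c₀⟩

lemma quad_rot (p₀ p₁ p₂ p₃ : ℂ) : quad p₁ p₂ p₃ p₀ = quad p₀ p₁ p₂ p₃ := by
  ext z; simp only [quad, mem_ofPred_eq]; tauto

lemma convex_quad (p₀ p₁ p₂ p₃ : ℂ) : Convex ℝ (quad p₀ p₁ p₂ p₃) := by
  rintro x ⟨h0, h1, h2, h3⟩ y ⟨k0, k1, k2, k3⟩ a b ha hb hab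
  refine ⟨?_, ?_, ?_, ?_⟩ <;> rw [el_comb _ _ _ _ _ _ hab] <;> positivity

lemma isClosed_quad (p₀ p₁ p₂ p₃ : ℂ) : IsClosed (quad p₀ p₁ p₂ p₃) := by
  have h : ∀ p q : ℂ, IsClosed {z | 0 ≤ el p q z} := fun p q =>
    isClosed_le continuous_const (continuous_el p q)
  exact (h _ _).inter ((h _ _).inter ((h _ _).inter (h _ _)))

namespace Ccw
variable {p₀ p₁ p₂ p₃ : ℂ}

lemma mem₀ (h : Ccw p₀ p₁ p₂ p₃) : p₀ ∈ quad p₀ p₁ p₂ p₃ :=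
  ⟨(el_self_left _ _).ge, by rw [← el_rot]; exact h.c₀.le, h.c₂.le, (el_self_right _ _).ge⟩

lemma mem₁ (h : Ccw p₀ p₁ p₂ p₃) : p₁ ∈ quad p₀ p₁ p₂ p₃ := by
  rw [← quad_rot]; exact h.rot.mem₀

lemma mem₂ (h : Ccw p₀ p₁ p₂ p₃) : p₂ ∈ quad p₀ p₁ p₂ p₃ := by
  rw [← quad_rot]; exact h.rot.mem₁

lemma mem₃ (h : Ccw p₀ p₁ p₂ p₃) : p₃ ∈ quad p₀ p₁ p₂ p₃ := by
  rw [← quad_rot]; exact h.rot.mem₂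

end Ccw

/-- Cramer's rule: barycentric coordinates are quotients of signed areas. -/
lemma bary_eq {p q r z : ℂ} (h : el p q r ≠ 0) :
    z = (el q r z / el p q r) • p + (el r p z / el p q r) • q + (el p q z / el p q r) • r := by
  have e1 : el q r z * p.re + el r p z * q.re + el p q z * r.re = z.re * el p q r := by
    simp only [el_def]; ring
  have e2 : el q r z * p.im + el r p z * q.im + el p q z * r.im = z.im * el p q r := by
    simp only [el_def]; ring
  apply Complex.ext
  · simp only [Complex.add_re, Complex.smul_re, smul_eq_mul]; field_simp; linarith
  · simp only [Complex.add_im, Complex.smul_im, smul_eq_mul]; field_simp; linarith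

lemma bary_sum {p q r z : ℂ} (h : el p q r ≠ 0) :
    el q r z / el p q r + el r p z / el p q r + el p q z / el p q r = 1 := by
  have : el q r z + el r p z + el p q z = el p q r := by simp only [el_def]; ring
  field_simp; linarith

lemma mem_of_triangle {s : Set ℂ} (hs : Convex ℝ s) {p q r z : ℂ} (hp : p ∈ s) (hq : q ∈ s)
    (hr : r ∈ s) (h : 0 < el p q r) (h1 : 0 ≤ el q r z) (h2 : 0 ≤ el r p z) (h3 : 0 ≤ el p q z) :
    z ∈ s := by
  rw [bary_eq (z := z) h.ne']
  have := bary_sum (z := z) h.ne'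
  have key := hs.sum_mem (t := (Finset.univ : Finset (Fin 3)))
    (w := ![el q r z / el p q r, el r p z / el p q r, el p q z / el p q r]) (z := ![p, q, r])
    (by intro i _; fin_cases i <;> simp <;> positivity)
    (by simp [Fin.sum_univ_three]; linarith)
    (by intro i _; fin_cases i <;> simpa)
  simpa [Fin.sum_univ_three] using key

/-- The diagonal through `p₀` and `p₂` splits the quadrilateral into two triangles; a point lies in
the one on its own side of the diagonal, where its barycentric coordinates are nonnegative. -/
lemma quad_subset_of_convex {p₀ p₁ p₂ p₃ : ℂ} (h : Ccw p₀ p₁ p₂ p₃) {s : Set ℂ} (hs : Convex ℝ s)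
    (h0 : p₀ ∈ s) (h1 : p₁ ∈ s) (h2 : p₂ ∈ s) (h3 : p₃ ∈ s) : quad p₀ p₁ p₂ p₃ ⊆ s := by
  rintro z ⟨z0, z1, z2, z3⟩
  rcases le_total (el p₂ p₀ z) 0 with hz | hz
  · refine mem_of_triangle hs h2 h3 h0 h.c₂ z3 ?_ z2
    rw [el_swap]; linarith
  · exact mem_of_triangle hs h0 h1 h2 h.c₀ z1 hz z0

lemma quad_eq_convexHull {p₀ p₁ p₂ p₃ : ℂ} (h : Ccw p₀ p₁ p₂ p₃) :
    quad p₀ p₁ p₂ p₃ = convexHull ℝ {p₀, p₁, p₂, p₃} := by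
  apply Subset.antisymm
  · apply quad_subset_of_convex h (convex_convexHull ℝ _) <;>
      exact subset_convexHull ℝ _ (by simp)
  · apply convexHull_min _ (convex_quad _ _ _ _)
    rintro z (rfl | rfl | rfl | rfl)
    exacts [h.mem₀, h.mem₁, h.mem₂, h.mem₃]

lemma isCompact_quad {p₀ p₁ p₂ p₃ : ℂ} (h : Ccw p₀ p₁ p₂ p₃) : IsCompact (quad p₀ p₁ p₂ p₃) := by
  rw [quad_eq_convexHull h]
  exact Set.Finite.isCompact_convexHull ℝ (by simp)

lemma Ccw.ne {p₀ p₁ p₂ p₃ : ℂ} (h : Ccw p₀ p₁ p₂ p₃) : p₀ ≠ p₁ := by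
  rintro rfl; have := h.c₀; simp [el_def] at this

/-- The open quadrilateral. -/
lemma interior_quad {p₀ p₁ p₂ p₃ : ℂ} (h : Ccw p₀ p₁ p₂ p₃) : interior (quad p₀ p₁ p₂ p₃) =
    {z | 0 < el p₀ p₁ z ∧ 0 < el p₁ p₂ z ∧ 0 < el p₂ p₃ z ∧ 0 < el p₃ p₀ z} := by
  have aux : ∀ p q : ℂ, p ≠ q → interior {z | 0 ≤ el p q z} ⊆ {z | 0 < el p q z} := by
    intro p q hpq z hz
    have hz0 : z ∈ {z | 0 ≤ el p q z} := interior_subset hz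
    replace hz0 : 0 ≤ el p q z := hz0
    rcases hz0.lt_or_eq with h | h
    · exact h
    exfalso
    -- A point on the line is not interior to the half-plane: moving it perpendicularly to the right
    -- makes `el p q` negative at once.
    have hc : Filter.Tendsto (fun t : ℝ => z + t • (Complex.I * (q - p))) (nhds 0)
        (nhds (z + (0:ℝ) • (Complex.I * (q - p)))) := by
      apply Continuous.tendsto; fun_prop
    simp only [zero_smul, add_zero] at hc
    have hev := hc.eventually (mem_interior_iff_mem_nhds.1 hz)
    obtain ⟨ε, hε, hb⟩ := Metric.eventually_nhds_iff.1 hev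
    have := hb (y := -(ε / 2)) (by simp [abs_of_pos hε]; linarith)
    simp only [el_add_smul, ← h] at this
    have hpos : 0 < cr (q - p) (Complex.I * (q - p)) := by
      have : cr (q - p) (Complex.I * (q - p)) = Complex.normSq (q - p) := by
        simp [cr, Complex.normSq_apply]; ring
      rw [this]; exact Complex.normSq_pos.2 (sub_ne_zero.2 hpq.symm)
    nlinarith
  apply Subset.antisymm
  · intro z hz
    have hsub : ∀ s, quad p₀ p₁ p₂ p₃ ⊆ s → z ∈ interior s := fun s hs => interior_mono hs hz
    exact ⟨aux _ _ h.ne (hsub _ fun w hw => hw.1), aux _ _ h.rot.ne (hsub _ fun w hw => hw.2.1),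
      aux _ _ h.rot.rot.ne (hsub _ fun w hw => hw.2.2.1),
      aux _ _ h.rot.rot.rot.ne (hsub _ fun w hw => hw.2.2.2)⟩
  · apply interior_maximal
    · rintro z ⟨a, b, c, d⟩; exact ⟨a.le, b.le, c.le, d.le⟩
    · have h : ∀ p q : ℂ, IsOpen {z | 0 < el p q z} := fun p q =>
        isOpen_lt continuous_const (continuous_el p q)
      exact (h _ _).inter ((h _ _).inter ((h _ _).inter (h _ _)))

lemma interior_quad_nonempty {p₀ p₁ p₂ p₃ : ℂ} (h : Ccw p₀ p₁ p₂ p₃) :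
    (interior (quad p₀ p₁ p₂ p₃)).Nonempty := by
  rw [interior_quad h]
  have h0 := h.c₀; have h1 := h.c₁; have h2 := h.c₂; have h3 := h.c₃
  refine ⟨(1/2 : ℝ) • ((1/2 : ℝ) • p₀ + (1/2 : ℝ) • p₁) + (1/2 : ℝ) • ((1/2 : ℝ) • p₂ + (1/2 : ℝ) • p₃), ?_⟩
  simp only [mem_ofPred_eq, el_comb _ _ _ _ (1/2) (1/2) (by norm_num), el_self_left, el_self_right]
  have e1 := el_rot p₀ p₁ p₂
  have e2 := el_rot p₁ p₂ p₃
  have e3 := el_rot p₂ p₃ p₀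
  have e4 := el_rot p₃ p₀ p₁
  refine ⟨?_, ?_, ?_, ?_⟩ <;> linarith

lemma closure_interior_quad {p₀ p₁ p₂ p₃ : ℂ} (h : Ccw p₀ p₁ p₂ p₃) :
    closure (interior (quad p₀ p₁ p₂ p₃)) = quad p₀ p₁ p₂ p₃ := by
  rw [(convex_quad _ _ _ _).closure_interior_eq_closure_of_nonempty_interior
    (interior_quad_nonempty h), (isClosed_quad _ _ _ _).closure_eq]

/-- A point of a quadrilateral on the line of the first side lies on that side. -/
lemma mem_segment_of_el_eq_zero {p₀ p₁ p₂ p₃ z : ℂ} (h : Ccw p₀ p₁ p₂ p₃)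
    (hz : z ∈ quad p₀ p₁ p₂ p₃) (h0 : el p₀ p₁ z = 0) : z ∈ segment ℝ p₀ p₁ := by
  have e := bary_eq (z := z) h.c₀.ne'
  have s := bary_sum (z := z) h.c₀.ne'
  rw [h0, zero_div, zero_smul, add_zero] at e
  rw [h0, zero_div, add_zero] at s
  refine ⟨_, _, div_nonneg hz.2.1 h.c₀.le, ?_, s, e.symm⟩
  have h3 := hz.2.2.2
  rw [e, el_comb _ _ _ _ _ _ s, el_self_right, mul_zero, zero_add] at h3
  exact nonneg_of_mul_nonneg_left h3 h.c₃

lemma segment_subset_quad {p₀ p₁ p₂ p₃ : ℂ} (h : Ccw p₀ p₁ p₂ p₃) :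
    segment ℝ p₀ p₁ ⊆ quad p₀ p₁ p₂ p₃ :=
  (convex_quad _ _ _ _).segment_subset h.mem₀ h.mem₁

lemma el_eq_zero_of_mem_segment {p q z : ℂ} (hz : z ∈ segment ℝ p q) : el p q z = 0 := by
  obtain ⟨a, b, -, -, hab, rfl⟩ := hz
  rw [el_comb _ _ _ _ _ _ hab, el_self_left, el_self_right]; ring

lemma mem_frontier_quad_iff {p₀ p₁ p₂ p₃ z : ℂ} (h : Ccw p₀ p₁ p₂ p₃) :
    z ∈ frontier (quad p₀ p₁ p₂ p₃) ↔ z ∈ quad p₀ p₁ p₂ p₃ ∧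
      (el p₀ p₁ z = 0 ∨ el p₁ p₂ z = 0 ∨ el p₂ p₃ z = 0 ∨ el p₃ p₀ z = 0) := by
  rw [frontier, (isClosed_quad _ _ _ _).closure_eq, interior_quad h, mem_sdiff]
  refine and_congr_right fun hz => ?_
  obtain ⟨a, b, c, d⟩ := hz
  simp only [mem_ofPred_eq, not_and_or, not_lt]
  constructor
  · rintro (k | k | k | k)
    exacts [.inl (le_antisymm k a), .inr (.inl (le_antisymm k b)),
      .inr (.inr (.inl (le_antisymm k c))), .inr (.inr (.inr (le_antisymm k d)))]
  · rintro (k | k | k | k)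
    exacts [.inl k.le, .inr (.inl k.le), .inr (.inr (.inl k.le)), .inr (.inr (.inr k.le))]

lemma frontier_quad {p₀ p₁ p₂ p₃ : ℂ} (h : Ccw p₀ p₁ p₂ p₃) : frontier (quad p₀ p₁ p₂ p₃) =
    segment ℝ p₀ p₁ ∪ segment ℝ p₁ p₂ ∪ segment ℝ p₂ p₃ ∪ segment ℝ p₃ p₀ := by
  ext z
  rw [mem_frontier_quad_iff h]
  constructor
  · rintro ⟨hz, k | k | k | k⟩
    · exact .inl (.inl (.inl (mem_segment_of_el_eq_zero h hz k)))
    · exact .inl (.inl (.inr (mem_segment_of_el_eq_zero h.rot (by rwa [quad_rot]) k)))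
    · exact .inl (.inr (mem_segment_of_el_eq_zero h.rot.rot (by rwa [quad_rot, quad_rot]) k))
    · exact .inr (mem_segment_of_el_eq_zero h.rot.rot.rot (by rwa [quad_rot, quad_rot, quad_rot]) k)
  · rintro (((k | k) | k) | k)
    · exact ⟨segment_subset_quad h k, .inl (el_eq_zero_of_mem_segment k)⟩
    · exact ⟨by have := segment_subset_quad h.rot k; rwa [quad_rot] at this,
        .inr (.inl (el_eq_zero_of_mem_segment k))⟩
    · exact ⟨by have := segment_subset_quad h.rot.rot k; rwa [quad_rot, quad_rot] at this,
        .inr (.inr (.inl (el_eq_zero_of_mem_segment k)))⟩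
    · exact ⟨by have := segment_subset_quad h.rot.rot.rot k; rwa [quad_rot, quad_rot, quad_rot] at this,
        .inr (.inr (.inr (el_eq_zero_of_mem_segment k)))⟩

/-! ### Nice directions -/

/-- `y` is obtained from `x` by a positive turn of an angle between `60°` and `120°`
(and a scaling). -/
def NiceDir (x y : ℂ) : Prop := 0 < cr x y ∧ √3 * |dt x y| ≤ cr x y

lemma niceDir_iff {x y : ℂ} : NiceDir x y ↔
    0 < cr x y ∧ √3 * dt x y ≤ cr x y ∧ -(√3 * dt x y) ≤ cr x y := by
  unfold NiceDir
  rw [show √3 * |dt x y| = |√3 * dt x y| by rw [abs_mul, abs_of_nonneg (Real.sqrt_nonneg 3)], abs_le]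
  constructor
  · rintro ⟨a, b, c⟩; exact ⟨a, c, by linarith⟩
  · rintro ⟨a, b, c⟩; exact ⟨a, by linarith, b⟩

/-- The angle from `y` to `-x` is supplementary to the angle from `x` to `y`, and the range from 60°
to 120° is symmetric about 90°. -/
lemma NiceDir.rot {x y : ℂ} (h : NiceDir x y) : NiceDir y (-x) := by
  unfold NiceDir at *
  have e1 : cr y (-x) = cr x y := by simp [cr]; ring
  have e2 : dt y (-x) = -dt x y := by simp [dt]; ring
  rwa [e1, e2, abs_neg]

lemma NiceDir.neg {x y : ℂ} (h : NiceDir x y) : NiceDir (-x) (-y) := by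
  unfold NiceDir at *
  have e1 : cr (-x) (-y) = cr x y := by simp [cr]
  have e2 : dt (-x) (-y) = dt x y := by simp [dt]
  rwa [e1, e2]

/-- For fixed `x` the conditions of `niceDir_iff` are linear in `y`, so the admissible directions
form a convex cone. This is why intermediate cuts inherit nice angles from the sides. -/
lemma NiceDir.add_right {x y z : ℂ} (h : NiceDir x y) (k : NiceDir x z) : NiceDir x (y + z) := by
  rw [niceDir_iff] at *
  have e1 : cr x (y + z) = cr x y + cr x z := by simp [cr]; ring
  have e2 : dt x (y + z) = dt x y + dt x z := by simp [dt]; ring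
  rw [e1, e2]
  refine ⟨by linarith, by linarith, by linarith⟩

lemma NiceDir.add_left {x y z : ℂ} (h : NiceDir x z) (k : NiceDir y z) : NiceDir (x + y) z := by
  rw [niceDir_iff] at *
  have e1 : cr (x + y) z = cr x z + cr y z := by simp [cr]; ring
  have e2 : dt (x + y) z = dt x z + dt y z := by simp [dt]; ring
  rw [e1, e2]
  refine ⟨by linarith, by linarith, by linarith⟩

lemma NiceDir.smul_right {x y : ℂ} {t : ℝ} (h : NiceDir x y) (ht : 0 < t) : NiceDir x (t • y) := by
  unfold NiceDir at *
  have e1 : cr x (t • y) = t * cr x y := by simp [cr]; ring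
  have e2 : dt x (t • y) = t * dt x y := by simp [dt]; ring
  rw [e1, e2, abs_mul, abs_of_pos ht]
  refine ⟨mul_pos ht h.1, ?_⟩
  calc √3 * (t * |dt x y|) = t * (√3 * |dt x y|) := by ring
    _ ≤ _ := mul_le_mul_of_nonneg_left h.2 ht.le

lemma NiceDir.smul_left {x y : ℂ} {t : ℝ} (h : NiceDir x y) (ht : 0 < t) : NiceDir (t • x) y := by
  have := (h.rot.smul_right ht).rot.neg
  simpa using this

lemma NiceDir.comb_left {x y z : ℂ} {t : ℝ} (h : NiceDir x z) (k : NiceDir y z) (h0 : 0 ≤ t)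
    (h1 : t ≤ 1) : NiceDir ((1 - t) • x + t • y) z := by
  rcases h0.eq_or_lt with rfl | h0
  · simpa using h
  rcases h1.eq_or_lt with rfl | h1
  · simpa using k
  exact (h.smul_left (by linarith)).add_left (k.smul_left h0)

lemma NiceDir.comb_right {x y z : ℂ} {t : ℝ} (h : NiceDir z x) (k : NiceDir z y) (h0 : 0 ≤ t)
    (h1 : t ≤ 1) : NiceDir z ((1 - t) • x + t • y) := by
  rcases h0.eq_or_lt with rfl | h0
  · simpa using h
  rcases h1.eq_or_lt with rfl | h1
  · simpa using k
  exact (h.smul_right (by linarith)).add_right (k.smul_right h0)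

lemma NiceDir.mul {x y ω : ℂ} (h : NiceDir x y) (hω : ω ≠ 0) : NiceDir (ω * x) (ω * y) := by
  unfold NiceDir at *
  have e1 : cr (ω * x) (ω * y) = Complex.normSq ω * cr x y := by
    simp [cr, Complex.normSq_apply]; ring
  have e2 : dt (ω * x) (ω * y) = Complex.normSq ω * dt x y := by
    simp [dt, Complex.normSq_apply]; ring
  have hp := Complex.normSq_pos.2 hω
  rw [e1, e2, abs_mul, abs_of_pos hp]
  refine ⟨mul_pos hp h.1, ?_⟩
  calc √3 * (Complex.normSq ω * |dt x y|) = Complex.normSq ω * (√3 * |dt x y|) := by ring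
    _ ≤ _ := mul_le_mul_of_nonneg_left h.2 hp.le

/-- Positively oriented quadrilaterals with all angles between `60°` and `120°`. -/
structure Nq (p₀ p₁ p₂ p₃ : ℂ) : Prop where
  n₀ : NiceDir (p₁ - p₀) (p₂ - p₁)
  n₁ : NiceDir (p₂ - p₁) (p₃ - p₂)
  n₂ : NiceDir (p₃ - p₂) (p₀ - p₃)
  n₃ : NiceDir (p₀ - p₃) (p₁ - p₀)

lemma Nq.rot {p₀ p₁ p₂ p₃ : ℂ} (h : Nq p₀ p₁ p₂ p₃) : Nq p₁ p₂ p₃ p₀ :=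
  ⟨h.n₁, h.n₂, h.n₃, h.n₀⟩

lemma el_eq_cr (p q z : ℂ) : el p q z = cr (q - p) (z - q) := by
  simp [el_def, cr]; ring

lemma Nq.ccw {p₀ p₁ p₂ p₃ : ℂ} (h : Nq p₀ p₁ p₂ p₃) : Ccw p₀ p₁ p₂ p₃ :=
  ⟨by rw [el_eq_cr]; exact h.n₀.1, by rw [el_eq_cr]; exact h.n₁.1,
   by rw [el_eq_cr]; exact h.n₂.1, by rw [el_eq_cr]; exact h.n₃.1⟩

/-- A quadrilateral whose horizontal sides make nice angles with its vertical sides. -/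
lemma Nq.of_dirs {p₀ p₁ p₂ p₃ : ℂ} (h00 : NiceDir (p₁ - p₀) (p₃ - p₀))
    (h01 : NiceDir (p₁ - p₀) (p₂ - p₁)) (h10 : NiceDir (p₂ - p₃) (p₃ - p₀))
    (h11 : NiceDir (p₂ - p₃) (p₂ - p₁)) : Nq p₀ p₁ p₂ p₃ := by
  refine ⟨h01, ?_, ?_, ?_⟩
  · simpa using h11.rot
  · simpa using h10.neg
  · simpa using h00.rot.neg

lemma Nq.dirs {p₀ p₁ p₂ p₃ : ℂ} (h : Nq p₀ p₁ p₂ p₃) : NiceDir (p₁ - p₀) (p₃ - p₀) ∧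
    NiceDir (p₁ - p₀) (p₂ - p₁) ∧ NiceDir (p₂ - p₃) (p₃ - p₀) ∧ NiceDir (p₂ - p₃) (p₂ - p₁) := by
  refine ⟨?_, h.n₀, ?_, ?_⟩
  · simpa using h.n₃.rot
  · simpa using h.n₂.neg
  · simpa using h.n₁.rot.neg

end SinkMesh

/-! ### Conforming tilings and their gluing. -/

namespace SinkMesh

/-- The closed quadrilateral with the corners `q 0, …, q 3`. -/
def tile (q : Fin 4 → ℂ) : Set ℂ := quad (q 0) (q 1) (q 2) (q 3)

/-- `T` is a conforming tiling of `D` by nice quadrilaterals whose vertices on the frontier of `D`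
are the points of `V` there. -/
structure IsMesh (T : Finset (Fin 4 → ℂ)) (D V : Set ℂ) : Prop where
  nice : ∀ q ∈ T, Nq (q 0) (q 1) (q 2) (q 3)
  disj : ∀ q ∈ T, ∀ q' ∈ T, q ≠ q' → Disjoint (interior (tile q)) (interior (tile q'))
  cover : (⋃ q ∈ T, tile q) = D
  conf : ∀ q ∈ T, ∀ q' ∈ T, ∀ i, q i ∈ tile q' → q i ∈ range q'
  bdry : ∀ z ∈ frontier D, z ∈ V ↔ ∃ q ∈ T, z ∈ range q

/-- `D` has a nice mesh with at most `n` elements and with frontier vertices `V`. -/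
def Meshable (D V : Set ℂ) (n : ℕ) : Prop := ∃ T, IsMesh T D V ∧ T.card ≤ n

lemma range_subset_tile {q : Fin 4 → ℂ} (h : Nq (q 0) (q 1) (q 2) (q 3)) : range q ⊆ tile q := by
  rintro _ ⟨i, rfl⟩
  fin_cases i
  exacts [h.ccw.mem₀, h.ccw.mem₁, h.ccw.mem₂, h.ccw.mem₃]

namespace IsMesh
variable {T : Finset (Fin 4 → ℂ)} {D V : Set ℂ}

lemma tile_subset (h : IsMesh T D V) {q} (hq : q ∈ T) : tile q ⊆ D := by
  rw [← h.cover]; exact subset_biUnion_of_mem (u := tile) hq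

lemma isClosed (h : IsMesh T D V) : IsClosed D := by
  rw [← h.cover]
  exact T.finite_toSet.isClosed_biUnion fun q _ => isClosed_quad _ _ _ _

lemma subset_closure_interior (h : IsMesh T D V) : D ⊆ closure (interior D) := by
  intro z hz
  rw [← h.cover] at hz
  obtain ⟨q, hq, hz⟩ := mem_iUnion₂.1 hz
  rw [tile, ← closure_interior_quad (h.nice q hq).ccw] at hz
  exact closure_mono (interior_mono (h.tile_subset hq)) hz

end IsMesh

namespace Meshable
variable {D V V' : Set ℂ} {n m : ℕ}

lemma congr (h : Meshable D V n) (hV : ∀ z ∈ frontier D, z ∈ V' ↔ z ∈ V) : Meshable D V' n := by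
  obtain ⟨T, hT, hn⟩ := h
  exact ⟨T, ⟨hT.nice, hT.disj, hT.cover, hT.conf, fun z hz => (hV z hz).trans (hT.bdry z hz)⟩, hn⟩

lemma mono (h : Meshable D V n) (hn : n ≤ m) : Meshable D V m := by
  obtain ⟨T, hT, h⟩ := h
  exact ⟨T, hT, h.trans hn⟩

lemma isClosed (h : Meshable D V n) : IsClosed D := h.choose_spec.1.isClosed

lemma subset_closure_interior (h : Meshable D V n) : D ⊆ closure (interior D) :=
  h.choose_spec.1.subset_closure_interior

end Meshable

/-- An interior point of `A` that lies in `B` is a limit of interior points of `B`, which would then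
lie in both interiors. -/
lemma mem_frontier_of_disjoint {A B : Set ℂ} (hA : IsClosed A) (hB : B ⊆ closure (interior B))
    (h : Disjoint (interior A) (interior B)) {z : ℂ} (hzA : z ∈ A) (hzB : z ∈ B) :
    z ∈ frontier A := by
  rw [frontier, hA.closure_eq]
  refine ⟨hzA, fun hz => ?_⟩
  obtain ⟨w, hw⟩ := mem_closure_iff.1 (hB hzB) _ isOpen_interior hz
  exact disjoint_left.1 h hw.1 hw.2

/-- Meshes of regions with disjoint interiors and with consistent vertices fit together. -/
theorem Meshable.biUnion {ι : Type*} (s : Finset ι) {D : ι → Set ℂ} {V : Set ℂ} {n : ι → ℕ}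
    (h : ∀ i ∈ s, Meshable (D i) V (n i))
    (hd : ∀ i ∈ s, ∀ j ∈ s, i ≠ j → Disjoint (interior (D i)) (interior (D j))) :
    Meshable (⋃ i ∈ s, D i) V (∑ i ∈ s, n i) := by
  classical
  have h' : ∀ i, ∃ T, i ∈ s → IsMesh T (D i) V ∧ T.card ≤ n i := fun i => by
    by_cases hi : i ∈ s
    · obtain ⟨T, hT⟩ := h i hi; exact ⟨T, fun _ => hT⟩
    · exact ⟨∅, fun h => absurd h hi⟩
  choose T hT using h'
  have hmem : ∀ q, q ∈ s.biUnion T ↔ ∃ i ∈ s, q ∈ T i := fun q => Finset.mem_biUnion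
  have hsub_int : ∀ i ∈ s, ∀ q ∈ T i, interior (tile q) ⊆ interior (D i) := fun i hi q hq =>
    interior_mono ((hT i hi).1.tile_subset hq)
  have hfr : ∀ i ∈ s, ∀ j ∈ s, i ≠ j → ∀ z ∈ D i, z ∈ D j → z ∈ frontier (D i) :=
    fun i hi j hj hij z hzi hzj => mem_frontier_of_disjoint (h i hi).isClosed
      (h j hj).subset_closure_interior (hd i hi j hj hij) hzi hzj
  refine ⟨s.biUnion T, ⟨?_, ?_, ?_, ?_, ?_⟩, Finset.card_biUnion_le.trans
    (Finset.sum_le_sum fun i hi => (hT i hi).2)⟩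
  · intro q hq
    obtain ⟨i, hi, hq⟩ := (hmem q).1 hq
    exact (hT i hi).1.nice q hq
  · intro q hq q' hq' hne
    obtain ⟨i, hi, hq⟩ := (hmem q).1 hq
    obtain ⟨j, hj, hq'⟩ := (hmem q').1 hq'
    by_cases hij : i = j
    · subst hij; exact (hT i hi).1.disj q hq q' hq' hne
    · exact (hd i hi j hj hij).mono (hsub_int i hi q hq) (hsub_int j hj q' hq')
  · ext z
    simp only [mem_iUnion, hmem, exists_prop]
    constructor
    · rintro ⟨q, ⟨i, hi, hq⟩, hz⟩
      exact ⟨i, hi, (hT i hi).1.tile_subset hq hz⟩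
    · rintro ⟨i, hi, hz⟩
      rw [← (hT i hi).1.cover] at hz
      obtain ⟨q, hq, hz⟩ := mem_iUnion₂.1 hz
      exact ⟨q, ⟨i, hi, hq⟩, hz⟩
  · intro q hq q' hq' k hk
    obtain ⟨i, hi, hq⟩ := (hmem q).1 hq
    obtain ⟨j, hj, hq'⟩ := (hmem q').1 hq'
    by_cases hij : i = j
    · subst hij; exact (hT i hi).1.conf q hq q' hq' k hk
    -- A corner of one region's tile that lies in another region is on both frontiers. There `V`
    -- decides for both meshes which points are vertices, so it is a vertex of the second mesh as
    -- well, and conformity of that mesh applies.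
    have hzi : q k ∈ D i := (hT i hi).1.tile_subset hq
      (range_subset_tile ((hT i hi).1.nice q hq) (mem_range_self k))
    have hzj : q k ∈ D j := (hT j hj).1.tile_subset hq' hk
    have hV : q k ∈ V := ((hT i hi).1.bdry _ (hfr i hi j hj hij _ hzi hzj)).2
      ⟨q, hq, mem_range_self k⟩
    obtain ⟨q'', hq'', k', hk'⟩ := ((hT j hj).1.bdry _ (hfr j hj i hi (Ne.symm hij) _ hzj hzi)).1 hV
    rw [← hk']
    exact (hT j hj).1.conf q'' hq'' q' hq' k' (by rwa [hk'])
  · intro z hz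
    have hcl : IsClosed (⋃ i ∈ s, D i) :=
      s.finite_toSet.isClosed_biUnion fun i hi => (h i hi).isClosed
    have hfr' : ∀ i ∈ s, z ∈ D i → z ∈ frontier (D i) := by
      intro i hi hzi
      rw [frontier, (h i hi).isClosed.closure_eq]
      refine ⟨hzi, fun hzint => ?_⟩
      exact hz.2 (interior_mono (subset_biUnion_of_mem (u := D) hi) hzint)
    have hzD : z ∈ ⋃ i ∈ s, D i := by have := hz.1; rwa [hcl.closure_eq] at this
    constructor
    · intro hV
      obtain ⟨i, hi, hzi⟩ := mem_iUnion₂.1 hzD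
      obtain ⟨q, hq, hzq⟩ := ((hT i hi).1.bdry z (hfr' i hi hzi)).1 hV
      exact ⟨q, (hmem q).2 ⟨i, hi, hq⟩, hzq⟩
    · rintro ⟨q, hq, hzq⟩
      obtain ⟨i, hi, hq⟩ := (hmem q).1 hq
      have hzi : z ∈ D i := (hT i hi).1.tile_subset hq
        (range_subset_tile ((hT i hi).1.nice q hq) hzq)
      exact ((hT i hi).1.bdry z (hfr' i hi hzi)).2 ⟨q, hq, hzq⟩

theorem Meshable.union {D D' V : Set ℂ} {n m : ℕ} (h : Meshable D V n) (h' : Meshable D' V m)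
    (hd : Disjoint (interior D) (interior D')) : Meshable (D ∪ D') V (n + m) := by
  have := Meshable.biUnion (Finset.univ : Finset Bool) (D := fun b => bif b then D else D')
    (V := V) (n := fun b => bif b then n else m) (by intro i _; cases i <;> simpa)
    (by intro i _ j _ hij; cases i <;> cases j <;> simp_all [hd.symm])
  convert this using 1
  · ext z; simp [mem_iUnion, or_comm]
  · simp

/-- Regions glued along consistent vertex sets. -/
theorem Meshable.biUnion' {ι : Type*} (s : Finset ι) {D : ι → Set ℂ} {V : ι → Set ℂ} {n : ι → ℕ}
    (h : ∀ i ∈ s, Meshable (D i) (V i) (n i))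
    (hd : ∀ i ∈ s, ∀ j ∈ s, i ≠ j → Disjoint (interior (D i)) (interior (D j)))
    (hV : ∀ i ∈ s, ∀ j ∈ s, i ≠ j → V i ∩ D j ⊆ V j) :
    Meshable (⋃ i ∈ s, D i) (⋃ i ∈ s, V i) (∑ i ∈ s, n i) := by
  refine Meshable.biUnion s (fun i hi => (h i hi).congr fun z hz => ?_) hd
  have hzi : z ∈ D i := by have := hz.1; rwa [(h i hi).isClosed.closure_eq] at this
  simp only [mem_iUnion, exists_prop]
  constructor
  · rintro ⟨j, hj, hzV⟩
    by_cases hij : j = i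
    · subst hij; exact hzV
    · exact hV j hj i hi hij ⟨hzV, hzi⟩
  · intro hz; exact ⟨i, hi, hz⟩

lemma Meshable.of_nq {p₀ p₁ p₂ p₃ : ℂ} (h : Nq p₀ p₁ p₂ p₃) :
    Meshable (quad p₀ p₁ p₂ p₃) {p₀, p₁, p₂, p₃} 1 := by
  refine ⟨{![p₀, p₁, p₂, p₃]}, ⟨?_, ?_, ?_, ?_, ?_⟩, by simp⟩
  · simpa using h
  · simp +contextual
  · simp [tile]
  · intro q hq q' hq' i _
    obtain rfl := Finset.mem_singleton.1 hq
    obtain rfl := Finset.mem_singleton.1 hq'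
    exact mem_range_self i
  · intro z _
    simp [Fin.exists_fin_succ, eq_comm]

/-! ### Similarities -/

/-- The similarity `z ↦ ω z + b`. -/
noncomputable def simil (ω : ℂ) (hω : ω ≠ 0) (b : ℂ) : ℂ ≃ₜ ℂ :=
  (Homeomorph.mulLeft₀ ω hω).trans (Homeomorph.addRight b)

lemma simil_apply (ω : ℂ) (hω : ω ≠ 0) (b z : ℂ) : simil ω hω b z = ω * z + b := rfl

lemma el_simil (ω : ℂ) (hω : ω ≠ 0) (b p q z : ℂ) :
    el (simil ω hω b p) (simil ω hω b q) (simil ω hω b z) = Complex.normSq ω * el p q z := by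
  simp only [simil_apply, el_def, Complex.normSq_apply, Complex.add_re, Complex.add_im,
    Complex.mul_re, Complex.mul_im]
  ring

lemma simil_image_quad (ω : ℂ) (hω : ω ≠ 0) (b p₀ p₁ p₂ p₃ : ℂ) :
    simil ω hω b '' quad p₀ p₁ p₂ p₃ =
      quad (simil ω hω b p₀) (simil ω hω b p₁) (simil ω hω b p₂) (simil ω hω b p₃) := by
  have hp := Complex.normSq_pos.2 hω
  ext z
  obtain ⟨w, rfl⟩ := (simil ω hω b).surjective z
  rw [(simil ω hω b).injective.mem_set_image]
  simp only [quad, mem_ofPred_eq, el_simil, mul_nonneg_iff_of_pos_left hp]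

lemma Nq.simil {p₀ p₁ p₂ p₃ : ℂ} (h : Nq p₀ p₁ p₂ p₃) (ω : ℂ) (hω : ω ≠ 0) (b : ℂ) :
    Nq (simil ω hω b p₀) (simil ω hω b p₁) (simil ω hω b p₂) (simil ω hω b p₃) := by
  have e : ∀ p q : ℂ, SinkMesh.simil ω hω b p - SinkMesh.simil ω hω b q = ω * (p - q) := fun p q => by
    simp only [simil_apply]; ring
  refine ⟨?_, ?_, ?_, ?_⟩ <;> rw [e, e]
  exacts [h.n₀.mul hω, h.n₁.mul hω, h.n₂.mul hω, h.n₃.mul hω]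

theorem Meshable.simil {D V : Set ℂ} {n : ℕ} (h : Meshable D V n) (ω : ℂ) (hω : ω ≠ 0) (b : ℂ) :
    Meshable (simil ω hω b '' D) (simil ω hω b '' V) n := by
  classical
  obtain ⟨T, hT, hn⟩ := h
  set f := SinkMesh.simil ω hω b with hf
  have htile : ∀ q : Fin 4 → ℂ, tile (f ∘ q) = f '' tile q := fun q =>
    (simil_image_quad ω hω b _ _ _ _).symm
  have hrange : ∀ q : Fin 4 → ℂ, range (f ∘ q) = f '' range q := fun q => range_comp _ _
  refine ⟨T.image (f ∘ ·), ⟨?_, ?_, ?_, ?_, ?_⟩, Finset.card_image_le.trans hn⟩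
  · simp only [Finset.forall_mem_image]
    intro q hq
    exact (hT.nice q hq).simil ω hω b
  · simp only [Finset.forall_mem_image]
    intro q hq q' hq' hne
    rw [htile, htile, ← f.image_interior, ← f.image_interior, disjoint_image_iff f.injective]
    exact hT.disj q hq q' hq' fun h => hne (by rw [h])
  · rw [← hT.cover, image_iUnion₂, Finset.set_biUnion_finset_image]
    simp only [htile]
  · simp only [Finset.forall_mem_image]
    intro q hq q' hq' i hi
    rw [htile, Function.comp_apply, f.injective.mem_set_image] at hi
    rw [hrange, Function.comp_apply, f.injective.mem_set_image]
    exact hT.conf q hq q' hq' i hi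
  · intro z hz
    rw [← f.image_frontier] at hz
    obtain ⟨w, hw, rfl⟩ := hz
    rw [f.injective.mem_set_image, hT.bdry w hw]
    simp only [Finset.exists_mem_image, hrange, f.injective.mem_set_image]

end SinkMesh

/-! ### Quadrilaterals with subdivided sides, and straight cuts. -/

namespace SinkMesh

/-- The point of parameter `t` on the line from `p` to `q`. -/
noncomputable def lm (p q : ℂ) (t : ℝ) : ℂ := p + t • (q - p)

lemma lm_zero (p q : ℂ) : lm p q 0 = p := by simp [lm]
lemma lm_one (p q : ℂ) : lm p q 1 = q := by simp [lm]

lemma lm_symm (p q : ℂ) (t : ℝ) : lm q p (1 - t) = lm p q t := by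
  apply Complex.ext <;> simp [lm] <;> ring

lemma lm_left (p q : ℂ) (l t : ℝ) : lm p (lm p q l) t = lm p q (l * t) := by
  apply Complex.ext <;> simp [lm] <;> ring

lemma lm_right (p q : ℂ) (l t : ℝ) : lm (lm p q l) q t = lm p q (l + (1 - l) * t) := by
  apply Complex.ext <;> simp [lm] <;> ring

lemma lm_eq (p q : ℂ) (t : ℝ) : lm p q t = (1 - t) • p + t • q := by
  apply Complex.ext <;> simp [lm] <;> ring

lemma el_lm (p q x y : ℂ) (t : ℝ) : el p q (lm x y t) = (1 - t) * el p q x + t * el p q y := by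
  rw [lm_eq, el_comb _ _ _ _ _ _ (by ring)]

lemma el_lm_right (p q z : ℂ) (t : ℝ) : el p (lm p q t) z = t * el p q z := by
  simp only [el_def, lm, Complex.add_re, Complex.add_im, Complex.smul_re, Complex.smul_im,
    Complex.sub_re, Complex.sub_im, smul_eq_mul]; ring

lemma el_lm_left (p q z : ℂ) (t : ℝ) : el (lm p q t) q z = (1 - t) * el p q z := by
  simp only [el_def, lm, Complex.add_re, Complex.add_im, Complex.smul_re, Complex.smul_im,
    Complex.sub_re, Complex.sub_im, smul_eq_mul]; ring

lemma lm_mem_segment {p q : ℂ} {t : ℝ} (h0 : 0 ≤ t) (h1 : t ≤ 1) : lm p q t ∈ segment ℝ p q :=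
  ⟨1 - t, t, by linarith, h0, by ring, (lm_eq p q t).symm⟩

/-- The points with parameters in `S` on the line from `p` to `q`. -/
noncomputable def pts (p q : ℂ) (S : Finset ℝ) : Set ℂ := Set.image (lm p q) S

/-- Finite subdivisions of the unit interval. -/
structure IsSub (S : Finset ℝ) : Prop where
  zero_mem : 0 ∈ S
  one_mem : 1 ∈ S
  nonneg : ∀ t ∈ S, 0 ≤ t
  le_one : ∀ t ∈ S, t ≤ 1

lemma isSub_pair : IsSub {0, 1} := ⟨by simp, by simp, by simp, by simp⟩

/-- The subdivision traversed backwards. -/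
noncomputable def rev (S : Finset ℝ) : Finset ℝ := S.image fun t => 1 - t

lemma mem_rev {S : Finset ℝ} {t : ℝ} : t ∈ rev S ↔ 1 - t ∈ S := by
  simp only [rev, Finset.mem_image]
  constructor
  · rintro ⟨s, hs, rfl⟩; simpa using hs
  · intro h; exact ⟨_, h, by ring⟩

lemma rev_rev (S : Finset ℝ) : rev (rev S) = S := by ext t; simp [mem_rev]

lemma card_rev (S : Finset ℝ) : (rev S).card = S.card :=
  Finset.card_image_of_injective _ fun a b h => by simpa using h

lemma IsSub.rev {S : Finset ℝ} (h : IsSub S) : IsSub (rev S) :=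
  ⟨by simp [mem_rev, h.one_mem], by simp [mem_rev, h.zero_mem],
    fun t ht => by linarith [h.le_one _ (mem_rev.1 ht)],
    fun t ht => by linarith [h.nonneg _ (mem_rev.1 ht)]⟩

lemma pts_rev (p q : ℂ) (S : Finset ℝ) : pts q p (rev S) = pts p q S := by
  ext z
  simp only [pts, mem_image, Finset.mem_coe, mem_rev]
  constructor
  · rintro ⟨t, ht, rfl⟩; exact ⟨_, ht, lm_symm q p t⟩
  · rintro ⟨t, ht, rfl⟩; exact ⟨1 - t, by simpa using ht, lm_symm p q t⟩

/-- Concatenation of two subdivisions, scaled to `[0, l]` and `[l, 1]`. -/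
noncomputable def join (l : ℝ) (A B : Finset ℝ) : Finset ℝ :=
  A.image (fun t => l * t) ∪ B.image (fun t => l + (1 - l) * t)

lemma pts_join (p q : ℂ) (l : ℝ) (A B : Finset ℝ) :
    pts p q (join l A B) = pts p (lm p q l) A ∪ pts (lm p q l) q B := by
  simp only [pts, join, Finset.coe_union, Finset.coe_image, image_union, image_image,
    lm_left, lm_right]

/-- The quadrilateral has a nice mesh with at most `n` elements and with the given frontier
vertices on its bottom, right, top and left side; horizontal sides are parametrised from left to
right, vertical ones upwards. -/
def QM (p₀ p₁ p₂ p₃ : ℂ) (Sb Sr St Sl : Finset ℝ) (n : ℕ) : Prop :=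
  Meshable (quad p₀ p₁ p₂ p₃) (pts p₀ p₁ Sb ∪ pts p₁ p₂ Sr ∪ pts p₃ p₂ St ∪ pts p₀ p₃ Sl) n

lemma QM.mono {p₀ p₁ p₂ p₃ : ℂ} {Sb Sr St Sl : Finset ℝ} {n m : ℕ}
    (h : QM p₀ p₁ p₂ p₃ Sb Sr St Sl n) (hn : n ≤ m) : QM p₀ p₁ p₂ p₃ Sb Sr St Sl m :=
  Meshable.mono h hn

/-- Horizontal sides are always read to the right and vertical ones upwards, so relabelling by a
rotation reverses the reading of two sides. -/
lemma QM.rot_iff {p₀ p₁ p₂ p₃ : ℂ} {Sb Sr St Sl : Finset ℝ} {n : ℕ} :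
    QM p₁ p₂ p₃ p₀ Sr (rev St) Sl (rev Sb) n ↔ QM p₀ p₁ p₂ p₃ Sb Sr St Sl n := by
  unfold QM
  rw [quad_rot, pts_rev, pts_rev]
  have : pts p₁ p₂ Sr ∪ pts p₃ p₂ St ∪ pts p₀ p₃ Sl ∪ pts p₀ p₁ Sb =
    pts p₀ p₁ Sb ∪ pts p₁ p₂ Sr ∪ pts p₃ p₂ St ∪ pts p₀ p₃ Sl := by
    ext z; simp only [mem_union]; tauto
  rw [this]

lemma QM.of_nq {p₀ p₁ p₂ p₃ : ℂ} (h : Nq p₀ p₁ p₂ p₃) :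
    QM p₀ p₁ p₂ p₃ {0, 1} {0, 1} {0, 1} {0, 1} 1 := by
  refine (Meshable.of_nq h).congr fun z _ => ?_
  have e : ∀ p q : ℂ, pts p q {0, 1} = {p, q} := fun p q => by
    simp [pts, image_insert_eq, lm_zero, lm_one]
  simp only [e, mem_union, mem_insert_iff, mem_singleton_iff]
  tauto

lemma el_lm_lm_left' (p₀ p₁ p₂ p₃ : ℂ) (l m : ℝ) : el (lm p₀ p₁ l) (lm p₃ p₂ m) p₃ =
    m * (l * el p₁ p₂ p₃ + (1 - l) * el p₂ p₃ p₀) := by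
  simp only [el_def, lm, Complex.add_re, Complex.add_im, Complex.smul_re, Complex.smul_im,
    Complex.sub_re, Complex.sub_im, smul_eq_mul]; ring

lemma el_nonneg_left {p q z : ℂ} {l : ℝ} (hl : 0 < l) : 0 ≤ el p (lm p q l) z ↔ 0 ≤ el p q z := by
  rw [el_lm_right, mul_nonneg_iff_of_pos_left hl]

lemma el_nonneg_right {p q z : ℂ} {l : ℝ} (hl : l < 1) : 0 ≤ el (lm p q l) q z ↔ 0 ≤ el p q z := by
  rw [el_lm_left, mul_nonneg_iff_of_pos_left (by linarith)]

section cut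
variable {p₀ p₁ p₂ p₃ : ℂ} {l m : ℝ}

lemma Ccw.cut_left (h : Ccw p₀ p₁ p₂ p₃) (hl : 0 < l) (hl1 : l < 1) (hm : 0 < m) (hm1 : m < 1) :
    Ccw p₀ (lm p₀ p₁ l) (lm p₃ p₂ m) p₃ := by
  have h0 := h.c₀; have h1 := h.c₁; have h2 := h.c₂; have h3 := h.c₃
  have hl' : 0 < 1 - l := by linarith
  have hm' : 0 < 1 - m := by linarith
  refine ⟨?_, ?_, ?_, ?_⟩
  · rw [el_lm_right, el_lm, ← el_rot p₃]; positivity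
  · rw [el_lm_lm_left']; positivity
  · rw [el_swap, el_lm_right, el_swap, mul_neg, neg_neg]; positivity
  · rw [el_lm, el_self_right, mul_zero, zero_add]; positivity

lemma Ccw.cut_right (h : Ccw p₀ p₁ p₂ p₃) (hl : 0 < l) (hl1 : l < 1) (hm : 0 < m) (hm1 : m < 1) :
    Ccw (lm p₀ p₁ l) p₁ p₂ (lm p₃ p₂ m) := by
  have := (h.rot.rot.cut_left (l := 1 - m) (m := 1 - l) (by linarith) (by linarith)
    (by linarith) (by linarith)).rot.rot
  rwa [lm_symm, lm_symm] at this

lemma quad_cut (h : Ccw p₀ p₁ p₂ p₃) (hl : 0 < l) (hl1 : l < 1) (hm : 0 < m) (hm1 : m < 1) :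
    quad p₀ p₁ p₂ p₃ = quad p₀ (lm p₀ p₁ l) (lm p₃ p₂ m) p₃ ∪
      quad (lm p₀ p₁ l) p₁ p₂ (lm p₃ p₂ m) := by
  have hb : lm p₀ p₁ l ∈ quad p₀ p₁ p₂ p₃ :=
    segment_subset_quad h (lm_mem_segment hl.le hl1.le)
  have ht : lm p₃ p₂ m ∈ quad p₀ p₁ p₂ p₃ := by
    have := segment_subset_quad h.rot.rot (segment_symm ℝ p₃ p₂ ▸ lm_mem_segment hm.le hm1.le)
    rwa [quad_rot, quad_rot] at this
  apply Subset.antisymm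
  · rintro z ⟨z0, z1, z2, z3⟩
    have e1 : el (lm p₃ p₂ m) p₃ z = m * el p₂ p₃ z := by
      rw [el_swap, el_lm_right, el_swap]; ring
    have e2 : el p₂ (lm p₃ p₂ m) z = (1 - m) * el p₂ p₃ z := by
      rw [el_swap, el_lm_left, el_swap]; ring
    rcases le_total 0 (el (lm p₀ p₁ l) (lm p₃ p₂ m) z) with hz | hz
    · exact .inl ⟨(el_nonneg_left hl).2 z0, hz, by rw [e1]; positivity, z3⟩
    · refine .inr ⟨(el_nonneg_right hl1).2 z0, z1, ?_, by rw [el_swap]; linarith⟩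
      rw [e2]; exact mul_nonneg (by linarith) z2
  · apply union_subset
    · exact quad_subset_of_convex (h.cut_left hl hl1 hm hm1) (convex_quad _ _ _ _) h.mem₀ hb ht h.mem₃
    · exact quad_subset_of_convex (h.cut_right hl hl1 hm hm1) (convex_quad _ _ _ _) hb h.mem₁ h.mem₂ ht

/-- Both parts induce the same subdivision `Z` of the cut. The line of the cut separates them, so a
vertex of one part that lies in the other part belongs to the cut, and the meshes are consistent
there. -/
theorem QM.vcut {Sb₁ Sb₂ Sr St₁ St₂ Sl Z : Finset ℝ} {n₁ n₂ : ℕ} (h : Ccw p₀ p₁ p₂ p₃)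
    (hl : 0 < l) (hl1 : l < 1) (hm : 0 < m) (hm1 : m < 1)
    (sb₁ : IsSub Sb₁) (sb₂ : IsSub Sb₂) (sr : IsSub Sr) (st₁ : IsSub St₁) (st₂ : IsSub St₂)
    (sl : IsSub Sl) (z : IsSub Z)
    (q₁ : QM p₀ (lm p₀ p₁ l) (lm p₃ p₂ m) p₃ Sb₁ Z St₁ Sl n₁)
    (q₂ : QM (lm p₀ p₁ l) p₁ p₂ (lm p₃ p₂ m) Sb₂ Sr St₂ Z n₂) :
    QM p₀ p₁ p₂ p₃ (join l Sb₁ Sb₂) Sr (join m St₁ St₂) Sl (n₁ + n₂) := by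
  set b := lm p₀ p₁ l with hb
  set t := lm p₃ p₂ m with ht
  have h1 := h.cut_left hl hl1 hm hm1
  have h2 := h.cut_right hl hl1 hm hm1
  rw [← hb, ← ht] at h1 h2
  have e0 : 0 < el b t p₀ := by rw [← el_rot]; exact h1.c₀
  have e3 : 0 < el b t p₃ := h1.c₁
  have e1 : el b t p₁ < 0 := by
    rw [el_swap]; have := h2.c₃; linarith
  have e2 : el b t p₂ < 0 := by
    rw [el_swap, ← el_rot]; have := h2.c₂; linarith
  have hbZ : b ∈ pts b t Z := ⟨0, z.zero_mem, lm_zero _ _⟩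
  have htZ : t ∈ pts b t Z := ⟨1, z.one_mem, lm_one _ _⟩
  set V₁ := pts p₀ b Sb₁ ∪ pts b t Z ∪ pts p₃ t St₁ ∪ pts p₀ p₃ Sl with hV₁
  set V₂ := pts b p₁ Sb₂ ∪ pts p₁ p₂ Sr ∪ pts t p₂ St₂ ∪ pts b t Z with hV₂
  have hD1 : ∀ w ∈ quad p₀ b t p₃, 0 ≤ el b t w := fun w hw => hw.2.1
  have hD2 : ∀ w ∈ quad b p₁ p₂ t, el b t w ≤ 0 := fun w hw => by
    rw [el_swap]; have := hw.2.2.2; linarith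
  have hV12 : ∀ w ∈ V₁, w ∈ quad b p₁ p₂ t → w ∈ V₂ := by
    rintro w (((⟨s, hs, rfl⟩ | hw) | ⟨s, hs, rfl⟩) | ⟨s, hs, rfl⟩) hw2
    · have := hD2 _ hw2
      rw [el_lm, el_self_left] at this
      have hs1 := sb₁.le_one s hs
      obtain rfl : s = 1 := by nlinarith
      rw [lm_one]; exact .inr hbZ
    · exact .inr hw
    · have := hD2 _ hw2
      rw [el_lm, el_self_right] at this
      have hs1 := st₁.le_one s hs
      obtain rfl : s = 1 := by nlinarith
      rw [lm_one]; exact .inr htZ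
    · have := hD2 _ hw2
      rw [el_lm] at this
      have hs1 := sl.le_one s hs
      have hs0 := sl.nonneg s hs
      exfalso
      rcases hs0.eq_or_lt with rfl | hs0
      · simp at this; linarith
      · nlinarith [mul_pos hs0 e3, mul_nonneg (sub_nonneg.2 hs1) e0.le]
  have hV21 : ∀ w ∈ V₂, w ∈ quad p₀ b t p₃ → w ∈ V₁ := by
    rintro w (((⟨s, hs, rfl⟩ | ⟨s, hs, rfl⟩) | ⟨s, hs, rfl⟩) | hw) hw2
    · have := hD1 _ hw2
      rw [el_lm, el_self_left] at this
      have hs1 := sb₂.nonneg s hs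
      obtain rfl : s = 0 := by nlinarith
      rw [lm_zero]; exact .inl (.inl (.inr hbZ))
    · have := hD1 _ hw2
      rw [el_lm] at this
      have hs1 := sr.le_one s hs
      have hs0 := sr.nonneg s hs
      exfalso
      rcases hs0.eq_or_lt with rfl | hs0
      · simp at this; linarith
      · nlinarith [mul_pos hs0 (neg_pos.2 e2), mul_nonneg (sub_nonneg.2 hs1) (neg_pos.2 e1).le]
    · have := hD1 _ hw2
      rw [el_lm, el_self_right] at this
      have hs1 := st₂.nonneg s hs
      obtain rfl : s = 0 := by nlinarith
      rw [lm_zero]; exact .inl (.inl (.inr htZ))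
    · exact .inl (.inl (.inr hw))
  have c1 : IsClosed (quad p₀ b t p₃) := isClosed_quad _ _ _ _
  have c2 : IsClosed (quad b p₁ p₂ t) := isClosed_quad _ _ _ _
  have m1 : Meshable (quad p₀ b t p₃) (V₁ ∪ V₂) n₁ := Meshable.congr q₁ fun w hw => by
    have hw' : w ∈ quad p₀ b t p₃ := by have := hw.1; rwa [c1.closure_eq] at this
    exact ⟨fun hh => hh.elim id fun h2 => hV21 w h2 hw', .inl⟩
  have m2 : Meshable (quad b p₁ p₂ t) (V₁ ∪ V₂) n₂ := Meshable.congr q₂ fun w hw => by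
    have hw' : w ∈ quad b p₁ p₂ t := by have := hw.1; rwa [c2.closure_eq] at this
    exact ⟨fun hh => hh.elim (fun h2 => hV12 w h2 hw') id, .inr⟩
  have hdis : Disjoint (interior (quad p₀ b t p₃)) (interior (quad b p₁ p₂ t)) := by
    rw [interior_quad h1, interior_quad h2, disjoint_left]
    rintro w ⟨-, k, -, -⟩ ⟨-, -, -, k'⟩
    rw [el_swap] at k'; linarith
  have key := m1.union m2 hdis
  rw [hb, ht, ← quad_cut h hl hl1 hm hm1] at key
  refine key.congr fun w hw => ?_
  rw [pts_join, pts_join, ← hb, ← ht]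
  constructor
  · rintro (((hw | hw) | hw) | hw)
    · rcases hw with hw | hw
      · exact .inl (.inl (.inl (.inl hw)))
      · exact .inr (.inl (.inl (.inl hw)))
    · exact .inr (.inl (.inl (.inr hw)))
    · rcases hw with hw | hw
      · exact .inl (.inl (.inr hw))
      · exact .inr (.inl (.inr hw))
    · exact .inl (.inr hw)
  -- Inner points of the cut are interior to the whole quadrilateral. Only its two ends reach the
  -- frontier, and they are vertices of the bottom and of the top already.
  · have hZ : w ∈ pts b t Z → w ∈ pts p₀ b Sb₁ ∪ pts b p₁ Sb₂ ∪ pts p₁ p₂ Sr ∪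
        (pts p₃ t St₁ ∪ pts t p₂ St₂) ∪ pts p₀ p₃ Sl := by
      rintro ⟨s, hs, rfl⟩
      have hs0 := z.nonneg s hs
      have hs1 := z.le_one s hs
      rcases hs0.eq_or_lt with rfl | hs0
      · rw [lm_zero]; exact .inl (.inl (.inl (.inl ⟨1, sb₁.one_mem, lm_one _ _⟩)))
      rcases hs1.eq_or_lt with rfl | hs1
      · rw [lm_one]; exact .inl (.inr (.inl ⟨1, st₁.one_mem, lm_one _ _⟩))
      exfalso
      have h0 := h.c₀; have h1 := h.c₁; have h2 := h.c₂; have h3 := h.c₃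
      have hl' : 0 < 1 - l := by linarith
      have hm' : 0 < 1 - m := by linarith
      have hs' : 0 < 1 - s := by linarith
      rcases ((mem_frontier_quad_iff h).1 hw).2 with k | k | k | k
      · rw [el_lm, hb, el_lm, el_self_left, el_self_right, ht, el_lm, ← el_rot p₃] at k
        have : 0 < (1 - m) * el p₃ p₀ p₁ + m * el p₀ p₁ p₂ := by positivity
        nlinarith [mul_pos hs0 this]
      · rw [el_lm, hb, el_lm, el_self_left, ← el_rot p₀, ht, el_lm, el_self_right] at k
        have q1 : 0 < (1 - l) * el p₀ p₁ p₂ := by positivity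
        have q2 : 0 < (1 - m) * el p₁ p₂ p₃ := by positivity
        nlinarith [mul_pos hs0 q2, mul_pos hs' q1]
      · rw [el_lm, hb, el_lm, ← el_rot p₁, ht, el_lm, el_self_right, el_self_left] at k
        have q1 : 0 < (1 - l) * el p₂ p₃ p₀ + l * el p₁ p₂ p₃ := by positivity
        nlinarith [mul_pos hs' q1]
      · rw [el_lm, hb, el_lm, el_self_right, ht, el_lm, el_self_left, ← el_rot p₂] at k
        have q1 : 0 < l * el p₃ p₀ p₁ := by positivity
        have q2 : 0 < m * el p₂ p₃ p₀ := by positivity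
        nlinarith [mul_pos hs0 q2, mul_pos hs' q1]
    rintro ((((hw | hw) | hw) | hw) | (((hw | hw) | hw) | hw))
    · exact .inl (.inl (.inl (.inl hw)))
    · exact hZ hw
    · exact .inl (.inr (.inl hw))
    · exact .inr hw
    · exact .inl (.inl (.inl (.inr hw)))
    · exact .inl (.inl (.inr hw))
    · exact .inl (.inr (.inr hw))
    · exact hZ hw

theorem QM.hcut {Sb Sr₁ Sr₂ St Sl₁ Sl₂ Z : Finset ℝ} {n₁ n₂ : ℕ} (h : Ccw p₀ p₁ p₂ p₃)
    (hl : 0 < l) (hl1 : l < 1) (hm : 0 < m) (hm1 : m < 1)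
    (sb : IsSub Sb) (sr₁ : IsSub Sr₁) (sr₂ : IsSub Sr₂) (st : IsSub St) (sl₁ : IsSub Sl₁)
    (sl₂ : IsSub Sl₂) (z : IsSub Z)
    (q₁ : QM p₀ p₁ (lm p₁ p₂ m) (lm p₀ p₃ l) Sb Sr₁ Z Sl₁ n₁)
    (q₂ : QM (lm p₀ p₃ l) (lm p₁ p₂ m) p₂ p₃ Z Sr₂ St Sl₂ n₂) :
    QM p₀ p₁ p₂ p₃ Sb (join m Sr₁ Sr₂) St (join l Sl₁ Sl₂) (n₁ + n₂) := by
  rw [← QM.rot_iff] at q₁ q₂ ⊢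
  exact QM.vcut h.rot hm hm1 hl hl1 sr₁ sr₂ st.rev sl₁ sl₂ sb.rev z.rev q₁ q₂

end cut

end SinkMesh

/-! ### Blocks: grids formed by two crossing families of segments. -/

namespace SinkMesh

/-- `β` maps the finite set `X` of indices, with least element `a` and largest element `b`, to a
subdivision of the unit interval. -/
structure Rail (X : Finset ℝ) (a b : ℝ) (β : ℝ → ℝ) : Prop where
  lt : a < b
  left : a ∈ X
  right : b ∈ X
  ge : ∀ x ∈ X, a ≤ x
  le : ∀ x ∈ X, x ≤ b
  mono : StrictMonoOn β X
  map_left : β a = 0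
  map_right : β b = 1

namespace Rail
variable {X : Finset ℝ} {a b x : ℝ} {β : ℝ → ℝ}

lemma isSub (h : Rail X a b β) : IsSub (X.image β) := by
  refine ⟨?_, ?_, ?_, ?_⟩
  · exact Finset.mem_image.2 ⟨a, h.left, h.map_left⟩
  · exact Finset.mem_image.2 ⟨b, h.right, h.map_right⟩
  · simp only [Finset.forall_mem_image]
    intro x hx
    rw [← h.map_left]; exact h.mono.monotoneOn h.left hx (h.ge x hx)
  · simp only [Finset.forall_mem_image]
    intro x hx
    rw [← h.map_right]; exact h.mono.monotoneOn hx h.right (h.le x hx)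

lemma pos (h : Rail X a b β) (hx : x ∈ X) (hax : a < x) : 0 < β x := by
  rw [← h.map_left]; exact h.mono h.left hx hax

lemma lt_one (h : Rail X a b β) (hx : x ∈ X) (hxb : x < b) : β x < 1 := by
  rw [← h.map_right]; exact h.mono hx h.right hxb

lemma lower (h : Rail X a b β) (hx : x ∈ X) (hax : a < x) :
    Rail (X.filter (· ≤ x)) a x (fun y => β y / β x) := by
  have hp := h.pos hx hax
  refine ⟨hax, by simp [h.left, hax.le], by simp [hx], fun y hy => h.ge y (Finset.mem_filter.1 hy).1,
    fun y hy => (Finset.mem_filter.1 hy).2, ?_, by simp [h.map_left], div_self hp.ne'⟩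
  intro y hy z hz hyz
  simp only [Finset.coe_filter] at hy hz
  exact div_lt_div_of_pos_right (h.mono hy.1 hz.1 hyz) hp

lemma upper (h : Rail X a b β) (hx : x ∈ X) (hxb : x < b) :
    Rail (X.filter (x ≤ ·)) x b (fun y => (β y - β x) / (1 - β x)) := by
  have hp := h.lt_one hx hxb
  refine ⟨hxb, by simp [hx], by simp [h.right, hxb.le], fun y hy => (Finset.mem_filter.1 hy).2,
    fun y hy => h.le y (Finset.mem_filter.1 hy).1, ?_, by simp, ?_⟩
  · intro y hy z hz hyz
    simp only [Finset.coe_filter] at hy hz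
    refine div_lt_div_of_pos_right ?_ (by linarith)
    linarith [h.mono hy.1 hz.1 hyz]
  · rw [h.map_right]; exact div_self (by linarith)

lemma image_eq_join (h : Rail X a b β) (hx : x ∈ X) (hax : a < x) (hxb : x < b) :
    X.image β = join (β x) ((X.filter (· ≤ x)).image (fun y => β y / β x))
      ((X.filter (x ≤ ·)).image (fun y => (β y - β x) / (1 - β x))) := by
  have hp := h.pos hx hax
  have hq := h.lt_one hx hxb
  have hq' : 1 - β x ≠ 0 := by linarith
  have hX : X = X.filter (· ≤ x) ∪ X.filter (x ≤ ·) := by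
    ext y; simp only [Finset.mem_union, Finset.mem_filter]
    have := le_total y x; tauto
  conv_lhs => rw [hX, Finset.image_union]
  rw [join, Finset.image_image, Finset.image_image]
  congr 1
  · apply Finset.image_congr; intro y _; simp only [Function.comp]; field_simp
  · apply Finset.image_congr; intro y _; simp only [Function.comp]; field_simp; ring

lemma card_filter (h : Rail X a b β) (hx : x ∈ X) :
    (X.filter (· ≤ x)).card + (X.filter (x ≤ ·)).card = X.card + 1 := by
  rw [← Finset.card_union_add_card_inter]
  congr 1
  · congr 1; ext y; simp only [Finset.mem_union, Finset.mem_filter]; have := le_total y x; tauto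
  · rw [Finset.card_eq_one]
    refine ⟨x, ?_⟩
    ext y; simp only [Finset.mem_inter, Finset.mem_filter, Finset.mem_singleton]
    constructor
    · rintro ⟨⟨-, h1⟩, -, h2⟩; exact le_antisymm h1 h2
    · rintro rfl; exact ⟨⟨hx, le_rfl⟩, hx, le_rfl⟩

lemma two_le_card (h : Rail X a b β) : 2 ≤ X.card :=
  Finset.one_lt_card.2 ⟨a, h.left, b, h.right, h.lt.ne⟩

lemma eq_pair (h : Rail X a b β) (hX : ∀ x ∈ X, ¬ (a < x ∧ x < b)) : X = {a, b} := by
  ext y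
  simp only [Finset.mem_insert, Finset.mem_singleton]
  constructor
  · intro hy
    have h1 := h.ge y hy; have h2 := h.le y hy
    rcases h1.eq_or_lt with h1 | h1
    · exact .inl h1.symm
    rcases h2.eq_or_lt with h2 | h2
    · exact .inr h2
    exact absurd ⟨h1, h2⟩ (hX y hy)
  · rintro (rfl | rfl)
    exacts [h.left, h.right]

end Rail

lemma lm_sub_left (p q : ℂ) (t : ℝ) : lm p q t - p = t • (q - p) := by simp [lm]
lemma lm_sub_right (p q : ℂ) (t : ℝ) : q - lm p q t = (1 - t) • (q - p) := by
  apply Complex.ext <;> simp [lm] <;> ring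

/-- A quadrilateral is cut by segments from its bottom to its top. -/
theorem QM.strip {p₀ p₁ p₂ p₃ : ℂ} {X : Finset ℝ} {a b : ℝ} {β γ : ℝ → ℝ} (hβ : Rail X a b β)
    (hγ : Rail X a b γ)
    (h0 : ∀ i ∈ X, NiceDir (p₁ - p₀) (lm p₃ p₂ (γ i) - lm p₀ p₁ (β i)))
    (h1 : ∀ i ∈ X, NiceDir (p₂ - p₃) (lm p₃ p₂ (γ i) - lm p₀ p₁ (β i))) :
    QM p₀ p₁ p₂ p₃ (X.image β) {0, 1} (X.image γ) {0, 1} (X.card - 1) := by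
  -- Cutting along the segment of an inner index leaves two smaller strips. The directions of the
  -- remaining segments are unchanged and the bottom and top are only rescaled, so the hypotheses
  -- persist.
  induction hn : X.card using Nat.strong_induction_on generalizing X a b β γ p₀ p₁ p₂ p₃ with
  | _ n ih =>
  have hnq : Nq p₀ p₁ p₂ p₃ := by
    have a0 := h0 a hβ.left; have a1 := h1 a hβ.left
    have b0 := h0 b hβ.right; have b1 := h1 b hβ.right
    rw [hβ.map_left, hγ.map_left, lm_zero, lm_zero] at a0 a1
    rw [hβ.map_right, hγ.map_right, lm_one, lm_one] at b0 b1
    exact Nq.of_dirs a0 b0 a1 b1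
  by_cases hX : ∀ x ∈ X, ¬ (a < x ∧ x < b)
  · have e := hβ.eq_pair hX
    have e1 : X.image β = {0, 1} := by
      rw [e, Finset.image_insert, Finset.image_singleton, hβ.map_left, hβ.map_right]
    have e2 : X.image γ = {0, 1} := by
      rw [e, Finset.image_insert, Finset.image_singleton, hγ.map_left, hγ.map_right]
    rw [e1, e2]
    exact (QM.of_nq hnq).mono (by have := hβ.two_le_card; omega)
  push Not at hX
  obtain ⟨x, hx, hax, hxb⟩ := hX
  have hc := hβ.card_filter hx
  have c1 := (hβ.lower hx hax).two_le_card
  have c2 := (hβ.upper hx hxb).two_le_card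
  have pβ := hβ.pos hx hax
  have pγ := hγ.pos hx hax
  have qβ := hβ.lt_one hx hxb
  have qγ := hγ.lt_one hx hxb
  have k1 := ih (X.filter (· ≤ x)).card (by omega) (p₀ := p₀) (p₁ := lm p₀ p₁ (β x))
    (p₂ := lm p₃ p₂ (γ x)) (p₃ := p₃) (hβ.lower hx hax) (hγ.lower hx hax)
    (by
      intro i hi
      rw [lm_left, lm_left, mul_div_cancel₀ _ pβ.ne', mul_div_cancel₀ _ pγ.ne', lm_sub_left]
      exact (h0 i (Finset.mem_filter.1 hi).1).smul_left pβ)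
    (by
      intro i hi
      rw [lm_left, lm_left, mul_div_cancel₀ _ pβ.ne', mul_div_cancel₀ _ pγ.ne', lm_sub_left]
      exact (h1 i (Finset.mem_filter.1 hi).1).smul_left pγ) rfl
  have e1 : ∀ u v : ℝ, v < 1 → v + (1 - v) * ((u - v) / (1 - v)) = u := fun u v hv => by
    have : 1 - v ≠ 0 := by linarith
    field_simp; ring
  have k2 := ih (X.filter (x ≤ ·)).card (by omega) (p₀ := lm p₀ p₁ (β x)) (p₁ := p₁)
    (p₂ := p₂) (p₃ := lm p₃ p₂ (γ x)) (hβ.upper hx hxb) (hγ.upper hx hxb)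
    (by
      intro i hi
      rw [lm_right, lm_right, e1 _ _ qβ, e1 _ _ qγ, lm_sub_right]
      exact (h0 i (Finset.mem_filter.1 hi).1).smul_left (by linarith))
    (by
      intro i hi
      rw [lm_right, lm_right, e1 _ _ qβ, e1 _ _ qγ, lm_sub_right]
      exact (h1 i (Finset.mem_filter.1 hi).1).smul_left (by linarith)) rfl
  have := QM.vcut hnq.ccw pβ qβ pγ qγ (hβ.lower hx hax).isSub (hβ.upper hx hxb).isSub isSub_pair
    (hγ.lower hx hax).isSub (hγ.upper hx hxb).isSub isSub_pair isSub_pair k1 k2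
  rw [← hβ.image_eq_join hx hax hxb, ← hγ.image_eq_join hx hax hxb] at this
  exact this.mono (by omega)

/-- The crossing point of a vertical and a horizontal segment of a quadrilateral. -/
lemma crossing {c d b t : ℂ} (h : 0 < cr (d - c) (t - b)) (hb : el c d b < 0) (ht : 0 < el c d t) :
    ∃ w k : ℝ, w = el b t c / cr (d - c) (t - b) ∧ 0 < k ∧ k < 1 ∧
      lm c d w = lm b t k := by
  have e : el c d t = el c d b + cr (d - c) (t - b) := by simp [el, cr]; ring
  refine ⟨_, -el c d b / cr (d - c) (t - b), rfl, div_pos (by linarith) h,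
    (div_lt_one h).2 (by linarith), ?_⟩
  have hne : cr (d - c) (t - b) ≠ 0 := h.ne'
  apply Complex.ext
  · simp only [lm, Complex.add_re, Complex.smul_re, Complex.sub_re, smul_eq_mul]
    field_simp
    simp only [el_def, cr, Complex.sub_re, Complex.sub_im]; ring
  · simp only [lm, Complex.add_im, Complex.smul_im, Complex.sub_im, smul_eq_mul]
    field_simp
    simp only [el_def, cr, Complex.sub_re, Complex.sub_im]; ring

lemma cr_smul_right (t : ℝ) (x y : ℂ) : cr x (t • y) = t * cr x y := by simp [cr]; ring
lemma cr_swap (x y : ℂ) : cr y x = -cr x y := by simp [cr]; ring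

lemma lm_sub_lm (p q : ℂ) (s t : ℝ) : lm p q t - lm p q s = (t - s) • (q - p) := by
  apply Complex.ext <;> simp [lm] <;> ring

/-- A quadrilateral is cut by two families of segments joining points on opposite sides; if all
segments of the first family make nice angles with all segments of the second one, all pieces are
nice. -/
theorem QM.block {p₀ p₁ p₂ p₃ : ℂ} {X L : Finset ℝ} {a b c d : ℝ} {β γ κ ρ : ℝ → ℝ}
    (hβ : Rail X a b β) (hγ : Rail X a b γ) (hκ : Rail L c d κ) (hρ : Rail L c d ρ)
    (h : ∀ j ∈ L, ∀ i ∈ X, NiceDir (lm p₁ p₂ (ρ j) - lm p₀ p₃ (κ j))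
      (lm p₃ p₂ (γ i) - lm p₀ p₁ (β i))) :
    QM p₀ p₁ p₂ p₃ (X.image β) (L.image ρ) (X.image γ) (L.image κ)
      ((X.card - 1) * (L.card - 1)) := by
  induction hn : L.card using Nat.strong_induction_on generalizing L c d κ ρ β γ p₀ p₁ p₂ p₃ with
  | _ n ih =>
  have h0 : ∀ i ∈ X, NiceDir (p₁ - p₀) (lm p₃ p₂ (γ i) - lm p₀ p₁ (β i)) := fun i hi => by
    have := h c hκ.left i hi
    rwa [hκ.map_left, hρ.map_left, lm_zero, lm_zero] at this
  have h1 : ∀ i ∈ X, NiceDir (p₂ - p₃) (lm p₃ p₂ (γ i) - lm p₀ p₁ (β i)) := fun i hi => by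
    have := h d hκ.right i hi
    rwa [hκ.map_right, hρ.map_right, lm_one, lm_one] at this
  have hnq : Nq p₀ p₁ p₂ p₃ := by
    have a0 := h0 a hβ.left; have a1 := h1 a hβ.left
    have b0 := h0 b hβ.right; have b1 := h1 b hβ.right
    rw [hβ.map_left, hγ.map_left, lm_zero, lm_zero] at a0 a1
    rw [hβ.map_right, hγ.map_right, lm_one, lm_one] at b0 b1
    exact Nq.of_dirs a0 b0 a1 b1
  by_cases hL : ∀ x ∈ L, ¬ (c < x ∧ x < d)
  · have e := hκ.eq_pair hL
    have e1 : L.image κ = {0, 1} := by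
      rw [e, Finset.image_insert, Finset.image_singleton, hκ.map_left, hκ.map_right]
    have e2 : L.image ρ = {0, 1} := by
      rw [e, Finset.image_insert, Finset.image_singleton, hρ.map_left, hρ.map_right]
    rw [e1, e2]
    refine (QM.strip hβ hγ h0 h1).mono ?_
    have := hκ.two_le_card
    exact Nat.le_mul_of_pos_right _ (by omega)
  push Not at hL
  obtain ⟨y, hy, hcy, hyd⟩ := hL
  have hc := hκ.card_filter hy
  have c1 := (hκ.lower hy hcy).two_le_card
  have c2 := (hκ.upper hy hyd).two_le_card
  have pκ := hκ.pos hy hcy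
  have pρ := hρ.pos hy hcy
  have qκ := hκ.lt_one hy hyd
  have qρ := hρ.lt_one hy hyd
  set C := lm p₀ p₃ (κ y) with hC
  set D := lm p₁ p₂ (ρ y) with hD
  have hccw := hnq.ccw.rot
  have hcw1 := hccw.cut_left pρ qρ pκ qκ
  have hcw2 := hccw.cut_right pρ qρ pκ qκ
  rw [← hC, ← hD] at hcw1 hcw2
  have dp0 : el C D p₀ < 0 := by have := hcw1.c₁; rw [el_swap]; linarith
  have dp1 : el C D p₁ < 0 := by have := hcw1.c₀; rw [el_swap, ← el_rot]; linarith
  have dp2 : 0 < el C D p₂ := by have := hcw2.c₃; exact this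
  have dp3 : 0 < el C D p₃ := by have := hcw2.c₂; rw [el_rot] at this; exact this
  have hseg : ∀ {P Q : ℂ} {s : ℝ}, 0 ≤ s → s ≤ 1 → el C D P < 0 → el C D Q < 0 →
      el C D (lm P Q s) < 0 := fun {P Q s} s0 s1 hP hQ => by
    rw [el_lm]
    rcases s0.eq_or_lt with rfl | s0
    · simpa using hP
    · nlinarith [mul_pos s0 (neg_pos.2 hQ), mul_nonneg (sub_nonneg.2 s1) (neg_pos.2 hP).le]
  have hseg' : ∀ {P Q : ℂ} {s : ℝ}, 0 ≤ s → s ≤ 1 → 0 < el C D P → 0 < el C D Q →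
      0 < el C D (lm P Q s) := fun {P Q s} s0 s1 hP hQ => by
    rw [el_lm]
    rcases s0.eq_or_lt with rfl | s0
    · simpa using hP
    · nlinarith [mul_pos s0 hQ, mul_nonneg (sub_nonneg.2 s1) hP.le]
  have sβ : ∀ i ∈ X, 0 ≤ β i ∧ β i ≤ 1 := fun i hi =>
    ⟨hβ.isSub.nonneg _ (Finset.mem_image_of_mem β hi), hβ.isSub.le_one _ (Finset.mem_image_of_mem β hi)⟩
  have sγ : ∀ i ∈ X, 0 ≤ γ i ∧ γ i ≤ 1 := fun i hi =>
    ⟨hγ.isSub.nonneg _ (Finset.mem_image_of_mem γ hi), hγ.isSub.le_one _ (Finset.mem_image_of_mem γ hi)⟩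
  have key : ∀ i ∈ X, ∃ k : ℝ, 0 < k ∧ k < 1 ∧
      lm C D (el (lm p₀ p₁ (β i)) (lm p₃ p₂ (γ i)) C /
        cr (D - C) (lm p₃ p₂ (γ i) - lm p₀ p₁ (β i))) =
      lm (lm p₀ p₁ (β i)) (lm p₃ p₂ (γ i)) k := by
    intro i hi
    obtain ⟨w, k, rfl, hk⟩ := crossing (h y hy i hi).1
      (hseg (sβ i hi).1 (sβ i hi).2 dp0 dp1) (hseg' (sγ i hi).1 (sγ i hi).2 dp3 dp2)
    exact ⟨k, hk⟩
  -- `z i` is the parameter on `C D` of the crossing with the `i`-th vertical segment. It serves as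
  -- top rail of the lower part and as bottom rail of the upper part.
  set z : ℝ → ℝ := fun i => el (lm p₀ p₁ (β i)) (lm p₃ p₂ (γ i)) C /
        cr (D - C) (lm p₃ p₂ (γ i) - lm p₀ p₁ (β i)) with hz
  choose! k hk0 hk1 hk using key
  have hrail : Rail X a b z := by
    refine ⟨hβ.lt, hβ.left, hβ.right, hβ.ge, hβ.le, ?_, ?_, ?_⟩
    · intro i hi j hj hij
      have hpos := (h y hy i hi).1
      set B := lm p₀ p₁ (β i) with hB
      set T := lm p₃ p₂ (γ i) with hT
      -- For `i < j` both ends of the `j`-th vertical segment lie strictly to the right of the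
      -- `i`-th one, hence so does its crossing with `C D`. This gives the monotonicity of `z`.
      have e1 : el B T (lm p₀ p₁ (β j)) < 0 := by
        have : el B T (lm p₀ p₁ (β j)) = (β j - β i) * cr (T - B) (p₁ - p₀) := by
          rw [el, hB, lm_sub_lm, cr_smul_right]
        rw [this, cr_swap]
        have := mul_pos (sub_pos.2 (hβ.mono hi hj hij)) (h0 i hi).1
        rw [← hB, ← hT] at this
        linarith
      have e2 : el B T (lm p₃ p₂ (γ j)) < 0 := by
        have : el B T (lm p₃ p₂ (γ j)) = (γ j - γ i) * cr (T - B) (p₂ - p₃) := by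
          rw [el_eq_cr, hT, lm_sub_lm, cr_smul_right]
        rw [this, cr_swap]
        have := mul_pos (sub_pos.2 (hγ.mono hi hj hij)) (h1 i hi).1
        rw [← hB, ← hT] at this
        linarith
      have e3 : el B T (lm C D (z j)) < 0 := by
        rw [hk j hj, el_lm]
        nlinarith [mul_pos (hk0 j hj) (neg_pos.2 e2), mul_pos (sub_pos.2 (hk1 j hj)) (neg_pos.2 e1)]
      have e4 : el B T (lm C D (z j)) = el B T C - z j * cr (D - C) (T - B) := by
        have : cr (T - B) (D - C) = -cr (D - C) (T - B) := cr_swap _ _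
        rw [lm, el_add_smul, this]; ring
      rw [e4] at e3
      have : z i = el B T C / cr (D - C) (T - B) := rfl
      rw [this, div_lt_iff₀ hpos]
      linarith
    · simp only [hz]
      rw [hβ.map_left, hγ.map_left, lm_zero, lm_zero, hC, el_lm, el_self_left, el_self_right]
      simp
    · have hpos := (h y hy b hβ.right).1
      simp only [hz]
      rw [hβ.map_right, hγ.map_right, lm_one, lm_one] at hpos ⊢
      rw [div_eq_one_iff_eq hpos.ne']
      have e : el p₁ p₂ D = 0 := by rw [hD, el_lm, el_self_left, el_self_right]; ring
      have e2 : el p₁ p₂ D = el p₁ p₂ C - cr (D - C) (p₂ - p₁) := by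
        simp only [el_def, cr, Complex.sub_re, Complex.sub_im]; ring
      linarith
  have hlow : ∀ i ∈ X, lm C D (z i) - lm p₀ p₁ (β i) =
      k i • (lm p₃ p₂ (γ i) - lm p₀ p₁ (β i)) := fun i hi => by rw [hk i hi, lm_sub_left]
  have hupp : ∀ i ∈ X, lm p₃ p₂ (γ i) - lm C D (z i) =
      (1 - k i) • (lm p₃ p₂ (γ i) - lm p₀ p₁ (β i)) := fun i hi => by rw [hk i hi, lm_sub_right]
  have k1 := ih (L.filter (· ≤ y)).card (by omega) (p₀ := p₀) (p₁ := p₁) (p₂ := D) (p₃ := C)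
    hβ hrail (hκ.lower hy hcy) (hρ.lower hy hcy)
    (by
      intro j hj i hi
      rw [hC, hD, lm_left, lm_left, mul_div_cancel₀ _ pκ.ne', mul_div_cancel₀ _ pρ.ne', ← hC, ← hD,
        hlow i hi]
      exact (h j (Finset.mem_filter.1 hj).1 i hi).smul_right (hk0 i hi)) rfl
  have e1 : ∀ u v : ℝ, v < 1 → v + (1 - v) * ((u - v) / (1 - v)) = u := fun u v hv => by
    have : 1 - v ≠ 0 := by linarith
    field_simp; ring
  have k2 := ih (L.filter (y ≤ ·)).card (by omega) (p₀ := C) (p₁ := D) (p₂ := p₂) (p₃ := p₃)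
    hrail hγ (hκ.upper hy hyd) (hρ.upper hy hyd)
    (by
      intro j hj i hi
      rw [hupp i hi, hC, hD, lm_right, lm_right, e1 _ _ qκ, e1 _ _ qρ]
      exact (h j (Finset.mem_filter.1 hj).1 i hi).smul_right (sub_pos.2 (hk1 i hi))) rfl
  have := QM.hcut hnq.ccw pκ qκ pρ qρ hβ.isSub (hρ.lower hy hcy).isSub (hρ.upper hy hyd).isSub
    hγ.isSub (hκ.lower hy hcy).isSub (hκ.upper hy hyd).isSub hrail.isSub k1 k2
  rw [← hκ.image_eq_join hy hcy hyd, ← hρ.image_eq_join hy hcy hyd] at this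
  refine this.mono ?_
  rw [← mul_add]
  exact Nat.mul_le_mul_left _ (by omega)

end SinkMesh

namespace SinkMesh

/-! ### Products and similarities of meshed quadrilaterals -/

lemma rail_id {X : Finset ℝ} (h : IsSub X) : Rail X 0 1 id :=
  ⟨one_pos, h.zero_mem, h.one_mem, h.nonneg, h.le_one, strictMono_id.strictMonoOn _, rfl, rfl⟩

/-- Equal subdivisions of opposite sides. -/
theorem QM.prod {p₀ p₁ p₂ p₃ : ℂ} (h : Nq p₀ p₁ p₂ p₃) {X L : Finset ℝ} (hX : IsSub X)
    (hL : IsSub L) : QM p₀ p₁ p₂ p₃ X L X L ((X.card - 1) * (L.card - 1)) := by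
  have := QM.block (p₀ := p₀) (p₁ := p₁) (p₂ := p₂) (p₃ := p₃) (rail_id hX) (rail_id hX)
    (rail_id hL) (rail_id hL) (by
    intro j hj i hi
    obtain ⟨h00, h01, h10, h11⟩ := h.dirs
    have e1 : lm p₁ p₂ (id j) - lm p₀ p₃ (id j) = (1 - j) • (p₁ - p₀) + j • (p₂ - p₃) := by
      apply Complex.ext <;> simp [lm] <;> ring
    have e2 : lm p₃ p₂ (id i) - lm p₀ p₁ (id i) = (1 - i) • (p₃ - p₀) + i • (p₂ - p₁) := by
      apply Complex.ext <;> simp [lm] <;> ring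
    rw [e1, e2]
    exact (h00.comb_left h10 (hL.nonneg j hj) (hL.le_one j hj)).comb_right
      (h01.comb_left h11 (hL.nonneg j hj) (hL.le_one j hj)) (hX.nonneg i hi) (hX.le_one i hi))
  simpa using this

lemma simil_lm (ω : ℂ) (hω : ω ≠ 0) (b p q : ℂ) (t : ℝ) :
    simil ω hω b (lm p q t) = lm (simil ω hω b p) (simil ω hω b q) t := by
  simp only [simil_apply, lm, Complex.real_smul]; ring

lemma simil_pts (ω : ℂ) (hω : ω ≠ 0) (b p q : ℂ) (S : Finset ℝ) :
    simil ω hω b '' pts p q S = pts (simil ω hω b p) (simil ω hω b q) S := by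
  simp only [pts, image_image, simil_lm]

theorem QM.simil {p₀ p₁ p₂ p₃ : ℂ} {Sb Sr St Sl : Finset ℝ} {n : ℕ}
    (h : QM p₀ p₁ p₂ p₃ Sb Sr St Sl n) (ω : ℂ) (hω : ω ≠ 0) (b : ℂ) :
    QM (simil ω hω b p₀) (simil ω hω b p₁) (simil ω hω b p₂) (simil ω hω b p₃) Sb Sr St Sl n := by
  have := Meshable.simil h ω hω b
  unfold QM
  simpa only [simil_image_quad, image_union, simil_pts] using this

/-! ### Gluing along common sides -/

/-- The vertex set of a quadrilateral with subdivided sides. -/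
def vq (p₀ p₁ p₂ p₃ : ℂ) (Sb Sr St Sl : Finset ℝ) : Set ℂ :=
  pts p₀ p₁ Sb ∪ pts p₁ p₂ Sr ∪ pts p₃ p₂ St ∪ pts p₀ p₃ Sl

lemma vq_rot (p₀ p₁ p₂ p₃ : ℂ) (Sb Sr St Sl : Finset ℝ) :
    vq p₁ p₂ p₃ p₀ Sr (rev St) Sl (rev Sb) = vq p₀ p₁ p₂ p₃ Sb Sr St Sl := by
  unfold vq; rw [pts_rev, pts_rev]; ext z; simp only [mem_union]; tauto

lemma pts_subset_segment (p q : ℂ) {S : Finset ℝ} (h : IsSub S) : pts p q S ⊆ segment ℝ p q := by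
  rintro _ ⟨t, ht, rfl⟩; exact lm_mem_segment (h.nonneg t ht) (h.le_one t ht)

/-- Vertices on the line of the right side belong to the right side. -/
lemma mem_right_of_el {p₀ p₁ p₂ p₃ z : ℂ} {Sb Sr St Sl : Finset ℝ} (h : Ccw p₀ p₁ p₂ p₃)
    (sb : IsSub Sb) (sr : IsSub Sr) (st : IsSub St) (sl : IsSub Sl)
    (hz : z ∈ vq p₀ p₁ p₂ p₃ Sb Sr St Sl) (he : el p₁ p₂ z ≤ 0) : z ∈ pts p₁ p₂ Sr := by
  have h0 : 0 < el p₁ p₂ p₀ := by rw [← el_rot]; exact h.c₀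
  have h3 : 0 < el p₁ p₂ p₃ := h.c₁
  rcases hz with ((⟨s, hs, rfl⟩ | hz) | ⟨s, hs, rfl⟩) | ⟨s, hs, rfl⟩
  · rw [el_lm, el_self_left] at he
    obtain rfl : s = 1 := by nlinarith [sb.le_one s hs]
    rw [lm_one]; exact ⟨0, sr.zero_mem, lm_zero _ _⟩
  · exact hz
  · rw [el_lm, el_self_right] at he
    obtain rfl : s = 1 := by nlinarith [st.le_one s hs]
    rw [lm_one]; exact ⟨1, sr.one_mem, lm_one _ _⟩
  · rw [el_lm] at he
    exfalso
    have hs1 := sl.le_one s hs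
    rcases (sl.nonneg s hs).eq_or_lt with rfl | hs0
    · simp at he; linarith
    · nlinarith [mul_pos hs0 h3, mul_nonneg (sub_nonneg.2 hs1) h0.le]

/-- Two regions with vertex sets that can be glued. -/
structure Compat (D V D' V' : Set ℂ) : Prop where
  disj : Disjoint (interior D) (interior D')
  sub : V ∩ D' ⊆ V'
  sub' : V' ∩ D ⊆ V

lemma Compat.symm {D V D' V' : Set ℂ} (h : Compat D V D' V') : Compat D' V' D V :=
  ⟨h.disj.symm, h.sub', h.sub⟩

/-- Quadrilaterals on both sides of a common side `b t`. -/
lemma Compat.of_side {a₀ a₃ b t b₁ b₂ : ℂ} {Ab At Al Bb Br Bt Z : Finset ℝ}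
    (hA : Ccw a₀ b t a₃) (hB : Ccw b b₁ b₂ t) (ab : IsSub Ab) (at' : IsSub At) (al : IsSub Al)
    (bb : IsSub Bb) (br : IsSub Br) (bt : IsSub Bt) (z : IsSub Z) :
    Compat (quad a₀ b t a₃) (vq a₀ b t a₃ Ab Z At Al) (quad b b₁ b₂ t) (vq b b₁ b₂ t Bb Br Bt Z) := by
  refine ⟨?_, ?_, ?_⟩
  · rw [interior_quad hA, interior_quad hB, disjoint_left]
    rintro w ⟨-, k, -, -⟩ ⟨-, -, -, k'⟩
    rw [el_swap] at k'; linarith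
  · rintro w ⟨hw, hw'⟩
    have : el b t w ≤ 0 := by have := hw'.2.2.2; rw [el_swap] at this; linarith
    exact .inr (mem_right_of_el hA ab z at' al hw this)
  · rintro w ⟨hw, hw'⟩
    have e := hw'.2.1
    rw [← vq_rot, ← vq_rot] at hw
    have : el t b w ≤ 0 := by rw [el_swap]; linarith
    have := mem_right_of_el hB.rot.rot bt.rev z.rev bb.rev br.rev hw this
    rw [pts_rev] at this
    exact .inl (.inl (.inr this))

/-- An open half-plane together with a single point of its boundary line is convex. -/
lemma el_pos_or_eq {p q v a₁ a₂ a₃ z : ℂ} (h : Ccw v a₁ a₂ a₃) (hv : el p q v = 0)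
    (h1 : 0 < el p q a₁) (h2 : 0 < el p q a₂) (h3 : 0 < el p q a₃) (hz : z ∈ quad v a₁ a₂ a₃) :
    0 < el p q z ∨ z = v := by
  have hconv : Convex ℝ ({w | 0 < el p q w} ∪ {v}) := by
    rintro x hx y hy s t hs ht hst
    have e := el_comb p q x y s t hst
    rcases hs.eq_or_lt with rfl | hs
    · obtain rfl : t = 1 := by linarith
      simpa using hy
    rcases ht.eq_or_lt with rfl | ht
    · obtain rfl : s = 1 := by linarith
      simpa using hx
    rcases hx with hx | rfl <;> rcases hy with hy | rfl
    · left; simp only [mem_ofPred_eq] at *; rw [e]; positivity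
    · left; simp only [mem_ofPred_eq] at *; rw [e, hv]; have := mul_pos hs hx; linarith
    · left; simp only [mem_ofPred_eq] at *; rw [e, hv]; have := mul_pos ht hy; linarith
    · right; rw [← add_smul, hst, one_smul]; rfl
  exact quad_subset_of_convex h hconv (.inr rfl) (.inl h1) (.inl h2) (.inl h3) hz

lemma el_nonpos_of_mem {p q a₀ a₁ a₂ a₃ z : ℂ} (h : Ccw a₀ a₁ a₂ a₃) (h0 : el p q a₀ ≤ 0)
    (h1 : el p q a₁ ≤ 0) (h2 : el p q a₂ ≤ 0) (h3 : el p q a₃ ≤ 0) (hz : z ∈ quad a₀ a₁ a₂ a₃) :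
    el p q z ≤ 0 := by
  have hconv : Convex ℝ {w | el p q w ≤ 0} := by
    rintro x hx y hy s t hs ht hst
    simp only [mem_ofPred_eq] at *
    rw [el_comb _ _ _ _ _ _ hst]
    nlinarith [mul_nonneg hs (neg_nonneg.2 hx), mul_nonneg ht (neg_nonneg.2 hy)]
  exact quad_subset_of_convex h hconv h0 h1 h2 h3 hz

lemma disjoint_interior_of_inter_subset {A B : Set ℂ} {v : ℂ} (h : A ∩ B ⊆ {v}) :
    Disjoint (interior A) (interior B) := by
  rw [disjoint_iff_inter_eq_empty, ← interior_inter]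
  exact subset_empty_iff.1 ((interior_mono h).trans (interior_singleton v).subset)

lemma Compat.of_inter {D V D' V' : Set ℂ} {v : ℂ} (h : D ∩ D' ⊆ {v}) (hV : V ⊆ D) (hV' : V' ⊆ D')
    (hv : v ∈ V) (hv' : v ∈ V') : Compat D V D' V' :=
  ⟨disjoint_interior_of_inter_subset h,
    fun _ hz => (h ⟨hV hz.1, hz.2⟩ : _ = v) ▸ hv', fun _ hz => (h ⟨hz.2, hV' hz.1⟩ : _ = v) ▸ hv⟩

lemma vq_subset {p₀ p₁ p₂ p₃ : ℂ} {Sb Sr St Sl : Finset ℝ} (h : Ccw p₀ p₁ p₂ p₃)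
    (sb : IsSub Sb) (sr : IsSub Sr) (st : IsSub St) (sl : IsSub Sl) :
    vq p₀ p₁ p₂ p₃ Sb Sr St Sl ⊆ quad p₀ p₁ p₂ p₃ := by
  have hc := convex_quad p₀ p₁ p₂ p₃
  refine union_subset (union_subset (union_subset ?_ ?_) ?_) ?_
  · exact (pts_subset_segment _ _ sb).trans (hc.segment_subset h.mem₀ h.mem₁)
  · exact (pts_subset_segment _ _ sr).trans (hc.segment_subset h.mem₁ h.mem₂)
  · exact (pts_subset_segment _ _ st).trans (hc.segment_subset h.mem₃ h.mem₂)
  · exact (pts_subset_segment _ _ sl).trans (hc.segment_subset h.mem₀ h.mem₃)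

lemma left_mem_vq (p₀ p₁ p₂ p₃ : ℂ) {Sb Sr St Sl : Finset ℝ} (sb : IsSub Sb) :
    p₀ ∈ vq p₀ p₁ p₂ p₃ Sb Sr St Sl := .inl (.inl (.inl ⟨0, sb.zero_mem, lm_zero _ _⟩))

/-- Quadrilaterals with a common corner `v` on the two sides of a line `p q`. -/
lemma Compat.of_corner {v a₁ a₂ a₃ b₁ b₂ b₃ : ℂ} (p q : ℂ) {Ab Ar At Al Bb Br Bt Bl : Finset ℝ}
    (hA : Ccw v a₁ a₂ a₃) (hB : Ccw v b₁ b₂ b₃) (ab : IsSub Ab) (ar : IsSub Ar) (at' : IsSub At)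
    (al : IsSub Al) (bb : IsSub Bb) (br : IsSub Br) (bt : IsSub Bt) (bl : IsSub Bl)
    (hv : el p q v = 0) (h1 : 0 < el p q a₁) (h2 : 0 < el p q a₂) (h3 : 0 < el p q a₃)
    (k1 : el p q b₁ ≤ 0) (k2 : el p q b₂ ≤ 0) (k3 : el p q b₃ ≤ 0) :
    Compat (quad v a₁ a₂ a₃) (vq v a₁ a₂ a₃ Ab Ar At Al) (quad v b₁ b₂ b₃)
      (vq v b₁ b₂ b₃ Bb Br Bt Bl) := by
  refine Compat.of_inter (v := v) ?_ (vq_subset hA ab ar at' al) (vq_subset hB bb br bt bl)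
    (left_mem_vq _ _ _ _ ab) (left_mem_vq _ _ _ _ bb)
  rintro z ⟨hz, hz'⟩
  have := el_nonpos_of_mem hB hv.le k1 k2 k3 hz'
  rcases el_pos_or_eq hA hv h1 h2 h3 hz with h | h
  · linarith
  · exact h

lemma Compat.of_separated {a₀ a₁ a₂ a₃ b₀ b₁ b₂ b₃ : ℂ} (p q : ℂ)
    {Ab Ar At Al Bb Br Bt Bl : Finset ℝ}
    (hA : Ccw a₀ a₁ a₂ a₃) (hB : Ccw b₀ b₁ b₂ b₃) (ab : IsSub Ab) (ar : IsSub Ar) (at' : IsSub At)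
    (al : IsSub Al) (bb : IsSub Bb) (br : IsSub Br) (bt : IsSub Bt) (bl : IsSub Bl)
    (h0 : 0 < el p q a₀) (h1 : 0 < el p q a₁) (h2 : 0 < el p q a₂) (h3 : 0 < el p q a₃)
    (k0 : el p q b₀ ≤ 0) (k1 : el p q b₁ ≤ 0) (k2 : el p q b₂ ≤ 0) (k3 : el p q b₃ ≤ 0) :
    Compat (quad a₀ a₁ a₂ a₃) (vq a₀ a₁ a₂ a₃ Ab Ar At Al) (quad b₀ b₁ b₂ b₃)
      (vq b₀ b₁ b₂ b₃ Bb Br Bt Bl) := by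
  have hempty : ∀ z, z ∈ quad a₀ a₁ a₂ a₃ → z ∈ quad b₀ b₁ b₂ b₃ → False := by
    intro z hz hz'
    have e := el_nonpos_of_mem hB k0 k1 k2 k3 hz'
    have hconv : Convex ℝ {w | 0 < el p q w} := by
      rintro x hx y hy s t hs ht hst
      simp only [mem_ofPred_eq] at *
      rw [el_comb _ _ _ _ _ _ hst]
      rcases hs.eq_or_lt with rfl | hs
      · obtain rfl : t = 1 := by linarith
        linarith
      · have := mul_pos hs hx; have := mul_nonneg ht hy.le; linarith
    have := quad_subset_of_convex hA hconv h0 h1 h2 h3 hz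
    simp only [mem_ofPred_eq] at this
    linarith
  refine ⟨disjoint_left.2 fun z hz hz' => hempty z (interior_subset hz) (interior_subset hz'), ?_, ?_⟩
  · rintro z ⟨hz, hz'⟩; exact (hempty z (vq_subset hA ab ar at' al hz) hz').elim
  · rintro z ⟨hz, hz'⟩; exact (hempty z hz' (vq_subset hB bb br bt bl hz)).elim

theorem Meshable.union₃ {D₀ D₁ D₂ V₀ V₁ V₂ : Set ℂ} {n₀ n₁ n₂ : ℕ} (h0 : Meshable D₀ V₀ n₀)
    (h1 : Meshable D₁ V₁ n₁) (h2 : Meshable D₂ V₂ n₂) (h01 : Compat D₀ V₀ D₁ V₁)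
    (h02 : Compat D₀ V₀ D₂ V₂) (h12 : Compat D₁ V₁ D₂ V₂) :
    Meshable (D₀ ∪ D₁ ∪ D₂) (V₀ ∪ V₁ ∪ V₂) (n₀ + n₁ + n₂) := by
  have key : ∀ i j : Fin 3, i ≠ j →
      Compat (![D₀, D₁, D₂] i) (![V₀, V₁, V₂] i) (![D₀, D₁, D₂] j) (![V₀, V₁, V₂] j) := by
    intro i j hij
    fin_cases i <;> fin_cases j <;> first | exact absurd rfl hij | skip
    exacts [h01, h02, h01.symm, h12, h02.symm, h12.symm]
  have := Meshable.biUnion' (Finset.univ : Finset (Fin 3)) (D := ![D₀, D₁, D₂])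
    (V := ![V₀, V₁, V₂]) (n := ![n₀, n₁, n₂])
    (by intro i _; fin_cases i; exacts [h0, h1, h2]) (fun i _ j _ hij => (key i j hij).disj)
    (fun i _ j _ hij => (key i j hij).sub)
  convert this using 1
  · ext z; simp [Fin.exists_fin_succ, or_assoc]
  · ext z; simp [Fin.exists_fin_succ, or_assoc]
  · simp [Fin.sum_univ_succ, add_assoc]

theorem Meshable.union₄ {D₀ D₁ D₂ D₃ V₀ V₁ V₂ V₃ : Set ℂ} {n₀ n₁ n₂ n₃ : ℕ}
    (h0 : Meshable D₀ V₀ n₀)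
    (h1 : Meshable D₁ V₁ n₁) (h2 : Meshable D₂ V₂ n₂) (h3 : Meshable D₃ V₃ n₃)
    (h01 : Compat D₀ V₀ D₁ V₁) (h02 : Compat D₀ V₀ D₂ V₂) (h03 : Compat D₀ V₀ D₃ V₃)
    (h12 : Compat D₁ V₁ D₂ V₂) (h13 : Compat D₁ V₁ D₃ V₃) (h23 : Compat D₂ V₂ D₃ V₃) :
    Meshable (D₀ ∪ D₁ ∪ D₂ ∪ D₃) (V₀ ∪ V₁ ∪ V₂ ∪ V₃) (n₀ + n₁ + n₂ + n₃) := by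
  have key : ∀ i j : Fin 4, i ≠ j → Compat (![D₀, D₁, D₂, D₃] i) (![V₀, V₁, V₂, V₃] i)
      (![D₀, D₁, D₂, D₃] j) (![V₀, V₁, V₂, V₃] j) := by
    intro i j hij
    fin_cases i <;> fin_cases j <;> first | exact absurd rfl hij | skip
    exacts [h01, h02, h03, h01.symm, h12, h13, h02.symm, h12.symm, h23, h03.symm, h13.symm, h23.symm]
  have := Meshable.biUnion' (Finset.univ : Finset (Fin 4)) (D := ![D₀, D₁, D₂, D₃])
    (V := ![V₀, V₁, V₂, V₃]) (n := ![n₀, n₁, n₂, n₃])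
    (by intro i _; fin_cases i; exacts [h0, h1, h2, h3]) (fun i _ j _ hij => (key i j hij).disj)
    (fun i _ j _ hij => (key i j hij).sub)
  convert this using 1
  · ext z; simp [Fin.exists_fin_succ, or_assoc]
  · ext z; simp [Fin.exists_fin_succ, or_assoc]
  · simp [Fin.sum_univ_succ, add_assoc]

end SinkMesh

namespace SinkMesh

/-! ### Operations on meshed quadrilaterals with admissible side data -/

lemma IsSub.join {l : ℝ} {A B : Finset ℝ} (hA : IsSub A) (hB : IsSub B) (h0 : 0 ≤ l) (h1 : l ≤ 1) :
    IsSub (join l A B) := by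
  have key : ∀ t ∈ SinkMesh.join l A B, 0 ≤ t ∧ t ≤ 1 := by
    intro t ht
    simp only [SinkMesh.join, Finset.mem_union, Finset.mem_image] at ht
    rcases ht with ⟨s, hs, rfl⟩ | ⟨s, hs, rfl⟩
    · have a := hA.nonneg s hs; have b := hA.le_one s hs
      constructor <;> nlinarith
    · have a := hB.nonneg s hs; have b := hB.le_one s hs
      constructor <;> nlinarith
  refine ⟨?_, ?_, fun t ht => (key t ht).1, fun t ht => (key t ht).2⟩
  · exact Finset.mem_union_left _ (Finset.mem_image.2 ⟨0, hA.zero_mem, by simp⟩)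
  · exact Finset.mem_union_right _ (Finset.mem_image.2 ⟨1, hB.one_mem, by simp⟩)

lemma rev_join (l : ℝ) (A B : Finset ℝ) : rev (join l A B) = join (1 - l) (rev B) (rev A) := by
  simp only [rev, join, Finset.image_union, Finset.image_image]
  rw [Finset.union_comm]
  congr 1 <;> apply Finset.image_congr <;> intro t _ <;> simp only [Function.comp] <;> ring

lemma rev_pair : rev {0, 1} = {0, 1} := by
  ext t; simp only [mem_rev, Finset.mem_insert, Finset.mem_singleton]
  constructor <;> rintro (h | h)
  · right; linarith
  · left; linarith
  · right; linarith
  · left; linarith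

/-- A meshed quadrilateral, together with the facts that it is positively oriented and that the
side data are subdivisions. -/
structure QS (p₀ p₁ p₂ p₃ : ℂ) (Sb Sr St Sl : Finset ℝ) (n : ℕ) : Prop where
  ccw : Ccw p₀ p₁ p₂ p₃
  sb : IsSub Sb
  sr : IsSub Sr
  st : IsSub St
  sl : IsSub Sl
  qm : QM p₀ p₁ p₂ p₃ Sb Sr St Sl n

namespace QS
variable {p₀ p₁ p₂ p₃ b t : ℂ} {Sb Sr St Sl Z A₁ A₂ B₁ B₂ : Finset ℝ} {n m : ℕ} {l k : ℝ}

lemma mono (h : QS p₀ p₁ p₂ p₃ Sb Sr St Sl n) (hn : n ≤ m) : QS p₀ p₁ p₂ p₃ Sb Sr St Sl m :=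
  ⟨h.1, h.2, h.3, h.4, h.5, h.6.mono hn⟩

lemma rot (h : QS p₀ p₁ p₂ p₃ Sb Sr St Sl n) : QS p₁ p₂ p₃ p₀ Sr (rev St) Sl (rev Sb) n :=
  ⟨h.1.rot, h.3, h.4.rev, h.5, h.2.rev, QM.rot_iff.2 h.6⟩

lemma prod (h : Nq p₀ p₁ p₂ p₃) (hb : IsSub Sb) (hl : IsSub Sl) :
    QS p₀ p₁ p₂ p₃ Sb Sl Sb Sl ((Sb.card - 1) * (Sl.card - 1)) :=
  ⟨h.ccw, hb, hl, hb, hl, QM.prod h hb hl⟩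

lemma simil (h : QS p₀ p₁ p₂ p₃ Sb Sr St Sl n) (ω : ℂ) (hω : ω ≠ 0) (c : ℂ) :
    QS (ω * p₀ + c) (ω * p₁ + c) (ω * p₂ + c) (ω * p₃ + c) Sb Sr St Sl n := by
  have hp := Complex.normSq_pos.2 hω
  refine ⟨⟨?_, ?_, ?_, ?_⟩, h.2, h.3, h.4, h.5, h.6.simil ω hω c⟩ <;>
    simp only [← simil_apply ω hω c, el_simil]
  exacts [mul_pos hp h.1.c₀, mul_pos hp h.1.c₁, mul_pos hp h.1.c₂, mul_pos hp h.1.c₃]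

lemma vcut (h : Ccw p₀ p₁ p₂ p₃) (hl : 0 < l) (hl1 : l < 1) (hk : 0 < k) (hk1 : k < 1)
    (hb : lm p₀ p₁ l = b) (ht : lm p₃ p₂ k = t)
    (h₁ : QS p₀ b t p₃ A₁ Z B₁ Sl n) (h₂ : QS b p₁ p₂ t A₂ Sr B₂ Z m) :
    QS p₀ p₁ p₂ p₃ (join l A₁ A₂) Sr (join k B₁ B₂) Sl (n + m) := by
  subst hb ht
  exact ⟨h, h₁.sb.join h₂.sb hl.le hl1.le, h₂.sr, h₁.st.join h₂.st hk.le hk1.le, h₁.sl,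
    QM.vcut h hl hl1 hk hk1 h₁.sb h₂.sb h₂.sr h₁.st h₂.st h₁.sl h₁.sr h₁.qm h₂.qm⟩

lemma hcut (h : Ccw p₀ p₁ p₂ p₃) (hl : 0 < l) (hl1 : l < 1) (hk : 0 < k) (hk1 : k < 1)
    (hb : lm p₀ p₃ l = b) (ht : lm p₁ p₂ k = t)
    (h₁ : QS p₀ p₁ t b Sb B₁ Z A₁ n) (h₂ : QS b t p₂ p₃ Z B₂ St A₂ m) :
    QS p₀ p₁ p₂ p₃ Sb (join k B₁ B₂) St (join l A₁ A₂) (n + m) := by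
  subst hb ht
  exact ⟨h, h₁.sb, h₁.sr.join h₂.sr hk.le hk1.le, h₂.st, h₁.sl.join h₂.sl hl.le hl1.le,
    QM.hcut h hl hl1 hk hk1 h₁.sb h₁.sr h₂.sr h₂.st h₁.sl h₂.sl h₁.st h₁.qm h₂.qm⟩

end QS

/-! ### Rectangles -/

lemma lm_mk (x₀ y₀ x₁ y₁ t : ℝ) :
    lm ⟨x₀, y₀⟩ ⟨x₁, y₁⟩ t = ⟨x₀ + t * (x₁ - x₀), y₀ + t * (y₁ - y₀)⟩ := by
  apply Complex.ext <;> simp [lm]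

lemma el_mk (x₀ y₀ x₁ y₁ x y : ℝ) : el ⟨x₀, y₀⟩ ⟨x₁, y₁⟩ ⟨x, y⟩ =
    (x₁ - x₀) * (y - y₀) - (y₁ - y₀) * (x - x₀) := by
  simp [el_def]

/-- A meshed axis-parallel rectangle `[x₀, x₁] × [y₀, y₁]`. -/
def RM (x₀ x₁ y₀ y₁ : ℝ) (Sb Sr St Sl : Finset ℝ) (n : ℕ) : Prop :=
  QS ⟨x₀, y₀⟩ ⟨x₁, y₀⟩ ⟨x₁, y₁⟩ ⟨x₀, y₁⟩ Sb Sr St Sl n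

lemma nq_rect {x₀ x₁ y₀ y₁ : ℝ} (hx : x₀ < x₁) (hy : y₀ < y₁) :
    Nq ⟨x₀, y₀⟩ ⟨x₁, y₀⟩ ⟨x₁, y₁⟩ ⟨x₀, y₁⟩ := by
  have h := mul_pos (sub_pos.2 hx) (sub_pos.2 hy)
  refine ⟨?_, ?_, ?_, ?_⟩ <;> refine ⟨?_, ?_⟩ <;> simp [cr, dt] <;> nlinarith

namespace RM
variable {x₀ x₁ y₀ y₁ x y : ℝ} {Sb Sr St Sl Z A₁ A₂ B₁ B₂ : Finset ℝ} {n m : ℕ}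

lemma mono (h : RM x₀ x₁ y₀ y₁ Sb Sr St Sl n) (hn : n ≤ m) : RM x₀ x₁ y₀ y₁ Sb Sr St Sl m :=
  QS.mono h hn

lemma prod (hx : x₀ < x₁) (hy : y₀ < y₁) (hb : IsSub Sb) (hl : IsSub Sl) :
    RM x₀ x₁ y₀ y₁ Sb Sl Sb Sl ((Sb.card - 1) * (Sl.card - 1)) :=
  QS.prod (nq_rect hx hy) hb hl

lemma vcut (h0 : x₀ < x) (h1 : x < x₁) (hy : y₀ < y₁) (h₁ : RM x₀ x y₀ y₁ A₁ Z B₁ Sl n)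
    (h₂ : RM x x₁ y₀ y₁ A₂ Sr B₂ Z m) :
    RM x₀ x₁ y₀ y₁ (join ((x - x₀) / (x₁ - x₀)) A₁ A₂) Sr (join ((x - x₀) / (x₁ - x₀)) B₁ B₂) Sl
      (n + m) := by
  have hd : 0 < x₁ - x₀ := by linarith
  have hl : 0 < (x - x₀) / (x₁ - x₀) := div_pos (by linarith) hd
  have hl1 : (x - x₀) / (x₁ - x₀) < 1 := (div_lt_one hd).2 (by linarith)
  refine QS.vcut (nq_rect (h0.trans h1) hy).ccw hl hl1 hl hl1 ?_ ?_ h₁ h₂ <;>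
    rw [lm_mk] <;> congr 1 <;> field_simp <;> ring

lemma hcut (h0 : y₀ < y) (h1 : y < y₁) (hx : x₀ < x₁) (h₁ : RM x₀ x₁ y₀ y Sb B₁ Z A₁ n)
    (h₂ : RM x₀ x₁ y y₁ Z B₂ St A₂ m) :
    RM x₀ x₁ y₀ y₁ Sb (join ((y - y₀) / (y₁ - y₀)) B₁ B₂) St (join ((y - y₀) / (y₁ - y₀)) A₁ A₂)
      (n + m) := by
  have hd : 0 < y₁ - y₀ := by linarith
  have hl : 0 < (y - y₀) / (y₁ - y₀) := div_pos (by linarith) hd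
  have hl1 : (y - y₀) / (y₁ - y₀) < 1 := (div_lt_one hd).2 (by linarith)
  refine QS.hcut (nq_rect hx (h0.trans h1)).ccw hl hl1 hl hl1 ?_ ?_ h₁ h₂ <;>
    rw [lm_mk] <;> congr 1 <;> field_simp <;> ring

lemma scale (h : RM x₀ x₁ y₀ y₁ Sb Sr St Sl n) {c : ℝ} (hc : 0 < c) (u v : ℝ) :
    RM (c * x₀ + u) (c * x₁ + u) (c * y₀ + v) (c * y₁ + v) Sb Sr St Sl n := by
  have := QS.simil h (c : ℂ) (by exact_mod_cast hc.ne') ⟨u, v⟩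
  unfold RM
  convert this using 1 <;> apply Complex.ext <;> simp

/-- A counterclockwise quarter turn about the origin. The old upper left corner becomes the lower
left one, which accounts for the three relabellings. -/
lemma rot (h : RM x₀ x₁ y₀ y₁ Sb Sr St Sl n) :
    RM (-y₁) (-y₀) x₀ x₁ (rev Sl) Sb (rev Sr) St n := by
  have := QS.simil (QS.rot (QS.rot (QS.rot h))) Complex.I Complex.I_ne_zero 0
  unfold RM
  rw [rev_rev, rev_rev] at this
  convert this using 1 <;> apply Complex.ext <;> simp

end RM

/-! ### Equal subdivisions -/

/-- The subdivision into `k` equal parts. -/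
noncomputable def eqd (k : ℕ) : Finset ℝ := (Finset.range (k + 1)).image fun i : ℕ => (i : ℝ) / k

lemma mem_eqd {k : ℕ} {t : ℝ} : t ∈ eqd k ↔ ∃ i ≤ k, (i : ℝ) / k = t := by
  simp [eqd, Nat.lt_succ_iff]

lemma isSub_eqd {k : ℕ} (hk : 0 < k) : IsSub (eqd k) := by
  have hk' : (0 : ℝ) < k := by exact_mod_cast hk
  refine ⟨mem_eqd.2 ⟨0, by simp, by simp⟩, mem_eqd.2 ⟨k, le_rfl, div_self hk'.ne'⟩, ?_, ?_⟩
  · intro t ht; obtain ⟨i, hi, rfl⟩ := mem_eqd.1 ht; positivity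
  · intro t ht; obtain ⟨i, hi, rfl⟩ := mem_eqd.1 ht
    rw [div_le_one hk']; exact_mod_cast hi

lemma card_eqd {k : ℕ} (hk : 0 < k) : (eqd k).card = k + 1 := by
  have hk' : (k : ℝ) ≠ 0 := by exact_mod_cast hk.ne'
  rw [eqd, Finset.card_image_of_injective, Finset.card_range]
  intro i j h
  exact_mod_cast (div_left_inj' hk').1 h

lemma rev_eqd {k : ℕ} (hk : 0 < k) : rev (eqd k) = eqd k := by
  have hk' : (k : ℝ) ≠ 0 := by exact_mod_cast hk.ne'
  have key : ∀ t, t ∈ eqd k → 1 - t ∈ eqd k := by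
    intro t ht
    obtain ⟨i, hi, rfl⟩ := mem_eqd.1 ht
    refine mem_eqd.2 ⟨k - i, by omega, ?_⟩
    rw [Nat.cast_sub hi]; field_simp
  ext t
  rw [mem_rev]
  exact ⟨fun h => by simpa using key _ h, key t⟩

lemma eqd_one : eqd 1 = {0, 1} := by
  ext t; simp [eqd, Finset.range_add_one, eq_comm, or_comm]

lemma card_join {l : ℝ} (h0 : 0 < l) (h1 : l < 1) {A B : Finset ℝ} (hA : IsSub A) (hB : IsSub B) :
    (join l A B).card + 1 = A.card + B.card := by
  have e1 : (A.image fun t => l * t).card = A.card :=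
    Finset.card_image_of_injective _ fun a b h => by simpa [h0.ne'] using h
  have e2 : (B.image fun t => l + (1 - l) * t).card = B.card :=
    Finset.card_image_of_injective _ fun a b h => by
      have : 1 - l ≠ 0 := by linarith
      simpa [this] using h
  have e3 : ((A.image fun t => l * t) ∩ (B.image fun t => l + (1 - l) * t)) = {l} := by
    ext t
    simp only [Finset.mem_inter, Finset.mem_image, Finset.mem_singleton]
    constructor
    · rintro ⟨⟨a, ha, rfl⟩, b, hb, e⟩
      have := hA.le_one a ha; have := hB.nonneg b hb
      have h2 : 0 ≤ (1 - l) * b := mul_nonneg (by linarith) this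
      nlinarith
    · rintro rfl
      exact ⟨⟨1, hA.one_mem, by ring⟩, 0, hB.zero_mem, by ring⟩
  have := Finset.card_union_add_card_inter (A.image fun t => l * t)
    (B.image fun t => l + (1 - l) * t)
  rw [e3, e1, e2, Finset.card_singleton] at this
  exact this

end SinkMesh

/-! ### The folding gadget. -/

namespace SinkMesh

lemma QS.compat {a₀ a₃ b t b₁ b₂ : ℂ} {Ab At Al Bb Br Bt Z : Finset ℝ} {n m : ℕ}
    (hA : QS a₀ b t a₃ Ab Z At Al n) (hB : QS b b₁ b₂ t Bb Br Bt Z m) :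
    Compat (quad a₀ b t a₃) (vq a₀ b t a₃ Ab Z At Al) (quad b b₁ b₂ t) (vq b b₁ b₂ t Bb Br Bt Z) :=
  Compat.of_side hA.ccw hB.ccw hA.sb hA.st hA.sl hB.sb hB.sr hB.st hA.sr

/-- Points of an interior edge starting at a corner lie on the frontier only at the corner. -/
lemma eq_of_mem_frontier {p₀ p₁ p₂ p₃ c z : ℂ} {S : Finset ℝ} (h : Ccw p₀ p₁ p₂ p₃) (hS : IsSub S)
    (h0 : 0 < el p₀ p₁ c) (h1 : 0 < el p₁ p₂ c) (h2 : 0 < el p₂ p₃ c) (h3 : 0 < el p₃ p₀ c)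
    {q : ℂ} (hq : q ∈ quad p₀ p₁ p₂ p₃) (hz : z ∈ pts q c S)
    (hf : z ∈ frontier (quad p₀ p₁ p₂ p₃)) : z = q := by
  obtain ⟨t, ht, rfl⟩ := hz
  rcases (hS.nonneg t ht).eq_or_lt with rfl | h0t
  · exact lm_zero _ _
  exfalso
  rw [frontier, interior_quad h] at hf
  refine hf.2 ?_
  have h1t := sub_nonneg.2 (hS.le_one t ht)
  obtain ⟨q0, q1, q2, q3⟩ := hq
  refine ⟨?_, ?_, ?_, ?_⟩ <;> rw [el_lm] <;> positivity

/-- Half of a regular hexagon is divided into four halves of half the size, of which this is one.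
All angles are 60° or 120°, the extreme values allowed. -/
lemma Nq.fold_left : Nq ⟨1, 0⟩ ⟨2, 0⟩ ⟨5 / 2, √3 / 2⟩ ⟨2, √3⟩ := by
  have h3 : √3 * √3 = 3 := Real.mul_self_sqrt (by norm_num)
  have hp : 0 < √3 := by positivity
  refine ⟨?_, ?_, ?_, ?_⟩ <;> rw [niceDir_iff] <;> simp only [cr, dt, Complex.sub_re, Complex.sub_im] <;>
    generalize √3 = r at * <;> refine ⟨?_, ?_, ?_⟩ <;> nlinarith

lemma Nq.fold_right : Nq ⟨4, 0⟩ ⟨5, 0⟩ ⟨4, √3⟩ ⟨7 / 2, √3 / 2⟩ := by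
  have h3 : √3 * √3 = 3 := Real.mul_self_sqrt (by norm_num)
  have hp : 0 < √3 := by positivity
  refine ⟨?_, ?_, ?_, ?_⟩ <;> rw [niceDir_iff] <;> simp only [cr, dt, Complex.sub_re, Complex.sub_im] <;>
    generalize √3 = r at * <;> refine ⟨?_, ?_, ?_⟩ <;> nlinarith

lemma Nq.fold_mid : Nq ⟨2, 0⟩ ⟨4, 0⟩ ⟨7 / 2, √3 / 2⟩ ⟨5 / 2, √3 / 2⟩ := by
  have h3 : √3 * √3 = 3 := Real.mul_self_sqrt (by norm_num)
  have hp : 0 < √3 := by positivity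
  refine ⟨?_, ?_, ?_, ?_⟩ <;> rw [niceDir_iff] <;> simp only [cr, dt, Complex.sub_re, Complex.sub_im] <;>
    generalize √3 = r at * <;> refine ⟨?_, ?_, ?_⟩ <;> nlinarith

lemma Nq.fold_top : Nq ⟨5 / 2, √3 / 2⟩ ⟨7 / 2, √3 / 2⟩ ⟨4, √3⟩ ⟨2, √3⟩ := by
  have h3 : √3 * √3 = 3 := Real.mul_self_sqrt (by norm_num)
  have hp : 0 < √3 := by positivity
  refine ⟨?_, ?_, ?_, ?_⟩ <;> rw [niceDir_iff] <;> simp only [cr, dt, Complex.sub_re, Complex.sub_im] <;>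
    generalize √3 = r at * <;> refine ⟨?_, ?_, ?_⟩ <;> nlinarith

/-- The bottom side of the folding gadget. -/
noncomputable def foldBottom (k v : ℕ) : Finset ℝ :=
  join (1 / 4) (eqd k) (join (2 / 3) (eqd v) (eqd k))

lemma ccw_fold : Ccw ⟨1, 0⟩ ⟨5, 0⟩ ⟨4, √3⟩ ⟨2, √3⟩ := by
  have h3 : √3 * √3 = 3 := Real.mul_self_sqrt (by norm_num)
  have hp : 0 < √3 := by positivity
  generalize √3 = r at *
  refine ⟨?_, ?_, ?_, ?_⟩ <;> rw [el_mk] <;> nlinarith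

lemma quad_fold : quad ⟨1, 0⟩ ⟨5, 0⟩ ⟨4, √3⟩ ⟨2, √3⟩ =
    quad ⟨1, 0⟩ ⟨2, 0⟩ ⟨5 / 2, √3 / 2⟩ ⟨2, √3⟩ ∪ quad ⟨2, 0⟩ ⟨4, 0⟩ ⟨7 / 2, √3 / 2⟩ ⟨5 / 2, √3 / 2⟩ ∪
      quad ⟨4, 0⟩ ⟨5, 0⟩ ⟨4, √3⟩ ⟨7 / 2, √3 / 2⟩ ∪ quad ⟨5 / 2, √3 / 2⟩ ⟨7 / 2, √3 / 2⟩ ⟨4, √3⟩ ⟨2, √3⟩ := by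
  have h3 : √3 * √3 = 3 := Real.mul_self_sqrt (by norm_num)
  have hp : 0 < √3 := by positivity
  have hc := convex_quad ⟨1, 0⟩ ⟨5, 0⟩ ⟨4, √3⟩ ⟨2, √3⟩
  have m : ∀ x y : ℝ, 0 ≤ y → y ≤ √3 → √3 * 1 + y ≤ √3 * x → √3 * x ≤ √3 * 5 - y →
      (⟨x, y⟩ : ℂ) ∈ quad ⟨1, 0⟩ ⟨5, 0⟩ ⟨4, √3⟩ ⟨2, √3⟩ := by
    intro x y h0 h1 h2 h3
    refine ⟨?_, ?_, ?_, ?_⟩ <;> rw [el_mk] <;> nlinarith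
  apply Subset.antisymm
  · rintro ⟨x, y⟩ ⟨z0, z1, z2, z3⟩
    simp only [el_mk] at z0 z1 z2 z3
    generalize √3 = r at *
    have a0 : 0 ≤ y := by linarith
    have a2 : y ≤ r := by linarith
    have a1 : r * x ≤ r * 5 - y := by linarith
    have a3 : r * 1 + y ≤ r * x := by nlinarith
    by_cases c1 : y ≤ r / 2
    · by_cases c2 : r * x ≤ r * 2 + y
      · left; left; left
        refine ⟨?_, ?_, ?_, ?_⟩ <;> rw [el_mk] <;> nlinarith
      by_cases c3 : r * x ≤ r * 4 - y
      · left; left; right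
        refine ⟨?_, ?_, ?_, ?_⟩ <;> rw [el_mk] <;> nlinarith
      · left; right
        refine ⟨?_, ?_, ?_, ?_⟩ <;> rw [el_mk] <;> nlinarith
    · by_cases c2 : r * x ≤ r * 3 - y
      · left; left; left
        refine ⟨?_, ?_, ?_, ?_⟩ <;> rw [el_mk] <;> nlinarith
      by_cases c3 : r * x ≤ r * 3 + y
      · right
        refine ⟨?_, ?_, ?_, ?_⟩ <;> rw [el_mk] <;> nlinarith
      · left; right
        refine ⟨?_, ?_, ?_, ?_⟩ <;> rw [el_mk] <;> nlinarith
  · refine union_subset (union_subset (union_subset ?_ ?_) ?_) ?_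
    · refine quad_subset_of_convex Nq.fold_left.ccw hc ?_ ?_ ?_ ?_ <;> apply m <;> nlinarith
    · refine quad_subset_of_convex Nq.fold_mid.ccw hc ?_ ?_ ?_ ?_ <;> apply m <;> nlinarith
    · refine quad_subset_of_convex Nq.fold_right.ccw hc ?_ ?_ ?_ ?_ <;> apply m <;> nlinarith
    · refine quad_subset_of_convex Nq.fold_top.ccw hc ?_ ?_ ?_ ?_ <;> apply m <;> nlinarith

lemma QS.rot₃ {p₀ p₁ p₂ p₃ : ℂ} {Sb Sr St Sl : Finset ℝ} {n : ℕ}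
    (h : QS p₀ p₁ p₂ p₃ Sb Sr St Sl n) : QS p₃ p₀ p₁ p₂ (rev Sl) Sb (rev Sr) St n := by
  have := h.rot.rot.rot
  rwa [rev_rev, rev_rev] at this

lemma vq_rot₃ (p₀ p₁ p₂ p₃ : ℂ) (Sb Sr St Sl : Finset ℝ) :
    vq p₃ p₀ p₁ p₂ (rev Sl) Sb (rev Sr) St = vq p₀ p₁ p₂ p₃ Sb Sr St Sl := by
  unfold vq; rw [pts_rev, pts_rev]; ext z; simp only [mem_union]; tauto

lemma pts_pair (p q : ℂ) : pts p q {0, 1} = {p, q} := by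
  simp [pts, image_insert_eq, lm_zero, lm_one]

/-- A trapezoid whose bottom has `2 k` edges more than its top. -/
lemma QS.fold {k v : ℕ} (hk : 0 < k) (hv : 0 < v) :
    QS ⟨1, 0⟩ ⟨5, 0⟩ ⟨4, √3⟩ ⟨2, √3⟩ (foldBottom k v) {0, 1} (eqd v) {0, 1} (k + v + k + v * k) := by
  have hp : 0 < √3 := by positivity
  have sk := isSub_eqd hk
  have sv := isSub_eqd hv
  have hcover := quad_fold
  have hccw := ccw_fold
  have qL := QS.prod Nq.fold_left sk isSub_pair
  have qM := QS.prod Nq.fold_mid sv isSub_pair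
  have qR := QS.prod Nq.fold_right sk isSub_pair
  have qT := QS.prod Nq.fold_top sv sk
  have hLR : Compat (quad ⟨1, 0⟩ ⟨2, 0⟩ ⟨5 / 2, √3 / 2⟩ ⟨2, √3⟩)
      (vq ⟨1, 0⟩ ⟨2, 0⟩ ⟨5 / 2, √3 / 2⟩ ⟨2, √3⟩ (eqd k) {0, 1} (eqd k) {0, 1})
      (quad ⟨4, 0⟩ ⟨5, 0⟩ ⟨4, √3⟩ ⟨7 / 2, √3 / 2⟩)
      (vq ⟨4, 0⟩ ⟨5, 0⟩ ⟨4, √3⟩ ⟨7 / 2, √3 / 2⟩ (eqd k) {0, 1} (eqd k) {0, 1}) := by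
    refine Compat.of_separated ⟨3, 0⟩ ⟨3, 1⟩ qL.ccw qR.ccw qL.sb qL.sr qL.st qL.sl qR.sb qR.sr qR.st
      qR.sl ?_ ?_ ?_ ?_ ?_ ?_ ?_ ?_ <;> rw [el_mk] <;> norm_num
  have eA1 : lm ⟨1, 0⟩ ⟨5, 0⟩ (1 / 4) = ⟨2, 0⟩ := by rw [lm_mk]; norm_num
  have eA2 : lm ⟨2, 0⟩ ⟨5, 0⟩ (2 / 3) = ⟨4, 0⟩ := by rw [lm_mk]; norm_num
  have hA1 : (⟨2, 0⟩ : ℂ) ∈ quad ⟨1, 0⟩ ⟨5, 0⟩ ⟨4, √3⟩ ⟨2, √3⟩ := by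
    refine ⟨?_, ?_, ?_, ?_⟩ <;> rw [el_mk] <;> nlinarith
  have hA2 : (⟨4, 0⟩ : ℂ) ∈ quad ⟨1, 0⟩ ⟨5, 0⟩ ⟨4, √3⟩ ⟨2, √3⟩ := by
    refine ⟨?_, ?_, ?_, ?_⟩ <;> rw [el_mk] <;> nlinarith
  have hC1 : ∀ {q z : ℂ} {S : Finset ℝ}, IsSub S → q ∈ quad ⟨1, 0⟩ ⟨5, 0⟩ ⟨4, √3⟩ ⟨2, √3⟩ →
      z ∈ pts q ⟨5 / 2, √3 / 2⟩ S → z ∈ frontier (quad ⟨1, 0⟩ ⟨5, 0⟩ ⟨4, √3⟩ ⟨2, √3⟩) → z = q :=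
    fun hS hq hz hf => eq_of_mem_frontier ccw_fold hS (by rw [el_mk]; nlinarith)
      (by rw [el_mk]; nlinarith) (by rw [el_mk]; nlinarith) (by rw [el_mk]; nlinarith) hq hz hf
  have hC2 : ∀ {q z : ℂ} {S : Finset ℝ}, IsSub S → q ∈ quad ⟨1, 0⟩ ⟨5, 0⟩ ⟨4, √3⟩ ⟨2, √3⟩ →
      z ∈ pts q ⟨7 / 2, √3 / 2⟩ S → z ∈ frontier (quad ⟨1, 0⟩ ⟨5, 0⟩ ⟨4, √3⟩ ⟨2, √3⟩) → z = q :=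
    fun hS hq hz hf => eq_of_mem_frontier ccw_fold hS (by rw [el_mk]; nlinarith)
      (by rw [el_mk]; nlinarith) (by rw [el_mk]; nlinarith) (by rw [el_mk]; nlinarith) hq hz hf
  have hCC : (⟨5 / 2, √3 / 2⟩ : ℂ) ∈ quad ⟨1, 0⟩ ⟨5, 0⟩ ⟨4, √3⟩ ⟨2, √3⟩ ∧
      (⟨5 / 2, √3 / 2⟩ : ℂ) ∉ frontier (quad ⟨1, 0⟩ ⟨5, 0⟩ ⟨4, √3⟩ ⟨2, √3⟩) := by
    have : (⟨5 / 2, √3 / 2⟩ : ℂ) ∈ interior (quad ⟨1, 0⟩ ⟨5, 0⟩ ⟨4, √3⟩ ⟨2, √3⟩) := by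
      rw [interior_quad ccw_fold]; refine ⟨?_, ?_, ?_, ?_⟩ <;> rw [el_mk] <;> nlinarith
    exact ⟨interior_subset this, fun h => h.2 this⟩
  generalize (⟨1, 0⟩ : ℂ) = A0 at *
  generalize (⟨2, 0⟩ : ℂ) = A1 at *
  generalize (⟨4, 0⟩ : ℂ) = A2 at *
  generalize (⟨5, 0⟩ : ℂ) = A3 at *
  generalize (⟨2, √3⟩ : ℂ) = B0 at *
  generalize (⟨4, √3⟩ : ℂ) = B3 at *
  generalize (⟨5 / 2, √3 / 2⟩ : ℂ) = C1 at *
  generalize (⟨7 / 2, √3 / 2⟩ : ℂ) = C2 at *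
  have hLM := qL.compat qM
  have hMR := qM.compat qR
  -- The two pieces read their common side in opposite directions; this does not matter since `eqd
  -- k` is symmetric.
  have hLT : Compat _ _ _ _ := QS.compat (Z := rev (eqd k)) qL.rot
    (by rw [rev_eqd hk]; exact qT)
  rw [quad_rot, vq_rot, rev_eqd hk] at hLT
  have hMT : Compat _ _ _ _ := QS.compat qM.rot qT.rot
  rw [quad_rot A1 A2 C2 C1, vq_rot A1, quad_rot C1 C2 B3 B0, vq_rot C1] at hMT
  have hTR : Compat _ _ _ _ := QS.compat qT qR.rot₃
  rw [← quad_rot C2, vq_rot₃] at hTR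
  -- In this union `k` strips enter the left piece from below, cross the top piece and come down
  -- through the right piece, while `v` strips run straight up through the middle. So the bottom has
  -- `2 * k + v` edges and the top only `v`.
  have key := Meshable.union₄ qL.qm qM.qm qR.qm qT.qm hLM hLR hLT hMR hMT hTR.symm
  rw [← hcover] at key
  refine ⟨hccw, ?_, isSub_pair, sv, isSub_pair, ?_⟩
  · exact sk.join (sv.join sk (by norm_num) (by norm_num)) (by norm_num) (by norm_num)
  refine (Meshable.congr key fun z hz => ?_).mono ?_
  · rw [foldBottom, pts_join, eA1, pts_join, eA2]
    simp only [mem_union, pts_pair, mem_insert_iff, mem_singleton_iff]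
    have f1 : z ∈ pts B0 C1 (eqd k) → z = B0 := fun h => hC1 sk hccw.mem₃ h hz
    have f1' : z ∈ pts C1 B0 (eqd k) → z = B0 := fun h => by
      rw [← rev_eqd hk, pts_rev] at h; exact f1 h
    have f2 : z ∈ pts C2 B3 (eqd k) → z = B3 := fun h => by
      rw [← rev_eqd hk, pts_rev] at h; exact hC2 sk hccw.mem₂ h hz
    have f3 : ¬ z ∈ pts C1 C2 (eqd v) := fun h => by
      have := hC2 sv hCC.1 h hz
      rw [this] at hz; exact hCC.2 hz
    have g1 : z = C1 → False := fun h => by rw [h] at hz; exact hCC.2 hz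
    have g2 : z = C2 → False := fun h => f3 ⟨1, sv.one_mem, by rw [lm_one, h]⟩
    have m1 : z = A1 → z ∈ pts A0 A1 (eqd k) := fun h => ⟨1, sk.one_mem, by rw [lm_one, h]⟩
    have m2 : z = A2 → z ∈ pts A1 A2 (eqd v) := fun h => ⟨1, sv.one_mem, by rw [lm_one, h]⟩
    constructor
    · rintro (((((h | h | h)) | (h | h)) | h) | (h | h)) <;> simp only [h, true_or, or_true]
    · rintro ((((((h | (h | h)) | h) | (h | h)) | (((h | (h | h)) | h) | (h | h))) |
        (((h | (h | h)) | h) | (h | h))) | (((h | h) | h) | h)) <;> first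
        | exact (f3 h).elim
        | exact (g1 h).elim
        | exact (g2 h).elim
        | (have h' := f1 h; simp only [h', true_or, or_true])
        | (have h' := f1' h; simp only [h', true_or, or_true])
        | (have h' := f2 h; simp only [h', true_or, or_true])
        | (have h' := m1 h; simp only [h', true_or, or_true])
        | (have h' := m2 h; simp only [h', true_or, or_true])
        | (simp only [h, true_or, or_true])
  · rw [card_eqd hk, card_eqd hv, Finset.card_pair (by norm_num)]; simp

/-- Bottom of a rectangle around the folding gadget. -/
noncomputable def foldIn (k v : ℕ) : Finset ℝ := join (1 / 6) {0, 1} (join (4 / 5) (foldBottom k v) {0, 1})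

/-- Top of a rectangle around the folding gadget. -/
noncomputable def foldOut (v : ℕ) : Finset ℝ := join (1 / 3) {0, 1} (join (1 / 2) (eqd v) {0, 1})

lemma nq_fold_filler_left : Nq ⟨0, 0⟩ ⟨1, 0⟩ ⟨2, √3⟩ ⟨0, √3⟩ := by
  have h3 : √3 * √3 = 3 := Real.mul_self_sqrt (by norm_num)
  have hp : 0 < √3 := by positivity
  refine ⟨?_, ?_, ?_, ?_⟩ <;> rw [niceDir_iff] <;> simp only [cr, dt, Complex.sub_re, Complex.sub_im] <;>
    generalize √3 = r at * <;> refine ⟨?_, ?_, ?_⟩ <;> nlinarith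

lemma nq_fold_filler_right : Nq ⟨5, 0⟩ ⟨6, 0⟩ ⟨6, √3⟩ ⟨4, √3⟩ := by
  have h3 : √3 * √3 = 3 := Real.mul_self_sqrt (by norm_num)
  have hp : 0 < √3 := by positivity
  refine ⟨?_, ?_, ?_, ?_⟩ <;> rw [niceDir_iff] <;> simp only [cr, dt, Complex.sub_re, Complex.sub_im] <;>
    generalize √3 = r at * <;> refine ⟨?_, ?_, ?_⟩ <;> nlinarith

/-- Two filler pieces with undivided sides complete the trapezoid to a rectangle, so that the gadget
can be placed along a side of a square. -/
lemma RM.fold {k v : ℕ} (hk : 0 < k) (hv : 0 < v) :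
    RM 0 6 0 (√3) (foldIn k v) {0, 1} (foldOut v) {0, 1} (1 + (k + v + k + v * k + 1)) := by
  have hp : 0 < √3 := by positivity
  have q0 := QS.prod nq_fold_filler_left isSub_pair isSub_pair
  have q2 := QS.prod nq_fold_filler_right isSub_pair isSub_pair
  rw [Finset.card_pair (by norm_num)] at q0 q2
  have q := QS.vcut (l := 4 / 5) (k := 1 / 2) (p₀ := ⟨1, 0⟩) (p₁ := ⟨6, 0⟩) (p₂ := ⟨6, √3⟩)
    (p₃ := ⟨2, √3⟩) ?_ (by norm_num) (by norm_num)
    (by norm_num) (by norm_num) (by rw [lm_mk]; norm_num) (by rw [lm_mk]; norm_num) (QS.fold hk hv) q2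
  · exact QS.vcut (l := 1 / 6) (k := 1 / 3) (nq_rect (by norm_num) hp).ccw (by norm_num) (by norm_num)
      (by norm_num) (by norm_num) (by rw [lm_mk]; norm_num) (by rw [lm_mk]; norm_num) q0 q
  · refine ⟨?_, ?_, ?_, ?_⟩ <;> rw [el_mk] <;> nlinarith

end SinkMesh

/-! ### The turning gadget. -/

namespace SinkMesh

/-- The side conditions say that both bracketings have their two breakpoints at the same places. -/
lemma join_assoc {l m l' m' : ℝ} (A B C : Finset ℝ) (h1 : l' = l + (1 - l) * m) (h2 : l = l' * m') :
    join l A (join m B C) = join l' (join m' A B) C := by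
  simp only [join, Finset.image_union, Finset.image_image, Finset.union_assoc]
  congr 1
  · apply Finset.image_congr; intro t _; simp only [Function.comp]; rw [h2]; ring
  congr 1
  · apply Finset.image_congr; intro t _; simp only [Function.comp]
    linear_combination (1 - t) * h2 + t * (h1.symm)
  · apply Finset.image_congr; intro t _; simp only [Function.comp]
    linear_combination (1 - t) * h1.symm

lemma eqd_two : eqd 2 = join (1 / 2) {0, 1} {0, 1} := by
  ext t
  simp only [eqd, join, Finset.range_add_one, Finset.range_zero, Finset.image_insert,
    Finset.image_singleton, Finset.mem_union, Finset.mem_insert, Finset.mem_singleton,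
    insert_empty_eq]
  norm_num
  tauto

/-- The inner corner of the gadget that turns a strip by a right angle. -/
noncomputable def turnPt : ℂ := ⟨1 + √3 / 3, 3 - √3 / 3⟩

lemma nq_turn₁ : Nq ⟨0, 2⟩ turnPt ⟨2, 4⟩ ⟨0, 4⟩ := by
  have h3 : √3 * √3 = 3 := Real.mul_self_sqrt (by norm_num)
  have hp : 1.7 < √3 := by rw [Real.lt_sqrt] <;> norm_num
  have hq : √3 < 1.8 := by rw [Real.sqrt_lt'] <;> norm_num
  refine ⟨?_, ?_, ?_, ?_⟩ <;> rw [niceDir_iff] <;> simp only [cr, dt, turnPt, Complex.sub_re, Complex.sub_im] <;>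
    generalize √3 = r at * <;> refine ⟨?_, ?_, ?_⟩ <;> nlinarith

lemma nq_turn₂ : Nq ⟨0, 1⟩ ⟨2, 2⟩ turnPt ⟨0, 2⟩ := by
  have h3 : √3 * √3 = 3 := Real.mul_self_sqrt (by norm_num)
  have hp : 1.7 < √3 := by rw [Real.lt_sqrt] <;> norm_num
  have hq : √3 < 1.8 := by rw [Real.sqrt_lt'] <;> norm_num
  refine ⟨?_, ?_, ?_, ?_⟩ <;> rw [niceDir_iff] <;> simp only [cr, dt, turnPt, Complex.sub_re, Complex.sub_im] <;>
    generalize √3 = r at * <;> refine ⟨?_, ?_, ?_⟩ <;> nlinarith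

lemma nq_turn₃ : Nq ⟨2, 2⟩ ⟨3, 4⟩ ⟨2, 4⟩ turnPt := by
  have h3 : √3 * √3 = 3 := Real.mul_self_sqrt (by norm_num)
  have hp : 1.7 < √3 := by rw [Real.lt_sqrt] <;> norm_num
  have hq : √3 < 1.8 := by rw [Real.sqrt_lt'] <;> norm_num
  refine ⟨?_, ?_, ?_, ?_⟩ <;> rw [niceDir_iff] <;> simp only [cr, dt, turnPt, Complex.sub_re, Complex.sub_im] <;>
    generalize √3 = r at * <;> refine ⟨?_, ?_, ?_⟩ <;> nlinarith

lemma ccw_turn : Ccw ⟨0, 1⟩ ⟨2, 2⟩ ⟨3, 4⟩ ⟨0, 4⟩ := by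
  refine ⟨?_, ?_, ?_, ?_⟩ <;> rw [el_mk] <;> norm_num

lemma quad_turn : quad ⟨0, 1⟩ ⟨2, 2⟩ ⟨3, 4⟩ ⟨0, 4⟩ = quad ⟨0, 2⟩ turnPt ⟨2, 4⟩ ⟨0, 4⟩ ∪
    quad ⟨0, 1⟩ ⟨2, 2⟩ turnPt ⟨0, 2⟩ ∪ quad ⟨2, 2⟩ ⟨3, 4⟩ ⟨2, 4⟩ turnPt := by
  have hp : 1.7 < √3 := by rw [Real.lt_sqrt] <;> norm_num
  have hq : √3 < 1.8 := by rw [Real.sqrt_lt'] <;> norm_num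
  have hc := convex_quad ⟨0, 1⟩ ⟨2, 2⟩ ⟨3, 4⟩ ⟨0, 4⟩
  have m : ∀ x y : ℝ, 0 ≤ x → y ≤ 4 → x + 2 ≤ 2 * y → 2 * x - 2 ≤ y →
      (⟨x, y⟩ : ℂ) ∈ quad ⟨0, 1⟩ ⟨2, 2⟩ ⟨3, 4⟩ ⟨0, 4⟩ := by
    intro x y h0 h1 h2 h3
    refine ⟨?_, ?_, ?_, ?_⟩ <;> rw [el_mk] <;> nlinarith
  apply Subset.antisymm
  · rintro ⟨x, y⟩ ⟨z0, z1, z2, z3⟩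
    -- The inner corner is a positive combination of the ends of the three inner edges, so the
    -- positions of a point relative to these edges satisfy a linear relation with positive
    -- coefficients. Their signs then determine one of the three sectors.
    have key : (1 - √3 / 3) * (el turnPt ⟨0, 2⟩ ⟨x, y⟩ + el turnPt ⟨2, 4⟩ ⟨x, y⟩) +
        (2 * √3 / 3) * el turnPt ⟨2, 2⟩ ⟨x, y⟩ = 0 := by
      simp only [turnPt, el_mk]; ring
    have s1 := el_swap turnPt ⟨0, 2⟩ ⟨x, y⟩
    have s2 := el_swap turnPt ⟨2, 4⟩ ⟨x, y⟩
    have s3 := el_swap turnPt ⟨2, 2⟩ ⟨x, y⟩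
    have b0 : 0 ≤ x := by rw [el_mk] at z3; linarith
    have b1 : y ≤ 4 := by rw [el_mk] at z2; linarith
    have c1 : 0 < 1 - √3 / 3 := by linarith
    have c2 : 0 < 2 * √3 / 3 := by linarith
    have g1 : el turnPt ⟨0, 2⟩ ⟨x, y⟩ ≤ 0 → 0 ≤ el turnPt ⟨2, 4⟩ ⟨x, y⟩ →
        (⟨x, y⟩ : ℂ) ∈ quad ⟨0, 2⟩ turnPt ⟨2, 4⟩ ⟨0, 4⟩ := fun h h' =>
      ⟨by linarith, h', by rw [el_mk]; linarith, by rw [el_mk]; linarith⟩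
    have g2 : el turnPt ⟨2, 2⟩ ⟨x, y⟩ ≤ 0 → 0 ≤ el turnPt ⟨0, 2⟩ ⟨x, y⟩ →
        (⟨x, y⟩ : ℂ) ∈ quad ⟨0, 1⟩ ⟨2, 2⟩ turnPt ⟨0, 2⟩ := fun h h' =>
      ⟨z0, by linarith, h', by rw [el_mk]; linarith⟩
    have g3 : el turnPt ⟨2, 4⟩ ⟨x, y⟩ ≤ 0 → 0 ≤ el turnPt ⟨2, 2⟩ ⟨x, y⟩ →
        (⟨x, y⟩ : ℂ) ∈ quad ⟨2, 2⟩ ⟨3, 4⟩ ⟨2, 4⟩ turnPt := fun h h' =>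
      ⟨z1, by rw [el_mk]; linarith, by linarith, h'⟩
    generalize el turnPt ⟨0, 2⟩ ⟨x, y⟩ = α at *
    generalize el turnPt ⟨2, 4⟩ ⟨x, y⟩ = β at *
    generalize el turnPt ⟨2, 2⟩ ⟨x, y⟩ = γ at *
    rcases le_total α 0 with ha | ha
    · rcases le_total 0 β with hb | hb
      · exact .inl (.inl (g1 ha hb))
      · exact .inr (g3 hb (by nlinarith))
    · rcases le_total γ 0 with hb | hb
      · exact .inl (.inr (g2 hb ha))
      · exact .inr (g3 (by nlinarith) hb)
  · have mt : turnPt ∈ quad ⟨0, 1⟩ ⟨2, 2⟩ ⟨3, 4⟩ ⟨0, 4⟩ := by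
      apply m <;> nlinarith
    refine union_subset (union_subset ?_ ?_) ?_
    · refine quad_subset_of_convex nq_turn₁.ccw hc ?_ mt ?_ ?_ <;> apply m <;> norm_num
    · refine quad_subset_of_convex nq_turn₂.ccw hc ?_ ?_ mt ?_ <;> apply m <;> norm_num
    · refine quad_subset_of_convex nq_turn₃.ccw hc ?_ ?_ ?_ mt <;> apply m <;> norm_num

/-- A strip of two tiles enters through the lower part of the left side and leaves through the right
part of the top; the third tile fills the corner that it encloses. -/
lemma QS.turn : QS ⟨0, 1⟩ ⟨2, 2⟩ ⟨3, 4⟩ ⟨0, 4⟩ {0, 1} {0, 1} (join (2 / 3) {0, 1} {0, 1})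
    (join (1 / 3) {0, 1} {0, 1}) 3 := by
  have hp : 1.7 < √3 := by rw [Real.lt_sqrt] <;> norm_num
  have hq : √3 < 1.8 := by rw [Real.sqrt_lt'] <;> norm_num
  have hcover := quad_turn
  have hccw := ccw_turn
  have q1 := QS.prod nq_turn₁ isSub_pair isSub_pair
  have q2 := QS.prod nq_turn₂ isSub_pair isSub_pair
  have q3 := QS.prod nq_turn₃ isSub_pair isSub_pair
  have ep2 : lm ⟨0, 1⟩ ⟨0, 4⟩ (1 / 3) = ⟨0, 2⟩ := by rw [lm_mk]; norm_num
  have eq1 : lm ⟨0, 4⟩ ⟨3, 4⟩ (2 / 3) = ⟨2, 4⟩ := by rw [lm_mk]; norm_num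
  have ht : turnPt ∉ frontier (quad ⟨0, 1⟩ ⟨2, 2⟩ ⟨3, 4⟩ ⟨0, 4⟩) := by
    have : turnPt ∈ interior (quad ⟨0, 1⟩ ⟨2, 2⟩ ⟨3, 4⟩ ⟨0, 4⟩) := by
      rw [interior_quad ccw_turn]; refine ⟨?_, ?_, ?_, ?_⟩ <;> rw [turnPt, el_mk] <;> nlinarith
    exact fun h => h.2 this
  generalize (⟨0, 1⟩ : ℂ) = a₁ at *
  generalize (⟨0, 2⟩ : ℂ) = a₂ at *
  generalize (⟨0, 4⟩ : ℂ) = c at *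
  generalize (⟨2, 4⟩ : ℂ) = b₁ at *
  generalize (⟨3, 4⟩ : ℂ) = b₂ at *
  generalize (⟨2, 2⟩ : ℂ) = w at *
  generalize turnPt = v at *
  have h12 := q2.rot.compat q1.rot
  rw [quad_rot a₁ w v a₂, vq_rot a₁, quad_rot a₂ v b₁ c, vq_rot a₂] at h12
  have h23 := q2.compat q3
  have h13 := q1.compat q3.rot₃
  rw [← quad_rot v w b₂ b₁, vq_rot₃] at h13
  have key := Meshable.union₃ q1.qm q2.qm q3.qm h12.symm h13 h23
  rw [← hcover] at key
  refine ⟨hccw, isSub_pair, isSub_pair, isSub_pair.join isSub_pair (by norm_num) (by norm_num),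
    isSub_pair.join isSub_pair (by norm_num) (by norm_num), ?_⟩
  refine (Meshable.congr key fun z hz => ?_).mono ?_
  · have hv : z ≠ v := fun h => ht (h ▸ hz)
    simp only [pts_join, eq1, ep2, mem_union, pts_pair, mem_insert_iff, mem_singleton_iff, hv, false_or, or_false]
    tauto
  · rw [Finset.card_pair (by norm_num)]

/-- Bottom and right side have two edges each, left side and top three: the turning strip
contributes one to each of the latter two. The inner point `⟨2, 2⟩` is common to all four parts. -/
lemma RM.turn : RM 0 4 0 4 (join (1 / 2) {0, 1} (eqd 1)) (join (1 / 2) (eqd 1) {0, 1})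
    (join (1 / 2) {0, 1} (eqd 2)) (join (1 / 2) (eqd 2) {0, 1}) 6 := by
  have n3 : Nq ⟨0, 0⟩ ⟨2, 0⟩ ⟨2, 2⟩ ⟨0, 1⟩ := by
    have h3 : √3 * √3 = 3 := Real.mul_self_sqrt (by norm_num)
    have hp : 1.7 < √3 := by rw [Real.lt_sqrt] <;> norm_num
    have hq : √3 < 1.8 := by rw [Real.sqrt_lt'] <;> norm_num
    refine ⟨?_, ?_, ?_, ?_⟩ <;> rw [niceDir_iff] <;> simp only [cr, dt, Complex.sub_re, Complex.sub_im] <;>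
      generalize √3 = r at * <;> refine ⟨?_, ?_, ?_⟩ <;> nlinarith
  have n5 : Nq ⟨2, 2⟩ ⟨4, 2⟩ ⟨4, 4⟩ ⟨3, 4⟩ := by
    have h3 : √3 * √3 = 3 := Real.mul_self_sqrt (by norm_num)
    have hp : 1.7 < √3 := by rw [Real.lt_sqrt] <;> norm_num
    have hq : √3 < 1.8 := by rw [Real.sqrt_lt'] <;> norm_num
    refine ⟨?_, ?_, ?_, ?_⟩ <;> rw [niceDir_iff] <;> simp only [cr, dt, Complex.sub_re, Complex.sub_im] <;>
      generalize √3 = r at * <;> refine ⟨?_, ?_, ?_⟩ <;> nlinarith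
  have n4 : Nq ⟨2, 0⟩ ⟨4, 0⟩ ⟨4, 2⟩ ⟨2, 2⟩ := nq_rect (by norm_num) (by norm_num)
  have q1 := QS.turn
  have q3 := QS.prod n3 isSub_pair isSub_pair
  have q4 := QS.prod n4 isSub_pair isSub_pair
  have q5 := QS.prod n5 isSub_pair isSub_pair
  have h35 : Compat _ _ _ _ := (Compat.of_corner (⟨2, 2⟩ : ℂ) ⟨3, 1⟩ q5.ccw q3.ccw.rot.rot q5.sb q5.sr q5.st q5.sl
    q3.st.rev q3.sl.rev q3.sb.rev q3.sr.rev (by rw [el_mk]; norm_num) (by rw [el_mk]; norm_num)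
    (by rw [el_mk]; norm_num) (by rw [el_mk]; norm_num) (by rw [el_mk]; norm_num)
    (by rw [el_mk]; norm_num) (by rw [el_mk]; norm_num)).symm
  have h14 : Compat _ _ _ _ := Compat.of_corner (⟨2, 2⟩ : ℂ) ⟨3, 3⟩ q1.rot.ccw q4.rot₃.ccw
    q1.rot.sb q1.rot.sr q1.rot.st q1.rot.sl q4.rot₃.sb q4.rot₃.sr q4.rot₃.st q4.rot₃.sl
    (by rw [el_mk]; norm_num) (by rw [el_mk]; norm_num)
    (by rw [el_mk]; norm_num) (by rw [el_mk]; norm_num) (by rw [el_mk]; norm_num)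
    (by rw [el_mk]; norm_num) (by rw [el_mk]; norm_num)
  have hccw := (nq_rect (x₀ := 0) (x₁ := 4) (y₀ := 0) (y₁ := 4) (by norm_num) (by norm_num)).ccw
  have hcover : quad ⟨0, 0⟩ ⟨4, 0⟩ ⟨4, 4⟩ ⟨0, 4⟩ = quad ⟨0, 1⟩ ⟨2, 2⟩ ⟨3, 4⟩ ⟨0, 4⟩ ∪
      quad ⟨0, 0⟩ ⟨2, 0⟩ ⟨2, 2⟩ ⟨0, 1⟩ ∪ quad ⟨2, 0⟩ ⟨4, 0⟩ ⟨4, 2⟩ ⟨2, 2⟩ ∪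
      quad ⟨2, 2⟩ ⟨4, 2⟩ ⟨4, 4⟩ ⟨3, 4⟩ := by
    have hc := convex_quad ⟨0, 0⟩ ⟨4, 0⟩ ⟨4, 4⟩ ⟨0, 4⟩
    have m : ∀ x y : ℝ, 0 ≤ x → y ≤ 4 → 0 ≤ y → x ≤ 4 →
        (⟨x, y⟩ : ℂ) ∈ quad ⟨0, 0⟩ ⟨4, 0⟩ ⟨4, 4⟩ ⟨0, 4⟩ := by
      intro x y h0 h1 h2 h3
      refine ⟨?_, ?_, ?_, ?_⟩ <;> rw [el_mk] <;> nlinarith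
    apply Subset.antisymm
    · rintro ⟨x, y⟩ ⟨z0, z1, z2, z3⟩
      simp only [el_mk] at z0 z1 z2 z3
      simp only [mem_union, quad, mem_ofPred_eq, el_mk]
      rcases le_total (x + 2) (2 * y) with h | h <;> rcases le_total (2 * x - 2) y with h' | h' <;>
      rcases le_total x 2 with h'' | h'' <;> rcases le_total y 2 with hy2 | hy2 <;>
      first
      | (left; left; left; refine ⟨?_, ?_, ?_, ?_⟩ <;> linarith)
      | (left; left; right; refine ⟨?_, ?_, ?_, ?_⟩ <;> linarith)
      | (left; right; refine ⟨?_, ?_, ?_, ?_⟩ <;> linarith)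
      | (right; refine ⟨?_, ?_, ?_, ?_⟩ <;> linarith)
    · refine union_subset (union_subset (union_subset ?_ ?_) ?_) ?_
      · refine quad_subset_of_convex ccw_turn hc ?_ ?_ ?_ ?_ <;> apply m <;> norm_num
      · refine quad_subset_of_convex n3.ccw hc ?_ ?_ ?_ ?_ <;> apply m <;> norm_num
      · refine quad_subset_of_convex n4.ccw hc ?_ ?_ ?_ ?_ <;> apply m <;> norm_num
      · refine quad_subset_of_convex n5.ccw hc ?_ ?_ ?_ ?_ <;> apply m <;> norm_num
  have hw : (⟨2, 2⟩ : ℂ) ∉ frontier (quad ⟨0, 0⟩ ⟨4, 0⟩ ⟨4, 4⟩ ⟨0, 4⟩) := by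
    have : (⟨2, 2⟩ : ℂ) ∈ interior (quad ⟨0, 0⟩ ⟨4, 0⟩ ⟨4, 4⟩ ⟨0, 4⟩) := by
      rw [interior_quad hccw]; refine ⟨?_, ?_, ?_, ?_⟩ <;> rw [el_mk] <;> norm_num
    exact fun h => h.2 this
  have e1 : lm ⟨0, 0⟩ ⟨4, 0⟩ (1 / 2) = ⟨2, 0⟩ := by rw [lm_mk]; norm_num
  have e2 : lm ⟨4, 0⟩ ⟨4, 4⟩ (1 / 2) = ⟨4, 2⟩ := by rw [lm_mk]; norm_num
  have e3 : lm ⟨0, 4⟩ ⟨4, 4⟩ (3 / 4) = ⟨3, 4⟩ := by rw [lm_mk]; norm_num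
  have e4 : lm ⟨0, 0⟩ ⟨0, 4⟩ (1 / 4) = ⟨0, 1⟩ := by rw [lm_mk]; norm_num
  -- The top has the breakpoints 1/2 and 3/4, the left side 1/4 and 1/2. They are regrouped so that
  -- the outer cut is at the corner `⟨3, 4⟩` or `⟨0, 1⟩` of the turning quadrilateral.
  rw [eqd_one, eqd_two, join_assoc (l := 1 / 2) (m := 1 / 2) (l' := 3 / 4) (m' := 2 / 3) _ _ _ (by norm_num) (by norm_num),
    ← join_assoc (l := 1 / 4) (m := 1 / 3) (l' := 1 / 2) (m' := 1 / 2) _ _ _ (by norm_num) (by norm_num)]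
  unfold RM
  generalize (⟨0, 1⟩ : ℂ) = a₁ at *
  generalize (⟨0, 4⟩ : ℂ) = c at *
  generalize (⟨3, 4⟩ : ℂ) = b₂ at *
  generalize (⟨2, 2⟩ : ℂ) = w at *
  generalize (⟨0, 0⟩ : ℂ) = o at *
  generalize (⟨2, 0⟩ : ℂ) = d at *
  generalize (⟨4, 0⟩ : ℂ) = e at *
  generalize (⟨4, 2⟩ : ℂ) = f at *
  generalize (⟨4, 4⟩ : ℂ) = g at *
  rw [quad_rot d w a₁ o, quad_rot o d w a₁, vq_rot d w a₁ o, vq_rot o d w a₁] at h35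
  rw [quad_rot a₁ w b₂ c, vq_rot a₁ w b₂ c, ← quad_rot w d e f, vq_rot₃] at h14
  have h13 := q3.rot.compat q1.rot
  rw [quad_rot o d w a₁, vq_rot o, quad_rot a₁ w b₂ c, vq_rot a₁] at h13
  have h34 := q3.compat q4
  have h45 := q4.rot.compat q5.rot
  rw [quad_rot d e f w, vq_rot d, quad_rot w f g b₂, vq_rot w] at h45
  have h15 := q1.compat q5
  have key := Meshable.union₄ q1.qm q3.qm q4.qm q5.qm h13.symm h14 h15 h34 h35 h45
  rw [← hcover] at key
  refine ⟨hccw, isSub_pair.join isSub_pair (by norm_num) (by norm_num),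
    isSub_pair.join isSub_pair (by norm_num) (by norm_num),
    (isSub_pair.join isSub_pair (by norm_num) (by norm_num)).join isSub_pair (by norm_num) (by norm_num),
    isSub_pair.join (isSub_pair.join isSub_pair (by norm_num) (by norm_num)) (by norm_num) (by norm_num), ?_⟩
  refine (Meshable.congr key fun z hz => ?_).mono ?_
  · have hv : z ≠ w := fun h => hw (h ▸ hz)
    simp only [pts_join o, pts_join e, pts_join c g, e1, e2, e3, e4, mem_union, pts_pair,
      mem_insert_iff, mem_singleton_iff, hv, false_or, or_false]
    generalize (z ∈ pts c b₂ (join (2 / 3) {0, 1} {0, 1})) = X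
    generalize (z ∈ pts a₁ c (join (1 / 3) {0, 1} {0, 1})) = Y
    tauto
  · rw [Finset.card_pair (by norm_num)]

end SinkMesh

/-! ### The core: a square with arbitrary numbers of edges. -/

namespace SinkMesh

lemma isSub_foldBottom {k v : ℕ} (hk : 0 < k) (hv : 0 < v) : IsSub (foldBottom k v) :=
  (isSub_eqd hk).join ((isSub_eqd hv).join (isSub_eqd hk) (by norm_num) (by norm_num))
    (by norm_num) (by norm_num)

lemma isSub_foldIn {k v : ℕ} (hk : 0 < k) (hv : 0 < v) : IsSub (foldIn k v) :=
  isSub_pair.join ((isSub_foldBottom hk hv).join isSub_pair (by norm_num) (by norm_num))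
    (by norm_num) (by norm_num)

lemma isSub_foldOut {v : ℕ} (hv : 0 < v) : IsSub (foldOut v) :=
  isSub_pair.join ((isSub_eqd hv).join isSub_pair (by norm_num) (by norm_num))
    (by norm_num) (by norm_num)

lemma card_pair₀₁ : ({0, 1} : Finset ℝ).card = 2 := Finset.card_pair (by norm_num)

lemma card_foldIn {k v : ℕ} (hk : 0 < k) (hv : 0 < v) : (foldIn k v).card = 2 * k + v + 3 := by
  have s1 := isSub_eqd hk
  have s2 := isSub_eqd hv
  have s3 := s2.join s1 (l := 2 / 3) (by norm_num) (by norm_num)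
  have c1 := card_join (l := 2 / 3) (by norm_num) (by norm_num) s2 s1
  have c2 := card_join (l := 1 / 4) (by norm_num) (by norm_num) s1 s3
  have s4 := isSub_foldBottom hk hv
  have s5 := s4.join isSub_pair (l := 4 / 5) (by norm_num) (by norm_num)
  have c3 := card_join (l := 4 / 5) (by norm_num) (by norm_num) s4 isSub_pair
  have c4 := card_join (l := 1 / 6) (by norm_num) (by norm_num) isSub_pair s5
  rw [card_pair₀₁] at c3 c4
  rw [card_eqd hk, card_eqd hv] at c1
  rw [card_eqd hk] at c2
  rw [foldIn]
  rw [foldBottom] at *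
  omega

lemma card_foldOut {v : ℕ} (hv : 0 < v) : (foldOut v).card = v + 3 := by
  have s2 := isSub_eqd hv
  have s3 := s2.join isSub_pair (l := 1 / 2) (by norm_num) (by norm_num)
  have c1 := card_join (l := 1 / 2) (by norm_num) (by norm_num) s2 isSub_pair
  have c2 := card_join (l := 1 / 3) (by norm_num) (by norm_num) isSub_pair s3
  rw [card_pair₀₁] at c1 c2
  rw [card_eqd hv] at c1
  rw [foldOut]
  omega

lemma rev_foldIn {k v : ℕ} (hk : 0 < k) (hv : 0 < v) : rev (foldIn k v) = foldIn k v := by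
  rw [foldIn, foldBottom]
  simp only [rev_join, rev_pair, rev_eqd hk, rev_eqd hv]
  rw [join_assoc (l := 1 / 4) (l' := 3 / 4) (m' := 1 / 3) _ _ _ (by norm_num) (by norm_num),
    join_assoc (l := 1 / 6) (l' := 5 / 6) (m' := 1 / 5) _ _ _ (by norm_num) (by norm_num)]
  norm_num

lemma rev_foldOut {v : ℕ} (hv : 0 < v) : rev (foldOut v) = foldOut v := by
  rw [foldOut]
  simp only [rev_join, rev_pair, rev_eqd hv]
  rw [join_assoc (l := 1 / 3) (l' := 2 / 3) (m' := 1 / 2) _ _ _ (by norm_num) (by norm_num)]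
  norm_num

/-- A row below and a column to the right are added to the turning square, so that each side becomes
the output of a folding gadget, with breakpoints at 2 and 4. -/
lemma RM.turn_six : RM 0 6 0 6 (foldOut 1) (foldOut 1) (foldOut 2) (foldOut 2) 16 := by
  have lower : RM 0 6 0 2 _ _ _ _ _ := RM.prod (by norm_num) (by norm_num) (isSub_foldOut one_pos) isSub_pair
  have tl := RM.turn.scale one_pos 0 2
  have right : RM 4 6 2 6 _ _ _ _ _ := RM.prod (Sl := join (1 / 2) (eqd 1) {0, 1}) (by norm_num) (by norm_num) isSub_pair
    ((isSub_eqd one_pos).join isSub_pair (by norm_num) (by norm_num))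
  norm_num at tl
  have upper := RM.vcut (by norm_num) (by norm_num) (by norm_num) tl right
  have e : ∀ v, foldOut v = join ((4 - 0) / (6 - 0)) (join (1 / 2) {0, 1} (eqd v)) {0, 1} := fun v => by
    rw [foldOut, join_assoc (l' := (4 - 0) / (6 - 0)) (m' := (1 / 2)) _ _ _ (by norm_num) (by norm_num)]
  rw [← e, ← e] at upper
  have := RM.hcut (by norm_num) (by norm_num) (by norm_num) lower upper
  have c1 := card_join (l := 1 / 2) (by norm_num) (by norm_num) (isSub_eqd one_pos) isSub_pair
  have e2 : ∀ v, join ((2 - 0) / (6 - 0)) {0, 1} (join (1 / 2) (eqd v) {0, 1}) = foldOut v := fun v => by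
    rw [foldOut]; norm_num
  norm_num at this e2
  rw [e2, e2] at this
  refine this.mono ?_
  rw [card_eqd one_pos] at c1
  norm_num at c1
  rw [card_foldOut one_pos]
  omega

/-- If opposite sides agree, a product grid does it. Otherwise, by parity, both pairs disagree, and
one of the four rotations of the turning square fits. -/
lemma RM.center {a b c d : ℕ} (ha : a = 1 ∨ a = 2) (hb : b = 1 ∨ b = 2) (hc : c = 1 ∨ c = 2)
    (hd : d = 1 ∨ d = 2) (h : Even (a + b + c + d)) :
    RM 0 6 0 6 (foldOut a) (foldOut b) (foldOut c) (foldOut d) 16 := by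
  have r1 : rev (foldOut 1) = foldOut 1 := rev_foldOut one_pos
  have r2 : rev (foldOut 2) = foldOut 2 := rev_foldOut two_pos
  have p : ∀ x y : ℕ, (x = 1 ∨ x = 2) → (y = 1 ∨ y = 2) →
      RM 0 6 0 6 (foldOut x) (foldOut y) (foldOut x) (foldOut y) 16 := by
    intro x y hx hy
    have h1 : 0 < x := by omega
    have h2 : 0 < y := by omega
    refine (RM.prod (by norm_num) (by norm_num) (isSub_foldOut h1) (isSub_foldOut h2)).mono ?_
    rw [card_foldOut h1, card_foldOut h2]
    rcases hx with rfl | rfl <;> rcases hy with rfl | rfl <;> norm_num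
  have t1 := RM.turn_six
  have t2 := t1.rot.scale one_pos 6 0
  rw [r1, r2] at t2
  norm_num at t2
  have t3 := t2.rot.scale one_pos 6 0
  rw [r1, r2] at t3
  norm_num at t3
  have t4 := t3.rot.scale one_pos 6 0
  rw [r1, r2] at t4
  norm_num at t4
  rcases ha with rfl | rfl <;> rcases hb with rfl | rfl <;> rcases hc with rfl | rfl <;>
    rcases hd with rfl | rfl <;> first
    | exact p _ _ (by norm_num) (by norm_num)
    | exact t1
    | exact t2
    | exact t3
    | exact t4
    | exact absurd h (by decide)

/-- A side of the core, with the folding gadget between two corner squares. -/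
noncomputable def wrap (S : Finset ℝ) : Finset ℝ :=
  join (√3 / (6 + 2 * √3)) {0, 1} (join (6 / (6 + √3)) S {0, 1})

lemma wrap_params : 0 < √3 / (6 + 2 * √3) ∧ √3 / (6 + 2 * √3) < 1 ∧ 0 < 6 / (6 + √3) ∧
    6 / (6 + √3) < 1 := by
  have hp : 0 < √3 := by positivity
  refine ⟨by positivity, ?_, by positivity, ?_⟩
  · rw [div_lt_one (by positivity)]; linarith
  · rw [div_lt_one (by positivity)]; linarith

lemma IsSub.wrap {S : Finset ℝ} (h : IsSub S) : IsSub (wrap S) := by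
  obtain ⟨h1, h2, h3, h4⟩ := wrap_params
  exact isSub_pair.join (h.join isSub_pair h3.le h4.le) h1.le h2.le

lemma card_wrap {S : Finset ℝ} (h : IsSub S) : (wrap S).card = S.card + 2 := by
  obtain ⟨h1, h2, h3, h4⟩ := wrap_params
  have c1 := card_join h3 h4 h isSub_pair
  have c2 := card_join h1 h2 isSub_pair (h.join isSub_pair h3.le h4.le)
  rw [card_pair₀₁] at c1 c2
  rw [SinkMesh.wrap]; omega

lemma rev_wrap {S : Finset ℝ} (h : rev S = S) : rev (wrap S) = wrap S := by
  have hp : 0 < √3 := by positivity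
  rw [wrap, rev_join, rev_join, rev_pair, h]
  symm
  rw [join_assoc]
  · field_simp; ring
  · field_simp; ring

/-- The central square of side 6 is surrounded by four folding rectangles of thickness `√3` and four
corner squares; the result is scaled to the unit square. -/
lemma RM.ring {A B C D A' B' C' D' : Finset ℝ} {n a b c d : ℕ}
    (hc : RM 0 6 0 6 A' B' C' D' n) (hA : RM 0 6 0 (√3) A {0, 1} A' {0, 1} a)
    (hB : RM 0 6 0 (√3) B {0, 1} B' {0, 1} b) (hC : RM 0 6 0 (√3) C {0, 1} C' {0, 1} c)
    (hD : RM 0 6 0 (√3) D {0, 1} D' {0, 1} d) (rC : rev C = C) (rC' : rev C' = C') (rD : rev D = D)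
    (rD' : rev D' = D') :
    RM 0 1 0 1 (wrap A) (wrap B) (wrap C) (wrap D) (n + a + b + c + d + 4) := by
  have hp : 0 < √3 := by positivity
  have hA := hA.scale one_pos 0 (-√3)
  have hB := hB.rot.scale one_pos (6 + √3) 0
  have hC := hC.rot.rot.scale one_pos 6 (6 + √3)
  have hD := hD.rot.rot.rot.scale one_pos (-√3) 6
  rw [rev_pair] at hB hC hD
  rw [rC, rC'] at hC
  rw [rev_pair, rD, rD'] at hD
  norm_num at hA hB hC hD
  have kor : ∀ x y : ℝ, RM x (x + √3) y (y + √3) {0, 1} {0, 1} {0, 1} {0, 1} 1 := fun x y =>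
    (RM.prod (by linarith) (by linarith) isSub_pair isSub_pair).mono (by rw [card_pair₀₁])
  have k1 := kor (-√3) (-√3)
  have k2 := kor 6 (-√3)
  have k3 := kor (-√3) 6
  have k4 := kor 6 6
  norm_num at k1 k2 k3 k4
  have hx1 : -√3 < 0 := by linarith
  have hx2 : (6 : ℝ) < 6 + √3 := by linarith
  have hx3 : (0 : ℝ) < 6 + √3 := by linarith
  have h06 : (0 : ℝ) < 6 := by norm_num
  have row1 := RM.vcut hx1 hx3 hx1 k1 (RM.vcut h06 hx2 hx1 hA k2)
  have row2 := RM.vcut hx1 hx3 h06 hD (RM.vcut h06 hx2 h06 hc hB)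
  have row3 := RM.vcut hx1 hx3 hx2 k3 (RM.vcut h06 hx2 hx2 hC k4)
  have all := RM.hcut hx1 hx3 (hx1.trans hx3) row1 (RM.hcut h06 hx2 (hx1.trans hx3) row2 row3)
  have all := all.scale (c := 1 / (6 + 2 * √3)) (by positivity) (√3 / (6 + 2 * √3)) (√3 / (6 + 2 * √3))
  have e1 : (0 - -√3) / (6 + √3 - -√3) = √3 / (6 + 2 * √3) := by congr 1 <;> ring
  have e2 : (6 - 0) / (6 + √3 - 0) = 6 / (6 + √3) := by congr 1 <;> ring
  have e3 : 1 / (6 + 2 * √3) * -√3 + √3 / (6 + 2 * √3) = 0 := by field_simp; ring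
  have e4 : 1 / (6 + 2 * √3) * (6 + √3) + √3 / (6 + 2 * √3) = 1 := by field_simp; ring
  rw [e1, e2, e3, e4] at all
  exact all.mono (by omega)

/-- The side data of a core square with `n` edges. -/
noncomputable def coreSet (n : ℕ) : Finset ℝ :=
  wrap (foldIn ((n - 5) / 2) (2 - n % 2))

/-- Of the `n` edges, four belong to the fillers and the corner squares, `2 - n % 2` pass to the
center, with the parity of `n`, and the others are folded in pairs. At least one pair is needed,
hence `7 ≤ n`. -/
lemma coreSet_params {n : ℕ} (hn : 7 ≤ n) : 0 < (n - 5) / 2 ∧ 0 < 2 - n % 2 ∧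
    2 * ((n - 5) / 2) + (2 - n % 2) + 4 = n := by omega

lemma isSub_coreSet {n : ℕ} (hn : 7 ≤ n) : IsSub (coreSet n) := by
  obtain ⟨h1, h2, -⟩ := coreSet_params hn
  exact (isSub_foldIn h1 h2).wrap

lemma card_coreSet {n : ℕ} (hn : 7 ≤ n) : (coreSet n).card = n + 1 := by
  obtain ⟨h1, h2, h3⟩ := coreSet_params hn
  rw [coreSet, card_wrap (isSub_foldIn h1 h2), card_foldIn h1 h2]; omega

lemma rev_coreSet {n : ℕ} (hn : 7 ≤ n) : rev (coreSet n) = coreSet n := by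
  obtain ⟨h1, h2, -⟩ := coreSet_params hn
  exact rev_wrap (rev_foldIn h1 h2)

/-- A square can be meshed with any sufficiently large numbers of edges on its sides whose sum is
even, provided that the vertices have prescribed positions. -/
theorem RM.core {a b c d : ℕ} (ha : 7 ≤ a) (hb : 7 ≤ b) (hc : 7 ≤ c) (hd : 7 ≤ d)
    (h : Even (a + b + c + d)) :
    RM 0 1 0 1 (coreSet a) (coreSet b) (coreSet c) (coreSet d) (3 * (a + b + c + d)) := by
  have hh := coreSet_params ha; have hb' := coreSet_params hb
  have hc' := coreSet_params hc; have hd' := coreSet_params hd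
  have cost : ∀ n : ℕ, 7 ≤ n → 1 + ((n - 5) / 2 + (2 - n % 2) + (n - 5) / 2 +
      (2 - n % 2) * ((n - 5) / 2) + 1) ≤ 2 * n := by
    intro n hn
    have : (2 - n % 2) * ((n - 5) / 2) ≤ 2 * ((n - 5) / 2) := Nat.mul_le_mul_right _ (by omega)
    omega
  refine (RM.ring (RM.center (a := 2 - a % 2) (b := 2 - b % 2) (c := 2 - c % 2) (d := 2 - d % 2)
    (by omega) (by omega) (by omega) (by omega) ?_)
    (RM.fold hh.1 hh.2.1) (RM.fold hb'.1 hb'.2.1) (RM.fold hc'.1 hc'.2.1) (RM.fold hd'.1 hd'.2.1)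
    (rev_foldIn hc'.1 hc'.2.1) (rev_foldOut hc'.2.1) (rev_foldIn hd'.1 hd'.2.1)
    (rev_foldOut hd'.2.1)).mono ?_
  · rw [Nat.even_iff] at h ⊢; omega
  · have := cost a ha; have := cost b hb; have := cost c hc; have := cost d hd
    omega

end SinkMesh

namespace SinkMesh

/-! ### Subdivisions with equally many points -/

/-- An order preserving bijection between two subdivisions moves points by at most `δ`. -/
def Shift (S T : Finset ℝ) (δ : ℝ) : Prop :=
  ∃ f : ℝ → ℝ, Rail S 0 1 f ∧ S.image f = T ∧ ∀ u ∈ S, |f u - u| ≤ δ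

lemma Rail.isSub_source {S : Finset ℝ} {f : ℝ → ℝ} (h : Rail S 0 1 f) : IsSub S :=
  ⟨h.left, h.right, h.ge, h.le⟩

namespace Shift
variable {S T S' T' : Finset ℝ} {δ δ' l : ℝ}

lemma isSub_left (h : Shift S T δ) : IsSub S := h.choose_spec.1.isSub_source

lemma isSub_right (h : Shift S T δ) : IsSub T := by
  obtain ⟨f, hf, rfl, -⟩ := h; exact hf.isSub

lemma card_eq (h : Shift S T δ) : S.card = T.card := by
  obtain ⟨f, hf, rfl, -⟩ := h
  exact (Finset.card_image_of_injOn hf.mono.injOn).symm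

lemma refl (h : IsSub S) (hδ : 0 ≤ δ) : Shift S S δ :=
  ⟨id, rail_id h, by simp, fun u _ => by simpa using hδ⟩

lemma symm (h : Shift S T δ) : Shift T S δ := by
  obtain ⟨f, hf, rfl, hδ⟩ := h
  have hex : ∀ t ∈ S.image f, ∃ s ∈ S, f s = t := fun t ht => by simpa using ht
  choose! g hg hfg using hex
  have gf : ∀ s ∈ S, g (f s) = s := fun s hs =>
    hf.mono.injOn (hg _ (Finset.mem_image_of_mem f hs)) hs (hfg _ (Finset.mem_image_of_mem f hs))
  have hT := hf.isSub
  refine ⟨g, ⟨one_pos, hT.zero_mem, hT.one_mem, hT.nonneg, hT.le_one, ?_, ?_, ?_⟩, ?_, ?_⟩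
  · intro x hx y hy hxy
    by_contra hle
    have := hf.mono.monotoneOn (hg y hy) (hg x hx) (not_lt.1 hle)
    rw [hfg y hy, hfg x hx] at this
    linarith
  · have := gf 0 hf.left; rwa [hf.map_left] at this
  · have := gf 1 hf.right; rwa [hf.map_right] at this
  · rw [Finset.image_image]
    ext s
    simp only [Finset.mem_image, Function.comp]
    constructor
    · rintro ⟨s', hs', rfl⟩; rwa [gf s' hs']
    · intro hs; exact ⟨s, hs, gf s hs⟩
  · intro u hu
    have := hδ _ (hg u hu)
    rw [hfg u hu] at this
    rwa [abs_sub_comm]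

lemma rev (h : Shift S T δ) : Shift (rev S) (rev T) δ := by
  obtain ⟨f, hf, rfl, hδ⟩ := h
  have hS := hf.isSub_source.rev
  refine ⟨fun u => 1 - f (1 - u), ⟨one_pos, hS.zero_mem, hS.one_mem, hS.nonneg, hS.le_one, ?_, ?_, ?_⟩,
    ?_, ?_⟩
  · intro x hx y hy hxy
    have := hf.mono (mem_rev.1 hy) (mem_rev.1 hx) (by linarith)
    simp only
    linarith
  · simp [hf.map_right]
  · simp [hf.map_left]
  · simp only [SinkMesh.rev, Finset.image_image]
    apply Finset.image_congr; intro t _; simp [Function.comp]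
  · intro u hu
    have := hδ _ (mem_rev.1 hu)
    rw [show 1 - f (1 - u) - u = -(f (1 - u) - (1 - u)) by ring, abs_neg]
    exact this

/-- The points are matched in increasing order. No point of the unit interval can move by more than
1. -/
lemma of_card (hS : IsSub S) (hT : IsSub T) (h : S.card = T.card) : Shift S T 1 := by
  set e : S ≃o T := (S.orderIsoOfFin rfl).symm.trans (T.orderIsoOfFin h.symm) with he
  set f : ℝ → ℝ := fun u => if hu : u ∈ S then (e ⟨u, hu⟩ : ℝ) else 0 with hf
  have fe : ∀ u (hu : u ∈ S), f u = e ⟨u, hu⟩ := fun u hu => by simp [hf, hu]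
  have fT : ∀ u ∈ S, f u ∈ T := fun u hu => by rw [fe u hu]; exact (e ⟨u, hu⟩).2
  have hmono : StrictMonoOn f S := by
    intro x hx y hy hxy
    rw [fe x hx, fe y hy]
    exact_mod_cast e.strictMono (show (⟨x, hx⟩ : S) < ⟨y, hy⟩ from hxy)
  have hsurj : ∀ t ∈ T, ∃ u ∈ S, f u = t := fun t ht => by
    refine ⟨e.symm ⟨t, ht⟩, (e.symm ⟨t, ht⟩).2, ?_⟩
    rw [fe _ (e.symm ⟨t, ht⟩).2]; simp
  refine ⟨f, ⟨one_pos, hS.zero_mem, hS.one_mem, hS.nonneg, hS.le_one, hmono, ?_, ?_⟩, ?_, ?_⟩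
  · obtain ⟨u, hu, h0⟩ := hsurj 0 hT.zero_mem
    have := hmono.monotoneOn hS.zero_mem hu (hS.nonneg u hu)
    have := hT.nonneg _ (fT 0 hS.zero_mem)
    linarith
  · obtain ⟨u, hu, h0⟩ := hsurj 1 hT.one_mem
    have := hmono.monotoneOn hu hS.one_mem (hS.le_one u hu)
    have := hT.le_one _ (fT 1 hS.one_mem)
    linarith
  · ext t; rw [Finset.mem_image]
    exact ⟨by rintro ⟨u, hu, rfl⟩; exact fT u hu, hsurj t⟩
  · intro u hu
    have := hT.le_one _ (fT u hu); have := hT.nonneg _ (fT u hu)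
    have := hS.le_one _ hu; have := hS.nonneg _ hu
    rw [abs_le]; constructor <;> linarith

/-- The two bijections are rescaled and put side by side; they agree at the common point `l`.
Displacements shrink with the lengths of the two parts. -/
lemma join {δ₁ δ₂ : ℝ} (h : Shift S T δ₁) (h' : Shift S' T' δ₂) (h0 : 0 < l) (h1 : l < 1)
    (hd : l * δ₁ ≤ δ) (hd' : (1 - l) * δ₂ ≤ δ) : Shift (join l S S') (join l T T') δ := by
  have hs := h.isSub_left; have hs' := h'.isSub_left
  obtain ⟨f, hf, rfl, hδ⟩ := h
  obtain ⟨g, hg, rfl, hδ'⟩ := h'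
  have hl' : 0 < 1 - l := by linarith
  set F : ℝ → ℝ := fun u => if u ≤ l then l * f (u / l) else l + (1 - l) * g ((u - l) / (1 - l)) with hF
  have F1 : ∀ s ∈ S, F (l * s) = l * f s := fun s hs2 => by
    have : l * s ≤ l := by nlinarith [hs.le_one s hs2]
    simp only [hF, if_pos this]; congr 2; field_simp
  have F2 : ∀ s ∈ S', F (l + (1 - l) * s) = l + (1 - l) * g s := fun s hs2 => by
    rcases (hs'.nonneg s hs2).eq_or_lt with rfl | hpos
    · simp only [hF]; rw [if_pos (by simp), mul_zero, add_zero, div_self h0.ne', hf.map_right, hg.map_left]; ring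
    · have : ¬ (l + (1 - l) * s ≤ l) := by have := mul_pos hl' hpos; linarith
      simp only [hF, if_neg this]; congr 3; field_simp; ring
  have mem : ∀ u ∈ SinkMesh.join l S S', (∃ s ∈ S, l * s = u) ∨ ∃ s ∈ S', l + (1 - l) * s = u := by
    intro u hu; simpa [SinkMesh.join] using hu
  have sub := hs.join hs' h0.le h1.le
  have fr := hf.isSub; have gr := hg.isSub
  refine ⟨F, ⟨one_pos, sub.zero_mem, sub.one_mem, sub.nonneg, sub.le_one, ?_, ?_, ?_⟩, ?_, ?_⟩
  · intro x hx y hy hxy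
    rcases mem x hx with ⟨s, hs2, rfl⟩ | ⟨s, hs2, rfl⟩ <;> rcases mem y hy with ⟨t, ht, rfl⟩ | ⟨t, ht, rfl⟩
    · rw [F1 s hs2, F1 t ht]
      exact mul_lt_mul_of_pos_left (hf.mono hs2 ht (lt_of_mul_lt_mul_left hxy h0.le)) h0
    · rw [F1 s hs2, F2 t ht]
      have a1 := fr.le_one _ (Finset.mem_image_of_mem f hs2)
      have a2 := gr.nonneg _ (Finset.mem_image_of_mem g ht)
      have a3 := mul_nonneg hl'.le a2
      rcases (hs.le_one s hs2).eq_or_lt with rfl | hlt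
      · have : 0 < t := by
          by_contra hn
          have : t = 0 := le_antisymm (not_lt.1 hn) (hs'.nonneg t ht)
          rw [this] at hxy; linarith
        have := hg.mono hg.left ht this
        rw [hg.map_left] at this
        have := mul_pos hl' this
        nlinarith
      · have := hf.mono hs2 hf.right hlt
        rw [hf.map_right] at this
        nlinarith
    · exfalso
      have := hs.le_one t ht; have := mul_nonneg hl'.le (hs'.nonneg s hs2)
      nlinarith
    · rw [F2 s hs2, F2 t ht]
      have : s < t := lt_of_mul_lt_mul_left (by linarith : (1 - l) * s < (1 - l) * t) hl'.le
      have := mul_lt_mul_of_pos_left (hg.mono hs2 ht this) hl'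
      linarith
  · have := F1 0 hs.zero_mem
    rwa [mul_zero, hf.map_left, mul_zero] at this
  · have := F2 1 hs'.one_mem
    rw [hg.map_right] at this
    rwa [show l + (1 - l) * 1 = 1 by ring] at this
  · simp only [SinkMesh.join, Finset.image_union, Finset.image_image]
    congr 1
    · apply Finset.image_congr; intro s hs2; exact F1 s hs2
    · apply Finset.image_congr; intro s hs2; exact F2 s hs2
  · intro u hu
    rcases mem u hu with ⟨s, hs2, rfl⟩ | ⟨s, hs2, rfl⟩
    · rw [F1 s hs2, ← mul_sub, abs_mul, abs_of_pos h0]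
      exact (mul_le_mul_of_nonneg_left (hδ s hs2) h0.le).trans hd
    · rw [F2 s hs2, show l + (1 - l) * g s - (l + (1 - l) * s) = (1 - l) * (g s - s) by ring, abs_mul,
        abs_of_pos hl']
      exact (mul_le_mul_of_nonneg_left (hδ' s hs2) hl'.le).trans hd'

end Shift

/-- Splitting a subdivision at one of its points. -/
lemma exists_join {S X Y : Finset ℝ} {l : ℝ} (hS : IsSub S) (h0 : 0 < l) (h1 : l < 1)
    (hX : IsSub X) (hY : IsSub Y) (hXY : join l X Y ⊆ S) :
    ∃ A B, IsSub A ∧ IsSub B ∧ X ⊆ A ∧ Y ⊆ B ∧ S = join l A B ∧ A.card + B.card = S.card + 1 := by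
  have hl : l ∈ S := hXY (Finset.mem_union_left _ (Finset.mem_image.2 ⟨1, hX.one_mem, by ring⟩))
  have hl' : 1 - l ≠ 0 := by linarith
  have r := rail_id hS
  have e := r.image_eq_join hl h0 h1
  simp only [Finset.image_id, id] at e
  have sA := (r.lower hl h0).isSub
  have sB := (r.upper hl h1).isSub
  simp only [id] at sA sB
  have hc := card_join h0 h1 sA sB
  refine ⟨_, _, sA, sB, ?_, ?_, e, ?_⟩
  · intro x hx
    refine Finset.mem_image.2 ⟨l * x, Finset.mem_filter.2 ⟨hXY (Finset.mem_union_left _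
      (Finset.mem_image_of_mem _ hx)), ?_⟩, by field_simp⟩
    nlinarith [hX.le_one x hx]
  · intro y hy
    have hm : l + (1 - l) * y ∈ S := hXY (Finset.mem_union_right _ (Finset.mem_image_of_mem _ hy))
    refine Finset.mem_image.2 ⟨_, Finset.mem_filter.2 ⟨hm, ?_⟩, by field_simp; ring⟩
    nlinarith [hY.nonneg y hy]
  · rw [← e] at hc; omega

/-- The concatenation of `n + 1` subdivisions, each scaled by `1 / (n + 1)`. -/
noncomputable def mj : ℕ → (ℕ → Finset ℝ) → Finset ℝ
  | 0, s => s 0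
  | n + 1, s => join (1 / (n + 2)) (s 0) (mj n fun k => s (k + 1))

lemma mj_param (n : ℕ) : (0 : ℝ) < 1 / (n + 2) ∧ (1 : ℝ) / (n + 2) < 1 := by
  have : (0 : ℝ) ≤ n := Nat.cast_nonneg n
  exact ⟨by positivity, by rw [div_lt_one (by positivity)]; linarith⟩

lemma IsSub.mj {n : ℕ} {s : ℕ → Finset ℝ} (h : ∀ k, IsSub (s k)) : IsSub (mj n s) := by
  induction n generalizing s with
  | zero => exact h 0
  | succ n ih => exact (h 0).join (ih fun k => h (k + 1)) (mj_param n).1.le (mj_param n).2.le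

lemma card_mj {n : ℕ} {s : ℕ → Finset ℝ} (h : ∀ k, IsSub (s k)) :
    (mj n s).card + n = ∑ k ∈ Finset.range (n + 1), (s k).card := by
  induction n generalizing s with
  | zero => simp [mj]
  | succ n ih =>
    have := card_join (mj_param n).1 (mj_param n).2 (h 0) (IsSub.mj (n := n) fun k => h (k + 1))
    have h2 := ih fun k => h (k + 1)
    rw [Finset.sum_range_succ', ← h2]
    simp only [mj]
    omega

/-- Each group is matched within itself, so no point moves further than the length of a group.
Without the groups the only bound would be 1. -/
lemma Shift.mj {n : ℕ} {s t : ℕ → Finset ℝ} (h : ∀ k, Shift (s k) (t k) 1) :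
    Shift (mj n s) (mj n t) (1 / (n + 1)) := by
  induction n generalizing s t with
  | zero => simpa [SinkMesh.mj] using h 0
  | succ n ih =>
    have hn : (0 : ℝ) ≤ n := Nat.cast_nonneg n
    refine (h 0).join (ih fun k => h (k + 1)) (mj_param n).1 (mj_param n).2 ?_ ?_
    · push_cast; apply le_of_eq; ring
    · push_cast; apply le_of_eq; field_simp; ring

lemma exists_mj {n : ℕ} {S X : Finset ℝ} (hS : IsSub S) (hX : IsSub X)
    (h : SinkMesh.mj n (fun _ => X) ⊆ S) :
    ∃ s : ℕ → Finset ℝ, (∀ k, IsSub (s k)) ∧ (∀ k, X ⊆ s k) ∧ S = mj n s := by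
  induction n generalizing S with
  | zero => exact ⟨fun _ => S, fun _ => hS, fun _ => h, rfl⟩
  | succ n ih =>
    obtain ⟨A, B, sA, sB, hA, hB, e, -⟩ := exists_join hS (mj_param n).1 (mj_param n).2 hX
      (IsSub.mj (n := n) fun _ => hX) h
    obtain ⟨s, h1, h2, h3⟩ := ih sB hB
    refine ⟨fun k => Nat.casesOn k A s, ?_, ?_, ?_⟩
    · rintro (_ | k); exacts [sA, h1 k]
    · rintro (_ | k); exacts [hA, h2 k]
    · rw [e, h3]; rfl

end SinkMesh

namespace SinkMesh

/-! ### Trapezoids with vertical sides -/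

/-- The addition formula for the tangent: `x` is within `arctan σ` of horizontal and `y` within
`arctan τ` of vertical, and the last hypothesis, with 1.7321 slightly above `√3`, says that these
two angles add up to at most 30°. -/
lemma niceDir_of_slopes {x y : ℂ} {σ τ : ℝ} (hx : 0 < x.re) (hy : 0 < y.im) (hσ : |x.im| ≤ σ * x.re)
    (hτ : |y.re| ≤ τ * y.im) (h0 : 0 ≤ σ) (h1 : 0 ≤ τ) (h : 1.7321 * (σ + τ) ≤ 1 - σ * τ) :
    NiceDir x y := by
  have h3 : √3 < 1.7321 := by rw [Real.sqrt_lt'] <;> norm_num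
  have hp : 0 < √3 := by positivity
  have a1 : |x.im * y.re| ≤ σ * τ * (x.re * y.im) := by
    rw [abs_mul]
    calc |x.im| * |y.re| ≤ (σ * x.re) * (τ * y.im) := mul_le_mul hσ hτ (abs_nonneg _) (by positivity)
      _ = _ := by ring
  have a2 : |x.im * y.im| ≤ σ * (x.re * y.im) := by
    rw [abs_mul, abs_of_pos hy]; nlinarith
  have a3 : |x.re * y.re| ≤ τ * (x.re * y.im) := by
    rw [abs_mul, abs_of_pos hx]; nlinarith
  have hxy : 0 < x.re * y.im := mul_pos hx hy
  have a4 : |dt x y| ≤ (σ + τ) * (x.re * y.im) := by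
    calc |dt x y| ≤ |x.re * y.re| + |x.im * y.im| := abs_add_le _ _
      _ ≤ _ := by linarith
  have a5 : (1 - σ * τ) * (x.re * y.im) ≤ cr x y := by
    have := (abs_le.1 a1).2; unfold cr; linarith
  have hs : √3 * (σ + τ) ≤ 1 - σ * τ := by nlinarith
  have hpos : 0 < 1 - σ * τ := by
    rcases (add_nonneg h0 h1).eq_or_lt with h' | h'
    · have : σ = 0 := by linarith
      rw [this]; norm_num
    · have := mul_pos hp h'; linarith
  refine ⟨lt_of_lt_of_le (mul_pos hpos hxy) a5, ?_⟩
  calc √3 * |dt x y| ≤ √3 * ((σ + τ) * (x.re * y.im)) := by gcongr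
    _ = (√3 * (σ + τ)) * (x.re * y.im) := by ring
    _ ≤ (1 - σ * τ) * (x.re * y.im) := by gcongr
    _ ≤ _ := a5

lemma ccw_trap {x₀ x₁ y₀ y₁ Y : ℝ} (hx : x₀ < x₁) (h0 : y₀ < Y) (h1 : y₁ < Y) :
    Ccw ⟨x₀, y₀⟩ ⟨x₁, y₁⟩ ⟨x₁, Y⟩ ⟨x₀, Y⟩ := by
  have a := mul_pos (sub_pos.2 hx) (sub_pos.2 h0)
  have b := mul_pos (sub_pos.2 hx) (sub_pos.2 h1)
  refine ⟨?_, ?_, ?_, ?_⟩ <;> rw [el_mk] <;> nlinarith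

lemma IsSub.one_lt_card {S : Finset ℝ} (h : IsSub S) : 2 ≤ S.card :=
  Finset.one_lt_card.2 ⟨0, h.zero_mem, 1, h.one_mem, by norm_num⟩

/-- A block in a trapezoid with vertical sides, horizontal top and nearly horizontal bottom. -/
lemma QS.trap {x₀ x₁ y₀ y₁ Y σ τ δ δ' : ℝ} {Sb Sr St Sl : Finset ℝ} (hx : x₀ < x₁) (h0 : y₀ < Y)
    (h1 : y₁ < Y) (hs : Shift Sb St δ) (hs' : Shift Sl Sr δ')
    (hσ : |y₁ - y₀| + δ' * (Y - y₁) ≤ σ * (x₁ - x₀) ∨ |y₁ - y₀| + δ' * (Y - y₀) ≤ σ * (x₁ - x₀))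
    (hτ : δ * (x₁ - x₀) ≤ τ * (Y - y₀)) (hτ' : δ * (x₁ - x₀) ≤ τ * (Y - y₁)) (hσ0 : 0 ≤ σ)
    (hτ0 : 0 ≤ τ) (h : 1.7321 * (σ + τ) ≤ 1 - σ * τ) :
    QS ⟨x₀, y₀⟩ ⟨x₁, y₁⟩ ⟨x₁, Y⟩ ⟨x₀, Y⟩ Sb Sr St Sl (Sb.card * Sl.card) := by
  refine ⟨ccw_trap hx h0 h1, hs.isSub_left, hs'.isSub_right, hs.isSub_right, hs'.isSub_left, ?_⟩
  have sb := hs.isSub_left; have sl := hs'.isSub_left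
  have sr := hs'.isSub_right
  obtain ⟨f, hf, rfl, hδ⟩ := hs
  obtain ⟨g, hg, rfl, hδ'⟩ := hs'
  have := QM.block (p₀ := ⟨x₀, y₀⟩) (p₁ := ⟨x₁, y₁⟩) (p₂ := ⟨x₁, Y⟩) (p₃ := ⟨x₀, Y⟩) (rail_id sb) hf
    (rail_id sl) hg (by
      intro u hu v hv
      simp only [id, lm_mk]
      have u0 := sl.nonneg u hu; have u1 := sl.le_one u hu
      have v0 := sb.nonneg v hv; have v1 := sb.le_one v hv
      have g0 := sr.nonneg _ (Finset.mem_image_of_mem g hu)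
      have g1 := sr.le_one _ (Finset.mem_image_of_mem g hu)
      apply niceDir_of_slopes (σ := σ) (τ := τ) _ _ _ _ hσ0 hτ0 h
      · simp only [Complex.sub_re]; linarith
      · simp only [Complex.sub_im]
        rcases le_total y₀ y₁ with hy | hy
        · nlinarith [mul_le_of_le_one_left (sub_nonneg.2 hy) v1]
        · nlinarith [mul_nonneg v0 (sub_nonneg.2 hy)]
      · simp only [Complex.sub_re, Complex.sub_im]
        have e1 : |(1 - u) * (y₁ - y₀)| ≤ |y₁ - y₀| := by
          rw [abs_mul, abs_of_nonneg (by linarith)]; exact mul_le_of_le_one_left (abs_nonneg _) (by linarith)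
        have e2 : |(1 - g u) * (y₁ - y₀)| ≤ |y₁ - y₀| := by
          rw [abs_mul, abs_of_nonneg (by linarith)]; exact mul_le_of_le_one_left (abs_nonneg _) (by linarith)
        -- The displacement on the vertical sides may be measured against the height of either side;
        -- the two ways of writing the difference of heights correspond to the two alternatives.
        rcases hσ with hσ | hσ
        · calc |y₁ + g u * (Y - y₁) - (y₀ + u * (Y - y₀))|
              = |(1 - u) * (y₁ - y₀) + (g u - u) * (Y - y₁)| := by congr 1; ring
            _ ≤ |(1 - u) * (y₁ - y₀)| + |(g u - u) * (Y - y₁)| := abs_add_le _ _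
            _ ≤ |y₁ - y₀| + δ' * (Y - y₁) := by
              rw [abs_mul (g u - u), abs_of_pos (by linarith : 0 < Y - y₁)]
              have := mul_le_mul_of_nonneg_right (hδ' u hu) (by linarith : 0 ≤ Y - y₁)
              linarith
            _ ≤ _ := by linarith
        · calc |y₁ + g u * (Y - y₁) - (y₀ + u * (Y - y₀))|
              = |(1 - g u) * (y₁ - y₀) + (g u - u) * (Y - y₀)| := by congr 1; ring
            _ ≤ |(1 - g u) * (y₁ - y₀)| + |(g u - u) * (Y - y₀)| := abs_add_le _ _
            _ ≤ |y₁ - y₀| + δ' * (Y - y₀) := by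
              rw [abs_mul (g u - u), abs_of_pos (by linarith : 0 < Y - y₀)]
              have := mul_le_mul_of_nonneg_right (hδ' u hu) (by linarith : 0 ≤ Y - y₀)
              linarith
            _ ≤ _ := by linarith
      · simp only [Complex.sub_re, Complex.sub_im]
        calc |x₀ + f v * (x₁ - x₀) - (x₀ + v * (x₁ - x₀))| = |(f v - v) * (x₁ - x₀)| := by congr 1; ring
          _ ≤ δ * (x₁ - x₀) := by
            rw [abs_mul, abs_of_pos (by linarith : 0 < x₁ - x₀)]
            exact mul_le_mul_of_nonneg_right (hδ v hv) (by linarith)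
          _ ≤ τ * (Y + f v * (Y - Y) - (y₀ + v * (y₁ - y₀))) := by nlinarith)
  simp only [Finset.image_id] at this
  exact this.mono (Nat.mul_le_mul (Nat.sub_le _ _) (Nat.sub_le _ _))

/-- A strip of width one that moves points to prescribed positions. -/
lemma QS.connector {y₀ y₁ Y : ℝ} {Sb St : Finset ℝ} (h0 : y₀ + 4.8 ≤ Y) (h1 : y₁ + 4.8 ≤ Y)
    (h01 : |y₁ - y₀| ≤ 0.28) (sb : IsSub Sb) (st : IsSub St) (hc : Sb.card = St.card) :
    QS ⟨0, y₀⟩ ⟨1, y₁⟩ ⟨1, Y⟩ ⟨0, Y⟩ Sb {0, 1} St {0, 1} (2 * Sb.card) := by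
  -- A horizontal displacement of at most 1 over a height of at least 4.8 has slope at most 0.21.
  refine (QS.trap (σ := 0.28) (τ := 0.21) one_pos (by linarith) (by linarith) (Shift.of_card sb st hc)
    (Shift.refl isSub_pair le_rfl) (.inl ?_) (by linarith) (by linarith) (by norm_num) (by norm_num)
    (by norm_num)).mono (by rw [card_pair₀₁, mul_comm])
  simpa using h01

/-- A spacer below a core: the side data. -/
noncomputable def cell (σ : ℝ) (a : ℕ) : Finset ℝ := join (σ / (σ + 1)) {0, 1} (coreSet a)

lemma cell_param {σ : ℝ} (h : 0 < σ) : 0 < σ / (σ + 1) ∧ σ / (σ + 1) < 1 :=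
  ⟨by positivity, by rw [div_lt_one (by positivity)]; linarith⟩

lemma isSub_cell {σ : ℝ} (h : 0 < σ) {a : ℕ} (ha : 7 ≤ a) : IsSub (cell σ a) :=
  isSub_pair.join (isSub_coreSet ha) (cell_param h).1.le (cell_param h).2.le

lemma card_cell {σ : ℝ} (h : 0 < σ) {a : ℕ} (ha : 7 ≤ a) : (cell σ a).card = a + 2 := by
  have := card_join (cell_param h).1 (cell_param h).2 isSub_pair (isSub_coreSet ha)
  rw [card_pair₀₁, card_coreSet ha] at this
  rw [cell]; omega

/-- A connector with a core on top. -/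
lemma QS.row {y₀ y₁ Y : ℝ} {Sb : Finset ℝ} {a b t : ℕ} (h0 : y₀ + 5.8 ≤ Y) (h1 : y₁ + 5.8 ≤ Y)
    (h01 : |y₁ - y₀| ≤ 0.28) (sb : IsSub Sb) (hc : 8 ≤ Sb.card) (ha : 7 ≤ a) (hb : 7 ≤ b) (ht : 7 ≤ t)
    (he : Even (Sb.card + (b + 1) + (t + 1) + (a + 1))) :
    QS ⟨0, y₀⟩ ⟨1, y₁⟩ ⟨1, Y⟩ ⟨0, Y⟩ Sb (cell (Y - 1 - y₁) b) (coreSet t) (cell (Y - 1 - y₀) a)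
      (5 * (Sb.card + a + b + t)) := by
  have hm : 7 ≤ Sb.card - 1 := by omega
  have cm := card_coreSet hm
  -- The connector brings the given points of the bottom to the standard positions required by the
  -- core above it.
  have q1 := QS.connector (y₀ := y₀) (y₁ := y₁) (Y := Y - 1) (by linarith) (by linarith) h01 sb
    (isSub_coreSet hm) (by omega)
  have q2 := (RM.core hm hb ht ha (by rw [Nat.even_iff] at he ⊢; omega)).scale one_pos 0 (Y - 1)
  norm_num at q2
  have := QS.hcut (l := (Y - 1 - y₀) / (Y - 1 - y₀ + 1)) (k := (Y - 1 - y₁) / (Y - 1 - y₁ + 1))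
    (ccw_trap one_pos (by linarith) (by linarith))
    (cell_param (by linarith)).1 (cell_param (by linarith)).2 (cell_param (by linarith)).1
    (cell_param (by linarith)).2 ?_ ?_ q1 q2
  · exact this.mono (by omega)
  · rw [lm_mk]
    have : Y - 1 - y₀ + 1 ≠ 0 := by linarith
    congr 1 <;> field_simp <;> ring
  · rw [lm_mk]
    have : Y - 1 - y₁ + 1 ≠ 0 := by linarith
    congr 1 <;> field_simp <;> ring

lemma isSub_mj_cell {σ : ℝ} (h : 0 < σ) {a : ℕ → ℕ} (ha : ∀ k, 7 ≤ a k) (n : ℕ) :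
    IsSub (mj n fun k => cell σ (a k)) := IsSub.mj fun k => isSub_cell h (ha k)

lemma card_mj_cell_succ {σ : ℝ} (h : 0 < σ) {a : ℕ → ℕ} (ha : ∀ k, 7 ≤ a k) (n : ℕ) :
    (mj (n + 1) fun k => cell σ (a k)).card = a 0 + 1 + (mj n fun k => cell σ (a (k + 1))).card := by
  have := card_join (mj_param n).1 (mj_param n).2 (isSub_cell h (ha 0))
    (isSub_mj_cell h (fun k => ha (k + 1)) n)
  rw [card_cell h (ha 0)] at this
  simp only [mj]; omega

/-- A column of cores. -/
theorem RM.column {n : ℕ} {σ : ℝ} (hσ : 5 ≤ σ) {Sb : Finset ℝ} (sb : IsSub Sb) (hc : 8 ≤ Sb.card)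
    {a b : ℕ → ℕ} (ha : ∀ k, 7 ≤ a k) (hb : ∀ k, 7 ≤ b k) {t : ℕ} (ht : 7 ≤ t)
    (he : Even (Sb.card + (mj n fun k => cell σ (b k)).card + (t + 1) +
      (mj n fun k => cell σ (a k)).card)) :
    RM 0 1 0 ((n + 1) * (σ + 1)) Sb (mj n fun k => cell σ (b k)) (coreSet t)
      (mj n fun k => cell σ (a k))
      (12 * (Sb.card + (mj n fun k => cell σ (b k)).card + t + (mj n fun k => cell σ (a k)).card)) := by
  have hσ0 : 0 < σ := by linarith
  induction n generalizing Sb a b with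
  | zero =>
    simp only [mj, card_cell hσ0 (ha 0), card_cell hσ0 (hb 0)] at he ⊢
    have := QS.row (y₀ := 0) (y₁ := 0) (Y := σ + 1) (by linarith) (by linarith) (by norm_num) sb hc (ha 0) (hb 0) ht
      (by rw [Nat.even_iff] at he ⊢; omega)
    have e : σ + 1 - 1 - 0 = σ := by ring
    rw [e] at this
    simp only [Nat.cast_zero, zero_add, one_mul]
    exact this.mono (by omega)
  | succ n ih =>
    rw [card_mj_cell_succ hσ0 ha, card_mj_cell_succ hσ0 hb] at he ⊢
    -- The number of edges between two rows is free. One of the values 7 and 8 makes the lowest row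
    -- even, and then the rest of the column is even as well.
    obtain ⟨u, hu, hu8, hev⟩ : ∃ u : ℕ, 7 ≤ u ∧ u ≤ 8 ∧
        Even (Sb.card + (b 0 + 1) + (u + 1) + (a 0 + 1)) :=
      ⟨7 + (Sb.card + b 0 + a 0) % 2, by omega, by omega, by rw [Nat.even_iff]; omega⟩
    have q1 := QS.row (y₀ := 0) (y₁ := 0) (Y := σ + 1) (by linarith) (by linarith) (by norm_num) sb hc (ha 0) (hb 0) hu hev
    have e : σ + 1 - 1 - 0 = σ := by ring
    rw [e] at q1
    have q2 := ih (isSub_coreSet hu) (by rw [card_coreSet hu]; omega) (fun k => ha (k + 1))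
      (fun k => hb (k + 1)) (by rw [card_coreSet hu]; rw [Nat.even_iff] at he hev ⊢; omega)
    have q2 := q2.scale one_pos 0 (σ + 1)
    have hn : (0 : ℝ) ≤ n := Nat.cast_nonneg n
    have hY : 1 * ((n + 1) * (σ + 1)) + (σ + 1) = ((n + 1 : ℕ) + 1 : ℝ) * (σ + 1) := by push_cast; ring
    rw [hY] at q2
    norm_num at q2
    have := RM.hcut (y₀ := 0) (y := σ + 1) (y₁ := ((n + 1 : ℕ) + 1 : ℝ) * (σ + 1)) (by linarith)
      (by push_cast; nlinarith) one_pos q1 (by push_cast; exact q2)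
    have e2 : (σ + 1 - 0) / (((n + 1 : ℕ) + 1 : ℝ) * (σ + 1) - 0) = 1 / (n + 2) := by
      push_cast
      have : σ + 1 ≠ 0 := by linarith
      field_simp; ring
    rw [e2] at this
    refine RM.mono this ?_
    rw [card_coreSet hu]
    have := ha 0; have := hb 0
    omega

/-- A column of cores with sloping bottom. -/
theorem QS.column {n : ℕ} {σ y₀ y₁ Y₁ : ℝ} (hσ : 5 ≤ σ) (h0 : y₀ + 5.8 ≤ Y₁) (h1 : y₁ + 5.8 ≤ Y₁)
    (h01 : |y₁ - y₀| ≤ 0.28) {Sb : Finset ℝ} (sb : IsSub Sb) (hc : 8 ≤ Sb.card)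
    {a b : ℕ → ℕ} (ha : ∀ k, 7 ≤ a k) (hb : ∀ k, 7 ≤ b k) {a₀ b₀ : ℕ} (ha0 : 7 ≤ a₀) (hb0 : 7 ≤ b₀)
    {t : ℕ} (ht : 7 ≤ t)
    (he : Even (Sb.card + (b₀ + 1 + (mj n fun k => cell σ (b k)).card) + (t + 1) +
      (a₀ + 1 + (mj n fun k => cell σ (a k)).card))) :
    QS ⟨0, y₀⟩ ⟨1, y₁⟩ ⟨1, Y₁ + (n + 1) * (σ + 1)⟩ ⟨0, Y₁ + (n + 1) * (σ + 1)⟩ Sb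
      (join ((Y₁ - y₁) / (Y₁ + (n + 1) * (σ + 1) - y₁)) (cell (Y₁ - 1 - y₁) b₀)
        (mj n fun k => cell σ (b k)))
      (coreSet t)
      (join ((Y₁ - y₀) / (Y₁ + (n + 1) * (σ + 1) - y₀)) (cell (Y₁ - 1 - y₀) a₀)
        (mj n fun k => cell σ (a k)))
      (12 * (Sb.card + (b₀ + 1 + (mj n fun k => cell σ (b k)).card) + t +
        (a₀ + 1 + (mj n fun k => cell σ (a k)).card))) := by
  have hσ0 : 0 < σ := by linarith
  have hn : (0 : ℝ) ≤ n := Nat.cast_nonneg n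
  have hH : 0 < (n + 1) * (σ + 1) := by positivity
  obtain ⟨u, hu, hu8, hev⟩ : ∃ u : ℕ, 7 ≤ u ∧ u ≤ 8 ∧
      Even (Sb.card + (b₀ + 1) + (u + 1) + (a₀ + 1)) :=
    ⟨7 + (Sb.card + b₀ + a₀) % 2, by omega, by omega, by rw [Nat.even_iff]; omega⟩
  have q1 := QS.row h0 h1 h01 sb hc ha0 hb0 hu hev
  -- Only the first row has a sloping base; above it the column is rectangular with rows of equal
  -- height.
  have q2 := RM.column (n := n) hσ (isSub_coreSet hu) (by rw [card_coreSet hu]; omega) ha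
      hb ht (by rw [card_coreSet hu]; rw [Nat.even_iff] at he hev ⊢; omega)
  have q2 := q2.scale one_pos 0 Y₁
  norm_num at q2
  rw [add_comm _ Y₁] at q2
  have l0 : ∀ y : ℝ, y + 5.8 ≤ Y₁ → 0 < (Y₁ - y) / (Y₁ + (n + 1) * (σ + 1) - y) ∧
      (Y₁ - y) / (Y₁ + (n + 1) * (σ + 1) - y) < 1 ∧
      y + (Y₁ - y) / (Y₁ + (n + 1) * (σ + 1) - y) * (Y₁ + (n + 1) * (σ + 1) - y) = Y₁ := by
    intro y hy
    have : 0 < Y₁ + (n + 1) * (σ + 1) - y := by linarith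
    refine ⟨div_pos (by linarith) this, by rw [div_lt_one this]; linarith, ?_⟩
    field_simp; ring
  refine (QS.hcut (ccw_trap one_pos (by linarith) (by linarith)) (l0 y₀ h0).1 (l0 y₀ h0).2.1
    (l0 y₁ h1).1 (l0 y₁ h1).2.1 ?_ ?_ q1 q2).mono ?_
  · rw [lm_mk, (l0 y₀ h0).2.2]; simp
  · rw [lm_mk, (l0 y₁ h1).2.2]; simp
  · rw [card_coreSet hu]
    omega

end SinkMesh

/-! ### The part of a trapezoid below its central row of cores. -/

namespace SinkMesh

/-- Side data of a horizontal row of cores. -/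
noncomputable def armSet (a : ℕ → ℕ) (t : ℕ) (b : ℕ → ℕ) : Finset ℝ :=
  join (78 / 157) (mj 12 fun k => cell 5 (a k)) (join (1 / 79) (coreSet t) (rev (mj 12 fun k => cell 5 (b k))))

/-- The subdivision of horizontal sides into groups facing the cores of a row. -/
noncomputable def armBase : Finset ℝ :=
  join (78 / 157) (mj 12 fun _ => eqd 8) (join (1 / 79) (eqd 7) (rev (mj 12 fun _ => eqd 8)))

lemma isSub_mj_eqd (n : ℕ) : IsSub (mj n fun _ => eqd 8) := IsSub.mj fun _ => isSub_eqd (by norm_num)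

lemma card_mj_eqd (n : ℕ) : (mj n fun _ => eqd 8).card = 8 * (n + 1) + 1 := by
  have := card_mj (n := n) (s := fun _ => eqd 8) fun _ => isSub_eqd (by norm_num)
  rw [Finset.sum_const, Finset.card_range, card_eqd (by norm_num), smul_eq_mul] at this
  omega

lemma isSub_armBase : IsSub armBase :=
  (isSub_mj_eqd 12).join ((isSub_eqd (by norm_num)).join (isSub_mj_eqd 12).rev (by norm_num)
    (by norm_num)) (by norm_num) (by norm_num)

lemma card_armBase : armBase.card = 216 := by
  have s7 : IsSub (eqd 7) := isSub_eqd (by norm_num)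
  have c1 := card_join (l := 1 / 79) (by norm_num) (by norm_num) s7 (isSub_mj_eqd 12).rev
  have c2 := card_join (l := 78 / 157) (by norm_num) (by norm_num) (isSub_mj_eqd 12)
    (s7.join (isSub_mj_eqd 12).rev (l := 1 / 79) (by norm_num) (by norm_num))
  rw [card_rev, card_mj_eqd, card_eqd (by norm_num)] at c1
  rw [card_mj_eqd] at c2
  rw [armBase]; omega

/-- Splitting a side into groups matched with a stack of cores. -/
lemma exists_groups {n : ℕ} {S : Finset ℝ} (σ : ℝ) (hσ : 0 < σ) (hS : IsSub S)
    (h : (mj n fun _ => eqd 8) ⊆ S) : ∃ a : ℕ → ℕ, (∀ k, 7 ≤ a k) ∧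
      Shift S (mj n fun k => cell σ (a k)) (1 / (n + 1)) := by
  obtain ⟨s, h1, h2, rfl⟩ := exists_mj hS (isSub_eqd (by norm_num)) h
  -- Eight prescribed edges in each group guarantee one edge for the spacer and at least seven for
  -- the core.
  have hc : ∀ k, 9 ≤ (s k).card := fun k => by
    have := Finset.card_le_card (h2 k); rwa [card_eqd (by norm_num)] at this
  have hc' : ∀ k, 7 ≤ (s k).card - 2 := fun k => by have := hc k; omega
  refine ⟨fun k => (s k).card - 2, hc', Shift.mj fun k => ?_⟩
  have := hc k
  exact Shift.of_card (h1 k) (isSub_cell hσ (hc' k)) (by rw [card_cell hσ (hc' k)]; omega)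

/-- Used for the slanted column, whose lowest cell has its own height. The two bounds on `δ` are the
lengths of the first group and of the others. -/
lemma exists_groups' {n : ℕ} {S : Finset ℝ} {σ σ' l δ : ℝ} (hσ : 0 < σ) (hσ' : 0 < σ') (h0 : 0 < l)
    (h1 : l < 1) (hl : l ≤ δ) (hl' : (1 - l) * (1 / (n + 1)) ≤ δ) (hS : IsSub S)
    (h : join l (eqd 8) (mj n fun _ => eqd 8) ⊆ S) : ∃ (a₀ : ℕ) (a : ℕ → ℕ), 7 ≤ a₀ ∧ (∀ k, 7 ≤ a k) ∧
      Shift S (join l (cell σ' a₀) (mj n fun k => cell σ (a k))) δ := by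
  obtain ⟨A, B, sA, sB, hA, hB, rfl, -⟩ := exists_join hS h0 h1 (isSub_eqd (by norm_num)) (isSub_mj_eqd n) h
  obtain ⟨a, ha, hs⟩ := exists_groups σ hσ sB hB
  have hc := Finset.card_le_card hA
  rw [card_eqd (by norm_num)] at hc
  refine ⟨A.card - 2, a, by omega, ha, Shift.join (δ₁ := 1) ?_ hs h0 h1 (by linarith) hl'⟩
  exact Shift.of_card sA (isSub_cell hσ' (by omega)) (by rw [card_cell hσ' (by omega)]; omega)

lemma card_join_cell {n : ℕ} {σ σ' l : ℝ} (hσ : 0 < σ) (hσ' : 0 < σ') (h0 : 0 < l) (h1 : l < 1)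
    {a₀ : ℕ} {a : ℕ → ℕ} (ha0 : 7 ≤ a₀) (ha : ∀ k, 7 ≤ a k) :
    (join l (cell σ' a₀) (mj n fun k => cell σ (a k))).card =
      a₀ + 1 + (mj n fun k => cell σ (a k)).card := by
  have := card_join h0 h1 (isSub_cell hσ' ha0) (isSub_mj_cell hσ ha n)
  rw [card_cell hσ' ha0] at this
  omega

lemma card_armSet {a b : ℕ → ℕ} {t : ℕ} (ha : ∀ k, 7 ≤ a k) (hb : ∀ k, 7 ≤ b k) (ht : 7 ≤ t) :
    (armSet a t b).card + 1 =
      (mj 12 fun k => cell 5 (a k)).card + t + (mj 12 fun k => cell 5 (b k)).card := by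
  have sb := (isSub_mj_cell (σ := 5) (by norm_num) hb 12).rev
  have c1 := card_join (l := 1 / 79) (by norm_num) (by norm_num) (isSub_coreSet ht) sb
  have c2 := card_join (l := 78 / 157) (by norm_num) (by norm_num) (isSub_mj_cell (σ := 5) (by norm_num) ha 12)
    ((isSub_coreSet ht).join sb (l := 1 / 79) (by norm_num) (by norm_num))
  rw [card_rev, card_coreSet ht] at c1
  rw [armSet]; omega

set_option maxHeartbeats 1000000 in
/-- The part of a trapezoid below its central row of cores. -/
theorem QS.lowerPart {yl yr Y : ℝ} (hs : |yr - yl| ≤ 0.28 * 157) (hl : 77 ≤ Y - yl)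
    (hr : 77 ≤ Y - yr) : ∃ Xl Xr : Finset ℝ, IsSub Xl ∧ IsSub Xr ∧
      (Xl.card : ℝ) ≤ 2 * ((Y - yl) + (Y - yr)) ∧ (Xr.card : ℝ) ≤ 2 * ((Y - yl) + (Y - yr)) ∧
      ∀ Sb Sr Sl : Finset ℝ, IsSub Sb → IsSub Sr → IsSub Sl → armBase ⊆ Sb → Xr ⊆ Sr → Xl ⊆ Sl →
      ∃ (a : ℕ → ℕ) (t : ℕ) (b : ℕ → ℕ), (∀ k, 7 ≤ a k) ∧ 7 ≤ t ∧ (∀ k, 7 ≤ b k) ∧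
        (armSet a t b).card ≤ Sb.card + 8 ∧
        Even (Sb.card + Sr.card + (armSet a t b).card + Sl.card) ∧
        QS ⟨-78, yl⟩ ⟨79, yr⟩ ⟨79, Y⟩ ⟨-78, Y⟩ Sb Sr (armSet a t b) Sl
          (26 * (Sb.card * (Sl.card + Sr.card))) := by
  -- `H` is the height above the midpoint of the base. It is divided into `m` rows of equal height
  -- `h` between 6 and 6.5, where the upper bound uses that there are at least 12 rows.
  set H := Y - (yl + yr) / 2 with hH
  set m := ⌊H / 6⌋₊ with hm
  have hH77 : 77 ≤ H := by rw [hH]; linarith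
  have hm12 : 12 ≤ m := Nat.le_floor (by push_cast; linarith)
  obtain ⟨n, hn⟩ : ∃ n, m = n + 2 := ⟨m - 2, by omega⟩
  have m1 : (m : ℝ) ≤ H / 6 := Nat.floor_le (by linarith)
  have m2 : H / 6 < m + 1 := Nat.lt_floor_add_one _
  have hmn : (m : ℝ) = n + 2 := by rw [hn]; push_cast; ring
  have hm12' : (12 : ℝ) ≤ m := by exact_mod_cast hm12
  have hm0 : (0 : ℝ) < m := by linarith
  set h := H / m with hh
  have h6 : 6 ≤ h := by rw [hh, le_div_iff₀ hm0]; linarith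
  have h7 : h ≤ 6.5 := by rw [hh, div_le_iff₀ hm0]; linarith
  have hHm : H = m * h := by rw [hh]; field_simp
  obtain ⟨σ, hσe⟩ : ∃ σ, h = σ + 1 := ⟨h - 1, by ring⟩
  rw [hσe] at h6 h7 hHm
  have hσ : 5 ≤ σ := by linarith
  have hσ0 : 0 < σ := by linarith
  -- `Y₁` is the top of the lowest row, and `y₀`, `y₁` are the heights of the base below the two
  -- sides of the column, at abscissas 0 and 1. The slope bound keeps both within 0.14 of the mean
  -- height.
  set Y₁ := Y - (n + 1) * (σ + 1) with hY₁
  set y₀ := yl + 78 / 157 * (yr - yl) with hy₀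
  set y₁ := yl + 79 / 157 * (yr - yl) with hy₁
  obtain ⟨hs1, hs2⟩ := abs_le.1 hs
  have hYm : Y₁ - (yl + yr) / 2 = σ + 1 := by
    have : H = (n + 2) * (σ + 1) := by rw [hHm, hmn]
    rw [hY₁]; linarith
  have b0 : y₀ + 5.8 ≤ Y₁ := by rw [hy₀]; linarith
  have b1 : y₁ + 5.8 ≤ Y₁ := by rw [hy₁]; linarith
  have b0' : Y₁ - y₀ ≤ 6.7 := by rw [hy₀]; linarith
  have b1' : Y₁ - y₁ ≤ 6.7 := by rw [hy₁]; linarith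
  have b01 : |y₁ - y₀| ≤ 0.28 := by rw [hy₀, hy₁, abs_le]; constructor <;> linarith
  have hYY : Y₁ + (n + 1) * (σ + 1) = Y := by rw [hY₁]; ring
  have hn0 : (0 : ℝ) ≤ n := Nat.cast_nonneg n
  have hpos : 0 < (n + 1) * (σ + 1) := by positivity
  have k0 : 77 ≤ Y - y₀ := by rw [hy₀]; linarith
  have k1 : 77 ≤ Y - y₁ := by rw [hy₁]; linarith
  have par : ∀ y : ℝ, y + 5.8 ≤ Y₁ → Y₁ - y ≤ 6.7 → 77 ≤ Y - y → 0 < (Y₁ - y) / (Y - y) ∧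
      (Y₁ - y) / (Y - y) < 1 ∧ (Y₁ - y) / (Y - y) ≤ 6.7 / (Y - y) ∧
      (1 - (Y₁ - y) / (Y - y)) * (1 / (n + 1)) ≤ 6.7 / (Y - y) := by
    intro y a1 a2 a3
    have hp : 0 < Y - y := by linarith
    refine ⟨div_pos (by linarith) hp, by rw [div_lt_one hp]; linarith, by gcongr, ?_⟩
    rw [show 1 - (Y₁ - y) / (Y - y) = (n + 1) * (σ + 1) / (Y - y) by
      rw [eq_div_iff hp.ne']; field_simp; linarith]
    rw [div_mul_eq_mul_div, mul_one_div, mul_comm, mul_div_assoc, div_self (by positivity), mul_one]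
    gcongr; linarith
  obtain ⟨p0, p1, p2, p3⟩ := par y₀ b0 b0' k0
  obtain ⟨r0, r1, r2, r3⟩ := par y₁ b1 b1' k1
  have e8 : IsSub (eqd 8) := isSub_eqd (by norm_num)
  have cardX : ∀ l : ℝ, 0 < l → l < 1 → ((join l (eqd 8) (mj n fun _ => eqd 8)).card : ℝ) ≤
      2 * ((Y - yl) + (Y - yr)) := by
    intro l l0 l1
    have := card_join l0 l1 e8 (isSub_mj_eqd n)
    rw [card_eqd (by norm_num), card_mj_eqd] at this
    have : (join l (eqd 8) (mj n fun _ => eqd 8)).card = 8 * m + 1 := by omega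
    rw [this]; push_cast; linarith
  -- The prescribed vertices on the vertical sides form one group of eight edges for each row of the
  -- column.
  refine ⟨join ((Y₁ - y₀) / (Y - y₀)) (eqd 8) (mj n fun _ => eqd 8),
    join ((Y₁ - y₁) / (Y - y₁)) (eqd 8) (mj n fun _ => eqd 8), e8.join (isSub_mj_eqd n) p0.le p1.le,
    e8.join (isSub_mj_eqd n) r0.le r1.le, cardX _ p0 p1, cardX _ r0 r1, ?_⟩
  intro Sb Sr Sl sb sr sl hXb hXr hXl
  -- The base splits into 13 groups on the left, a central group below the column, and 13 groups on
  -- the right, each facing a core of the row above.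
  obtain ⟨B₁, B', sB₁, sB', hB₁, hB', rfl, cb⟩ := exists_join sb (by norm_num) (by norm_num) (isSub_mj_eqd 12)
    ((isSub_eqd (by norm_num)).join (isSub_mj_eqd 12).rev (l := 1 / 79) (by norm_num) (by norm_num)) hXb
  obtain ⟨B₀, B₂, sB₀, sB₂, hB₀, hB₂, rfl, cb'⟩ := exists_join sB' (by norm_num) (by norm_num)
    (isSub_eqd (by norm_num)) (isSub_mj_eqd 12).rev hB'
  have cB₀ := Finset.card_le_card hB₀
  rw [card_eqd (by norm_num)] at cB₀
  have hB₂' : (mj 12 fun _ => eqd 8) ⊆ rev B₂ := by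
    intro t ht; exact mem_rev.2 (hB₂ (by rw [mem_rev]; simpa using ht))
  obtain ⟨a, ha, hsa⟩ := exists_groups 5 (by norm_num) sB₁ hB₁
  obtain ⟨b, hb, hsb⟩ := exists_groups 5 (by norm_num) sB₂.rev hB₂'
  have hsb := hsb.rev
  rw [rev_rev] at hsb
  obtain ⟨c₀, c, hc0, hc, hsl⟩ := exists_groups' (σ' := Y₁ - 1 - y₀) hσ0 (by linarith) p0 p1 p2 p3 sl hXl
  obtain ⟨d₀, d, hd0, hd, hsr⟩ := exists_groups' (σ' := Y₁ - 1 - y₁) hσ0 (by linarith) r0 r1 r2 r3 sr hXr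
  have cl := hsl.card_eq
  have cr := hsr.card_eq
  rw [card_join_cell hσ0 (by linarith) p0 p1 hc0 hc] at cl
  rw [card_join_cell hσ0 (by linarith) r0 r1 hd0 hd] at cr
  -- The number of edges on top of the column is chosen to make the column even. The blocks at its
  -- sides carry points across unchanged in number, so the whole part is even too.
  obtain ⟨t, ht, ht8, hev⟩ : ∃ t : ℕ, 7 ≤ t ∧ t ≤ 8 ∧ Even (B₀.card + Sr.card + (t + 1) + Sl.card) :=
    ⟨7 + (B₀.card + Sr.card + Sl.card) % 2, by omega, by omega, by rw [Nat.even_iff]; omega⟩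
  have qc := QS.column hσ b0 b1 b01 sB₀ cB₀ hc hd hc0 hd0 ht (by rw [← cl, ← cr]; exact hev)
  rw [← cl, ← cr, hYY] at qc
  -- In a block of width 78, vertical groups of length at most 6.7 add less than 0.1 to the slope
  -- 0.28 of the base. Horizontal groups have length 6, and the height is at least 77, which gives a
  -- slope below 0.1.
  have qL := QS.trap (x₀ := -78) (x₁ := 0) (y₀ := yl) (y₁ := y₀) (Y := Y) (σ := 0.38) (τ := 0.1)
    (by norm_num) (by linarith) (by linarith) hsa hsl (.inl (by
      rw [div_mul_cancel₀ _ (by linarith)]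
      have : |y₀ - yl| ≤ 0.28 * 78 := by rw [hy₀, abs_le]; constructor <;> linarith
      linarith)) (by norm_num; linarith) (by norm_num; linarith) (by norm_num) (by norm_num) (by norm_num)
  have qR := QS.trap (x₀ := 1) (x₁ := 79) (y₀ := y₁) (y₁ := yr) (Y := Y) (σ := 0.38) (τ := 0.1)
    (by norm_num) (by linarith) (by linarith) hsb hsr.symm (.inr (by
      rw [div_mul_cancel₀ _ (by linarith)]
      have : |yr - y₁| ≤ 0.28 * 78 := by rw [hy₁, abs_le]; constructor <;> linarith
      linarith)) (by norm_num; linarith) (by norm_num; linarith) (by norm_num) (by norm_num) (by norm_num)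
  have q1 := QS.vcut (p₀ := ⟨0, y₀⟩) (p₁ := ⟨79, yr⟩) (p₂ := ⟨79, Y⟩) (p₃ := ⟨0, Y⟩) (l := 1 / 79) (k := 1 / 79)
    (ccw_trap (by norm_num) (by linarith) (by linarith)) (by norm_num) (by norm_num) (by norm_num)
    (by norm_num) (by rw [lm_mk, hy₀, hy₁]; congr 1 <;> ring) (by rw [lm_mk]; congr 1 <;> ring) qc qR
  have q2 := QS.vcut (p₀ := ⟨-78, yl⟩) (p₁ := ⟨79, yr⟩) (p₂ := ⟨79, Y⟩) (p₃ := ⟨-78, Y⟩) (l := 78 / 157) (k := 78 / 157)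
    (ccw_trap (by norm_num) (by linarith) (by linarith)) (by norm_num) (by norm_num) (by norm_num)
    (by norm_num) (by rw [lm_mk, hy₀]; congr 1; ring) (by rw [lm_mk]; congr 1 <;> ring) qL q1
  have ca := card_armSet ha hb ht
  have c1 := hsa.card_eq
  have c2 := hsb.card_eq
  rw [card_rev] at c2
  refine ⟨a, t, b, ha, ht, hb, by omega, ?_, q2.mono ?_⟩
  · rw [Nat.even_iff] at hev ⊢; omega
  · rw [← hsr.card_eq]
    set x := (join (78 / 157) B₁ (join (1 / 79) B₀ B₂)).card with hx
    have g1 : B₁.card ≤ x := by have := sB'.one_lt_card; omega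
    have g2 : B₂.card ≤ x := by have := sB₁.one_lt_card; omega
    have g0 : B₀.card ≤ x := by
      have := sB₁.one_lt_card; have := sB₂.one_lt_card; omega
    have f1 := Nat.mul_le_mul_right Sl.card g1
    have f2 := Nat.mul_le_mul_right Sr.card g2
    have f3 := sl.one_lt_card
    have f4 := sr.one_lt_card
    have f5 : 8 ≤ x := by omega
    have f6 : 4 * x ≤ x * (Sl.card + Sr.card) := by
      rw [mul_comm 4]; exact Nat.mul_le_mul_left _ (by omega)
    have f7 : 8 * (Sl.card + Sr.card) ≤ x * (Sl.card + Sr.card) := Nat.mul_le_mul_right _ f5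
    have f8 : x * (Sl.card + Sr.card) = x * Sl.card + x * Sr.card := by ring
    omega

end SinkMesh

/-! ### Tall trapezoids are sinks. -/

namespace SinkMesh

/-- The central row of cores. -/
lemma RM.midRow {a b a' b' : ℕ → ℕ} {t t' : ℕ} {SL SR : Finset ℝ} (ha : ∀ k, 7 ≤ a k)
    (hb : ∀ k, 7 ≤ b k) (ha' : ∀ k, 7 ≤ a' k) (hb' : ∀ k, 7 ≤ b' k) (ht : 7 ≤ t) (ht' : 7 ≤ t')
    (sL : IsSub SL) (sR : IsSub SR) (hL : 8 ≤ SL.card) (hR : 8 ≤ SR.card)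
    (he : Even ((armSet a t b).card + SR.card + (armSet a' t' b').card + SL.card)) :
    RM (-78) 79 0 1 (armSet a t b) SR (armSet a' t' b') SL
      (12 * (SL.card + SR.card + (armSet a t b).card + (armSet a' t' b').card) + 300) := by
  have c := card_armSet ha hb ht
  have c' := card_armSet ha' hb' ht'
  -- The two sides of the central core facing the arms are free. They are used to make both arms
  -- even, and then the core itself is even because the total is.
  obtain ⟨u, hu, hu8, hev⟩ : ∃ u : ℕ, 7 ≤ u ∧ u ≤ 8 ∧ Even ((rev SL).card +
      (mj 12 fun k => cell 5 (a k)).card + (u + 1) + (mj 12 fun k => cell 5 (a' k)).card) :=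
    ⟨7 + ((rev SL).card + (mj 12 fun k => cell 5 (a k)).card + (mj 12 fun k => cell 5 (a' k)).card) % 2,
      by omega, by omega, by rw [Nat.even_iff]; omega⟩
  obtain ⟨v, hv, hv8, hev'⟩ : ∃ u : ℕ, 7 ≤ u ∧ u ≤ 8 ∧ Even (SR.card +
      (mj 12 fun k => cell 5 (b' k)).card + (u + 1) + (mj 12 fun k => cell 5 (b k)).card) :=
    ⟨7 + (SR.card + (mj 12 fun k => cell 5 (b' k)).card + (mj 12 fun k => cell 5 (b k)).card) % 2,
      by omega, by omega, by rw [Nat.even_iff]; omega⟩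
  have q1 := RM.column (n := 12) le_rfl sL.rev (by rwa [card_rev]) ha' ha hu hev
  have q2 := RM.column (n := 12) le_rfl sR hR hb hb' hv hev'
  rw [card_rev] at hev q1
  have q3 := RM.core ht hv ht' hu (by rw [Nat.even_iff] at he hev hev' ⊢; omega)
  have q1 := q1.rot.rot.rot.scale one_pos (-78) 1
  rw [rev_rev, rev_rev, rev_rev, rev_coreSet hu] at q1
  have q2 := q2.rot.scale one_pos 79 0
  unfold armSet at *
  generalize (mj 12 fun k => cell 5 (a k)) = A at *
  generalize (mj 12 fun k => cell 5 (a' k)) = A' at *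
  generalize (mj 12 fun k => cell 5 (b k)) = B at *
  generalize (mj 12 fun k => cell 5 (b' k)) = B' at *
  norm_num at q1 q2
  have q := RM.vcut (x₀ := 0) (x := 1) (x₁ := 79) (by norm_num) (by norm_num) one_pos q3 q2
  have q := RM.vcut (x₀ := -78) (x := 0) (x₁ := 79) (by norm_num) (by norm_num) one_pos q1 q
  norm_num at q
  exact q.mono (by omega)

lemma rev_armSet (a b : ℕ → ℕ) {t : ℕ} (ht : 7 ≤ t) : rev (armSet a t b) = armSet b t a := by
  unfold armSet
  rw [rev_join, rev_join, rev_rev, rev_coreSet ht]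
  symm
  rw [join_assoc]
  · norm_num
  · norm_num

/-- A quadrilateral that can be meshed for all refinements of a fixed subdivision of its sides with
evenly many edges, with explicit control of the number of elements. -/
def CSink (p₀ p₁ p₂ p₃ : ℂ) (N : ℕ) : Prop :=
  Ccw p₀ p₁ p₂ p₃ ∧ ∃ Xb Xr Xt Xl : Finset ℝ, (IsSub Xb ∧ IsSub Xr ∧ IsSub Xt ∧ IsSub Xl) ∧
    (Xb.card ≤ N ∧ Xr.card ≤ N ∧ Xt.card ≤ N ∧ Xl.card ≤ N) ∧
    ∀ Sb Sr St Sl : Finset ℝ, IsSub Sb → IsSub Sr → IsSub St → IsSub Sl → Xb ⊆ Sb → Xr ⊆ Sr →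
      Xt ⊆ St → Xl ⊆ Sl → Even (Sb.card + Sr.card + St.card + Sl.card) →
      QS p₀ p₁ p₂ p₃ Sb Sr St Sl (N * ((Sb.card + St.card) * (Sl.card + Sr.card)))

lemma subset_rev {X Y : Finset ℝ} (h : rev X ⊆ Y) : X ⊆ rev Y := by
  intro t ht; exact mem_rev.2 (h (by rw [mem_rev]; simpa using ht))

lemma CSink.mono {p₀ p₁ p₂ p₃ : ℂ} {N N' : ℕ} (h : CSink p₀ p₁ p₂ p₃ N) (hN : N ≤ N') :
    CSink p₀ p₁ p₂ p₃ N' := by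
  obtain ⟨h1, Xb, Xr, Xt, Xl, h2, ⟨c1, c2, c3, c4⟩, h4⟩ := h
  refine ⟨h1, Xb, Xr, Xt, Xl, h2, ⟨c1.trans hN, c2.trans hN, c3.trans hN, c4.trans hN⟩, ?_⟩
  intro Sb Sr St Sl a1 a2 a3 a4 a5 a6 a7 a8 a9
  exact (h4 Sb Sr St Sl a1 a2 a3 a4 a5 a6 a7 a8 a9).mono (Nat.mul_le_mul_right _ hN)

lemma CSink.rot {p₀ p₁ p₂ p₃ : ℂ} {N : ℕ} (h : CSink p₀ p₁ p₂ p₃ N) : CSink p₁ p₂ p₃ p₀ N := by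
  obtain ⟨h1, Xb, Xr, Xt, Xl, ⟨s1, s2, s3, s4⟩, ⟨c1, c2, c3, c4⟩, h4⟩ := h
  refine ⟨h1.rot, Xr, rev Xt, Xl, rev Xb, ⟨s2, s3.rev, s4, s1.rev⟩,
    ⟨c2, by rwa [card_rev], c4, by rwa [card_rev]⟩, ?_⟩
  intro Sb Sr St Sl a1 a2 a3 a4 a5 a6 a7 a8 a9
  have := (h4 (rev Sl) Sb (rev Sr) St a4.rev a1 a2.rev a3 (subset_rev a8) a5 (subset_rev a6) a7
    (by simp only [card_rev]; rw [Nat.even_iff] at a9 ⊢; omega)).rot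
  rw [rev_rev, rev_rev, card_rev, card_rev] at this
  refine this.mono (le_of_eq ?_)
  ring

lemma CSink.simil {p₀ p₁ p₂ p₃ : ℂ} {N : ℕ} (h : CSink p₀ p₁ p₂ p₃ N) (ω : ℂ) (hω : ω ≠ 0) (c : ℂ) :
    CSink (ω * p₀ + c) (ω * p₁ + c) (ω * p₂ + c) (ω * p₃ + c) N := by
  obtain ⟨h1, Xb, Xr, Xt, Xl, h2, h3, h4⟩ := h
  have hp := Complex.normSq_pos.2 hω
  refine ⟨⟨?_, ?_, ?_, ?_⟩, Xb, Xr, Xt, Xl, h2, h3, ?_⟩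
  · rw [← simil_apply ω hω c, ← simil_apply ω hω c, ← simil_apply ω hω c, el_simil]; exact mul_pos hp h1.c₀
  · rw [← simil_apply ω hω c, ← simil_apply ω hω c, ← simil_apply ω hω c, el_simil]; exact mul_pos hp h1.c₁
  · rw [← simil_apply ω hω c, ← simil_apply ω hω c, ← simil_apply ω hω c, el_simil]; exact mul_pos hp h1.c₂
  · rw [← simil_apply ω hω c, ← simil_apply ω hω c, ← simil_apply ω hω c, el_simil]; exact mul_pos hp h1.c₃
  intro Sb Sr St Sl a1 a2 a3 a4 a5 a6 a7 a8 a9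
  exact (h4 Sb Sr St Sl a1 a2 a3 a4 a5 a6 a7 a8 a9).simil ω hω c

/-- The part of a trapezoid above its central row of cores. -/
lemma RM.upperPart (Y : ℝ) : ∃ Xl Xr : Finset ℝ, IsSub Xl ∧ IsSub Xr ∧ Xl.card ≤ 312 ∧ Xr.card ≤ 312 ∧
      ∀ St Sr Sl : Finset ℝ, IsSub St → IsSub Sr → IsSub Sl → armBase ⊆ rev St → Xr ⊆ Sr → Xl ⊆ Sl →
      ∃ (a : ℕ → ℕ) (t : ℕ) (b : ℕ → ℕ), (∀ k, 7 ≤ a k) ∧ 7 ≤ t ∧ (∀ k, 7 ≤ b k) ∧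
        (armSet a t b).card ≤ St.card + 8 ∧
        Even ((armSet a t b).card + Sr.card + St.card + Sl.card) ∧
        RM (-78) 79 (Y - 78) Y (armSet a t b) Sr St Sl (26 * (St.card * (Sl.card + Sr.card))) := by
  -- The upper part is the lower part of a rectangle of height 78, turned by 180°; there the bound
  -- on the prescribed vertices becomes 312.
  obtain ⟨Xl, Xr, s1, s2, c1, c2, h⟩ := QS.lowerPart (yl := 0) (yr := 0) (Y := 78) (by norm_num)
    (by norm_num) (by norm_num)
  refine ⟨rev Xr, rev Xl, s2.rev, s1.rev, ?_, ?_, ?_⟩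
  · rw [card_rev]; norm_num at c2; exact_mod_cast c2
  · rw [card_rev]; norm_num at c1; exact_mod_cast c1
  intro St Sr Sl t1 t2 t3 hb hr hl
  obtain ⟨a, t, b, ha, ht, hb, hc, he, q⟩ := h (rev St) (rev Sl) (rev Sr) t1.rev t3.rev t2.rev hb
    (subset_rev hl) (subset_rev hr)
  have q : RM _ _ _ _ _ _ _ _ _ := q
  have q := q.rot.rot.scale one_pos 1 Y
  rw [rev_rev, rev_rev, rev_rev, rev_armSet _ _ ht, card_rev, card_rev, card_rev] at q
  rw [card_rev] at hc
  rw [card_rev, card_rev, card_rev] at he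
  have hcard : (armSet b t a).card = (armSet a t b).card := by rw [← rev_armSet _ _ ht, card_rev]
  rw [← hcard] at hc he
  refine ⟨b, t, a, hb, ht, ha, hc, by rw [Nat.even_iff] at he ⊢; omega, ?_⟩
  norm_num at q
  rw [show -78 + Y = Y - 78 by ring, add_comm Sr.card] at q
  exact q

/-- Trapezoids with vertical sides that are at least as high as they are wide. -/
theorem CSink.trap {yl yr Y ρ : ℝ} {N : ℕ} (hs : |yr - yl| ≤ 0.28 * 157) (hl : 157 ≤ Y - yl)
    (hr : 157 ≤ Y - yr) (hl' : Y - yl ≤ ρ) (hr' : Y - yr ≤ ρ) (hN : 1000 + 8 * ρ ≤ N) :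
    CSink ⟨-78, yl⟩ ⟨79, yr⟩ ⟨79, Y⟩ ⟨-78, Y⟩ N := by
  -- The row of cores occupies the heights from `Y - 79` to `Y - 78`, so the upper part has height
  -- 78 and the lower one at least 78.
  obtain ⟨Al, Ar, sAl, sAr, cAl, cAr, hA⟩ := QS.lowerPart (yl := yl) (yr := yr) (Y := Y - 79) hs
    (by linarith) (by linarith)
  obtain ⟨Bl, Br, sBl, sBr, cBl, cBr, hB⟩ := RM.upperPart Y
  have par : ∀ y, 157 ≤ Y - y → 0 < (Y - 79 - y) / (Y - y) ∧ (Y - 79 - y) / (Y - y) < 1 ∧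
      y + (Y - 79 - y) / (Y - y) * (Y - y) = Y - 79 := fun y hy => by
    have h0 : 0 < Y - y := by linarith
    refine ⟨div_pos (by linarith) h0, by rw [div_lt_one h0]; linarith, ?_⟩
    field_simp; ring
  obtain ⟨l0, l1, l2⟩ := par yl hl
  obtain ⟨r0, r1, r2⟩ := par yr hr
  have e7 : IsSub (eqd 7) := isSub_eqd (by norm_num)
  have c7 : (eqd 7).card = 8 := card_eqd (by norm_num)
  have sL' := e7.join sBl (l := 1 / 79) (by norm_num) (by norm_num)
  have sR' := e7.join sBr (l := 1 / 79) (by norm_num) (by norm_num)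
  have cj : ∀ {l : ℝ} {A B : Finset ℝ}, 0 < l → l < 1 → IsSub A → IsSub B → B.card ≤ 312 →
      (A.card : ℝ) ≤ 4 * ρ → (join l A (join (1 / 79) (eqd 7) B)).card ≤ N := by
    intro l A B h0 h1 sA sB hB hA
    have k1 := card_join (l := 1 / 79) (by norm_num) (by norm_num) e7 sB
    have k2 := card_join h0 h1 sA (e7.join sB (l := 1 / 79) (by norm_num) (by norm_num))
    have k3 : (join l A (join (1 / 79) (eqd 7) B)).card ≤ A.card + 320 := by omega
    have k4 : ((join l A (join (1 / 79) (eqd 7) B)).card : ℝ) ≤ A.card + 320 := by exact_mod_cast k3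
    have : ((join l A (join (1 / 79) (eqd 7) B)).card : ℝ) ≤ N := by linarith
    exact_mod_cast this
  have hN' : 1000 ≤ N := by
    have : (1000 : ℝ) ≤ N := by linarith
    exact_mod_cast this
  refine ⟨ccw_trap (by norm_num) (by linarith) (by linarith), armBase,
    join ((Y - 79 - yr) / (Y - yr)) Ar (join (1 / 79) (eqd 7) Br), rev armBase,
    join ((Y - 79 - yl) / (Y - yl)) Al (join (1 / 79) (eqd 7) Bl),
    ⟨isSub_armBase, sAr.join sR' r0.le r1.le, isSub_armBase.rev, sAl.join sL' l0.le l1.le⟩,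
    ⟨by rw [card_armBase]; omega, cj r0 r1 sAr sBr cBr (by linarith), by rw [card_rev, card_armBase]; omega,
      cj l0 l1 sAl sBl cBl (by linarith)⟩, ?_⟩
  intro Sb Sr St Sl sb sr st sl hXb hXr hXt hXl he
  obtain ⟨L₁, L', sL₁, sL'', hL₁, hL', rfl, cL⟩ := exists_join sl l0 l1 sAl sL' hXl
  obtain ⟨L₂, L₃, sL₂, sL₃, hL₂, hL₃, rfl, cL'⟩ := exists_join sL'' (by norm_num) (by norm_num) e7 sBl hL'
  obtain ⟨R₁, R', sR₁, sR'', hR₁, hR', rfl, cR⟩ := exists_join sr r0 r1 sAr sR' hXr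
  obtain ⟨R₂, R₃, sR₂, sR₃, hR₂, hR₃, rfl, cR'⟩ := exists_join sR'' (by norm_num) (by norm_num) e7 sBr hR'
  -- The lower and the upper part each produce a row of standard positions facing the arms; the
  -- central row of cores is then fitted between these two.
  obtain ⟨a, t, b, ha, ht, hb, c1, e1, q1⟩ := hA Sb R₁ L₁ sb sR₁ sL₁ hXb hR₁ hL₁
  obtain ⟨a', t', b', ha', ht', hb', c2, e2, q2⟩ := hB St R₃ L₃ st sR₃ sL₃ (subset_rev hXt) hR₃ hL₃
  have d1 := Finset.card_le_card hL₂
  have d2 := Finset.card_le_card hR₂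
  rw [c7] at d1 d2
  have q3 := (RM.midRow ha hb ha' hb' ht ht' sL₂ sR₂ d1 d2
    (by rw [Nat.even_iff] at *; omega)).scale one_pos 0 (Y - 79)
  norm_num at q3
  rw [show 1 + (Y - 79) = Y - 78 by ring] at q3
  have q4 := RM.hcut (by linarith) (by linarith) (by norm_num) q3 q2
  rw [show (Y - 78 - (Y - 79)) / (Y - (Y - 79)) = 1 / 79 by ring_nf] at q4
  have q5 := QS.hcut (ccw_trap (by norm_num) (by linarith) (by linarith)) l0 l1 r0 r1
    (by rw [lm_mk, l2]; simp) (by rw [lm_mk, r2]; simp) q1 q4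
  refine q5.mono ?_
  have w1 := sL₁.one_lt_card; have w2 := sR₁.one_lt_card
  have w3 := sL₃.one_lt_card; have w4 := sR₃.one_lt_card
  have w5 := Finset.card_le_card hXb
  rw [card_armBase] at w5
  set x := (join ((Y - 79 - yl) / (Y - yl)) L₁ (join (1 / 79) L₂ L₃)).card
  set y := (join ((Y - 79 - yr) / (Y - yr)) R₁ (join (1 / 79) R₂ R₃)).card
  set z := Sb.card + St.card with hz
  have f1 : Sb.card * (L₁.card + R₁.card) ≤ z * (x + y) := Nat.mul_le_mul (by omega) (by omega)
  have f2 : St.card * (L₃.card + R₃.card) ≤ z * (x + y) := Nat.mul_le_mul (by omega) (by omega)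
  have f3 : z * 1 ≤ z * (x + y) := Nat.mul_le_mul_left _ (by omega)
  have f4 : 216 * (x + y) ≤ z * (x + y) := Nat.mul_le_mul_right _ (by omega)
  have f5 : 1000 * (z * (x + y)) ≤ N * (z * (x + y)) := Nat.mul_le_mul_right _ hN'
  omega

end SinkMesh

/-! ### Assembling a sink from nine pieces. -/

namespace SinkMesh

/-- The width is scaled to 157, the sum of two blocks of width 78 and the unit column; accordingly
`1256 = 8 * 157`. -/
lemma CSink.trapezoid {x₀ x₁ yl yr Y ρ : ℝ} {N : ℕ} (hx : x₀ < x₁) (hs : |yr - yl| ≤ 0.28 * (x₁ - x₀))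
    (hl : x₁ - x₀ ≤ Y - yl) (hr : x₁ - x₀ ≤ Y - yr) (hl' : Y - yl ≤ ρ * (x₁ - x₀))
    (hr' : Y - yr ≤ ρ * (x₁ - x₀)) (hN : 1000 + 1256 * ρ ≤ N) :
    CSink ⟨x₀, yl⟩ ⟨x₁, yr⟩ ⟨x₁, Y⟩ ⟨x₀, Y⟩ N := by
  have hw : 0 < x₁ - x₀ := by linarith
  set c := (x₁ - x₀) / 157 with hc
  have hc0 : 0 < c := by positivity
  have hcw : x₁ - x₀ = 157 * c := by rw [hc]; ring
  rw [hcw] at hs hl hr hl' hr'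
  have hdiv : ∀ y z : ℝ, z / c - y / c = (z - y) / c := fun y z => by ring
  have h1 := CSink.trap (yl := yl / c) (yr := yr / c) (Y := Y / c) (ρ := 157 * ρ) (N := N)
    (by rw [hdiv, abs_div, abs_of_pos hc0, div_le_iff₀ hc0]; linarith)
    (by rw [hdiv, le_div_iff₀ hc0]; linarith) (by rw [hdiv, le_div_iff₀ hc0]; linarith)
    (by rw [hdiv, div_le_iff₀ hc0]; linarith) (by rw [hdiv, div_le_iff₀ hc0]; linarith) (by linarith)
  have h2 := h1.simil (c : ℂ) (by exact_mod_cast hc0.ne') ⟨x₀ + 78 * c, 0⟩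
  have e : ∀ y : ℝ, (c : ℂ) * ⟨-78, y / c⟩ + ⟨x₀ + 78 * c, 0⟩ = ⟨x₀, y⟩ := fun y => by
    apply Complex.ext <;> simp
    · ring
    · field_simp
  have e' : ∀ y : ℝ, (c : ℂ) * ⟨79, y / c⟩ + ⟨x₀ + 78 * c, 0⟩ = ⟨x₁, y⟩ := fun y => by
    apply Complex.ext <;> simp
    · linarith
    · field_simp
  rwa [e, e', e, e'] at h2

/-- For a side shared by two pieces: the union of both prescribed subdivisions works, after
inserting one further point if the parity is wrong. Its size does not depend on what happens on the
outer boundary. -/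
lemma exists_parity {X Y : Finset ℝ} (hX : IsSub X) (hY : IsSub Y) (m : ℕ) :
    ∃ Z : Finset ℝ, IsSub Z ∧ X ⊆ Z ∧ Y ⊆ Z ∧ Z.card ≤ X.card + Y.card + 1 ∧ Even (Z.card + m) := by
  classical
  have hU : IsSub (X ∪ Y) := by
    refine ⟨Finset.mem_union_left _ hX.zero_mem, Finset.mem_union_left _ hX.one_mem, ?_, ?_⟩
    · intro t ht; rcases Finset.mem_union.1 ht with h | h; exacts [hX.nonneg t h, hY.nonneg t h]
    · intro t ht; rcases Finset.mem_union.1 ht with h | h; exacts [hX.le_one t h, hY.le_one t h]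
  have hc := Finset.card_union_le X Y
  rcases Nat.even_or_odd ((X ∪ Y).card + m) with h | h
  · exact ⟨X ∪ Y, hU, Finset.subset_union_left, Finset.subset_union_right, by omega, h⟩
  · obtain ⟨t, ht, hn⟩ := (Ioo_infinite (zero_lt_one' ℝ)).exists_notMem_finset (X ∪ Y)
    refine ⟨insert t (X ∪ Y), ?_, ?_, ?_, ?_, ?_⟩
    · refine ⟨Finset.mem_insert_of_mem hU.zero_mem, Finset.mem_insert_of_mem hU.one_mem, ?_, ?_⟩
      · intro s hs; rcases Finset.mem_insert.1 hs with rfl | hs; exacts [ht.1.le, hU.nonneg s hs]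
      · intro s hs; rcases Finset.mem_insert.1 hs with rfl | hs; exacts [ht.2.le, hU.le_one s hs]
    · exact Finset.subset_union_left.trans (Finset.subset_insert _ _)
    · exact Finset.subset_union_right.trans (Finset.subset_insert _ _)
    · rw [Finset.card_insert_of_notMem hn]; omega
    · rw [Finset.card_insert_of_notMem hn]; rw [Nat.even_iff]; rw [Nat.odd_iff] at h; omega

lemma Ccw.cut_upper {p₀ p₁ p₂ p₃ : ℂ} {l k : ℝ} (h : Ccw p₀ p₁ p₂ p₃) (hl : 0 < l) (hl1 : l < 1)
    (hk : 0 < k) (hk1 : k < 1) : Ccw (lm p₀ p₃ l) (lm p₁ p₂ k) p₂ p₃ :=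
  (h.rot.cut_right hk hk1 hl hl1).rot.rot.rot

/-- Membership of the parameter of a cut. -/
def InI (t : ℝ) : Prop := 0 < t ∧ t < 1

lemma card_join₃ {l k : ℝ} (hl : InI l) (hk : InI k) {A B C : Finset ℝ} (hA : IsSub A) (hB : IsSub B)
    (hC : IsSub C) : (join l A (join k B C)).card + 2 = A.card + B.card + C.card := by
  have h1 := card_join hk.1 hk.2 hB hC
  have h2 := card_join hl.1 hl.2 hA (hB.join hC hk.1.le hk.2.le)
  omega

lemma IsSub.join₃ {l k : ℝ} (hl : InI l) (hk : InI k) {A B C : Finset ℝ} (hA : IsSub A) (hB : IsSub B)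
    (hC : IsSub C) : IsSub (SinkMesh.join l A (SinkMesh.join k B C)) :=
  hA.join (hB.join hC hk.1.le hk.2.le) hl.1.le hl.2.le

lemma exists_join₃ {S X Y Z : Finset ℝ} {l k : ℝ} (hS : IsSub S) (hl : InI l) (hk : InI k)
    (hX : IsSub X) (hY : IsSub Y) (hZ : IsSub Z) (h : join l X (join k Y Z) ⊆ S) :
    ∃ A B C, IsSub A ∧ IsSub B ∧ IsSub C ∧ X ⊆ A ∧ Y ⊆ B ∧ Z ⊆ C ∧ S = join l A (join k B C) ∧
      A.card + B.card + C.card = S.card + 2 := by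
  obtain ⟨A, B', sA, sB', hA, hB', rfl, c1⟩ := exists_join hS hl.1 hl.2 hX (hY.join hZ hk.1.le hk.2.le) h
  obtain ⟨B, C, sB, sC, hB, hC, rfl, c2⟩ := exists_join sB' hk.1 hk.2 hY hZ hB'
  exact ⟨A, B, C, sA, sB, sC, hA, hB, hC, rfl, by omega⟩

/-- A quadrilateral cut into nine pieces: if the four corner pieces are nice and the other five
pieces can be meshed for all refinements of some subdivisions, so can the quadrilateral. -/
theorem CSink.cross {p₀ p₁ p₂ p₃ b₁ b₂ t₁ t₂ l₁ l₂ r₁ r₂ c₀₀ c₁₀ c₁₁ c₀₁ : ℂ}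
    {α₁ α₂ α₃ α₄ β₁ β₂ β₃ β₄ β₅ β₆ γ₂ γ₄ : ℝ} {N : ℕ} (h : Ccw p₀ p₁ p₂ p₃)
    (i₁ : InI α₁) (i₂ : InI α₂) (i₃ : InI α₃) (i₄ : InI α₄) (j₁ : InI β₁) (j₂ : InI β₂) (j₃ : InI β₃)
    (j₄ : InI β₄) (j₅ : InI β₅) (j₆ : InI β₆) (k₂ : InI γ₂) (k₄ : InI γ₄)
    (eb₁ : lm p₀ p₁ α₁ = b₁) (et₁ : lm p₃ p₂ α₂ = t₁) (eb₂ : lm b₁ p₁ α₃ = b₂) (et₂ : lm t₁ p₂ α₄ = t₂)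
    (el₁ : lm p₀ p₃ β₁ = l₁) (e₀₀ : lm b₁ t₁ β₂ = c₀₀) (el₂ : lm l₁ p₃ β₃ = l₂)
    (e₀₁ : lm c₀₀ t₁ β₄ = c₀₁) (e₁₀ : lm b₂ t₂ γ₂ = c₁₀) (e₁₁ : lm c₁₀ t₂ γ₄ = c₁₁)
    (er₁ : lm p₁ p₂ β₅ = r₁) (er₂ : lm r₁ p₂ β₆ = r₂)
    (n₀ : Nq p₀ b₁ c₀₀ l₁) (n₁ : Nq b₂ p₁ r₁ c₁₀) (n₂ : Nq c₁₁ r₂ p₂ t₂) (n₃ : Nq l₂ c₀₁ t₁ p₃)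
    (sB : CSink b₁ b₂ c₁₀ c₀₀ N) (sR : CSink c₁₀ r₁ r₂ c₁₁ N) (sT : CSink c₀₁ c₁₁ t₂ t₁ N)
    (sL : CSink l₁ c₀₀ c₀₁ l₂ N) (sC : CSink c₀₀ c₁₀ c₁₁ c₀₁ N) :
    CSink p₀ p₁ p₂ p₃ (100 * (N + 1) ^ 3) := by
  have hw1 := h.cut_left i₁.1 i₁.2 i₂.1 i₂.2
  have hw2 := h.cut_right i₁.1 i₁.2 i₂.1 i₂.2
  rw [eb₁, et₁] at hw1 hw2
  have hw3 := hw2.cut_left i₃.1 i₃.2 i₄.1 i₄.2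
  have hw4 := hw2.cut_right i₃.1 i₃.2 i₄.1 i₄.2
  rw [eb₂, et₂] at hw3 hw4
  have hu1 := hw1.cut_upper j₁.1 j₁.2 j₂.1 j₂.2
  have hu3 := hw3.cut_upper j₂.1 j₂.2 k₂.1 k₂.2
  have hu4 := hw4.cut_upper k₂.1 k₂.2 j₅.1 j₅.2
  rw [el₁, e₀₀] at hu1
  rw [e₀₀, e₁₀] at hu3
  rw [e₁₀, er₁] at hu4
  obtain ⟨-, Bb, Br, Bt, Bl, ⟨u1, u2, u3, u4⟩, ⟨v1, v2, v3, v4⟩, hB⟩ := sB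
  obtain ⟨-, Rb, Rr, Rt, Rl, ⟨u5, u6, u7, u8⟩, ⟨v5, v6, v7, v8⟩, hR⟩ := sR
  obtain ⟨-, Tb, Tr, Tt, Tl, ⟨w1, w2, w3, w4⟩, ⟨x1, x2, x3, x4⟩, hT⟩ := sT
  obtain ⟨-, Lb, Lr, Lt, Ll, ⟨w5, w6, w7, w8⟩, ⟨x5, x6, x7, x8⟩, hL⟩ := sL
  obtain ⟨-, Cb, Cr, Ct, Cl, ⟨y1, y2, y3, y4⟩, ⟨z1, z2, z3, z4⟩, hC⟩ := sC
  have hN : 3 * N ≤ 100 * (N + 1) ^ 3 := by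
    have : N + 1 ≤ (N + 1) ^ 3 := Nat.le_self_pow (by norm_num) _
    omega
  have cX : ∀ {l k : ℝ} {A B C : Finset ℝ}, InI l → InI k → IsSub A → IsSub B → IsSub C → A.card ≤ N →
      B.card ≤ N → C.card ≤ N → (join l A (join k B C)).card ≤ 100 * (N + 1) ^ 3 := by
    intro l k A B C hl hk hA hB hC cA cB cC
    have := card_join₃ hl hk hA hB hC; omega
  refine ⟨h, join α₁ Lb (join α₃ Bb Rb), join β₅ Br (join β₆ Rr Tr), join α₂ Lt (join α₄ Tt Rt),
    join β₁ Bl (join β₃ Ll Tl), ⟨w5.join₃ i₁ i₃ u1 u5, u2.join₃ j₅ j₆ u6 w2, w7.join₃ i₂ i₄ w3 u7,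
    u4.join₃ j₁ j₃ w8 w4⟩, ⟨cX i₁ i₃ w5 u1 u5 x5 v1 v5, cX j₅ j₆ u2 u6 w2 v2 v6 x2,
    cX i₂ i₄ w7 w3 u7 x7 x3 v7, cX j₁ j₃ u4 w8 w4 v4 x8 x4⟩, ?_⟩
  intro Sb Sr St Sl sb sr st sl hXb hXr hXt hXl he
  obtain ⟨B₁, B₂, B₃, sB₁, sB₂, sB₃, hB₁, hB₂, hB₃, rfl, cb⟩ := exists_join₃ sb i₁ i₃ w5 u1 u5 hXb
  obtain ⟨R₁, R₂, R₃, sR₁, sR₂, sR₃, hR₁, hR₂, hR₃, rfl, cr⟩ := exists_join₃ sr j₅ j₆ u2 u6 w2 hXr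
  obtain ⟨T₁, T₂, T₃, sT₁, sT₂, sT₃, hT₁, hT₂, hT₃, rfl, ct⟩ := exists_join₃ st i₂ i₄ w7 w3 u7 hXt
  obtain ⟨L₁, L₂, L₃, sL₁, sL₂, sL₃, hL₁, hL₂, hL₃, rfl, cl⟩ := exists_join₃ sl j₁ j₃ u4 w8 w4 hXl
  -- Corner pieces are product grids and transmit the points of the boundary to the neighbouring
  -- pieces. Each side of the central piece is chosen to make the adjacent outer piece even; the
  -- central piece is then even because the total is.
  obtain ⟨Zb, sZb, zb1, zb2, zbc, zbe⟩ := exists_parity u3 y1 (B₂.card + R₁.card + L₁.card)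
  obtain ⟨Zl, sZl, zl1, zl2, zlc, zle⟩ := exists_parity w6 y4 (B₁.card + T₁.card + L₂.card)
  obtain ⟨Zr, sZr, zr1, zr2, zrc, zre⟩ := exists_parity u8 y2 (B₃.card + R₂.card + T₃.card)
  obtain ⟨Zt, sZt, zt1, zt2, ztc, zte⟩ := exists_parity w1 y3 (R₃.card + T₂.card + L₃.card)
  have qB := hB B₂ R₁ Zb L₁ sB₂ sR₁ sZb sL₁ hB₂ hR₁ zb1 hL₁ (by rw [Nat.even_iff] at *; omega)
  have qL := hL B₁ Zl T₁ L₂ sB₁ sZl sT₁ sL₂ hB₁ zl1 hT₁ hL₂ (by rw [Nat.even_iff] at *; omega)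
  have qR := hR B₃ R₂ T₃ Zr sB₃ sR₂ sT₃ sZr hB₃ hR₂ hT₃ zr1 (by rw [Nat.even_iff] at *; omega)
  have qT := hT Zt R₃ T₂ L₃ sZt sR₃ sT₂ sL₃ zt1 hR₃ hT₂ hL₃ (by rw [Nat.even_iff] at *; omega)
  have qC := hC Zb Zr Zt Zl sZb sZr sZt sZl zb2 zr2 zt2 zl2 (by rw [Nat.even_iff] at *; omega)
  -- The left, middle and right columns are put together from below and then joined.
  have s1 := QS.hcut hw1 j₁.1 j₁.2 j₂.1 j₂.2 el₁ e₀₀ (QS.prod n₀ sB₁ sL₁)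
    (QS.hcut hu1 j₃.1 j₃.2 j₄.1 j₄.2 el₂ e₀₁ qL (QS.prod n₃ sT₁ sL₃))
  have s2 := QS.hcut hw3 j₂.1 j₂.2 k₂.1 k₂.2 e₀₀ e₁₀ qB
    (QS.hcut hu3 j₄.1 j₄.2 k₄.1 k₄.2 e₀₁ e₁₁ qC qT)
  have s3 := QS.hcut hw4 k₂.1 k₂.2 j₅.1 j₅.2 e₁₀ er₁ (QS.prod n₁ sB₃ sR₁)
    (QS.hcut hu4 k₄.1 k₄.2 j₆.1 j₆.2 e₁₁ er₂ qR (QS.prod n₂ sT₃ sR₃))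
  have s := QS.vcut h i₁.1 i₁.2 i₂.1 i₂.2 eb₁ et₁ s1 (QS.vcut hw2 i₃.1 i₃.2 i₄.1 i₄.2 eb₂ et₂ s2 s3)
  refine s.mono ?_
  have m1 := sB₁.one_lt_card; have m2 := sB₂.one_lt_card; have m3 := sB₃.one_lt_card
  have m4 := sT₁.one_lt_card; have m5 := sT₂.one_lt_card; have m6 := sT₃.one_lt_card
  have m7 := sL₁.one_lt_card; have m8 := sL₂.one_lt_card; have m9 := sL₃.one_lt_card
  have o1 := sR₁.one_lt_card; have o2 := sR₂.one_lt_card; have o3 := sR₃.one_lt_card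
  set X := (join α₁ B₁ (join α₃ B₂ B₃)).card + (join α₂ T₁ (join α₄ T₂ T₃)).card with hX
  set Y := (join β₁ L₁ (join β₃ L₂ L₃)).card + (join β₅ R₁ (join β₆ R₂ R₃)).card with hY
  set M := N + 1 with hM
  have d : ∀ {a b : ℕ}, a ≤ X → b ≤ Y → (a - 1) * (b - 1) ≤ X * Y := fun ha hb =>
    Nat.mul_le_mul (by omega) (by omega)
  have q : ∀ {a b : ℕ}, a ≤ 4 * M * X → b ≤ Y → N * (a * b) ≤ 4 * M ^ 2 * (X * Y) := by
    intro a b ha hb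
    calc N * (a * b) ≤ M * ((4 * M * X) * Y) := Nat.mul_le_mul (by omega) (Nat.mul_le_mul ha hb)
      _ = _ := by ring
  have q' : ∀ {a b : ℕ}, a ≤ X → b ≤ 4 * M * Y → N * (a * b) ≤ 4 * M ^ 2 * (X * Y) := by
    intro a b ha hb
    calc N * (a * b) ≤ M * (X * (4 * M * Y)) := Nat.mul_le_mul (by omega) (Nat.mul_le_mul ha hb)
      _ = _ := by ring
  have hMX : ∀ {a b : ℕ}, a ≤ X → b ≤ 2 * M → 1 ≤ X → a + b ≤ 4 * M * X := by
    intro a b ha hb hx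
    have h1 : 1 * X ≤ M * X := Nat.mul_le_mul_right _ (by omega)
    have h2 : M * 1 ≤ M * X := Nat.mul_le_mul_left _ hx
    have h3 : 4 * M * X = 4 * (M * X) := by ring
    omega
  have hMY : ∀ {a b : ℕ}, a ≤ Y → b ≤ 2 * M → 1 ≤ Y → a + b ≤ 4 * M * Y := by
    intro a b ha hb hx
    have h1 : 1 * Y ≤ M * Y := Nat.mul_le_mul_right _ (by omega)
    have h2 : M * 1 ≤ M * Y := Nat.mul_le_mul_left _ hx
    have h3 : 4 * M * Y = 4 * (M * Y) := by ring
    omega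
  have hX1 : 1 ≤ X := by omega
  have hY1 : 1 ≤ Y := by omega
  have g1 := d (a := B₁.card) (b := L₁.card) (by omega) (by omega)
  have g2 := d (a := T₁.card) (b := L₃.card) (by omega) (by omega)
  have g3 := d (a := B₃.card) (b := R₁.card) (by omega) (by omega)
  have g4 := d (a := T₃.card) (b := R₃.card) (by omega) (by omega)
  -- In the pieces next to the bottom and the top only one pair of sides carries boundary points in
  -- full; the inner side has at most `2 * N + 1`. So each piece costs a constant times the product
  -- of the two total counts.
  have g5 := q (a := B₂.card + Zb.card) (b := L₁.card + R₁.card)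
    (hMX (by omega) (by omega) hX1) (by omega)
  have g6 := q (a := Zt.card + T₂.card) (b := L₃.card + R₃.card)
    (by rw [add_comm]; exact hMX (by omega) (by omega) hX1) (by omega)
  have g7 := q' (a := B₁.card + T₁.card) (b := L₂.card + Zl.card) (by omega)
    (hMY (by omega) (by omega) hY1)
  have g8 := q' (a := B₃.card + T₃.card) (b := Zr.card + R₂.card) (by omega)
    (by rw [add_comm]; exact hMY (by omega) (by omega) hY1)
  have g9 : N * ((Zb.card + Zt.card) * (Zl.card + Zr.card)) ≤ 16 * M ^ 3 * (X * Y) := by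
    calc N * ((Zb.card + Zt.card) * (Zl.card + Zr.card)) ≤ M * ((4 * M) * (4 * M)) :=
          Nat.mul_le_mul (by omega) (Nat.mul_le_mul (by omega) (by omega))
      _ = 16 * M ^ 3 * 1 := by ring
      _ ≤ _ := Nat.mul_le_mul_left _ (Nat.mul_pos hX1 hY1)
  have hM1 : 1 ≤ M := by omega
  have e1 : M ^ 2 * (X * Y) ≤ M ^ 3 * (X * Y) := Nat.mul_le_mul_right _ (Nat.pow_le_pow_right hM1 (by norm_num))
  have e0 : 1 * (X * Y) ≤ M ^ 3 * (X * Y) := Nat.mul_le_mul_right _ (Nat.one_le_pow _ _ hM1)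
  have e2 : 4 * M ^ 2 * (X * Y) = 4 * (M ^ 2 * (X * Y)) := by ring
  have e3 : 16 * M ^ 3 * (X * Y) = 16 * (M ^ 3 * (X * Y)) := by ring
  have e4 : 100 * M ^ 3 * (X * Y) = 100 * (M ^ 3 * (X * Y)) := by ring
  rw [e4]
  rw [e2] at g5 g6 g7 g8
  rw [e3] at g9
  generalize M ^ 3 * (X * Y) = P3 at *
  generalize M ^ 2 * (X * Y) = P2 at *
  generalize X * Y = P1 at *
  clear_value X Y M
  omega

end SinkMesh

/-! ### Quadrilaterals with nearly axis-parallel sides. -/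

namespace SinkMesh

/-- Both parts of the segment keep its slope, so the lemma can be applied again to the second part,
to cut at two abscissas. -/
lemma exists_lm_re {x₀ y₀ x₁ y₁ x : ℝ} (h₀ : x₀ < x) (h₁ : x < x₁) (hs : |y₁ - y₀| ≤ 0.28 * (x₁ - x₀)) :
    ∃ α y : ℝ, InI α ∧ lm (⟨x₀, y₀⟩ : ℂ) ⟨x₁, y₁⟩ α = ⟨x, y⟩ ∧ |y - y₀| ≤ 0.28 * (x - x₀) ∧
      |y₁ - y| ≤ 0.28 * (x₁ - x) ∧ min y₀ y₁ ≤ y ∧ y ≤ max y₀ y₁ := by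
  have hw : 0 < x₁ - x₀ := by linarith
  obtain ⟨α, hα⟩ : ∃ α, α = (x - x₀) / (x₁ - x₀) := ⟨_, rfl⟩
  have e : x - x₀ = α * (x₁ - x₀) := by rw [hα]; field_simp
  have a0 : 0 < α := by rw [hα]; exact div_pos (by linarith) hw
  have a1 : α < 1 := by rw [hα, div_lt_one hw]; linarith
  refine ⟨α, y₀ + α * (y₁ - y₀), ⟨a0, a1⟩, ?_, ?_, ?_, ?_, ?_⟩
  · rw [lm_mk]; apply Complex.ext <;> simp; linarith
  · rw [add_sub_cancel_left, abs_mul, abs_of_pos a0, e]; nlinarith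
  · rw [show y₁ - (y₀ + α * (y₁ - y₀)) = (1 - α) * (y₁ - y₀) by ring, abs_mul, abs_of_pos (by linarith : 0 < 1 - α),
      show x₁ - x = (1 - α) * (x₁ - x₀) by linarith]; nlinarith
  · rcases le_total y₀ y₁ with h | h
    · rw [min_eq_left h]; nlinarith
    · rw [min_eq_right h]; nlinarith
  · rcases le_total y₀ y₁ with h | h
    · rw [max_eq_right h]; nlinarith
    · rw [max_eq_left h]; nlinarith

lemma exists_lm_im {x₀ y₀ x₁ y₁ y : ℝ} (h₀ : y₀ < y) (h₁ : y < y₁) (hs : |x₁ - x₀| ≤ 0.28 * (y₁ - y₀)) :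
    ∃ α x : ℝ, InI α ∧ lm (⟨x₀, y₀⟩ : ℂ) ⟨x₁, y₁⟩ α = ⟨x, y⟩ ∧ |x - x₀| ≤ 0.28 * (y - y₀) ∧
      |x₁ - x| ≤ 0.28 * (y₁ - y) ∧ min x₀ x₁ ≤ x ∧ x ≤ max x₀ x₁ := by
  obtain ⟨α, x, hα, e, h⟩ := exists_lm_re h₀ h₁ hs
  refine ⟨α, x, hα, ?_, h⟩
  rw [lm_mk] at e ⊢
  have e1 := congrArg Complex.re e
  have e2 := congrArg Complex.im e
  exact Complex.ext e2 e1

lemma exists_lm_vertical {x y₀ y₁ y : ℝ} (h₀ : y₀ < y) (h₁ : y < y₁) :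
    ∃ α : ℝ, InI α ∧ lm (⟨x, y₀⟩ : ℂ) ⟨x, y₁⟩ α = ⟨x, y⟩ := by
  obtain ⟨α, x', hα, e, -, -, h, h'⟩ :=
    exists_lm_im (x₀ := x) (x₁ := x) h₀ h₁ (by rw [sub_self, abs_zero]; linarith)
  simp only [min_self, max_self] at h h'
  obtain rfl := le_antisymm h h'
  exact ⟨α, hα, e⟩

lemma niceDir_horizontal {x y : ℂ} (hx : 0 < x.re) (hx' : x.im = 0) (hy : 0 < y.im) (h : |y.re| ≤ 0.28 * y.im) :
    NiceDir x y :=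
  niceDir_of_slopes hx hy (σ := 0) (τ := 0.28) (by simp [hx']) h le_rfl (by norm_num) (by norm_num)

lemma niceDir_vertical {x y : ℂ} (hy : 0 < y.im) (hy' : y.re = 0) (hx : 0 < x.re) (h : |x.im| ≤ 0.28 * x.re) :
    NiceDir x y :=
  niceDir_of_slopes hx hy (σ := 0.28) (τ := 0) h (by simp [hy']) (by norm_num) le_rfl (by norm_num)

set_option maxHeartbeats 1600000 in
/-- A nice quadrilateral with nearly axis-parallel sides that surrounds the square `[-3, 3]²`. -/
lemma CSink.of_surrounds {x₀ y₀ x₁ y₁ x₂ y₂ x₃ y₃ ρ : ℝ} {N : ℕ}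
    (h : Nq ⟨x₀, y₀⟩ ⟨x₁, y₁⟩ ⟨x₂, y₂⟩ ⟨x₃, y₃⟩)
    (hx₀ : x₀ ≤ -3) (hy₀ : y₀ ≤ -3) (hx₁ : 3 ≤ x₁) (hy₁ : y₁ ≤ -3) (hx₂ : 3 ≤ x₂) (hy₂ : 3 ≤ y₂)
    (hx₃ : x₃ ≤ -3) (hy₃ : 3 ≤ y₃) (hx₀' : -ρ ≤ x₀) (hy₀' : -ρ ≤ y₀) (hx₁' : x₁ ≤ ρ) (hy₁' : -ρ ≤ y₁)
    (hx₂' : x₂ ≤ ρ) (hy₂' : y₂ ≤ ρ) (hx₃' : -ρ ≤ x₃) (hy₃' : y₃ ≤ ρ)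
    (hb : |y₁ - y₀| ≤ 0.28 * (x₁ - x₀)) (ht : |y₂ - y₃| ≤ 0.28 * (x₂ - x₃))
    (hl : |x₃ - x₀| ≤ 0.28 * (y₃ - y₀)) (hr : |x₂ - x₁| ≤ 0.28 * (y₂ - y₁)) (hN : 1000 + 1256 * ρ ≤ N) :
    CSink ⟨x₀, y₀⟩ ⟨x₁, y₁⟩ ⟨x₂, y₂⟩ ⟨x₃, y₃⟩ (100 * (N + 1) ^ 3) := by
  -- The lines through the sides of the square `[-1, 1]²` cut the quadrilateral. Between the square
  -- and each side this leaves a trapezoid of width 2 whose parallel sides have length at least 2.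
  obtain ⟨α₁, u₁, i₁, eb₁, sb₁, sb₁', lb₁, hb₁⟩ := exists_lm_re (x := -1) (by linarith) (by linarith) hb
  obtain ⟨α₃, u₂, i₃, eb₂, sb₂, sb₂', lb₂, hb₂⟩ := exists_lm_re (x := 1) (by linarith) (by linarith) sb₁'
  obtain ⟨α₂, v₁, i₂, et₁, st₁, st₁', lt₁, ht₁⟩ := exists_lm_re (x := -1) (by linarith) (by linarith) ht
  obtain ⟨α₄, v₂, i₄, et₂, st₂, st₂', lt₂, ht₂⟩ := exists_lm_re (x := 1) (by linarith) (by linarith) st₁'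
  obtain ⟨β₁, a₁, j₁, el₁, sl₁, sl₁', ll₁, hl₁⟩ := exists_lm_im (y := -1) (by linarith) (by linarith) hl
  obtain ⟨β₃, a₂, j₃, el₂, sl₂, sl₂', ll₂, hl₂⟩ := exists_lm_im (y := 1) (by linarith) (by linarith) sl₁'
  obtain ⟨β₅, c₁, j₅, er₁, sr₁, sr₁', lr₁, hr₁⟩ := exists_lm_im (y := -1) (by linarith) (by linarith) hr
  obtain ⟨β₆, c₂, j₆, er₂, sr₂, sr₂', lr₂, hr₂⟩ := exists_lm_im (y := 1) (by linarith) (by linarith) sr₁'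
  have mu₁ : u₁ ≤ -3 := hb₁.trans (max_le hy₀ hy₁)
  have mu₁' : -ρ ≤ u₁ := (le_min hy₀' hy₁').trans lb₁
  have mu₂ : u₂ ≤ -3 := hb₂.trans (max_le mu₁ hy₁)
  have mu₂' : -ρ ≤ u₂ := (le_min mu₁' hy₁').trans lb₂
  have mv₁ : 3 ≤ v₁ := (le_min hy₃ hy₂).trans lt₁
  have mv₁' : v₁ ≤ ρ := ht₁.trans (max_le hy₃' hy₂')
  have mv₂ : 3 ≤ v₂ := (le_min mv₁ hy₂).trans lt₂
  have mv₂' : v₂ ≤ ρ := ht₂.trans (max_le mv₁' hy₂')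
  have ma₁ : a₁ ≤ -3 := hl₁.trans (max_le hx₀ hx₃)
  have ma₁' : -ρ ≤ a₁ := (le_min hx₀' hx₃').trans ll₁
  have ma₂ : a₂ ≤ -3 := hl₂.trans (max_le ma₁ hx₃)
  have ma₂' : -ρ ≤ a₂ := (le_min ma₁' hx₃').trans ll₂
  have mc₁ : 3 ≤ c₁ := (le_min hx₁ hx₂).trans lr₁
  have mc₁' : c₁ ≤ ρ := hr₁.trans (max_le hx₁' hx₂')
  have mc₂ : 3 ≤ c₂ := (le_min mc₁ hx₂).trans lr₂
  have mc₂' : c₂ ≤ ρ := hr₂.trans (max_le mc₁' hx₂')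
  clear lb₁ hb₁ lb₂ hb₂ lt₁ ht₁ lt₂ ht₂ ll₁ hl₁ ll₂ hl₂ lr₁ hr₁ lr₂ hr₂
  obtain ⟨β₂, j₂, e₀₀⟩ := exists_lm_vertical (x := -1) (y₀ := u₁) (y₁ := v₁) (y := -1) (by linarith) (by linarith)
  obtain ⟨β₄, j₄, e₀₁⟩ := exists_lm_vertical (x := -1) (y₀ := -1) (y₁ := v₁) (y := 1) (by linarith) (by linarith)
  obtain ⟨γ₂, k₂, e₁₀⟩ := exists_lm_vertical (x := 1) (y₀ := u₂) (y₁ := v₂) (y := -1) (by linarith) (by linarith)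
  obtain ⟨γ₄, k₄, e₁₁⟩ := exists_lm_vertical (x := 1) (y₀ := -1) (y₁ := v₂) (y := 1) (by linarith) (by linarith)
  have hρ : 3 ≤ ρ := by linarith
  obtain ⟨d00, d01, d10, d11⟩ := h.dirs
  refine CSink.cross h.ccw i₁ i₂ i₃ i₄ j₁ j₂ j₃ j₄ j₅ j₆ k₂ k₄ eb₁ et₁ eb₂ et₂ el₁ e₀₀ el₂ e₀₁ e₁₀ e₁₁
    er₁ er₂ ?_ ?_ ?_ ?_ ?_ ?_ ?_ ?_ ?_
  -- Of the four angles of a corner piece, one is an angle of the given quadrilateral, two lie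
  -- between an axis-parallel cut and a nearly axis-parallel side, and one is a right angle.
  · refine Nq.of_dirs ?_ (niceDir_vertical ?_ ?_ ?_ ?_) (niceDir_horizontal ?_ ?_ ?_ ?_)
      (niceDir_horizontal ?_ ?_ ?_ ?_)
    · rw [← eb₁, ← el₁, lm_sub_left, lm_sub_left]; exact (d00.smul_left i₁.1).smul_right j₁.1
    all_goals simp only [Complex.sub_re, Complex.sub_im]
    all_goals linarith
  · refine Nq.of_dirs (niceDir_vertical ?_ ?_ ?_ ?_) ?_ (niceDir_horizontal ?_ ?_ ?_ ?_)
      (niceDir_horizontal ?_ ?_ ?_ ?_)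
    on_goal 5 =>
      rw [← eb₂, ← er₁, lm_sub_left, lm_sub_right, ← eb₁, lm_sub_right]
      exact ((d01.smul_left (sub_pos.2 i₁.2)).smul_left (sub_pos.2 i₃.2)).smul_right j₅.1
    all_goals simp only [Complex.sub_re, Complex.sub_im]
    all_goals linarith
  · refine Nq.of_dirs (niceDir_horizontal ?_ ?_ ?_ ?_) (niceDir_horizontal ?_ ?_ ?_ ?_)
      (niceDir_vertical ?_ ?_ ?_ ?_) ?_
    on_goal 13 =>
      rw [← et₂, ← er₂, lm_sub_right, lm_sub_right, ← et₁, ← er₁, lm_sub_right, lm_sub_right]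
      exact (((d11.smul_left (sub_pos.2 i₂.2)).smul_left (sub_pos.2 i₄.2)).smul_right (sub_pos.2 j₅.2)).smul_right
        (sub_pos.2 j₆.2)
    all_goals simp only [Complex.sub_re, Complex.sub_im]
    all_goals linarith
  · refine Nq.of_dirs (niceDir_horizontal ?_ ?_ ?_ ?_) (niceDir_horizontal ?_ ?_ ?_ ?_) ?_
      (niceDir_vertical ?_ ?_ ?_ ?_)
    on_goal 9 =>
      rw [← et₁, ← el₂, lm_sub_right, lm_sub_left, ← el₁, lm_sub_right]
      exact ((d10.smul_left i₂.1).smul_right (sub_pos.2 j₁.2)).smul_right (sub_pos.2 j₃.2)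
    all_goals simp only [Complex.sub_re, Complex.sub_im]
    all_goals linarith
  · exact CSink.trapezoid (ρ := ρ) (by norm_num) sb₂ (by linarith) (by linarith) (by linarith) (by linarith) hN
  -- The other three trapezoids are obtained from the standard position, with horizontal top at
  -- height -1, by rotations about the origin.
  · have := ((CSink.trapezoid (x₀ := -1) (x₁ := 1) (yl := -c₁) (yr := -c₂) (Y := -1) (ρ := ρ) (N := N) (by norm_num)
      (by rw [← abs_neg]; ring_nf at sr₂ ⊢; exact sr₂) (by linarith) (by linarith) (by linarith) (by linarith)
      hN).simil Complex.I Complex.I_ne_zero 0).rot.rot.rot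
    convert this using 1 <;> apply Complex.ext <;> simp
  · have := ((CSink.trapezoid (x₀ := -1) (x₁ := 1) (yl := -v₂) (yr := -v₁) (Y := -1) (ρ := ρ) (N := N) (by norm_num)
      (by ring_nf at st₂ ⊢; exact st₂) (by linarith) (by linarith) (by linarith) (by linarith)
      hN).simil (-1) (by norm_num) 0).rot.rot
    convert this using 1 <;> apply Complex.ext <;> simp
  · have := ((CSink.trapezoid (x₀ := -1) (x₁ := 1) (yl := a₂) (yr := a₁) (Y := -1) (ρ := ρ) (N := N) (by norm_num)
      (by rw [abs_sub_comm]; exact sl₂) (by linarith) (by linarith) (by linarith) (by linarith)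
      hN).simil (-Complex.I) (by simp) 0).rot
    convert this using 1 <;> apply Complex.ext <;> simp
  · exact CSink.trapezoid (ρ := ρ) (by norm_num) (by norm_num) (by norm_num) (by norm_num) (by linarith) (by linarith) hN

end SinkMesh

/-! ### Cutting sinks into slices. -/

namespace SinkMesh

variable {p₀ p₁ p₂ p₃ b t : ℂ}

/-- Cutting a quadrilateral into two pieces preserves the property of being a sink; this is the
growth of the constant. -/
def cutF (N : ℕ) : ℕ := 8 * (N + 1) ^ 2

lemma le_cutF (N : ℕ) : N ≤ cutF N := by unfold cutF; nlinarith

lemma le_iterate_cutF (N k : ℕ) : N ≤ cutF^[k] N := by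
  induction k with
  | zero => exact le_rfl
  | succ k ih => rw [Function.iterate_succ_apply']; exact ih.trans (le_cutF _)

lemma iterate_cutF_mono (N : ℕ) {k m : ℕ} (h : k ≤ m) : cutF^[k] N ≤ cutF^[m] N := by
  obtain ⟨j, rfl⟩ := Nat.exists_eq_add_of_le h
  rw [add_comm, Function.iterate_add_apply]; exact le_iterate_cutF _ _

/-- The cut receives a subdivision that serves both parts and makes the first one even. It has at
most `2 * N + 1` points, so the bilinear form of the bound survives with a larger constant. -/
theorem CSink.vcut {l k : ℝ} {N : ℕ} (h : Ccw p₀ p₁ p₂ p₃) (hl : InI l) (hk : InI k)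
    (hb : lm p₀ p₁ l = b) (ht : lm p₃ p₂ k = t) (h₁ : CSink p₀ b t p₃ N) (h₂ : CSink b p₁ p₂ t N) :
    CSink p₀ p₁ p₂ p₃ (cutF N) := by
  obtain ⟨-, Ab, Ar, At, Al, ⟨u1, u2, u3, u4⟩, ⟨v1, v2, v3, v4⟩, hA⟩ := h₁
  obtain ⟨-, Bb, Br, Bt, Bl, ⟨w1, w2, w3, w4⟩, ⟨x1, x2, x3, x4⟩, hB⟩ := h₂
  have c1 := card_join hl.1 hl.2 u1 w1
  have c2 := card_join hk.1 hk.2 u3 w3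
  have hN : 2 * N ≤ cutF N := by unfold cutF; nlinarith
  refine ⟨h, join l Ab Bb, Br, join k At Bt, Al, ⟨u1.join w1 hl.1.le hl.2.le, w2, u3.join w3 hk.1.le hk.2.le, u4⟩,
    ⟨by omega, by omega, by omega, by omega⟩, ?_⟩
  intro Sb Sr St Sl sb sr st sl hXb hXr hXt hXl he
  obtain ⟨B₁, B₂, sB₁, sB₂, hB₁, hB₂, rfl, cb⟩ := exists_join sb hl.1 hl.2 u1 w1 hXb
  obtain ⟨T₁, T₂, sT₁, sT₂, hT₁, hT₂, rfl, ct⟩ := exists_join st hk.1 hk.2 u3 w3 hXt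
  obtain ⟨Z, sZ, z1, z2, zc, ze⟩ := exists_parity u2 w4 (B₁.card + T₁.card + Sl.card)
  have q1 := hA B₁ Z T₁ Sl sB₁ sZ sT₁ sl hB₁ z1 hT₁ hXl (by rw [Nat.even_iff] at *; omega)
  have q2 := hB B₂ Sr T₂ Z sB₂ sr sT₂ sZ hB₂ hXr hT₂ z2 (by rw [Nat.even_iff] at *; omega)
  refine (QS.vcut h hl.1 hl.2 hk.1 hk.2 hb ht q1 q2).mono ?_
  have m1 := sB₁.one_lt_card; have m2 := sB₂.one_lt_card; have m3 := sT₁.one_lt_card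
  have m4 := sT₂.one_lt_card; have m5 := sl.one_lt_card; have m6 := sr.one_lt_card
  set X := (join l B₁ B₂).card + (join k T₁ T₂).card with hX
  set Y := Sl.card + Sr.card with hY
  have g : ∀ {a b : ℕ}, a ≤ X → b ≤ 2 * (N + 1) * Y → N * (a * b) ≤ 2 * (N + 1) ^ 2 * (X * Y) := by
    intro a b ha hb
    calc N * (a * b) ≤ (N + 1) * (X * (2 * (N + 1) * Y)) := Nat.mul_le_mul (by omega) (Nat.mul_le_mul ha hb)
      _ = _ := by ring
  have hMY : ∀ {a : ℕ}, a ≤ Y → a + Z.card ≤ 2 * (N + 1) * Y := by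
    intro a ha
    have : (N + 1) * 2 ≤ (N + 1) * Y := Nat.mul_le_mul_left _ (by omega)
    have : 1 * Y ≤ (N + 1) * Y := Nat.mul_le_mul_right _ (by omega)
    have : 2 * (N + 1) * Y = 2 * ((N + 1) * Y) := by ring
    omega
  have g1 := g (a := B₁.card + T₁.card) (b := Sl.card + Z.card) (by omega) (hMY (by omega))
  have g2 := g (a := B₂.card + T₂.card) (b := Z.card + Sr.card) (by omega)
    (by rw [add_comm]; exact hMY (by omega))
  unfold cutF
  rw [show 8 * (N + 1) ^ 2 * (X * Y) = 4 * (2 * (N + 1) ^ 2 * (X * Y)) by ring]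
  omega

lemma lm_lm (p q : ℂ) (s u t : ℝ) : lm (lm p q s) (lm p q u) t = lm p q (s + (u - s) * t) := by
  simp only [lm, Complex.real_smul]; push_cast; ring

lemma lm_sub_lm_comb (p₀ p₁ p₂ p₃ : ℂ) (s : ℝ) :
    lm p₃ p₂ s - lm p₀ p₁ s = (1 - s) • (p₃ - p₀) + s • (p₂ - p₁) := by
  simp only [lm, Complex.real_smul]; push_cast; ring

/-- A slice has sides parallel to the old bottom and top, and its cuts are convex combinations of
the old left and right sides, so the cone property applies. -/
lemma Nq.sub (h : Nq p₀ p₁ p₂ p₃) {s u : ℝ} (h0 : 0 ≤ s) (hsu : s < u) (h1 : u ≤ 1) :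
    Nq (lm p₀ p₁ s) (lm p₀ p₁ u) (lm p₃ p₂ u) (lm p₃ p₂ s) := by
  obtain ⟨d00, d01, d10, d11⟩ := h.dirs
  have hp : 0 < u - s := by linarith
  refine Nq.of_dirs ?_ ?_ ?_ ?_ <;> rw [lm_sub_lm, lm_sub_lm_comb]
  · exact (d00.comb_right d01 h0 (by linarith)).smul_left hp
  · exact (d00.comb_right d01 (by linarith) h1).smul_left hp
  · exact (d10.comb_right d11 h0 (by linarith)).smul_left hp
  · exact (d10.comb_right d11 (by linarith) h1).smul_left hp

/-- Cutting a nice quadrilateral into equal slices. -/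
theorem CSink.slices (h : Nq p₀ p₁ p₂ p₃) {N k : ℕ}
    (hp : ∀ i ≤ k, CSink (lm p₀ p₁ (i / (k + 1))) (lm p₀ p₁ ((i + 1) / (k + 1)))
      (lm p₃ p₂ ((i + 1) / (k + 1))) (lm p₃ p₂ (i / (k + 1))) N) : CSink p₀ p₁ p₂ p₃ (cutF^[k] N) := by
  have hk : (0 : ℝ) < k + 1 := by positivity
  -- The union of the first `j + 1` slices; each further slice costs one application of `cutF`.
  have key : ∀ j ≤ k, CSink p₀ (lm p₀ p₁ ((j + 1) / (k + 1))) (lm p₃ p₂ ((j + 1) / (k + 1))) p₃ (cutF^[j] N) := by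
    intro j hj
    induction j with
    | zero => simpa [lm_zero] using hp 0 hj
    | succ j ih =>
      rw [Function.iterate_succ_apply']
      have hj' : ((j + 1 : ℕ) : ℝ) = j + 1 := by push_cast; ring
      have hle : ((j : ℝ) + 1) + 1 ≤ k + 1 := by have : ((j + 1 : ℕ) : ℝ) ≤ k := by exact_mod_cast hj
                                                 linarith
      have hc := (h.sub (s := 0) (u := ((j + 1 : ℕ) + 1) / (k + 1)) le_rfl (by positivity)
        (by rw [div_le_one hk, hj']; exact hle)).ccw
      rw [lm_zero, lm_zero] at hc
      have hI : InI (((j : ℝ) + 1) / (j + 1 + 1)) :=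
        ⟨by positivity, by rw [div_lt_one (by positivity)]; linarith⟩
      have hq := hp (j + 1) hj
      rw [hj'] at hq hc ⊢
      have e : (((j : ℝ) + 1) + 1) / (k + 1) * ((j + 1) / (j + 1 + 1)) = (j + 1) / (k + 1) := by
        field_simp
      refine CSink.vcut hc hI hI ?_ ?_ (ih (by omega)) (hq.mono (le_iterate_cutF _ _)) <;> rw [lm_left, e]
  have := key k le_rfl
  rwa [div_self hk.ne', lm_one, lm_one] at this

end SinkMesh

/-! ### Almost parallelograms. -/

namespace SinkMesh

variable {p₀ p₁ p₂ p₃ : ℂ}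

/-- The constant for quadrilaterals that are almost parallelograms with comparable sides. -/
def paraN : ℕ := 100 * ((1000 + 1256 * 40) + 1) ^ 3

/-- The slopes of the sides are bounded by 0.5 / 1.866, which is about tan 15° and leaves room below
0.28 for the perturbation `w`. After centering, lengths between 12 and 30 are large enough to
surround `[-3, 3]²` even if the two sides lean against each other. -/
lemma CSink.of_frame {u v w : ℂ} {U V g c : ℝ} (h : Nq p₀ (p₀ + u) (p₀ + u + v + w) (p₀ + v))
    (hu : u = ⟨U * g, U * c⟩) (hv : v = ⟨V * c, V * g⟩) (hg : 1.866 ≤ g) (hg' : g ≤ 2)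
    (hc : |c| ≤ 0.5) (hU : 12 ≤ U) (hU' : U ≤ 30) (hV : 12 ≤ V) (hV' : V ≤ 30)
    (hw : |w.re| ≤ 0.12) (hw' : |w.im| ≤ 0.12) :
    CSink p₀ (p₀ + u) (p₀ + u + v + w) (p₀ + v) paraN := by
  have hq := h.simil 1 one_ne_zero (-(p₀ + (1 / 2 : ℝ) • (u + v)))
  simp only [simil_apply, one_mul] at hq
  have key := CSink.of_surrounds (ρ := 40) (N := 1000 + 1256 * 40) hq
  have hu1 : u.re = U * g := by rw [hu]
  have hu2 : u.im = U * c := by rw [hu]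
  have hv1 : v.re = V * c := by rw [hv]
  have hv2 : v.im = V * g := by rw [hv]
  have a1 : 1.866 * U ≤ U * g := by nlinarith
  have a2 : U * g ≤ 2 * U := by nlinarith
  have a3 : 1.866 * V ≤ V * g := by nlinarith
  have a4 : V * g ≤ 2 * V := by nlinarith
  obtain ⟨c1, c2⟩ := abs_le.1 hc
  have b1 : U * c ≤ 0.5 * U := by nlinarith
  have b2 : -(0.5 * U) ≤ U * c := by nlinarith
  have b3 : V * c ≤ 0.5 * V := by nlinarith
  have b4 : -(0.5 * V) ≤ V * c := by nlinarith
  obtain ⟨w1, w2⟩ := abs_le.1 hw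
  obtain ⟨w3, w4⟩ := abs_le.1 hw'
  simp only [Complex.add_re, Complex.add_im, Complex.neg_re, Complex.neg_im, Complex.smul_re,
    Complex.smul_im, smul_eq_mul, hu1, hu2, hv1, hv2] at key
  generalize U * g = X at *
  generalize U * c = Y at *
  generalize V * g = Z at *
  generalize V * c = W at *
  clear hg hg' hc c1 c2 hw hw'
  have key' := key (by linarith) (by linarith) (by linarith) (by linarith) (by linarith) (by linarith)
    (by linarith) (by linarith) (by linarith) (by linarith) (by linarith) (by linarith)
    (by linarith) (by linarith) (by linarith) (by linarith)
    (abs_le.2 ⟨by linarith, by linarith⟩) (abs_le.2 ⟨by linarith, by linarith⟩)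
    (abs_le.2 ⟨by linarith, by linarith⟩) (abs_le.2 ⟨by linarith, by linarith⟩) (by norm_num)
  have := key'.simil 1 one_ne_zero (p₀ + (1 / 2 : ℝ) • (u + v))
  unfold paraN
  convert this using 1 <;> apply Complex.ext <;> simp [hu1, hu2, hv1, hv2] <;> ring

lemma cr_sq_add_dt_sq (u v : ℂ) : cr u v ^ 2 + dt u v ^ 2 = ‖u‖ ^ 2 * ‖v‖ ^ 2 := by
  rw [Complex.sq_norm, Complex.sq_norm, Complex.normSq_apply, Complex.normSq_apply]
  simp only [cr, dt]; ring

/-- The sine of the angle is at least `√3 / 2`, which slightly exceeds 0.866. -/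
lemma NiceDir.norm_mul_le {u v : ℂ} (h : NiceDir u v) : 0.866 * (‖u‖ * ‖v‖) ≤ cr u v := by
  have h3 : √3 ^ 2 = 3 := Real.sq_sqrt (by norm_num)
  have h1 := cr_sq_add_dt_sq u v
  have h2 : 3 * dt u v ^ 2 ≤ cr u v ^ 2 := by
    have := mul_self_le_mul_self (by positivity) h.2
    rw [← sq_abs (dt u v)]; nlinarith
  refine abs_le_of_sq_le_sq' ?_ h.1.le |>.2
  nlinarith [mul_nonneg (sq_nonneg ‖u‖) (sq_nonneg ‖v‖)]

lemma NiceDir.abs_dt_le {u v : ℂ} (h : NiceDir u v) : |dt u v| ≤ 0.5 * (‖u‖ * ‖v‖) := by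
  have h3 : √3 ^ 2 = 3 := Real.sq_sqrt (by norm_num)
  have h1 := cr_sq_add_dt_sq u v
  have h2 : 3 * dt u v ^ 2 ≤ cr u v ^ 2 := by
    have := mul_self_le_mul_self (by positivity) h.2
    rw [← sq_abs (dt u v)]; nlinarith
  refine abs_le_of_sq_le_sq ?_ (by positivity)
  nlinarith

lemma cr_le_norm_mul (u v : ℂ) : cr u v ≤ ‖u‖ * ‖v‖ := by
  have h1 := cr_sq_add_dt_sq u v
  refine (abs_le_of_sq_le_sq' (b := ‖u‖ * ‖v‖) ?_ (by positivity)).2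
  nlinarith [sq_nonneg (dt u v)]

lemma NiceDir.norm_pos {u v : ℂ} (h : NiceDir u v) : 0 < ‖u‖ ∧ 0 < ‖v‖ := by
  refine ⟨norm_pos_iff.2 ?_, norm_pos_iff.2 ?_⟩ <;> rintro rfl <;> simpa [cr] using h.1

/-- Almost parallelograms with comparable sides. -/
lemma CSink.of_almost_rhombus {u v w : ℂ} (h : Nq p₀ (p₀ + u) (p₀ + u + v + w) (p₀ + v))
    (hw : ‖w‖ ≤ ‖u‖ / 200) (hw' : ‖w‖ ≤ ‖v‖ / 200) (huv : ‖u‖ ≤ 2.5 * ‖v‖) (hvu : ‖v‖ ≤ 2.5 * ‖u‖) :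
    CSink p₀ (p₀ + u) (p₀ + u + v + w) (p₀ + v) paraN := by
  have hd : NiceDir u v := by simpa using h.dirs.1
  obtain ⟨hU, hV⟩ := hd.norm_pos
  obtain ⟨m, hm, hmU, hmV, hU', hV', hmw⟩ : ∃ m : ℝ, 0 < m ∧ m ≤ ‖u‖ ∧ m ≤ ‖v‖ ∧ ‖u‖ ≤ 2.5 * m ∧
      ‖v‖ ≤ 2.5 * m ∧ ‖w‖ ≤ m / 200 := by
    rcases le_total ‖u‖ ‖v‖ with h | h
    · exact ⟨‖u‖, hU, le_rfl, h, by linarith, hvu, hw⟩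
    · exact ⟨‖v‖, hV, h, le_rfl, huv, by linarith, hw'⟩
  set U := ‖u‖ with hUd
  set V := ‖v‖ with hVd
  have nU : U ^ 2 = u.re ^ 2 + u.im ^ 2 := by rw [hUd, Complex.sq_norm, Complex.normSq_apply]; ring
  have nV : V ^ 2 = v.re ^ 2 + v.im ^ 2 := by rw [hVd, Complex.sq_norm, Complex.normSq_apply]; ring
  have e1 := hd.norm_mul_le
  have e2 := hd.abs_dt_le
  have e3 := cr_le_norm_mul u v
  rw [← hUd, ← hVd] at e1 e2 e3
  have hUV : 0 < U * V := by positivity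
  -- `ω` is the sum of the conjugate of `u / U` and `I` times the conjugate of `v / V`, that is, of
  -- the rotations taking `u` to the real and `v` to the imaginary axis. Multiplication by this sum
  -- shares the deviation from a right angle equally between the two sides.
  obtain ⟨ω, hω⟩ : ∃ ω : ℂ, ω = ⟨u.re / U + v.im / V, -u.im / U + v.re / V⟩ := ⟨_, rfl⟩
  have hωu : ω * u = ⟨U * (1 + cr u v / (U * V)), U * (dt u v / (U * V))⟩ := by
    rw [hω]
    apply Complex.ext <;> simp only [Complex.mul_re, Complex.mul_im, cr, dt] <;> field_simp
    · linear_combination (-V) * nU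
    · ring
  have hωv : ω * v = ⟨V * (dt u v / (U * V)), V * (1 + cr u v / (U * V))⟩ := by
    rw [hω]
    apply Complex.ext <;> simp only [Complex.mul_re, Complex.mul_im, cr, dt] <;> field_simp
    · ring
    · linear_combination (-U) * nV
  have hω0 : ω ≠ 0 := by
    rintro rfl
    have := congrArg Complex.re hωu
    simp only [zero_mul, Complex.zero_re] at this
    have h2 : 0 < U * (1 + cr u v / (U * V)) := by have := hd.1; positivity
    linarith
  have hωn : ‖ω‖ ≤ 2 := by
    have h1 : ω = (starRingEnd ℂ u) / U + Complex.I * (starRingEnd ℂ v) / V := by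
      rw [hω]; apply Complex.ext <;> simp [Complex.div_ofReal_re, Complex.div_ofReal_im]
    rw [h1]
    refine (norm_add_le _ _).trans ?_
    simp only [norm_div, norm_mul, Complex.norm_I, one_mul, RCLike.norm_conj, Complex.norm_real, Real.norm_eq_abs,
      abs_of_pos hU, abs_of_pos hV, ← hUd, ← hVd]
    rw [div_self hU.ne', div_self hV.ne']; norm_num
  -- The factor `12 / m` makes the two lengths lie between 12 and 30, and `‖ω‖ ≤ 2` brings the
  -- perturbation below 0.12.
  obtain ⟨Ω, hΩ⟩ : ∃ Ω : ℂ, Ω = ((12 / m : ℝ) : ℂ) * ω := ⟨_, rfl⟩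
  have hΩ0 : Ω ≠ 0 := by rw [hΩ]; exact mul_ne_zero (by exact_mod_cast (by positivity)) hω0
  have hΩw : ‖Ω * w‖ ≤ 0.12 := by
    rw [hΩ, norm_mul, norm_mul, Complex.norm_real, Real.norm_of_nonneg (by positivity)]
    calc 12 / m * ‖ω‖ * ‖w‖ ≤ 12 / m * 2 * (m / 200) := by gcongr
      _ = 0.12 := by field_simp; norm_num
  have hq := h.simil Ω hΩ0 0
  simp only [simil_apply, add_zero, mul_add] at hq
  have key := CSink.of_frame (U := 12 / m * U) (V := 12 / m * V) (g := 1 + cr u v / (U * V))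
    (c := dt u v / (U * V)) hq
    (by rw [hΩ, mul_assoc, hωu]; apply Complex.ext <;> simp <;> ring)
    (by rw [hΩ, mul_assoc, hωv]; apply Complex.ext <;> simp <;> ring)
    (by rw [show (1.866 : ℝ) = 1 + 0.866 by norm_num]; gcongr; rw [le_div_iff₀ hUV]; exact e1)
    (by have : cr u v / (U * V) ≤ 1 := by rw [div_le_one hUV]; exact e3
        linarith)
    (by rw [abs_div, abs_of_pos hUV, div_le_iff₀ hUV]; exact e2)
    (by rw [div_mul_eq_mul_div, le_div_iff₀ hm]; linarith) (by rw [div_mul_eq_mul_div, div_le_iff₀ hm]; linarith)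
    (by rw [div_mul_eq_mul_div, le_div_iff₀ hm]; linarith) (by rw [div_mul_eq_mul_div, div_le_iff₀ hm]; linarith)
    ((Complex.abs_re_le_norm _).trans hΩw) ((Complex.abs_im_le_norm _).trans hΩw)
  have := key.simil Ω⁻¹ (inv_ne_zero hΩ0) 0
  convert this using 1 <;> field_simp <;> ring

/-- Almost parallelograms of bounded eccentricity, cut along the longer side. -/
lemma CSink.of_almost_para (ρ : ℝ) {u v w : ℂ} (h : Nq p₀ (p₀ + u) (p₀ + u + v + w) (p₀ + v))
    (hw : ‖w‖ ≤ ‖u‖ / 400) (hw' : ‖w‖ ≤ ‖v‖ / 400) (huv : ‖u‖ ≤ ρ * ‖v‖) (hvu : ‖v‖ ≤ 2 * ‖u‖) :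
    CSink p₀ (p₀ + u) (p₀ + u + v + w) (p₀ + v) (cutF^[⌊ρ⌋₊] paraN) := by
  have hd : NiceDir u v := by simpa using h.dirs.1
  obtain ⟨hU, hV⟩ := hd.norm_pos
  -- With `k + 1` slices, the side of a slice along `u` is at most `‖v‖` and at least half of it.
  obtain ⟨k, hk⟩ : ∃ k, k = ⌊‖u‖ / ‖v‖⌋₊ := ⟨_, rfl⟩
  have hkρ : k ≤ ⌊ρ⌋₊ := by rw [hk]; exact Nat.floor_mono (by rwa [div_le_iff₀ hV])
  have hk1 : (k : ℝ) * ‖v‖ ≤ ‖u‖ := by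
    rw [← le_div_iff₀ hV, hk]; exact Nat.floor_le (by positivity)
  have hk2 : ‖u‖ < (k + 1) * ‖v‖ := by
    rw [← div_lt_iff₀ hV, hk]; exact Nat.lt_floor_add_one _
  have hk3 : (k + 1) * ‖v‖ ≤ 2 * ‖u‖ := by
    rcases Nat.eq_zero_or_pos k with h0 | h0
    · rw [h0]; simpa using hvu
    · have : (1 : ℝ) ≤ k := by exact_mod_cast h0
      nlinarith
  have hkp : (0 : ℝ) < k + 1 := by positivity
  refine (CSink.slices h (N := paraN) (k := k) fun i hi => ?_).mono (iterate_cutF_mono _ hkρ)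
  have hik : (i : ℝ) ≤ k := by exact_mod_cast hi
  have hs := h.sub (s := i / (k + 1)) (u := (i + 1) / (k + 1)) (by positivity) (by gcongr; linarith)
    (by rw [div_le_one hkp]; linarith)
  obtain ⟨τ, hτ⟩ : ∃ τ : ℝ, τ = i / (k + 1) := ⟨_, rfl⟩
  have hτ0 : 0 ≤ τ := by rw [hτ]; positivity
  have hτ1 : τ ≤ 1 := by rw [hτ, div_le_one hkp]; linarith
  have hτ' : ((i : ℝ) + 1) / (k + 1) = τ + (1 / (k + 1) : ℝ) := by rw [hτ]; ring
  rw [hτ', ← hτ] at hs ⊢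
  obtain ⟨ε, hε⟩ : ∃ ε : ℝ, ε = 1 / (k + 1) := ⟨_, rfl⟩
  rw [← hε] at hs ⊢
  have hε0 : 0 < ε := by rw [hε]; positivity
  have hε1 : ε ≤ 1 := by rw [hε, div_le_one hkp]; linarith [(Nat.cast_nonneg k : (0 : ℝ) ≤ k)]
  have f1 : lm p₀ (p₀ + u) (τ + ε) = lm p₀ (p₀ + u) τ + ε • u := by
    simp only [lm, Complex.real_smul]; push_cast; ring
  have f2 : lm (p₀ + v) (p₀ + u + v + w) (τ + ε) = lm p₀ (p₀ + u) τ + ε • u + (v + τ • w) + ε • w := by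
    simp only [lm, Complex.real_smul]; push_cast; ring
  have f3 : lm (p₀ + v) (p₀ + u + v + w) τ = lm p₀ (p₀ + u) τ + (v + τ • w) := by
    simp only [lm, Complex.real_smul]; push_cast; ring
  rw [f1, f2, f3] at hs ⊢
  have n1 : ‖τ • w‖ ≤ ‖v‖ / 400 := by
    rw [norm_smul, Real.norm_of_nonneg hτ0]; nlinarith [norm_nonneg w]
  have n2 := norm_add_le v (τ • w)
  have n3 := norm_sub_le (v + τ • w) (τ • w)
  rw [add_sub_cancel_right] at n3
  have n4 : ‖ε • w‖ ≤ ‖w‖ := by rw [norm_smul, Real.norm_of_nonneg hε0.le]; nlinarith [norm_nonneg w]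
  have g1 : ε * ‖u‖ ≤ ‖v‖ := by rw [hε, one_div_mul_eq_div, div_le_iff₀ hkp]; linarith
  have g2 : ‖v‖ ≤ 2 * (ε * ‖u‖) := by
    rw [hε, one_div_mul_eq_div, ← mul_div_assoc, le_div_iff₀ hkp]; linarith
  have n5 : ‖ε • u‖ = ε * ‖u‖ := by rw [norm_smul, Real.norm_of_nonneg hε0.le]
  have n6 : ‖ε • w‖ = ε * ‖w‖ := by rw [norm_smul, Real.norm_of_nonneg hε0.le]
  refine CSink.of_almost_rhombus hs ?_ ?_ ?_ ?_
  · rw [n5, n6]; nlinarith [mul_le_mul_of_nonneg_left hw hε0.le, mul_pos hε0 hU]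
  · linarith
  · rw [n5]; linarith
  · rw [n5]; linarith

end SinkMesh

/-! ### Quadrilaterals of bounded eccentricity. -/

namespace SinkMesh

variable {p₀ p₁ p₂ p₃ : ℂ}

/-- If `v` is the longer side, the quadrilateral is relabelled by a rotation. The longer side is
then `v + w` instead of `v`, hence the stricter bounds on `w`. -/
lemma CSink.of_almost_para' {ρ : ℝ} (hρ : 1 ≤ ρ) {u v w : ℂ} (h : Nq p₀ (p₀ + u) (p₀ + u + v + w) (p₀ + v))
    (hw : ‖w‖ ≤ ‖u‖ / 1000) (hw' : ‖w‖ ≤ ‖v‖ / 1000) (huv : ‖u‖ ≤ ρ * ‖v‖) (hvu : ‖v‖ ≤ ρ * ‖u‖) :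
    CSink p₀ (p₀ + u) (p₀ + u + v + w) (p₀ + v) (cutF^[⌊2 * ρ⌋₊] paraN) := by
  have hU := norm_nonneg u
  have hV := norm_nonneg v
  rcases le_total ‖v‖ ‖u‖ with huv' | huv'
  · exact CSink.of_almost_para (2 * ρ) h (by linarith) (by linarith) (by nlinarith) (by linarith)
  · have e1 : p₀ + u + (v + w) = p₀ + u + v + w := by ring
    have e2 : p₀ + u + (v + w) + -u + -w = p₀ + v := by ring
    have e3 : p₀ + u + -u = p₀ := by ring
    have hr := h.rot
    have n1 := norm_add_le v w
    have n2 := norm_sub_le (v + w) w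
    rw [add_sub_cancel_right] at n2
    have := CSink.of_almost_para (2 * ρ) (p₀ := p₀ + u) (u := v + w) (v := -u) (w := -w)
      (by rw [e1] at e2 ⊢; rw [e2, e3]; exact hr) (by rw [norm_neg]; linarith) (by rw [norm_neg, norm_neg]; linarith)
      (by rw [norm_neg]; nlinarith) (by rw [norm_neg]; linarith)
    rw [e1] at e2 this
    rw [e2, e3] at this
    exact this.rot.rot.rot

/-- Two directions nice to a common `z` cannot cancel: the cross product with `z` is linear and is
at least 0.866 times the product of the norms for both of them. -/
lemma norm_comb_ge {x y z : ℂ} {t ℓ : ℝ} (hx : NiceDir x z) (hy : NiceDir y z) (h0 : 0 ≤ t) (h1 : t ≤ 1)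
    (lx : ℓ ≤ ‖x‖) (ly : ℓ ≤ ‖y‖) : 0.866 * ℓ ≤ ‖(1 - t) • x + t • y‖ := by
  have hz := hx.norm_pos.2
  have e := cr_le_norm_mul ((1 - t) • x + t • y) z
  have e' : cr ((1 - t) • x + t • y) z = (1 - t) * cr x z + t * cr y z := by simp [cr]; ring
  have e1 := hx.norm_mul_le
  have e2 := hy.norm_mul_le
  have f1 : 0.866 * (ℓ * ‖z‖) ≤ cr x z := by nlinarith
  have f2 : 0.866 * (ℓ * ‖z‖) ≤ cr y z := by nlinarith
  rw [e'] at e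
  have : 0.866 * ℓ * ‖z‖ ≤ ‖(1 - t) • x + t • y‖ * ‖z‖ := by nlinarith
  exact le_of_mul_le_mul_right this hz

lemma norm_comb_le {x y : ℂ} {t L : ℝ} (h0 : 0 ≤ t) (h1 : t ≤ 1) (lx : ‖x‖ ≤ L) (ly : ‖y‖ ≤ L) :
    ‖(1 - t) • x + t • y‖ ≤ L := by
  refine (norm_add_le _ _).trans ?_
  rw [norm_smul, norm_smul, Real.norm_of_nonneg h0, Real.norm_of_nonneg (by linarith)]
  nlinarith

/-- Nice quadrilaterals of bounded eccentricity are sinks with a uniform constant. -/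
theorem CSink.of_bounded_eccentricity (ρ : ℝ) (hρ : 1 ≤ ρ) : ∃ N : ℕ, ∀ (p₀ p₁ p₂ p₃ : ℂ) (ℓ : ℝ),
    Nq p₀ p₁ p₂ p₃ → 0 < ℓ → ℓ ≤ ‖p₁ - p₀‖ → ‖p₁ - p₀‖ ≤ ρ * ℓ → ℓ ≤ ‖p₂ - p₁‖ → ‖p₂ - p₁‖ ≤ ρ * ℓ →
    ℓ ≤ ‖p₂ - p₃‖ → ‖p₂ - p₃‖ ≤ ρ * ℓ → ℓ ≤ ‖p₃ - p₀‖ → ‖p₃ - p₀‖ ≤ ρ * ℓ → CSink p₀ p₁ p₂ p₃ N := by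
  -- The quadrilateral is cut by a grid of `n + 1` by `n + 1` cells. In a cell the difference of two
  -- opposite sides is of second order in `ε = 1 / (n + 1)`, while the sides are of first order.
  obtain ⟨n, hn⟩ : ∃ n, n = ⌈2400 * ρ⌉₊ := ⟨_, rfl⟩
  have hn' : 2400 * ρ ≤ n := by rw [hn]; exact Nat.le_ceil _
  refine ⟨cutF^[n] (cutF^[n] (cutF^[⌊2 * (2 * ρ)⌋₊] paraN)), ?_⟩
  intro p₀ p₁ p₂ p₃ ℓ h hℓ a1 a2 b1 b2 c1 c2 d1 d2
  obtain ⟨d00, d01, d10, d11⟩ := h.dirs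
  have hkp : (0 : ℝ) < n + 1 := by positivity
  obtain ⟨ε, hε⟩ : ∃ ε : ℝ, ε = 1 / (n + 1) := ⟨_, rfl⟩
  have hε0 : 0 < ε := by rw [hε]; positivity
  have hε1 : ε * ρ * 2400 ≤ 1 := by rw [hε, one_div_mul_eq_div, div_mul_eq_mul_div, div_le_one hkp]; linarith
  have split : ∀ i : ℕ, i ≤ n → ∃ τ : ℝ, τ = i / (n + 1) ∧ 0 ≤ τ ∧ τ + ε ≤ 1 ∧ ((i : ℝ) + 1) / (n + 1) = τ + ε := by
    intro i hi
    have hin : (i : ℝ) ≤ n := by exact_mod_cast hi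
    refine ⟨_, rfl, by positivity, ?_, ?_⟩
    · rw [hε, ← add_div, div_le_one hkp]; linarith
    · rw [hε]; ring
  refine CSink.slices h fun i hi => ?_
  obtain ⟨s, hs, hs0, hs1, hs'⟩ := split i hi
  rw [hs', ← hs]
  have hq := h.sub hs0 (by linarith : s < s + ε) hs1
  obtain ⟨q₀, hq₀⟩ : ∃ q, q = lm p₀ p₁ s := ⟨_, rfl⟩
  obtain ⟨q₁, hq₁⟩ : ∃ q, q = lm p₀ p₁ (s + ε) := ⟨_, rfl⟩
  obtain ⟨q₂, hq₂⟩ : ∃ q, q = lm p₃ p₂ (s + ε) := ⟨_, rfl⟩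
  obtain ⟨q₃, hq₃⟩ : ∃ q, q = lm p₃ p₂ s := ⟨_, rfl⟩
  rw [← hq₀, ← hq₁, ← hq₂, ← hq₃] at hq ⊢
  suffices CSink q₁ q₂ q₃ q₀ (cutF^[n] (cutF^[⌊2 * (2 * ρ)⌋₊] paraN)) from this.rot.rot.rot
  refine CSink.slices hq.rot fun j hj => ?_
  obtain ⟨τ, hτ, hτ0, hτ1, hτ'⟩ := split j hj
  rw [hτ', ← hτ]
  have hc := hq.rot.sub hτ0 (by linarith : τ < τ + ε) hτ1
  have eu : q₂ - q₁ = (1 - (s + ε)) • (p₃ - p₀) + (s + ε) • (p₂ - p₁) := by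
    rw [hq₁, hq₂]; simp only [lm, Complex.real_smul]; push_cast; ring
  have ew : (q₃ - q₀) - (q₂ - q₁) = ε • ((p₃ - p₀) - (p₂ - p₁)) := by
    rw [hq₁, hq₂, hq₃, hq₀]; simp only [lm, Complex.real_smul]; push_cast; ring
  have ev : lm q₀ q₃ τ - lm q₁ q₂ τ = -(ε • ((1 - τ) • (p₁ - p₀) + τ • (p₂ - p₃))) := by
    rw [hq₁, hq₂, hq₃, hq₀]; simp only [lm, Complex.real_smul]; push_cast; ring
  have f1 : lm q₁ q₂ (τ + ε) = lm q₁ q₂ τ + ε • (q₂ - q₁) := by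
    simp only [lm, Complex.real_smul]; push_cast; ring
  have f2 : lm q₀ q₃ (τ + ε) = lm q₁ q₂ τ + ε • (q₂ - q₁) + (lm q₀ q₃ τ - lm q₁ q₂ τ) +
      ε • ((q₃ - q₀) - (q₂ - q₁)) := by
    simp only [lm, Complex.real_smul]; push_cast; ring
  have f3 : lm q₀ q₃ τ = lm q₁ q₂ τ + (lm q₀ q₃ τ - lm q₁ q₂ τ) := by ring
  have nu1 : 0.866 * ℓ ≤ ‖q₂ - q₁‖ := by
    rw [eu]; exact norm_comb_ge d00.rot d01.rot (by linarith) hs1 d1 b1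
  have nu2 : ‖q₂ - q₁‖ ≤ ρ * ℓ := by
    rw [eu]; exact norm_comb_le (by linarith) hs1 d2 b2
  have nv1 : ε * (0.866 * ℓ) ≤ ‖lm q₀ q₃ τ - lm q₁ q₂ τ‖ := by
    rw [ev, norm_neg, norm_smul, Real.norm_of_nonneg hε0.le]
    exact mul_le_mul_of_nonneg_left (norm_comb_ge d00 d10 hτ0 (by linarith) a1 c1) hε0.le
  have nv2 : ‖lm q₀ q₃ τ - lm q₁ q₂ τ‖ ≤ ε * (ρ * ℓ) := by
    rw [ev, norm_neg, norm_smul, Real.norm_of_nonneg hε0.le]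
    exact mul_le_mul_of_nonneg_left (norm_comb_le hτ0 (by linarith) a2 c2) hε0.le
  -- This needs `2 * ρ * ε ≤ 0.866 / 1000`, which explains the number 2400.
  have nw : ‖ε • ((q₃ - q₀) - (q₂ - q₁))‖ ≤ ε * (0.866 * ℓ) / 1000 := by
    rw [ew, norm_smul, norm_smul, Real.norm_of_nonneg hε0.le]
    have : ‖(p₃ - p₀) - (p₂ - p₁)‖ ≤ 2 * (ρ * ℓ) := (norm_sub_le _ _).trans (by linarith)
    have h2 : ε * ‖(p₃ - p₀) - (p₂ - p₁)‖ ≤ 0.866 * ℓ / 1000 := by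
      have := mul_le_mul_of_nonneg_left this hε0.le
      nlinarith
    have := mul_le_mul_of_nonneg_left h2 hε0.le
    linarith
  have nu3 : ‖ε • (q₂ - q₁)‖ = ε * ‖q₂ - q₁‖ := by rw [norm_smul, Real.norm_of_nonneg hε0.le]
  have nu4 := mul_le_mul_of_nonneg_left nu1 hε0.le
  have nu5 := mul_le_mul_of_nonneg_left nu2 hε0.le
  have hεℓ : 0 < ε * ℓ := by positivity
  rw [f1, f2] at hc ⊢
  nth_rewrite 2 [f3] at hc
  nth_rewrite 2 [f3]
  refine CSink.of_almost_para' (ρ := 2 * ρ) (by linarith) hc ?_ ?_ ?_ ?_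
  · rw [nu3]; linarith
  · linarith
  · rw [nu3]; nlinarith
  · rw [nu3]; nlinarith

end SinkMesh

/-! ### Chains of sinks. -/

namespace SinkMesh

variable {p₀ p₁ p₂ p₃ b t : ℂ}

/-- A chain of `n` sinks. The cost is linear in `n` and bilinear in the numbers of additional points;
for `σ = 0` only few points on the left side are allowed and they are not counted. -/
def GSink (p₀ p₁ p₂ p₃ : ℂ) (N A n σ : ℕ) : Prop :=
  Ccw p₀ p₁ p₂ p₃ ∧ ∃ Xb Xr Xt Xl : Finset ℝ, (IsSub Xb ∧ IsSub Xr ∧ IsSub Xt ∧ IsSub Xl) ∧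
    (Xb.card + Xt.card ≤ 2 * N * n ∧ n + 1 ≤ Xb.card ∧ Xr.card ≤ N ∧ Xl.card ≤ N) ∧
    ∀ (Sb Sr St Sl : Finset ℝ) (e : ℕ), IsSub Sb → IsSub Sr → IsSub St → IsSub Sl → Xb ⊆ Sb → Xr ⊆ Sr →
      Xt ⊆ St → Xl ⊆ Sl → Even (Sb.card + Sr.card + St.card + Sl.card) →
      Sb.card + St.card ≤ Xb.card + Xt.card + e → (Sl.card ≤ 2 * N + 1 ∨ σ = 1) →
      QS p₀ p₁ p₂ p₃ Sb Sr St Sl (A * (n + e) + A * (1 + e) * (σ * Sl.card + Sr.card))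

/-- The cost of one link: `z` counts the points of an interface, and `y` those of the left side. The
latter are either bounded as well, and absorbed by the constant, or charged with `σ = 1`. -/
lemma chain_cost {N x e y z σ : ℕ} (hN : 1 ≤ N) (hx : x ≤ 2 * N + e) (hz : z ≤ 2 * N + 1)
    (hy : y ≤ 2 * N + 1 ∨ σ = 1) : N * (x * (y + z)) ≤ 4 * N ^ 2 * (2 * N + 1) * (1 + e) +
      4 * N ^ 2 * (2 * N + 1) * (1 + e) * (σ * y) := by
  have h1 : x ≤ 2 * N * (1 + e) := by nlinarith
  have h2 : N * (x * (y + z)) ≤ 2 * N ^ 2 * (1 + e) * (y + z) :=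
    calc N * (x * (y + z)) ≤ N * ((2 * N * (1 + e)) * (y + z)) :=
          Nat.mul_le_mul_left _ (Nat.mul_le_mul_right _ h1)
      _ = _ := by ring
  refine h2.trans ?_
  rcases hy with hy | rfl
  · calc 2 * N ^ 2 * (1 + e) * (y + z) ≤ 2 * N ^ 2 * (1 + e) * (2 * (2 * N + 1)) :=
          Nat.mul_le_mul_left _ (by omega)
      _ = 4 * N ^ 2 * (2 * N + 1) * (1 + e) := by ring
      _ ≤ _ := Nat.le_add_right _ _
  · calc 2 * N ^ 2 * (1 + e) * (y + z) ≤ 2 * N ^ 2 * (1 + e) * (2 * (2 * N + 1) + 2 * (2 * N + 1) * y) :=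
          Nat.mul_le_mul_left _ (by nlinarith)
      _ = _ := by ring

lemma CSink.gsink {N : ℕ} (h : CSink p₀ p₁ p₂ p₃ N) (σ : ℕ) :
    GSink p₀ p₁ p₂ p₃ N (4 * N ^ 2 * (2 * N + 1)) 1 σ := by
  obtain ⟨h1, Xb, Xr, Xt, Xl, ⟨s1, s2, s3, s4⟩, ⟨c1, c2, c3, c4⟩, h4⟩ := h
  have m1 := s1.one_lt_card
  refine ⟨h1, Xb, Xr, Xt, Xl, ⟨s1, s2, s3, s4⟩, ⟨by omega, m1, c2, c4⟩, ?_⟩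
  intro Sb Sr St Sl e a1 a2 a3 a4 a5 a6 a7 a8 a9 he hl
  refine (h4 Sb Sr St Sl a1 a2 a3 a4 a5 a6 a7 a8 a9).mono ?_
  have hN : 1 ≤ N := by omega
  have h1 : Sb.card + St.card ≤ 2 * N * (1 + e) := by nlinarith
  have g1 := chain_cost (z := 0) hN (show Sb.card + St.card ≤ 2 * N + e by omega) (by omega) hl
  have g2 : N * ((Sb.card + St.card) * Sr.card) ≤ 4 * N ^ 2 * (2 * N + 1) * (1 + e) * Sr.card :=
    calc N * ((Sb.card + St.card) * Sr.card) ≤ N * ((2 * N * (1 + e)) * Sr.card) :=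
          Nat.mul_le_mul_left _ (Nat.mul_le_mul_right _ h1)
      _ = 2 * N ^ 2 * (1 + e) * Sr.card := by ring
      _ ≤ _ := Nat.mul_le_mul_right _ (Nat.mul_le_mul_right _ (by nlinarith [Nat.zero_le (N ^ 3)]))
  rw [add_zero] at g1
  rw [mul_add (Sb.card + St.card), mul_add N, mul_add _ (σ * _)]
  omega

/-- The new interface has at most `2 * N + 1` points whatever is on the outer boundary, so the rest
of the chain is needed only with `σ = 0`. The additional points on the long sides are split between
the link and the rest, hence costs add up along the chain instead of multiplying. -/
lemma GSink.cons {l k : ℝ} {N n : ℕ} (h : Ccw p₀ p₁ p₂ p₃) (hl : InI l) (hk : InI k)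
    (hb : lm p₀ p₁ l = b) (ht : lm p₃ p₂ k = t) (h₁ : CSink p₀ b t p₃ N)
    (h₂ : GSink b p₁ p₂ t N (4 * N ^ 2 * (2 * N + 1)) n 0) (σ : ℕ) :
    GSink p₀ p₁ p₂ p₃ N (4 * N ^ 2 * (2 * N + 1)) (n + 1) σ := by
  obtain ⟨-, Ab, Ar, At, Al, ⟨u1, u2, u3, u4⟩, ⟨v1, v2, v3, v4⟩, hA⟩ := h₁
  obtain ⟨-, Bb, Br, Bt, Bl, ⟨w1, w2, w3, w4⟩, ⟨x1, x2, x3, x4⟩, hB⟩ := h₂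
  have c1 := card_join hl.1 hl.2 u1 w1
  have c2 := card_join hk.1 hk.2 u3 w3
  have m1 := u1.one_lt_card
  have hN : 1 ≤ N := by omega
  refine ⟨h, join l Ab Bb, Br, join k At Bt, Al, ⟨u1.join w1 hl.1.le hl.2.le, w2, u3.join w3 hk.1.le hk.2.le, u4⟩,
    ⟨by rw [mul_add]; omega, by omega, by omega, by omega⟩, ?_⟩
  intro Sb Sr St Sl e sb sr st sl hXb hXr hXt hXl he hcard hσ
  obtain ⟨B₁, B₂, sB₁, sB₂, hB₁, hB₂, rfl, cb⟩ := exists_join sb hl.1 hl.2 u1 w1 hXb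
  obtain ⟨T₁, T₂, sT₁, sT₂, hT₁, hT₂, rfl, ct⟩ := exists_join st hk.1 hk.2 u3 w3 hXt
  obtain ⟨Z, sZ, z1, z2, zc, ze⟩ := exists_parity u2 w4 (B₁.card + T₁.card + Sl.card)
  have y1 := Finset.card_le_card hB₁
  have y2 := Finset.card_le_card hB₂
  have y3 := Finset.card_le_card hT₁
  have y4 := Finset.card_le_card hT₂
  obtain ⟨e₁, he₁⟩ := Nat.exists_eq_add_of_le (Nat.add_le_add y1 y3)
  obtain ⟨e₂, he₂⟩ := Nat.exists_eq_add_of_le (Nat.add_le_add y2 y4)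
  have q1 := hA B₁ Z T₁ Sl sB₁ sZ sT₁ sl hB₁ z1 hT₁ hXl (by rw [Nat.even_iff] at *; omega)
  have q2 := hB B₂ Sr T₂ Z e₂ sB₂ sr sT₂ sZ hB₂ hXr hT₂ z2 (by rw [Nat.even_iff] at *; omega) (by omega)
    (Or.inl (by omega))
  refine (QS.vcut h hl.1 hl.2 hk.1 hk.2 hb ht q1 q2).mono ?_
  have g := chain_cost hN (show B₁.card + T₁.card ≤ 2 * N + e₁ by omega) (show Z.card ≤ 2 * N + 1 by omega) hσ
  have hee : e₁ + e₂ ≤ e := by omega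
  generalize 4 * N ^ 2 * (2 * N + 1) = A at *
  have g1 : A * (1 + e₁) * (σ * Sl.card) ≤ A * (1 + e) * (σ * Sl.card) :=
    Nat.mul_le_mul_right _ (Nat.mul_le_mul_left _ (by omega))
  have g2 : A * (1 + e₂) * Sr.card ≤ A * (1 + e) * Sr.card :=
    Nat.mul_le_mul_right _ (Nat.mul_le_mul_left _ (by omega))
  have g3 : A * (1 + e₁) + A * (n + e₂) ≤ A * (n + 1 + e) := by
    rw [← mul_add]; exact Nat.mul_le_mul_left _ (by omega)
  rw [mul_add _ (σ * _), zero_mul, zero_add]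
  omega

lemma norm_comb_ge' {x y z : ℂ} {t : ℝ} (hx : NiceDir z x) (hy : NiceDir z y) (h0 : 0 ≤ t) (h1 : t ≤ 1) :
    0.866 * ((1 - t) * ‖x‖ + t * ‖y‖) ≤ ‖(1 - t) • x + t • y‖ := by
  have hz := hx.norm_pos.1
  have e := cr_le_norm_mul z ((1 - t) • x + t • y)
  have e' : cr z ((1 - t) • x + t • y) = (1 - t) * cr z x + t * cr z y := by simp [cr]; ring
  have e1 := mul_le_mul_of_nonneg_left hx.norm_mul_le (sub_nonneg.2 h1)
  have e2 := mul_le_mul_of_nonneg_left hy.norm_mul_le h0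
  rw [e'] at e
  refine le_of_mul_le_mul_left ?_ hz
  linarith

lemma norm_comb_le' {x y : ℂ} {t : ℝ} (h0 : 0 ≤ t) (h1 : t ≤ 1) :
    ‖(1 - t) • x + t • y‖ ≤ (1 - t) * ‖x‖ + t * ‖y‖ := by
  refine (norm_add_le _ _).trans ?_
  rw [norm_smul, norm_smul, Real.norm_of_nonneg h0, Real.norm_of_nonneg (by linarith)]

lemma abs_dt_le_norm_mul (u v : ℂ) : |dt u v| ≤ ‖u‖ * ‖v‖ := by
  have h1 := cr_sq_add_dt_sq u v
  refine abs_le_of_sq_le_sq ?_ (by positivity)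
  nlinarith [sq_nonneg (cr u v)]

/-- In a nice quadrilateral, the two sides adjacent to a side `d` differ by a bounded factor, up to `d`. -/
lemma Nq.norm_le (h : Nq p₀ p₁ p₂ p₃) :
    ‖p₁ - p₀‖ ≤ 3 * ‖p₂ - p₃‖ + 2 * ‖p₃ - p₀‖ ∧ ‖p₂ - p₃‖ ≤ 3 * ‖p₁ - p₀‖ + 2 * ‖p₃ - p₀‖ ∧
      ‖p₂ - p₁‖ ≤ ‖p₁ - p₀‖ + ‖p₂ - p₃‖ + ‖p₃ - p₀‖ := by
  obtain ⟨d00, d01, d10, d11⟩ := h.dirs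
  obtain ⟨a, ha⟩ : ∃ a, a = p₁ - p₀ := ⟨_, rfl⟩
  obtain ⟨c, hc⟩ : ∃ c, c = p₂ - p₃ := ⟨_, rfl⟩
  obtain ⟨d, hd⟩ : ∃ d, d = p₃ - p₀ := ⟨_, rfl⟩
  have hb : p₂ - p₁ = c + d - a := by rw [ha, hc, hd]; ring
  rw [hb, ← ha, ← hc, ← hd]
  rw [hb, ← ha] at d01
  rw [hb, ← hc] at d11
  rw [← ha, ← hd] at d00
  rw [← hc, ← hd] at d10
  have n0 : ‖c + d - a‖ ≤ ‖a‖ + ‖c‖ + ‖d‖ :=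
    (norm_sub_le _ _).trans (by linarith [norm_add_le c d])
  -- The closing side `c + d - a` is projected onto `a`. Since its angle with `a` is nice, this
  -- projection is at least minus half its length, which bounds `‖a‖` by `‖c‖` and `‖d‖`; the roles
  -- of `a` and `c` are then exchanged.
  have ea : dt a (c + d - a) = dt a c + dt a d - ‖a‖ ^ 2 := by
    rw [Complex.sq_norm, Complex.normSq_apply]; simp [dt]; ring
  have ec : dt c (c + d - a) = ‖c‖ ^ 2 + dt c d - dt a c := by
    rw [Complex.sq_norm, Complex.normSq_apply]; simp [dt]; ring
  have f1 := (abs_le.1 d01.abs_dt_le).1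
  have f2 := (abs_le.1 d11.abs_dt_le).2
  have f3 := (abs_le.1 d00.abs_dt_le).2
  have f4 := (abs_le.1 d10.abs_dt_le).1
  have f5 := (abs_le.1 (abs_dt_le_norm_mul a c)).2
  obtain ⟨pa, pd⟩ := d00.norm_pos
  have pc := d10.norm_pos.1
  rw [ea] at f1
  rw [ec] at f2
  refine ⟨?_, ?_, n0⟩
  · have m := mul_le_mul_of_nonneg_left n0 pa.le
    refine le_of_mul_le_mul_left (a := ‖a‖) ?_ pa
    nlinarith
  · have m := mul_le_mul_of_nonneg_left n0 pc.le
    refine le_of_mul_le_mul_left (a := ‖c‖) ?_ pc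
    nlinarith

/-- Nice quadrilaterals are chains of sinks. The number of sinks is bounded by the eccentricity. -/
theorem exists_chain : ∃ N A : ℕ, ∀ p₀ p₁ p₂ p₃ : ℂ, Nq p₀ p₁ p₂ p₃ → ‖p₃ - p₀‖ ≤ ‖p₁ - p₀‖ →
    ‖p₃ - p₀‖ ≤ ‖p₂ - p₁‖ → ‖p₃ - p₀‖ ≤ ‖p₂ - p₃‖ →
    ∃ n : ℕ, (n : ℝ) ≤ 28 * (‖p₁ - p₀‖ / ‖p₃ - p₀‖) + 1 ∧ GSink p₀ p₁ p₂ p₃ N A n 1 := by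
  -- The slices used below have sides between `4 / 25 * (a * g s)` and `48 * (a * g s)`, which is
  -- 300 times as much.
  obtain ⟨N, hN⟩ := CSink.of_bounded_eccentricity 300 (by norm_num)
  refine ⟨N, 4 * N ^ 2 * (2 * N + 1), ?_⟩
  intro p₀ p₁ p₂ p₃ h hda hdb hdc
  obtain ⟨hac, hca, hb⟩ := h.norm_le
  obtain ⟨d00, d01, d10, d11⟩ := h.dirs
  obtain ⟨pa, pd⟩ := d00.norm_pos
  obtain ⟨a, ha⟩ : ∃ a, a = ‖p₁ - p₀‖ := ⟨_, rfl⟩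
  obtain ⟨b, hbd⟩ : ∃ b, b = ‖p₂ - p₁‖ := ⟨_, rfl⟩
  obtain ⟨c, hc⟩ : ∃ c, c = ‖p₂ - p₃‖ := ⟨_, rfl⟩
  obtain ⟨d, hd⟩ : ∃ d, d = ‖p₃ - p₀‖ := ⟨_, rfl⟩
  have fb : ∀ {s : ℝ}, 0 ≤ s → s ≤ 1 → 0.866 * ((1 - s) * d + s * b) ≤ ‖lm p₃ p₂ s - lm p₀ p₁ s‖ ∧
      ‖lm p₃ p₂ s - lm p₀ p₁ s‖ ≤ (1 - s) * d + s * b := by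
    intro s h0 h1
    rw [lm_sub_lm_comb, hd, hbd]; exact ⟨norm_comb_ge' d00 d01 h0 h1, norm_comb_le' h0 h1⟩
  have fa : ∀ {s u : ℝ}, s < u → ‖lm p₀ p₁ u - lm p₀ p₁ s‖ = (u - s) * a ∧
      ‖lm p₃ p₂ u - lm p₃ p₂ s‖ = (u - s) * c := by
    intro s u hsu
    rw [lm_sub_lm, lm_sub_lm, norm_smul, norm_smul, Real.norm_of_nonneg (by linarith), ha, hc]; exact ⟨rfl, rfl⟩
  rw [← ha, ← hd]
  rw [← ha, ← hd] at hda
  rw [← hd, ← hbd] at hdb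
  rw [← hd, ← hc] at hdc
  rw [← ha, ← hc, ← hd] at hac hca hb
  rw [← hbd] at hb
  rw [← ha] at pa
  rw [← hd] at pd
  -- `g s` is the step width at parameter `s`: the length interpolated there between the two ends,
  -- divided by `28 * a`. A slice of this width is neither too thin nor too long.
  obtain ⟨g, hg⟩ : ∃ g : ℝ → ℝ, ∀ s, ((1 - s) * d + s * b) = 28 * a * g s :=
    ⟨fun s => ((1 - s) * d + s * b) / (28 * a), fun s => by field_simp⟩
  have hgd : ∀ {s}, 0 ≤ s → d ≤ 28 * a * g s := fun {s} h0 => by rw [← hg]; nlinarith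
  -- `b - d ≤ 7 * a` makes `g` grow with slope at most 1/4, so the step width is nearly constant
  -- within a slice.
  have hgu : ∀ {s u : ℝ}, s ≤ u → 28 * a * g s ≤ 28 * a * g u ∧ 28 * a * g u ≤ 28 * a * g s + 7 * a * (u - s) := by
    intro s u hsu
    rw [← hg, ← hg]
    constructor
    · nlinarith
    · nlinarith [mul_nonneg (sub_nonneg.2 hsu) (show 0 ≤ 7 * a - (b - d) by linarith)]
  have hg0 : ∀ {s}, 0 ≤ s → 0 < g s := fun {s} h0 => by
    by_contra hn; have := hgd h0; nlinarith
  have fat : ∀ {s u : ℝ}, 0 ≤ s → u ≤ 1 → 4 / 5 * g s ≤ u - s → u - s ≤ 2 * g s →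
      CSink (lm p₀ p₁ s) (lm p₀ p₁ u) (lm p₃ p₂ u) (lm p₃ p₂ s) N := by
    intro s u h0 h1 l1 l2
    have g0 := hg0 h0
    have hsu : s < u := by linarith
    obtain ⟨a1, a2⟩ := fa hsu
    obtain ⟨b1, b2⟩ := fb h0 (by linarith : s ≤ 1)
    obtain ⟨b3, b4⟩ := fb (by linarith : 0 ≤ u) h1
    obtain ⟨k1, k2⟩ := hgu hsu.le
    rw [hg] at b1 b2 b3 b4
    have g1 : g s ≤ g u := by nlinarith
    have x1 := mul_le_mul_of_nonneg_left l1 pa.le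
    have x2 := mul_le_mul_of_nonneg_left l2 pa.le
    have x0 : 0 < a * g s := by positivity
    have y1 : (u - s) * a ≤ 5 * ((u - s) * c) := by nlinarith
    have y2 : (u - s) * c ≤ 5 * ((u - s) * a) := by nlinarith
    refine hN _ _ _ _ (4 / 25 * (a * g s)) (h.sub h0 hsu h1) (by positivity) ?_ ?_ ?_ ?_ ?_ ?_ ?_ ?_
    · rw [a1]; linarith
    · rw [a1]; linarith
    · linarith
    · linarith
    · rw [a2]; linarith
    · rw [a2]; linarith
    · linarith
    · linarith
  -- Every step advances by at least `d / (28 * a)`, so the remaining length bounds the number of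
  -- slices. The lower bound on the remaining length ensures that the last slice is not too thin.
  have key : ∀ m : ℕ, ∀ s : ℝ, 0 ≤ s → s < 1 → 4 / 5 * g s ≤ 1 - s → (1 - s) * (28 * a) ≤ m * d → ∀ σ : ℕ,
      ∃ n, n ≤ m ∧ GSink (lm p₀ p₁ s) p₁ p₂ (lm p₃ p₂ s) N (4 * N ^ 2 * (2 * N + 1)) n σ := by
    intro m
    induction m with
    | zero => intro s h0 h1 _ h2; push_cast at h2; nlinarith
    | succ m ih =>
      intro s h0 h1 h2 h3 σ
      have g0 := hg0 h0
      rcases le_or_gt (1 - s) (2 * g s) with hs | hs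
      · refine ⟨1, by omega, ?_⟩
        have := fat h0 le_rfl h2 hs
        rw [lm_one, lm_one] at this
        exact this.gsink σ
      · have hgd' := hgd h0
        obtain ⟨k1, k2⟩ := hgu (show s ≤ s + g s by linarith)
        -- More than `g s` is left after the step, and the new step width is at most `5 / 4 * g s`;
        -- this restores the lower bound for the induction.
        have k3 : g (s + g s) ≤ 5 / 4 * g s := by
          refine le_of_mul_le_mul_left (a := 28 * a) ?_ (by positivity)
          nlinarith
        obtain ⟨n, hn, hG⟩ := ih (s + g s) (by linarith) (by linarith) (by linarith)
          (by push_cast at h3; nlinarith) 0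
        refine ⟨n + 1, by omega, ?_⟩
        have hq := h.sub h0 h1 le_rfl
        rw [lm_one, lm_one] at hq
        have hI : InI (g s / (1 - s)) := ⟨by apply div_pos <;> linarith, by rw [div_lt_one (by linarith)]; linarith⟩
        have e : s + (1 - s) * (g s / (1 - s)) = s + g s := by
          rw [mul_div_cancel₀]; linarith
        refine GSink.cons hq.ccw hI hI ?_ ?_ (fat h0 (by linarith) (by linarith) (by linarith)) hG σ <;>
          rw [lm_right, e]
  obtain ⟨n, hn, hG⟩ := key ⌈28 * (a / d)⌉₊ 0 le_rfl one_pos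
    (by have := hg 0; nlinarith)
    (by have := Nat.le_ceil (28 * (a / d))
        have := mul_le_mul_of_nonneg_right this pd.le
        rw [mul_assoc, div_mul_cancel₀ _ pd.ne'] at this
        linarith) 1
  rw [lm_zero, lm_zero] at hG
  refine ⟨n, ?_, hG⟩
  have h1 := Nat.ceil_lt_add_one (show 0 ≤ 28 * (a / d) by positivity)
  have h2 : (n : ℝ) ≤ ⌈28 * (a / d)⌉₊ := by exact_mod_cast hn
  linarith

end SinkMesh

/-! ### Faces of tilings, and tiles as polygons. -/

namespace SinkMesh

lemma convex_halfPlane (a b : ℂ) : Convex ℝ {z | el a b z < 0} := by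
  intro x hx y hy s t hs ht hst
  simp only [mem_ofPred_eq] at *
  rw [el_comb _ _ _ _ _ _ hst]
  rcases hs.eq_or_lt with rfl | hs
  · have : t = 1 := by linarith
    subst this; simpa using hy
  · nlinarith [mul_neg_of_pos_of_neg hs hx, mul_nonneg ht (neg_nonneg.2 hy.le)]

lemma not_isBounded_halfPlane {a b x : ℂ} (hab : a ≠ b) (hx : el a b x < 0) :
    ¬ Bornology.IsBounded {z | el a b z < 0} := by
  intro h
  obtain ⟨R, hR⟩ := h.exists_norm_le
  have hp : 0 < ‖b - a‖ := norm_pos_iff.2 (sub_ne_zero.2 hab.symm)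
  obtain ⟨t, ht⟩ : ∃ t : ℝ, t = (|R| + ‖x‖ + 1) / ‖b - a‖ := ⟨_, rfl⟩
  have ht' : t * ‖b - a‖ = |R| + ‖x‖ + 1 := by rw [ht]; field_simp
  have ht0 : 0 ≤ t := by rw [ht]; positivity
  have hm : x + t • (b - a) ∈ {z | el a b z < 0} := by
    simp only [mem_ofPred_eq]
    rw [el_add_smul, show cr (b - a) (b - a) = 0 by simp only [cr]; ring]; simpa using hx
  have h1 := hR _ hm
  have h2 : ‖t • (b - a)‖ ≤ ‖x + t • (b - a)‖ + ‖x‖ := by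
    have := norm_sub_le (x + t • (b - a)) x; rwa [add_sub_cancel_left] at this
  rw [norm_smul, Real.norm_of_nonneg ht0, ht'] at h2
  linarith [le_abs_self R]

lemma exists_el_neg_of_notMem {p₀ p₁ p₂ p₃ x : ℂ} (h : Ccw p₀ p₁ p₂ p₃) (hx : x ∉ quad p₀ p₁ p₂ p₃) :
    ∃ a b, a ≠ b ∧ el a b x < 0 ∧ ∀ z ∈ quad p₀ p₁ p₂ p₃, 0 ≤ el a b z := by
  by_contra! hn
  refine hx ⟨?_, ?_, ?_, ?_⟩ <;> by_contra! hc
  · obtain ⟨z, hz, hlt⟩ := hn p₀ p₁ h.ne hc; exact absurd hz.1 (not_le.2 hlt)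
  · obtain ⟨z, hz, hlt⟩ := hn p₁ p₂ h.rot.ne hc; exact absurd hz.2.1 (not_le.2 hlt)
  · obtain ⟨z, hz, hlt⟩ := hn p₂ p₃ h.rot.rot.ne hc; exact absurd hz.2.2.1 (not_le.2 hlt)
  · obtain ⟨z, hz, hlt⟩ := hn p₃ p₀ h.rot.rot.rot.ne hc; exact absurd hz.2.2.2 (not_le.2 hlt)

/-- The faces of a tiling of a convex quadrilateral. -/
theorem boundedComponents_tiling {T : Finset (Fin 4 → ℂ)} {p₀ p₁ p₂ p₃ : ℂ} (h : Ccw p₀ p₁ p₂ p₃)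
    (hT : ∀ q ∈ T, Ccw (q 0) (q 1) (q 2) (q 3))
    (disj : ∀ q ∈ T, ∀ q' ∈ T, q ≠ q' → Disjoint (interior (tile q)) (interior (tile q')))
    (cover : (⋃ q ∈ T, tile q) = quad p₀ p₁ p₂ p₃) :
    boundedComponents (⋃ q ∈ T, frontier (tile q)) = (fun q => interior (tile q)) '' T := by
  set K := ⋃ q ∈ T, frontier (tile q) with hK
  have hKD : K ⊆ quad p₀ p₁ p₂ p₃ := by
    rw [← cover]
    exact iUnion₂_mono fun q _ => (isClosed_quad _ _ _ _).frontier_subset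
  have hdK : ∀ q ∈ T, interior (tile q) ⊆ Kᶜ := by
    intro q hq z hz hzK
    obtain ⟨q', hq', hz'⟩ := mem_iUnion₂.1 hzK
    rcases eq_or_ne q q' with rfl | hne
    · exact hz'.2 hz
    · have h1 : z ∈ closure (interior (tile q')) := by
        rw [tile, closure_interior_quad (hT q' hq')]; exact (isClosed_quad _ _ _ _).frontier_subset hz'
      exact ((disj q hq q' hq' hne).closure_right isOpen_interior).le_bot ⟨hz, h1⟩
  -- The interior of a tile is connected and avoids `K`. A component containing it cannot leave it
  -- without meeting the frontier of the tile, which belongs to `K`.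
  have hcomp : ∀ q ∈ T, ∀ x ∈ interior (tile q), connectedComponentIn Kᶜ x = interior (tile q) := by
    intro q hq x hx
    refine Subset.antisymm ?_ ((convex_quad _ _ _ _).interior.isPreconnected.subset_connectedComponentIn hx (hdK q hq))
    refine isPreconnected_connectedComponentIn.subset_left_of_subset_union isOpen_interior
      (isClosed_quad (q 0) (q 1) (q 2) (q 3)).isOpen_compl
      (disjoint_compl_right.mono_left interior_subset) ?_ ⟨x, mem_connectedComponentIn (hdK q hq hx), hx⟩
    intro z hz
    by_cases hzt : z ∈ tile q
    · left
      by_contra hzi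
      refine (connectedComponentIn_subset _ _ hz : z ∈ Kᶜ) (mem_iUnion₂.2 ⟨q, hq, ?_⟩)
      exact ⟨subset_closure hzt, hzi⟩
    · exact .inr hzt
  ext F
  constructor
  · rintro ⟨⟨x, hx, rfl⟩, hb⟩
    by_cases hxD : x ∈ quad p₀ p₁ p₂ p₃
    · rw [← cover] at hxD
      obtain ⟨q, hq, hxq⟩ := mem_iUnion₂.1 hxD
      have hxi : x ∈ interior (tile q) := by
        by_contra hxi
        exact hx (mem_iUnion₂.2 ⟨q, hq, subset_closure hxq, hxi⟩)
      exact ⟨q, hq, (hcomp q hq x hxi).symm⟩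
    -- Outside the quadrilateral, some side bounds an open half-plane that contains the point and
    -- misses `K`. It is connected and unbounded, and so is the component.
    · exfalso
      obtain ⟨a, b, hab, hneg, hpos⟩ := exists_el_neg_of_notMem h hxD
      refine not_isBounded_halfPlane hab hneg (hb.subset ?_)
      refine (convex_halfPlane a b).isPreconnected.subset_connectedComponentIn hneg ?_
      intro z hz hzK
      exact absurd (hpos z (hKD hzK)) (not_le.2 hz)
  · rintro ⟨q, hq, rfl⟩
    obtain ⟨x, hx⟩ := interior_quad_nonempty (hT q hq)
    exact ⟨⟨x, hdK q hq hx, (hcomp q hq x hx).symm⟩,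
      (isCompact_quad (hT q hq)).isBounded.subset interior_subset⟩

lemma boundedComponents_frontier_tile {q : Fin 4 → ℂ} (h : Ccw (q 0) (q 1) (q 2) (q 3)) :
    boundedComponents (frontier (tile q)) = {interior (tile q)} := by
  have := boundedComponents_tiling (T := {q}) h (by simpa using h)
    (by simp only [Finset.mem_singleton]; rintro _ rfl _ rfl h; exact absurd rfl h) (by simp [tile])
  simpa using this

lemma polyEdge_four (q : Fin 4 → ℂ) (i : Fin 4) : polyEdge q i = openSegment ℝ (q i) (q (i + 1)) := by
  rw [polyEdge, finRotate_apply]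

lemma polyCurve_eq_iUnion (q : Fin 4 → ℂ) : polyCurve q = ⋃ i, segment ℝ (q i) (q (i + 1)) := by
  ext z
  simp only [polyCurve, polyEdge_four, mem_union, mem_iUnion, ← insert_endpoints_openSegment, mem_insert_iff,
    mem_range]
  constructor
  · rintro (⟨i, rfl⟩ | ⟨i, hi⟩)
    exacts [⟨i, .inl rfl⟩, ⟨i, .inr (.inr hi)⟩]
  · rintro ⟨i, rfl | rfl | hi⟩
    exacts [.inl ⟨i, rfl⟩, .inl ⟨_, rfl⟩, .inr ⟨i, hi⟩]

lemma polyCurve_eq_frontier {q : Fin 4 → ℂ} (h : Ccw (q 0) (q 1) (q 2) (q 3)) :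
    polyCurve q = frontier (tile q) := by
  rw [polyCurve_eq_iUnion, tile, frontier_quad h]
  ext z
  simp only [mem_iUnion, Fin.exists_fin_succ, Fin.exists_fin_zero, mem_union]
  simp [or_assoc]

lemma polyInterior_eq_interior {q : Fin 4 → ℂ} (h : Ccw (q 0) (q 1) (q 2) (q 3)) :
    polyInterior q = interior (tile q) := by
  rw [polyInterior, polyCurve_eq_frontier h, boundedComponents_frontier_tile h, sUnion_singleton]

lemma polynomialHull_frontier {p₀ p₁ p₂ p₃ : ℂ} (h : Ccw p₀ p₁ p₂ p₃) :
    polynomialHull (frontier (quad p₀ p₁ p₂ p₃)) = quad p₀ p₁ p₂ p₃ := by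
  have := boundedComponents_frontier_tile (q := ![p₀, p₁, p₂, p₃]) h
  have e : tile ![p₀, p₁, p₂, p₃] = quad p₀ p₁ p₂ p₃ := rfl
  rw [e] at this
  rw [polynomialHull, this, sUnion_singleton, (isClosed_quad _ _ _ _).frontier_eq, sdiff_union_self,
    union_eq_self_of_subset_right interior_subset]

lemma Ccw.cyc {q : Fin 4 → ℂ} (h : Ccw (q 0) (q 1) (q 2) (q 3)) (i : Fin 4) :
    Ccw (q i) (q (i + 1)) (q (i + 2)) (q (i + 3)) := by
  fin_cases i
  exacts [h, h.rot, h.rot.rot, h.rot.rot.rot]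

lemma Nq.cyc {q : Fin 4 → ℂ} (h : Nq (q 0) (q 1) (q 2) (q 3)) (i : Fin 4) :
    Nq (q i) (q (i + 1)) (q (i + 2)) (q (i + 3)) := by
  fin_cases i
  exacts [h, h.rot, h.rot.rot, h.rot.rot.rot]

lemma el_of_mem_openSegment {p₀ p₁ p₂ p₃ z : ℂ} (h : Ccw p₀ p₁ p₂ p₃) (hz : z ∈ openSegment ℝ p₀ p₁) :
    el p₀ p₁ z = 0 ∧ 0 < el p₁ p₂ z ∧ 0 < el p₂ p₃ z ∧ 0 < el p₃ p₀ z := by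
  obtain ⟨a, b, ha, hb, hab, rfl⟩ := hz
  have h0 := h.c₀; have h1 := h.c₁; have h2 := h.c₂; have h3 := h.c₃
  have e1 := el_rot p₀ p₁ p₂
  have e2 := el_rot p₁ p₂ p₃
  have e3 := el_rot p₂ p₃ p₀
  have e4 := el_rot p₃ p₀ p₁
  simp only [el_comb _ _ _ _ _ _ hab, el_self_left, el_self_right, mul_zero, add_zero, zero_add]
  rw [← e1]
  refine ⟨trivial, by positivity, ?_, by positivity⟩
  rw [← e2]; positivity

lemma exists_eq_add (i j : Fin 4) : i = j ∨ i = j + 1 ∨ i = j + 2 ∨ i = j + 3 := by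
  revert i j; decide

lemma el_polyEdge {q : Fin 4 → ℂ} (h : Ccw (q 0) (q 1) (q 2) (q 3)) {j : Fin 4} {z : ℂ} (hz : z ∈ polyEdge q j) :
    el (q j) (q (j + 1)) z = 0 ∧ ∀ i, i ≠ j → 0 < el (q i) (q (i + 1)) z := by
  rw [polyEdge_four] at hz
  obtain ⟨a, b, c, d⟩ := el_of_mem_openSegment (h.cyc j) hz
  refine ⟨a, fun i hi => ?_⟩
  rcases exists_eq_add i j with rfl | rfl | rfl | rfl
  · exact absurd rfl hi
  · rwa [add_assoc]
  · rwa [add_assoc]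
  · rw [add_assoc, show (3 + 1 : Fin 4) = 0 from rfl, add_zero]; exact d

lemma Ccw.isSimplePolygon {q : Fin 4 → ℂ} (h : Ccw (q 0) (q 1) (q 2) (q 3)) : IsSimplePolygon q where
  three_le := by norm_num
  injective := by
    intro i j hij
    rcases exists_eq_add i j with rfl | rfl | rfl | rfl
    · rfl
    · exact absurd hij (h.cyc j).ne.symm
    · exfalso
      have h1 := (h.cyc j).c₀
      rw [hij, el_self_left] at h1; exact lt_irrefl _ h1
    · exact absurd hij (h.cyc j).rot.rot.rot.ne
  edges_disjoint i j hij := by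
    rw [Set.disjoint_left]
    intro z hi hj
    exact ((el_polyEdge h hj).2 i hij).ne' (el_polyEdge h hi).1
  vertex_notMem_edge i j hij := by
    have h2 := (el_polyEdge h hij).2
    have h3 : i = j := by
      by_contra hne; exact (h2 i hne).ne' (el_self_left _ _)
    have h4 : i + 3 = j := by
      by_contra hne
      refine (h2 (i + 3) hne).ne' ?_
      rw [add_assoc, show (3 + 1 : Fin 4) = 0 from rfl, add_zero, el_self_right]
    rw [← h3] at h4
    revert h4; clear * -; revert i; decide

lemma inner_eq_dt (x y : ℂ) : inner ℝ x y = dt x y := by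
  rw [Complex.inner]; simp [dt]; ring

lemma angle_mem_iff {x y : ℂ} (hx : x ≠ 0) (hy : y ≠ 0) :
    InnerProductGeometry.angle x y ∈ Icc (Real.pi / 3) (2 * Real.pi / 3) ↔ |dt x y| ≤ 0.5 * (‖x‖ * ‖y‖) := by
  have hp : 0 < ‖x‖ * ‖y‖ := by positivity
  have hpi := Real.pi_pos
  have c1 : Real.cos (2 * Real.pi / 3) = -(1 / 2) := by
    rw [show 2 * Real.pi / 3 = Real.pi - Real.pi / 3 by ring, Real.cos_pi_sub, Real.cos_pi_div_three]
  have hc : Real.cos (InnerProductGeometry.angle x y) = dt x y / (‖x‖ * ‖y‖) := by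
    rw [InnerProductGeometry.cos_angle, inner_eq_dt]
  have h0 := InnerProductGeometry.angle_nonneg x y
  have h1 := InnerProductGeometry.angle_le_pi x y
  have i1 : Real.pi / 3 ≤ InnerProductGeometry.angle x y ↔ dt x y ≤ 1 / 2 * (‖x‖ * ‖y‖) := by
    rw [← Real.strictAntiOn_cos.le_iff_ge ⟨h0, h1⟩ ⟨by positivity, by linarith⟩, Real.cos_pi_div_three, hc,
      div_le_iff₀ hp]
  have i2 : InnerProductGeometry.angle x y ≤ 2 * Real.pi / 3 ↔ -(1 / 2) * (‖x‖ * ‖y‖) ≤ dt x y := by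
    rw [← Real.strictAntiOn_cos.le_iff_ge ⟨by positivity, by linarith⟩ ⟨h0, h1⟩, c1, hc, le_div_iff₀ hp]
  rw [mem_Icc, i1, i2, abs_le]
  constructor
  · rintro ⟨a, b⟩; constructor <;> linarith
  · rintro ⟨a, b⟩; constructor <;> linarith

lemma Nq.isNiceQuad {q : Fin 4 → ℂ} (h : Nq (q 0) (q 1) (q 2) (q 3)) : IsNiceQuad q where
  simple := h.ccw.isSimplePolygon
  angle_mem i := by
    have hd := (h.cyc i).n₀
    obtain ⟨h1, h2⟩ := hd.norm_pos
    rw [EuclideanGeometry.angle, vsub_eq_sub, vsub_eq_sub, angle_mem_iff]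
    · rw [← neg_sub (q (i + 1)) (q i), norm_neg, show dt (-(q (i + 1) - q i)) (q (i + 2) - q (i + 1)) =
        -dt (q (i + 1) - q i) (q (i + 2) - q (i + 1)) by simp [dt]; ring, abs_neg]
      exact hd.abs_dt_le
    · rw [← neg_sub, neg_ne_zero]; exact norm_pos_iff.1 h1
    · exact norm_pos_iff.1 h2

end SinkMesh

/-! ### Nice quadrilaterals are convex. -/

namespace SinkMesh

/-- The segments `ab` and `cd` cross if each separates the ends of the other. -/
lemma exists_mem_openSegment_of_separated {a b c d : ℂ} (h₁ : el a b c * el a b d < 0)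
    (h₂ : el c d a * el c d b < 0) : ∃ z, z ∈ openSegment ℝ a b ∧ z ∈ openSegment ℝ c d := by
  have key : ∀ {x y : ℝ}, x * y < 0 → x - y ≠ 0 ∧ 0 < x / (x - y) ∧ 0 < -y / (x - y) ∧
      x / (x - y) + -y / (x - y) = 1 := by
    intro x y hxy
    have hne : x - y ≠ 0 := fun h => by
      have : x = y := by linarith
      rw [this] at hxy; nlinarith [mul_self_nonneg y]
    refine ⟨hne, ?_, ?_, by rw [← add_div, ← sub_eq_add_neg, div_self hne]⟩
    · rcases lt_trichotomy x 0 with h | h | h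
      · exact div_pos_of_neg_of_neg h (by have := pos_of_mul_neg_right hxy h.le; linarith)
      · rw [h, zero_mul] at hxy; exact absurd hxy (lt_irrefl _)
      · exact div_pos h (by have := neg_of_mul_neg_right hxy h.le; linarith)
    · rcases lt_trichotomy x 0 with h | h | h
      · have := pos_of_mul_neg_right hxy h.le
        exact div_pos_of_neg_of_neg (by linarith) (by linarith)
      · rw [h, zero_mul] at hxy; exact absurd hxy (lt_irrefl _)
      · have := neg_of_mul_neg_right hxy h.le
        exact div_pos (by linarith) (by linarith)
  obtain ⟨n1, x1, y1, s1⟩ := key h₁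
  obtain ⟨n2, x2, y2, s2⟩ := key h₂
  refine ⟨_, ⟨_, _, y2, x2, by rw [add_comm]; exact s2, rfl⟩, ⟨_, _, y1, x1, by rw [add_comm]; exact s1, ?_⟩⟩
  simp only [el_def] at n1 n2 ⊢
  apply Complex.ext
  · simp only [Complex.add_re, Complex.smul_re, smul_eq_mul]; field_simp; ring
  · simp only [Complex.add_im, Complex.smul_im, smul_eq_mul]; field_simp; ring

/-- Each of the three products on the left is at most a third of the right-hand side. For sines `y`
and cosines `x` this says that three angles between 60° and 120° have a sum with nonpositive sine.
-/
lemma abs_mul_mul_le {x₀ x₁ x₂ y₀ y₁ y₂ : ℝ} (h₀ : √3 * |x₀| ≤ y₀) (h₁ : √3 * |x₁| ≤ y₁) (h₂ : √3 * |x₂| ≤ y₂) :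
    x₀ * x₁ * y₂ + x₀ * y₁ * x₂ + y₀ * x₁ * x₂ ≤ y₀ * y₁ * y₂ := by
  have h3 : √3 * √3 = 3 := Real.mul_self_sqrt (by norm_num)
  have key : ∀ {x x' y y' : ℝ}, √3 * |x| ≤ y → √3 * |x'| ≤ y' → 3 * (x * x') ≤ y * y' := by
    intro x x' y y' h h'
    have := mul_le_mul h h' (by positivity) (le_trans (by positivity) h)
    have e : √3 * |x| * (√3 * |x'|) = 3 * |x * x'| := by rw [abs_mul]; linear_combination |x| * |x'| * h3
    rw [e] at this
    linarith [le_abs_self (x * x')]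
  have p₀ : 0 ≤ y₀ := le_trans (by positivity) h₀
  have p₁ : 0 ≤ y₁ := le_trans (by positivity) h₁
  have p₂ : 0 ≤ y₂ := le_trans (by positivity) h₂
  have k1 := mul_le_mul_of_nonneg_right (key h₀ h₁) p₂
  have k2 := mul_le_mul_of_nonneg_right (key h₀ h₂) p₁
  have k3 := mul_le_mul_of_nonneg_right (key h₁ h₂) p₀
  nlinarith

/-- Three nice left turns and a nice right turn do not add up to a full turn. -/
lemma not_three_turns {e₀ e₁ e₂ e₃ : ℂ} (h₀ : NiceDir e₀ e₁) (h₁ : NiceDir e₁ e₂) (h₂ : NiceDir e₂ e₃)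
    (h₃ : NiceDir e₀ e₃) : False := by
  have h := abs_mul_mul_le h₀.2 h₁.2 h₂.2
  have n1 := pow_pos h₁.norm_pos.1 2
  have n2 := pow_pos h₁.norm_pos.2 2
  have hc := h₃.1
  -- The addition formula for the sine of a sum of three angles, with the lengths of the vectors
  -- kept.
  have e : cr e₀ e₁ * dt e₁ e₂ * dt e₂ e₃ + dt e₀ e₁ * cr e₁ e₂ * dt e₂ e₃ + dt e₀ e₁ * dt e₁ e₂ * cr e₂ e₃ -
      cr e₀ e₁ * cr e₁ e₂ * cr e₂ e₃ = ‖e₁‖ ^ 2 * ‖e₂‖ ^ 2 * cr e₀ e₃ := by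
    rw [Complex.sq_norm, Complex.sq_norm, Complex.normSq_apply, Complex.normSq_apply]
    simp only [cr, dt]; ring
  have : 0 < ‖e₁‖ ^ 2 * ‖e₂‖ ^ 2 * cr e₀ e₃ := by positivity
  linarith

/-- The angle condition, without orientation. -/
def NiceAngle (x y : ℂ) : Prop := NiceDir x y ∨ NiceDir y x

/-- `cr² + dt²` is the squared product of the norms, so a cosine of modulus at most 1/2 forces a
sine of modulus at least `√3` times as large; its sign gives the orientation. -/
lemma niceAngle_of_abs_dt_le {x y : ℂ} (hx : x ≠ 0) (hy : y ≠ 0) (h : |dt x y| ≤ 0.5 * (‖x‖ * ‖y‖)) :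
    NiceAngle x y := by
  have h3 : √3 ^ 2 = 3 := Real.sq_sqrt (by norm_num)
  have h1 := cr_sq_add_dt_sq x y
  have hp : 0 < ‖x‖ ^ 2 * ‖y‖ ^ 2 := by positivity
  have h2 : dt x y ^ 2 ≤ 1 / 4 * (‖x‖ ^ 2 * ‖y‖ ^ 2) := by
    have := mul_self_le_mul_self (abs_nonneg _) h
    rw [← sq_abs]; nlinarith
  have h4 : √3 * |dt x y| ≤ |cr x y| := by
    refine abs_le_of_sq_le_sq' (b := |cr x y|) ?_ (abs_nonneg _) |>.2
    rw [mul_pow, sq_abs, sq_abs, h3]; nlinarith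
  have h5 : cr x y ≠ 0 := fun h0 => by rw [h0] at h1; nlinarith
  rcases lt_or_gt_of_ne h5 with h0 | h0
  · right
    rw [abs_of_neg h0, ← cr_swap] at h4
    refine ⟨by rw [cr_swap]; linarith, ?_⟩
    rwa [show dt y x = dt x y by simp only [dt]; ring]
  · left; rw [abs_of_pos h0] at h4; exact ⟨h0, h4⟩

lemma IsNiceQuad.niceAngle {q : Fin 4 → ℂ} (h : IsNiceQuad q) (i : Fin 4) :
    NiceAngle (q (i + 1) - q i) (q (i + 2) - q (i + 1)) := by
  have hne : ∀ j, q (j + 1) - q j ≠ 0 := fun j =>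
    sub_ne_zero.2 fun he => by have := h.simple.injective he; revert this; clear * -; revert j; decide
  have h1 := h.angle_mem i
  have hn := hne (i + 1)
  rw [add_assoc, show (1 + 1 : Fin 4) = 2 from rfl] at hn
  rw [EuclideanGeometry.angle, vsub_eq_sub, vsub_eq_sub, angle_mem_iff (by rw [← neg_sub, neg_ne_zero]; exact hne i) hn]
    at h1
  refine niceAngle_of_abs_dt_le (hne i) hn ?_
  rwa [← neg_sub (q (i + 1)) (q i), norm_neg, show dt (-(q (i + 1) - q i)) (q (i + 2) - q (i + 1)) =
        -dt (q (i + 1) - q i) (q (i + 2) - q (i + 1)) by simp [dt]; ring, abs_neg] at h1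

/-- A nice quadrilateral is convex; its corners are listed counterclockwise or clockwise. -/
theorem IsNiceQuad.nq_or_nq {q : Fin 4 → ℂ} (h : IsNiceQuad q) :
    Nq (q 0) (q 1) (q 2) (q 3) ∨ Nq (q 3) (q 2) (q 1) (q 0) := by
  have a₀ : NiceAngle (q 1 - q 0) (q 2 - q 1) := h.niceAngle 0
  have a₁ : NiceAngle (q 2 - q 1) (q 3 - q 2) := h.niceAngle 1
  have a₂ : NiceAngle (q 3 - q 2) (q 0 - q 3) := h.niceAngle 2
  have a₃ : NiceAngle (q 0 - q 3) (q 1 - q 0) := h.niceAngle 3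
  have d₀ : Disjoint (openSegment ℝ (q 0) (q 1)) (openSegment ℝ (q 2) (q 3)) := by
    have := h.simple.edges_disjoint 0 2 (by decide); rwa [polyEdge_four, polyEdge_four] at this
  have d₁ : Disjoint (openSegment ℝ (q 1) (q 2)) (openSegment ℝ (q 3) (q 0)) := by
    have := h.simple.edges_disjoint 1 3 (by decide); rwa [polyEdge_four, polyEdge_four] at this
  generalize q 0 = p₀ at *
  generalize q 1 = p₁ at *
  generalize q 2 = p₂ at *
  generalize q 3 = p₃ at *
  have c₀ : cr (p₁ - p₀) (p₂ - p₁) = el p₀ p₁ p₂ := (el_eq_cr _ _ _).symm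
  have c₁ : cr (p₂ - p₁) (p₃ - p₂) = el p₁ p₂ p₃ := (el_eq_cr _ _ _).symm
  have c₂ : cr (p₃ - p₂) (p₀ - p₃) = el p₂ p₃ p₀ := (el_eq_cr _ _ _).symm
  have c₃ : cr (p₀ - p₃) (p₁ - p₀) = el p₃ p₀ p₁ := (el_eq_cr _ _ _).symm
  have hsum : el p₀ p₁ p₂ + el p₂ p₃ p₀ = el p₁ p₂ p₃ + el p₃ p₀ p₁ := by simp only [el_def]; ring
  have x₀ : ¬ (el p₀ p₁ p₂ * el p₃ p₀ p₁ < 0 ∧ el p₂ p₃ p₀ * el p₁ p₂ p₃ < 0) := by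
    rintro ⟨h1, h2⟩
    obtain ⟨z, hz, hz'⟩ := exists_mem_openSegment_of_separated (a := p₀) (b := p₁) (c := p₂) (d := p₃)
      (by rwa [el_rot p₃ p₀ p₁] at h1) (by rwa [el_rot p₁ p₂ p₃] at h2)
    exact d₀.le_bot ⟨hz, hz'⟩
  have x₁ : ¬ (el p₁ p₂ p₃ * el p₀ p₁ p₂ < 0 ∧ el p₃ p₀ p₁ * el p₂ p₃ p₀ < 0) := by
    rintro ⟨h1, h2⟩
    obtain ⟨z, hz, hz'⟩ := exists_mem_openSegment_of_separated (a := p₁) (b := p₂) (c := p₃) (d := p₀)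
      (by rwa [el_rot p₀ p₁ p₂] at h1) (by rwa [el_rot p₂ p₃ p₀] at h2)
    exact d₁.le_bot ⟨hz, hz'⟩
  have neg : ∀ {x y : ℂ}, NiceDir y x → cr x y < 0 := fun {x y} hn => by
    have := hn.1; rw [cr_swap] at this; linarith
  -- Sixteen patterns of left and right turns. Equal turns give the two conclusions, and one
  -- deviating turn contradicts `not_three_turns`. Two adjacent left and two right turns make
  -- opposite sides cross, and alternating turns contradict the area identity `hsum`.
  rcases a₀ with a₀ | a₀ <;> rcases a₁ with a₁ | a₁ <;> rcases a₂ with a₂ | a₂ <;> rcases a₃ with a₃ | a₃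
  · exact .inl ⟨a₀, a₁, a₂, a₃⟩
  · exact (not_three_turns a₀ a₁ a₂ a₃).elim
  · exact (not_three_turns a₃ a₀ a₁ a₂).elim
  · exfalso
    have b₀ := a₀.1; have b₁ := a₁.1; have b₂ := neg a₂; have b₃ := neg a₃
    rw [c₀] at b₀; rw [c₁] at b₁; rw [c₂] at b₂; rw [c₃] at b₃
    exact x₀ ⟨by nlinarith, by nlinarith⟩
  · exact (not_three_turns a₂ a₃ a₀ a₁).elim
  · exfalso
    have b₀ := a₀.1; have b₁ := neg a₁; have b₂ := a₂.1; have b₃ := neg a₃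
    linarith
  · exfalso
    have b₀ := a₀.1; have b₁ := neg a₁; have b₂ := neg a₂; have b₃ := a₃.1
    rw [c₀] at b₀; rw [c₁] at b₁; rw [c₂] at b₂; rw [c₃] at b₃
    exact x₁ ⟨by nlinarith, by nlinarith⟩
  · exact (not_three_turns a₃ a₂ a₁ a₀).elim
  · exact (not_three_turns a₁ a₂ a₃ a₀).elim
  · exfalso
    have b₀ := neg a₀; have b₁ := a₁.1; have b₂ := a₂.1; have b₃ := neg a₃
    rw [c₀] at b₀; rw [c₁] at b₁; rw [c₂] at b₂; rw [c₃] at b₃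
    exact x₁ ⟨by nlinarith, by nlinarith⟩
  · exfalso
    have b₀ := neg a₀; have b₁ := a₁.1; have b₂ := neg a₂; have b₃ := a₃.1
    linarith
  · exact (not_three_turns a₀ a₃ a₂ a₁).elim
  · exfalso
    have b₀ := neg a₀; have b₁ := neg a₁; have b₂ := a₂.1; have b₃ := a₃.1
    rw [c₀] at b₀; rw [c₁] at b₁; rw [c₂] at b₂; rw [c₃] at b₃
    exact x₀ ⟨by nlinarith, by nlinarith⟩
  · exact (not_three_turns a₁ a₀ a₃ a₂).elim
  · exact (not_three_turns a₂ a₁ a₀ a₃).elim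
  · right
    have b₀ := a₀.neg; have b₁ := a₁.neg; have b₂ := a₂.neg; have b₃ := a₃.neg
    simp only [neg_sub] at b₀ b₁ b₂ b₃
    exact ⟨b₁, b₀, b₃, b₂⟩

end SinkMesh

/-! ### Adding vertices to a polygon. -/

namespace SinkMesh

lemma polyEdge_succ {m : ℕ} (z : Fin (m + 1) → ℂ) (i : Fin (m + 1)) :
    polyEdge z i = openSegment ℝ (z i) (z (i + 1)) := by
  rw [polyEdge, finRotate_apply]

section Shift
variable {m : ℕ} (z : Fin (m + 1) → ℂ) (c : Fin (m + 1))

lemma polyEdge_shift (i : Fin (m + 1)) : polyEdge (fun i => z (i + c)) i = polyEdge z (i + c) := by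
  rw [polyEdge_succ, polyEdge_succ, add_right_comm]

lemma range_shift : range (fun i => z (i + c)) = range z :=
  (Equiv.addRight c).surjective.range_comp z

lemma polyCurve_shift : polyCurve (fun i => z (i + c)) = polyCurve z := by
  rw [polyCurve, polyCurve, range_shift]
  simp only [polyEdge_shift]
  congr 1
  exact (Equiv.addRight c).surjective.iUnion_comp (polyEdge z)

variable {z}

lemma IsSimplePolygon.shift (h : IsSimplePolygon z) : IsSimplePolygon (fun i => z (i + c)) where
  three_le := h.three_le
  injective i j hij := add_right_cancel (h.injective hij)
  edges_disjoint i j hij := by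
    rw [polyEdge_shift, polyEdge_shift]; exact h.edges_disjoint _ _ fun he => hij (add_right_cancel he)
  vertex_notMem_edge i j := by
    rw [polyEdge_shift]; exact h.vertex_notMem_edge _ _

end Shift

lemma exists_lm_of_mem_openSegment {a b p : ℂ} (hp : p ∈ openSegment ℝ a b) : ∃ t, InI t ∧ lm a b t = p := by
  rw [openSegment_eq_image_lineMap] at hp
  obtain ⟨t, ht, rfl⟩ := hp
  exact ⟨t, ht, by simp [lm, AffineMap.lineMap_apply]; ring⟩

lemma lm_mem_openSegment {a b : ℂ} {t : ℝ} (ht : InI t) : lm a b t ∈ openSegment ℝ a b := by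
  rw [openSegment_eq_image_lineMap]
  exact ⟨t, ht, by simp [lm, AffineMap.lineMap_apply]; ring⟩

lemma lm_injective {a b : ℂ} (hab : a ≠ b) : Function.Injective (lm a b) := by
  intro s t h
  have h1 : (s - t) • (b - a) = 0 := by
    rw [← lm_sub_lm, h, sub_self]
  rcases smul_eq_zero.1 h1 with h | h
  · linarith
  · exact absurd (sub_eq_zero.1 h).symm hab

/-- An inner point splits a segment into two. -/
lemma openSegment_split {a b p : ℂ} (hab : a ≠ b) (hp : p ∈ openSegment ℝ a b) :
    openSegment ℝ a b = openSegment ℝ a p ∪ {p} ∪ openSegment ℝ p b ∧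
      Disjoint (openSegment ℝ a p) (openSegment ℝ p b) ∧ p ∉ openSegment ℝ a p ∧ p ∉ openSegment ℝ p b := by
  obtain ⟨t, ht, rfl⟩ := exists_lm_of_mem_openSegment hp
  have m1 : ∀ {z}, z ∈ openSegment ℝ a (lm a b t) ↔ ∃ s, 0 < s ∧ s < t ∧ lm a b s = z := by
    intro z
    constructor
    · intro hz
      obtain ⟨s, hs, rfl⟩ := exists_lm_of_mem_openSegment hz
      exact ⟨t * s, mul_pos ht.1 hs.1, by nlinarith [ht.1, hs.2], by rw [lm_left]⟩
    · rintro ⟨s, h0, h1, rfl⟩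
      have := lm_mem_openSegment (a := a) (b := lm a b t) (t := s / t)
        ⟨div_pos h0 ht.1, by rw [div_lt_one ht.1]; exact h1⟩
      rwa [lm_left, mul_div_cancel₀ _ ht.1.ne'] at this
  have m2 : ∀ {z}, z ∈ openSegment ℝ (lm a b t) b ↔ ∃ s, t < s ∧ s < 1 ∧ lm a b s = z := by
    intro z
    have ht' : 0 < 1 - t := by linarith [ht.2]
    constructor
    · intro hz
      obtain ⟨s, hs, rfl⟩ := exists_lm_of_mem_openSegment hz
      exact ⟨t + (1 - t) * s, by nlinarith [hs.1], by nlinarith [hs.2], by rw [lm_right]⟩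
    · rintro ⟨s, h0, h1, rfl⟩
      have := lm_mem_openSegment (a := lm a b t) (b := b) (t := (s - t) / (1 - t))
        ⟨div_pos (by linarith) ht', by rw [div_lt_one ht']; linarith⟩
      rwa [lm_right, mul_div_cancel₀ _ ht'.ne', add_sub_cancel] at this
  have inj := lm_injective hab
  refine ⟨?_, ?_, ?_, ?_⟩
  · ext z
    rw [mem_union, mem_union, m1, m2, mem_singleton_iff]
    constructor
    · intro hz
      obtain ⟨s, hs, rfl⟩ := exists_lm_of_mem_openSegment hz
      rcases lt_trichotomy s t with h | h | h
      exacts [.inl (.inl ⟨s, hs.1, h, rfl⟩), .inl (.inr (by rw [h])), .inr ⟨s, h, hs.2, rfl⟩]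
    · rintro ((⟨s, h0, h1, rfl⟩ | rfl) | ⟨s, h0, h1, rfl⟩)
      exacts [lm_mem_openSegment ⟨h0, h1.trans ht.2⟩, lm_mem_openSegment ht,
        lm_mem_openSegment ⟨ht.1.trans h0, h1⟩]
  · rw [Set.disjoint_left]
    intro z h h'
    obtain ⟨s, _, h1, rfl⟩ := m1.1 h
    obtain ⟨u, h2, _, h3⟩ := m2.1 h'
    have := inj h3; linarith
  · intro h
    obtain ⟨s, _, h1, h2⟩ := m1.1 h
    have := inj h2; linarith
  · intro h
    obtain ⟨s, h1, _, h2⟩ := m2.1 h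
    have := inj h2; linarith

section Snoc
variable {m : ℕ} {z : Fin (m + 1) → ℂ} {p : ℂ}

/-- The polygon `z` with the vertex `p` appended. -/
def snocPoly (z : Fin (m + 1) → ℂ) (p : ℂ) : Fin (m + 2) → ℂ := Fin.snoc (α := fun _ => ℂ) z p

lemma snocPoly_castSucc (i : Fin (m + 1)) : snocPoly z p i.castSucc = z i := Fin.snoc_castSucc ..
lemma snocPoly_last : snocPoly z p (Fin.last _) = p := Fin.snoc_last ..

lemma range_snocPoly : range (snocPoly z p) = insert p (range z) := by
  ext x
  simp only [mem_range, mem_insert_iff, Fin.exists_fin_succ', snocPoly_castSucc, snocPoly_last]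
  rw [or_comm, eq_comm (a := p)]

lemma polyEdge_snocPoly_last : polyEdge (snocPoly z p) (Fin.last _) = openSegment ℝ p (z 0) := by
  rw [polyEdge_succ, snocPoly_last, Fin.last_add_one, ← Fin.castSucc_zero, snocPoly_castSucc]

lemma polyEdge_snocPoly_castSucc_last :
    polyEdge (snocPoly z p) (Fin.last m).castSucc = openSegment ℝ (z (Fin.last m)) p := by
  rw [polyEdge_succ, snocPoly_castSucc, Fin.coeSucc_eq_succ, Fin.succ_last, snocPoly_last]

lemma polyEdge_snocPoly_castSucc {i : Fin (m + 1)} (hi : i ≠ Fin.last m) :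
    polyEdge (snocPoly z p) i.castSucc = polyEdge z i := by
  obtain ⟨j, rfl⟩ := Fin.exists_castSucc_eq.2 hi
  rw [polyEdge_succ, polyEdge_succ, snocPoly_castSucc, Fin.coeSucc_eq_succ]
  congr 1
  have : (Fin.castSucc j).succ = (j.succ).castSucc := rfl
  rw [this, snocPoly_castSucc]
  cases m with
  | zero => exact j.elim0
  | succ m => rw [Fin.coeSucc_eq_succ]

/-- Appending `p` replaces only the last edge, by its two halves. Other edges are made the last one
by a cyclic shift of the labels. -/
lemma addsVertices_snocPoly (hz : IsSimplePolygon z) (hp : p ∈ polyEdge z (Fin.last m)) :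
    AddsVertices z (snocPoly z p) := by
  have hE : polyEdge z (Fin.last m) = openSegment ℝ (z (Fin.last m)) (z 0) := by
    rw [polyEdge_succ, Fin.last_add_one]
  have hne : z (Fin.last m) ≠ z 0 := fun h => by
    have := hz.injective h
    have h3 := hz.three_le
    have := congrArg Fin.val this
    simp at this; omega
  obtain ⟨hs, hd, n1, n2⟩ := openSegment_split hne (hE ▸ hp)
  rw [← hE] at hs
  have A : openSegment ℝ (z (Fin.last m)) p ⊆ polyEdge z (Fin.last m) := by
    rw [hs]; exact subset_union_left.trans subset_union_left
  have B : openSegment ℝ p (z 0) ⊆ polyEdge z (Fin.last m) := by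
    rw [hs]; exact subset_union_right
  have hpz : p ∉ range z := by rintro ⟨i, rfl⟩; exact hz.vertex_notMem_edge i _ hp
  have edge : ∀ i : Fin (m + 1), polyEdge (snocPoly z p) i.castSucc ⊆ polyEdge z i := by
    intro i
    rcases eq_or_ne i (Fin.last m) with rfl | hi
    · rw [polyEdge_snocPoly_castSucc_last]; exact A
    · rw [polyEdge_snocPoly_castSucc hi]
  have edge_p : ∀ i : Fin (m + 1), p ∉ polyEdge (snocPoly z p) i.castSucc := by
    intro i
    rcases eq_or_ne i (Fin.last m) with rfl | hi
    · rw [polyEdge_snocPoly_castSucc_last]; exact n1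
    · rw [polyEdge_snocPoly_castSucc hi]
      exact fun h => (hz.edges_disjoint _ _ hi).le_bot ⟨h, hp⟩
  have edge_last : ∀ i : Fin (m + 1), Disjoint (polyEdge (snocPoly z p) i.castSucc) (openSegment ℝ p (z 0)) := by
    intro i
    rcases eq_or_ne i (Fin.last m) with rfl | hi
    · rw [polyEdge_snocPoly_castSucc_last]; exact hd
    · rw [polyEdge_snocPoly_castSucc hi]; exact (hz.edges_disjoint _ _ hi).mono_right B
  refine ⟨⟨by have := hz.three_le; omega, ?_, ?_, ?_⟩, ?_, by rw [range_snocPoly]; exact subset_insert _ _⟩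
  · exact Fin.snoc_injective_iff.2 ⟨hz.injective, hpz⟩
  · intro i j
    refine Fin.lastCases ?_ (fun i => ?_) i <;> refine Fin.lastCases ?_ (fun j => ?_) j
    · exact fun h => absurd rfl h
    · rw [polyEdge_snocPoly_last]; exact fun _ => (edge_last j).symm
    · rw [polyEdge_snocPoly_last]; exact fun _ => edge_last i
    · intro hij
      exact (hz.edges_disjoint i j fun h => hij (by rw [h])).mono (edge i) (edge j)
  · intro i j
    refine Fin.lastCases ?_ (fun i => ?_) i <;> refine Fin.lastCases ?_ (fun j => ?_) j
    · rw [polyEdge_snocPoly_last, snocPoly_last]; exact n2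
    · rw [snocPoly_last]; exact edge_p j
    · rw [polyEdge_snocPoly_last, snocPoly_castSucc]; exact fun h => hz.vertex_notMem_edge _ _ (B h)
    · rw [snocPoly_castSucc]; exact fun h => hz.vertex_notMem_edge _ _ (edge j h)
  · apply Subset.antisymm
    · rintro x (hx | hx)
      · rw [range_snocPoly] at hx
        rcases hx with rfl | hx
        exacts [.inr (mem_iUnion.2 ⟨_, hp⟩), .inl hx]
      · obtain ⟨i, hi⟩ := mem_iUnion.1 hx
        revert hi
        refine Fin.lastCases (fun hi => ?_) (fun i hi => ?_) i
        · rw [polyEdge_snocPoly_last] at hi; exact .inr (mem_iUnion.2 ⟨_, B hi⟩)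
        · exact .inr (mem_iUnion.2 ⟨_, edge i hi⟩)
    · rintro x (hx | hx)
      · exact .inl (by rw [range_snocPoly]; exact .inr hx)
      · obtain ⟨i, hi⟩ := mem_iUnion.1 hx
        rcases eq_or_ne i (Fin.last m) with rfl | hne
        · rw [hs] at hi
          rcases hi with (hi | hi) | hi
          · exact .inr (mem_iUnion.2 ⟨(Fin.last m).castSucc, by rwa [polyEdge_snocPoly_castSucc_last]⟩)
          · exact .inl (by rw [range_snocPoly]; exact .inl hi)
          · exact .inr (mem_iUnion.2 ⟨Fin.last _, by rwa [polyEdge_snocPoly_last]⟩)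
        · exact .inr (mem_iUnion.2 ⟨i.castSucc, by rwa [polyEdge_snocPoly_castSucc hne]⟩)

end Snoc

lemma AddsVertices.trans {n m k : ℕ} {z : Fin n → ℂ} {w : Fin m → ℂ} {v : Fin k → ℂ} (h : AddsVertices z w)
    (h' : AddsVertices w v) : AddsVertices z v :=
  ⟨h'.simple, h'.curve_eq.trans h.curve_eq, h.subset.trans h'.subset⟩

lemma exists_insert_vertex {n : ℕ} {z : Fin n → ℂ} (hz : IsSimplePolygon z) {p : ℂ} (hp : p ∈ polyCurve z)
    (hn : p ∉ range z) : ∃ w : Fin (n + 1) → ℂ, AddsVertices z w ∧ range w = insert p (range z) := by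
  obtain ⟨m, rfl⟩ : ∃ m, n = m + 1 := ⟨n - 1, by have := hz.three_le; omega⟩
  obtain ⟨i, hi⟩ := mem_iUnion.1 (hp.resolve_left hn)
  have h := addsVertices_snocPoly (hz.shift (i - Fin.last m)) (p := p)
    (by rw [polyEdge_shift, add_sub_cancel]; exact hi)
  refine ⟨_, ⟨h.simple, h.curve_eq.trans (polyCurve_shift _ _), ?_⟩, ?_⟩
  · have := h.subset; rwa [range_shift] at this
  · rw [range_snocPoly, range_shift]

/-- Finitely many points of a simple polygon can be added to its vertices. -/
theorem exists_addsVertices {n : ℕ} {z : Fin n → ℂ} (hz : IsSimplePolygon z) (S : Finset ℂ)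
    (hS : (S : Set ℂ) ⊆ polyCurve z) :
    ∃ (k : ℕ) (w : Fin (n + k) → ℂ), AddsVertices z w ∧ range w = range z ∪ S := by
  classical
  induction S using Finset.induction_on with
  | empty => exact ⟨0, z, ⟨hz, rfl, Subset.rfl⟩, by simp⟩
  | insert p S hp ih =>
    rw [Finset.coe_insert, insert_subset_iff] at hS
    obtain ⟨k, w, hw, hr⟩ := ih hS.2
    by_cases hpw : p ∈ range w
    · refine ⟨k, w, hw, ?_⟩
      rw [Finset.coe_insert, union_insert, ← hr, insert_eq_of_mem hpw]
    · obtain ⟨v, hv, hr'⟩ := exists_insert_vertex hw.simple (by rw [hw.curve_eq]; exact hS.1) hpw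
      refine ⟨k + 1, v, hw.trans hv, ?_⟩
      rw [hr', hr, Finset.coe_insert, union_insert]

end SinkMesh

/-! ### From tilings to planar straight line graphs. -/

namespace SinkMesh

/-- Points slightly to the left of an inner point of a side are in the interior. -/
lemma eventually_mem_interior {q : Fin 4 → ℂ} (h : Ccw (q 0) (q 1) (q 2) (q 3)) {j : Fin 4} {z v : ℂ}
    (hz : z ∈ polyEdge q j) (hv : 0 < cr (q (j + 1) - q j) v) :
    ∀ᶠ ε in nhdsWithin (0 : ℝ) (Ioi 0), z + ε • v ∈ interior (tile q) := by
  obtain ⟨h0, h1⟩ := el_polyEdge h hz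
  have key : ∀ i : Fin 4, ∀ᶠ ε in nhdsWithin (0 : ℝ) (Ioi 0), 0 < el (q i) (q (i + 1)) (z + ε • v) := by
    intro i
    rcases eq_or_ne i j with rfl | hij
    · filter_upwards [self_mem_nhdsWithin] with ε hε
      rw [el_add_smul, h0, zero_add]; exact mul_pos hε hv
    · have hc : Continuous fun ε : ℝ => el (q i) (q (i + 1)) (z + ε • v) :=
        (continuous_el _ _).comp (by fun_prop)
      refine (hc.continuousAt.eventually (lt_mem_nhds ?_)).filter_mono nhdsWithin_le_nhds
      simpa using h1 i hij
  filter_upwards [key 0, key 1, key 2, key 3] with ε a b c d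
  rw [tile, interior_quad h]
  exact ⟨a, b, c, d⟩

/-- Overlapping collinear segments, none of which contains an end of the other, are equal. -/
lemma openSegment_eq_of_collinear {a b c d z : ℂ} (hab : a ≠ b) (hcd : c ≠ d) (hcol : cr (b - a) (d - c) = 0)
    (hz : z ∈ openSegment ℝ a b) (hz' : z ∈ openSegment ℝ c d) (ha : a ∉ openSegment ℝ c d)
    (hb : b ∉ openSegment ℝ c d) (hc : c ∉ openSegment ℝ a b) (hd : d ∉ openSegment ℝ a b) :
    openSegment ℝ a b = openSegment ℝ c d := by
  obtain ⟨t, ht, rfl⟩ := exists_lm_of_mem_openSegment hz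
  obtain ⟨r, hr, hzr⟩ := exists_lm_of_mem_openSegment hz'
  have hn : 0 < (b - a).re ^ 2 + (b - a).im ^ 2 := by
    have := Complex.normSq_pos.2 (sub_ne_zero.2 hab.symm)
    rw [Complex.normSq_apply] at this; nlinarith
  obtain ⟨k, hk⟩ : ∃ k : ℝ, d - c = k • (b - a) := by
    refine ⟨dt (b - a) (d - c) / ((b - a).re ^ 2 + (b - a).im ^ 2), ?_⟩
    simp only [cr] at hcol
    apply Complex.ext <;> simp only [Complex.smul_re, Complex.smul_im, smul_eq_mul, dt] <;>
      rw [div_mul_eq_mul_div, eq_div_iff hn.ne']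
    · linear_combination (-(b - a).im) * hcol
    · linear_combination (b - a).re * hcol
  have hc' : c = lm a b (t - r * k) := by
    have : c = lm a b t - r • (d - c) := by rw [← hzr]; simp [lm]
    rw [this, hk]; simp only [lm, Complex.real_smul]; push_cast; ring
  have hd' : d = lm a b (t - r * k + k) := by
    have : d = c + (d - c) := by ring
    rw [this, hk]; nth_rewrite 1 [hc']; simp only [lm, Complex.real_smul]; push_cast; ring
  obtain ⟨s, hs⟩ : ∃ s, s = t - r * k := ⟨_, rfl⟩
  rw [← hs] at hc' hd'
  have hk0 : k ≠ 0 := by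
    rintro rfl; rw [zero_smul] at hk; exact hcd (sub_eq_zero.1 hk).symm
  have e0 : ∀ x : ℝ, InI x → lm c d x = lm a b (s + k * x) := fun x _ => by
    rw [hc', hd', lm_lm]; congr 1; ring
  have na : ∀ x : ℝ, InI x → s + k * x ≠ 0 := fun x hx h => ha (by
    have := lm_mem_openSegment (a := c) (b := d) hx; rwa [e0 x hx, h, lm_zero] at this)
  have nb : ∀ x : ℝ, InI x → s + k * x ≠ 1 := fun x hx h => hb (by
    have := lm_mem_openSegment (a := c) (b := d) hx; rwa [e0 x hx, h, lm_one] at this)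
  have nc : ¬ InI s := fun h => hc (by rw [hc']; exact lm_mem_openSegment h)
  have nd : ¬ InI (s + k) := fun h => hd (by rw [hd']; exact lm_mem_openSegment h)
  have hts : t = s + k * r := by rw [hs]; ring
  -- On the line parametrised by `a` and `b`, the second segment runs from `s` to `s + k` and meets
  -- the interval between 0 and 1. As no end of either interval is inside the other one, they
  -- coincide, possibly with reversed direction.
  have fin : (s = 0 ∧ s + k = 1) ∨ (s = 1 ∧ s + k = 0) := by
    have inI : ∀ {y : ℝ}, InI ((y - s) / k) → s + k * ((y - s) / k) = y := fun {y} _ => by field_simp; ring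
    rcases lt_or_gt_of_ne hk0 with hk | hk
    · right
      have u1 : 1 ≤ s := by
        by_contra hlt; exact nc ⟨by nlinarith [ht.1, hr.1, hr.2], by linarith⟩
      have u2 : s + k ≤ 0 := by
        by_contra hlt; exact nd ⟨by linarith, by nlinarith [ht.2, hr.1, hr.2]⟩
      constructor
      · refine le_antisymm ?_ u1
        by_contra! hlt
        have hI : InI ((1 - s) / k) := ⟨div_pos_of_neg_of_neg (by linarith) hk, by
          rw [div_lt_one_of_neg hk]; linarith⟩
        exact nb _ hI (inI hI)
      · refine le_antisymm u2 ?_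
        by_contra! hlt
        have hI : InI ((0 - s) / k) := ⟨div_pos_of_neg_of_neg (by linarith) hk, by
          rw [div_lt_one_of_neg hk]; linarith⟩
        exact na _ hI (inI hI)
    · left
      have u1 : s ≤ 0 := by
        by_contra hlt; exact nc ⟨by linarith, by nlinarith [ht.2, hr.1, hr.2]⟩
      have u2 : 1 ≤ s + k := by
        by_contra hlt; exact nd ⟨by nlinarith [ht.1, hr.1, hr.2], by linarith⟩
      constructor
      · refine le_antisymm u1 ?_
        by_contra! hlt
        have hI : InI ((0 - s) / k) := ⟨div_pos (by linarith) hk, by rw [div_lt_one hk]; linarith⟩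
        exact na _ hI (inI hI)
      · refine le_antisymm ?_ u2
        by_contra! hlt
        have hI : InI ((1 - s) / k) := ⟨div_pos (by linarith) hk, by rw [div_lt_one hk]; linarith⟩
        exact nb _ hI (inI hI)
  rcases fin with ⟨h1, h2⟩ | ⟨h1, h2⟩
  · rw [h1, lm_zero] at hc'; rw [h2, lm_one] at hd'; rw [hc', hd']
  · rw [h1, lm_one] at hc'; rw [h2, lm_zero] at hd'; rw [hc', hd', openSegment_symm]

namespace IsMesh
variable {T : Finset (Fin 4 → ℂ)} {D V : Set ℂ}

lemma vertex_notMem_edge (h : IsMesh T D V) {q q' : Fin 4 → ℂ} (hq : q ∈ T) (hq' : q' ∈ T) (i j : Fin 4) :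
    q i ∉ polyEdge q' j := by
  intro hi
  have hc := (h.nice q' hq').ccw
  have h1 : q i ∈ tile q' := by
    have : q i ∈ frontier (tile q') := by
      rw [← polyCurve_eq_frontier hc]; exact .inr (mem_iUnion.2 ⟨j, hi⟩)
    exact (isClosed_quad _ _ _ _).frontier_subset this
  obtain ⟨k, hk⟩ := h.conf q hq q' hq' i h1
  rw [← hk] at hi
  exact hc.isSimplePolygon.vertex_notMem_edge _ _ hi

/-- Sides that cross at an angle would make the interiors of the two tiles meet near the crossing.
Overlapping collinear sides are equal, because conformity keeps corners out of open sides. -/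
lemma edge_eq_or_disjoint (h : IsMesh T D V) {q q' : Fin 4 → ℂ} (hq : q ∈ T) (hq' : q' ∈ T) (i j : Fin 4) :
    polyEdge q i = polyEdge q' j ∨ Disjoint (polyEdge q i) (polyEdge q' j) := by
  have hc := (h.nice q hq).ccw
  have hc' := (h.nice q' hq').ccw
  rw [or_iff_not_imp_right]
  intro hnd
  obtain ⟨z, hz, hz'⟩ := Set.not_disjoint_iff.1 hnd
  rcases eq_or_ne q q' with rfl | hne
  · by_contra hne
    exact hnd (hc.isSimplePolygon.edges_disjoint i j fun h => hne (by rw [h]))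
  have n1 := h.vertex_notMem_edge hq hq' i j
  have n2 := h.vertex_notMem_edge hq hq' (i + 1) j
  have n3 := h.vertex_notMem_edge hq' hq j i
  have n4 := h.vertex_notMem_edge hq' hq (j + 1) i
  by_cases hcr : cr (q (i + 1) - q i) (q' (j + 1) - q' j) = 0
  · rw [polyEdge_four, polyEdge_four] at *
    exact openSegment_eq_of_collinear (hc.cyc i).ne (hc'.cyc j).ne hcr hz hz' n1 n2 n3 n4
  · exfalso
    obtain ⟨x, hx⟩ : ∃ x, x = q (i + 1) - q i := ⟨_, rfl⟩
    obtain ⟨y, hy⟩ : ∃ y, y = q' (j + 1) - q' j := ⟨_, rfl⟩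
    rw [← hx, ← hy] at hcr
    -- A vector pointing strictly to the left of both sides. Moving a common point slightly along it
    -- leads into both interiors.
    have v1 : cr x ((1 / cr x y) • (y - x)) = 1 := by
      rw [cr_smul_right, show cr x (y - x) = cr x y by simp [cr]; ring]; field_simp
    have v2 : cr y ((1 / cr x y) • (y - x)) = 1 := by
      rw [cr_smul_right, show cr y (y - x) = cr x y by simp [cr]; ring]; field_simp
    have f1 := eventually_mem_interior hc hz (v := (1 / cr x y) • (y - x)) (by rw [← hx, v1]; exact one_pos)
    have f2 := eventually_mem_interior hc' hz' (v := (1 / cr x y) • (y - x)) (by rw [← hy, v2]; exact one_pos)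
    obtain ⟨ε, h1, h2⟩ := (f1.and f2).exists
    exact (h.disj q hq q' hq' hne).le_bot ⟨h1, h2⟩

/-- The planar straight line graph formed by the sides of the tiles. -/
theorem exists_pslg (h : IsMesh T D V) : ∃ Γ : PSLG, (Γ.verts : Set ℂ) = ⋃ q ∈ T, range q ∧
    Γ.carrier = ⋃ q ∈ T, frontier (tile q) := by
  classical
  let E : Finset (ℂ × ℂ) := T.biUnion fun q => Finset.univ.image fun i : Fin 4 => (q i, q (i + 1))
  have hE : ∀ {e}, e ∈ E → ∃ q ∈ T, ∃ i, e = (q i, q (i + 1)) := by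
    intro e he
    simp only [E, Finset.mem_biUnion, Finset.mem_image, Finset.mem_univ, true_and] at he
    obtain ⟨q, hq, i, rfl⟩ := he
    exact ⟨q, hq, i, rfl⟩
  -- Neighbouring tiles list their common side in opposite directions. One ordered pair is kept for
  -- each open segment, so that distinct edges of the graph are disjoint.
  obtain ⟨E', hE'E, hinj, himg⟩ := Finset.exists_subset_injOn_image_eq_of_surjOn E
    (E.image fun e : ℂ × ℂ => openSegment ℝ e.1 e.2) (f := fun e : ℂ × ℂ => openSegment ℝ e.1 e.2)
    (by intro x hx; simpa using hx)
  refine ⟨⟨T.biUnion fun q => Finset.univ.image q, E', ?_, ?_, ?_, ?_, ?_⟩, ?_, ?_⟩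
  · intro e he
    obtain ⟨q, hq, i, rfl⟩ := hE (hE'E he)
    exact ((h.nice q hq).ccw.cyc i).ne
  · intro e he
    obtain ⟨q, hq, i, rfl⟩ := hE (hE'E he)
    simp only [Finset.mem_biUnion, Finset.mem_image, Finset.mem_univ, true_and]
    exact ⟨q, hq, i, rfl⟩
  · intro e he
    obtain ⟨q, hq, i, rfl⟩ := hE (hE'E he)
    simp only [Finset.mem_biUnion, Finset.mem_image, Finset.mem_univ, true_and]
    exact ⟨q, hq, i + 1, rfl⟩
  · intro e he v hv
    obtain ⟨q, hq, i, rfl⟩ := hE (hE'E he)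
    simp only [Finset.mem_biUnion, Finset.mem_image, Finset.mem_univ, true_and] at hv
    obtain ⟨q', hq', j, rfl⟩ := hv
    have := h.vertex_notMem_edge hq' hq j i
    rwa [polyEdge_four] at this
  · intro e he f hf hef
    have hne : openSegment ℝ e.1 e.2 ≠ openSegment ℝ f.1 f.2 := fun heq => hef (hinj he hf heq)
    obtain ⟨q, hq, i, rfl⟩ := hE (hE'E he)
    obtain ⟨q', hq', j, rfl⟩ := hE (hE'E hf)
    have := h.edge_eq_or_disjoint hq hq' i j
    rw [polyEdge_four, polyEdge_four] at this
    exact this.resolve_left hne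
  · ext z; simp
  · have hcurve : ∀ q ∈ T, frontier (tile q) = polyCurve q := fun q hq =>
      (polyCurve_eq_frontier (h.nice q hq).ccw).symm
    rw [iUnion₂_congr hcurve]
    ext z
    simp only [PSLG.carrier, polyCurve, mem_union, mem_iUnion, Finset.coe_biUnion, Finset.coe_image,
      Finset.coe_univ, image_univ, Finset.mem_coe, exists_prop]
    constructor
    · rintro (⟨q, hq, hz⟩ | ⟨e, he, hz⟩)
      · exact ⟨q, hq, .inl hz⟩
      · obtain ⟨q, hq, i, rfl⟩ := hE (hE'E he)
        exact ⟨q, hq, .inr ⟨i, by rwa [polyEdge_four]⟩⟩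
    · rintro ⟨q, hq, hz | ⟨i, hz⟩⟩
      · exact .inl ⟨q, hq, hz⟩
      · right
        have hm : openSegment ℝ (q i) (q (i + 1)) ∈ E.image fun e : ℂ × ℂ => openSegment ℝ e.1 e.2 := by
          refine Finset.mem_image.2 ⟨(q i, q (i + 1)), ?_, rfl⟩
          simp only [E, Finset.mem_biUnion, Finset.mem_image, Finset.mem_univ, true_and]
          exact ⟨q, hq, i, rfl⟩
        rw [← himg] at hm
        obtain ⟨e, he, hee⟩ := Finset.mem_image.1 hm
        refine ⟨e, he, ?_⟩
        rw [polyEdge_four, ← hee] at hz; exact hz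

/-- A nice mesh of a convex quadrilateral as a planar straight line graph. -/
theorem exists_isNiceQuadMesh {p₀ p₁ p₂ p₃ : ℂ} {R : Set ℂ} {n : ℕ} {w : Fin n → ℂ}
    (h : IsMesh T (quad p₀ p₁ p₂ p₃) R) (hc : Ccw p₀ p₁ p₂ p₃) (hw : polyCurve w = frontier (quad p₀ p₁ p₂ p₃))
    (hR : range w = R) :
    ∃ Γ : PSLG, Γ.IsNiceQuadMesh w ∧ Γ.Extends w ∧ Γ.faces.Finite ∧ Γ.faces.ncard ≤ T.card := by
  obtain ⟨Γ, hv, hcar⟩ := h.exists_pslg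
  have hfaces : Γ.faces = (fun q => interior (tile q)) '' T := by
    rw [PSLG.faces, hcar]
    exact boundedComponents_tiling hc (fun q hq => (h.nice q hq).ccw) h.disj h.cover
  have hRw : range w ⊆ frontier (quad p₀ p₁ p₂ p₃) := by rw [← hw]; exact subset_union_left
  have hmem : ∀ z ∈ frontier (quad p₀ p₁ p₂ p₃), z ∈ Γ.verts ↔ z ∈ range w := by
    intro z hz
    rw [hR, h.bdry z hz, ← Finset.mem_coe, hv]; simp
  refine ⟨Γ, ⟨?_, ?_, ?_, ?_⟩, ?_, ?_, ?_⟩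
  · intro z hz; exact (hmem z (hRw hz)).2 hz
  · rw [hw, hcar]
    intro z hz
    have hzD := (isClosed_quad _ _ _ _).frontier_subset hz
    rw [← h.cover] at hzD
    obtain ⟨q, hq, hzq⟩ := mem_iUnion₂.1 hzD
    exact mem_iUnion₂.2 ⟨q, hq, subset_closure hzq, fun hi => hz.2 (interior_mono (h.tile_subset hq) hi)⟩
  · rw [hw, polynomialHull_frontier hc, hcar]
    exact iUnion₂_subset fun q hq => (isClosed_quad _ _ _ _).frontier_subset.trans (h.tile_subset hq)
  · intro F hF
    rw [hfaces] at hF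
    obtain ⟨q, hq, rfl⟩ := hF
    have hn := h.nice q hq
    refine ⟨q, hn.isNiceQuad, polyInterior_eq_interior hn.ccw, ?_⟩
    rw [hv]
    apply Subset.antisymm
    · rintro z ⟨hz, hz'⟩
      obtain ⟨q', hq', i, rfl⟩ := mem_iUnion₂.1 hz
      rw [polyCurve_eq_frontier hn.ccw] at hz'
      exact h.conf q' hq' q hq i ((isClosed_quad _ _ _ _).frontier_subset hz')
    · intro z hz
      exact ⟨mem_iUnion₂.2 ⟨q, hq, hz⟩, .inl hz⟩
  · rw [PSLG.Extends, hw]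
    ext z
    constructor
    · rintro ⟨h1, h2⟩; exact (hmem z h2).1 h1
    · intro hz; exact ⟨(hmem z (hRw hz)).2 hz, hRw hz⟩
  · rw [hfaces]; exact T.finite_toSet.image _
  · rw [hfaces]; exact (ncard_image_le T.finite_toSet).trans (by rw [ncard_coe_finset])

end IsMesh

end SinkMesh

/-! ### Counting boundary points side by side. -/

namespace SinkMesh
open scoped Classical in
/-- The subdivision of a segment by the points of a finite set. -/
lemma exists_sideSet {a b : ℂ} (hab : a ≠ b) {R : Finset ℂ} (ha : a ∈ R) (hb : b ∈ R) :
    ∃ S : Finset ℝ, IsSub S ∧ (∀ t, t ∈ S ↔ 0 ≤ t ∧ t ≤ 1 ∧ lm a b t ∈ R) ∧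
      S.card = (R.filter (· ∈ openSegment ℝ a b)).card + 2 := by
  have inj := lm_injective hab
  set F := R.filter (· ∈ openSegment ℝ a b) with hF
  set S₀ := F.preimage (lm a b) inj.injOn with hS₀
  have mem₀ : ∀ t, t ∈ S₀ ↔ InI t ∧ lm a b t ∈ R := by
    intro t
    rw [hS₀, Finset.mem_preimage, hF, Finset.mem_filter]
    constructor
    · rintro ⟨h1, h2⟩
      obtain ⟨s, hs, h3⟩ := exists_lm_of_mem_openSegment h2
      rw [← inj h3]; exact ⟨hs, by rwa [h3]⟩
    · rintro ⟨h1, h2⟩; exact ⟨h2, lm_mem_openSegment h1⟩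
  have card₀ : S₀.card = F.card := by
    rw [← Finset.card_image_of_injective S₀ inj]
    congr 1
    ext z
    constructor
    · intro hz
      obtain ⟨t, ht, rfl⟩ := Finset.mem_image.1 hz
      exact Finset.mem_preimage.1 ht
    · intro hz
      obtain ⟨t, ht, rfl⟩ := exists_lm_of_mem_openSegment (Finset.mem_filter.1 hz).2
      exact Finset.mem_image.2 ⟨t, Finset.mem_preimage.2 hz, rfl⟩
  have h1 : (1 : ℝ) ∉ S₀ := fun h => lt_irrefl _ ((mem₀ 1).1 h).1.2
  have h0 : (0 : ℝ) ∉ insert 1 S₀ := fun h => by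
    rcases Finset.mem_insert.1 h with h | h
    exacts [zero_ne_one h, lt_irrefl _ ((mem₀ 0).1 h).1.1]
  have mem : ∀ t, t ∈ insert 0 (insert 1 S₀) ↔ 0 ≤ t ∧ t ≤ 1 ∧ lm a b t ∈ R := by
    intro t
    rw [Finset.mem_insert, Finset.mem_insert, mem₀]
    constructor
    · rintro (rfl | rfl | ⟨h, h'⟩)
      · exact ⟨le_rfl, zero_le_one, by rwa [lm_zero]⟩
      · exact ⟨zero_le_one, le_rfl, by rwa [lm_one]⟩
      · exact ⟨h.1.le, h.2.le, h'⟩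
    · rintro ⟨h, h', h''⟩
      rcases h.eq_or_lt with h | h
      · exact .inl h.symm
      rcases h'.eq_or_lt with h' | h'
      · exact .inr (.inl h')
      · exact .inr (.inr ⟨⟨h, h'⟩, h''⟩)
  refine ⟨insert 0 (insert 1 S₀), ⟨?_, ?_, ?_, ?_⟩, mem, ?_⟩
  · simp
  · simp
  · intro t ht; exact ((mem t).1 ht).1
  · intro t ht; exact ((mem t).1 ht).2.1
  · rw [Finset.card_insert_of_notMem h0, Finset.card_insert_of_notMem h1, card₀]

open scoped Classical in
/-- The number of points of `R` on the `i`-th open side of `q`. -/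
noncomputable def cnt (q : Fin 4 → ℂ) (R : Finset ℂ) (i : Fin 4) : ℕ := (R.filter (· ∈ polyEdge q i)).card

lemma card_eq_sum_cnt {q : Fin 4 → ℂ} (h : IsSimplePolygon q) {R : Finset ℂ} (hq : range q ⊆ (R : Set ℂ))
    (hR : (R : Set ℂ) ⊆ polyCurve q) : R.card = 4 + ∑ i, cnt q R i := by
  classical
  have e : R = Finset.univ.image q ∪ Finset.univ.biUnion fun i => R.filter (· ∈ polyEdge q i) := by
    ext z
    simp only [Finset.mem_union, Finset.mem_image, Finset.mem_univ, true_and, Finset.mem_biUnion, Finset.mem_filter]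
    constructor
    · intro hz
      rcases hR hz with h | h
      · exact .inl h
      · obtain ⟨i, hi⟩ := mem_iUnion.1 h; exact .inr ⟨i, hz, hi⟩
    · rintro (h | ⟨i, h, _⟩)
      exacts [hq h, h]
  have hd : Disjoint (Finset.univ.image q) (Finset.univ.biUnion fun i => R.filter (· ∈ polyEdge q i)) := by
    rw [Finset.disjoint_left]
    intro z hz hz'
    simp only [Finset.mem_image, Finset.mem_univ, true_and, Finset.mem_biUnion, Finset.mem_filter] at hz hz'
    obtain ⟨i, rfl⟩ := hz
    obtain ⟨j, _, hj⟩ := hz'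
    exact h.vertex_notMem_edge i j hj
  conv_lhs => rw [e]
  rw [Finset.card_union_of_disjoint hd, Finset.card_image_of_injective _ h.injective, Finset.card_biUnion]
  · unfold cnt; simp
  · intro i _ j _ hij
    rw [Function.onFun, Finset.disjoint_left]
    intro z hz hz'
    exact (h.edges_disjoint i j hij).le_bot ⟨(Finset.mem_filter.1 hz).2, (Finset.mem_filter.1 hz').2⟩

lemma cnt_add_ncard {q : Fin 4 → ℂ} (h : IsSimplePolygon q) {R R' : Finset ℂ} (hRR : R ⊆ R') {i j : Fin 4}
    (hij : i ≠ j) : cnt q R' i + cnt q R' j = cnt q R i + cnt q R j +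
      (((R' : Set ℂ) \ R) ∩ (polyEdge q i ∪ polyEdge q j)).ncard := by
  classical
  have e : ((R' : Set ℂ) \ R) ∩ (polyEdge q i ∪ polyEdge q j) =
      (((R' \ R).filter (· ∈ polyEdge q i) ∪ (R' \ R).filter (· ∈ polyEdge q j) : Finset ℂ) : Set ℂ) := by
    ext z; simp only [mem_inter_iff, mem_sdiff, mem_union, Finset.coe_union, Finset.coe_filter, Finset.mem_sdiff,
      Finset.mem_coe, mem_ofPred_eq]; tauto
  have c : ∀ k, cnt q R' k = cnt q R k + ((R' \ R).filter (· ∈ polyEdge q k)).card := by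
    intro k
    unfold cnt
    rw [← Finset.card_union_of_disjoint, ← Finset.filter_union, Finset.union_sdiff_of_subset hRR]
    exact Finset.disjoint_filter_filter Finset.disjoint_sdiff
  rw [e, ncard_coe_finset, Finset.card_union_of_disjoint, c, c]
  · ring
  · rw [Finset.disjoint_left]
    intro z hz hzj
    exact (h.edges_disjoint i j hij).le_bot ⟨(Finset.mem_filter.1 hz).2, (Finset.mem_filter.1 hzj).2⟩

/-- A subdivision can be refined by any number of points. -/
lemma IsSub.exists_card_eq {X : Finset ℝ} (hX : IsSub X) (k : ℕ) :
    ∃ Y, IsSub Y ∧ X ⊆ Y ∧ Y.card = X.card + k := by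
  classical
  induction k with
  | zero => exact ⟨X, hX, Subset.rfl, rfl⟩
  | succ k ih =>
    obtain ⟨Y, hY, hXY, hc⟩ := ih
    obtain ⟨t, ht, hn⟩ := (Ioo_infinite (zero_lt_one' ℝ)).exists_notMem_finset Y
    refine ⟨insert t Y, ⟨Finset.mem_insert_of_mem hY.zero_mem, Finset.mem_insert_of_mem hY.one_mem, ?_, ?_⟩,
      hXY.trans (Finset.subset_insert _ _), by rw [Finset.card_insert_of_notMem hn, hc]; ring⟩
    · intro s hs; rcases Finset.mem_insert.1 hs with rfl | hs; exacts [ht.1.le, hY.nonneg s hs]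
    · intro s hs; rcases Finset.mem_insert.1 hs with rfl | hs; exacts [ht.2.le, hY.le_one s hs]

lemma exists_vertices (q : Fin 4 → ℂ) {Xb Xr Xt Xl : Finset ℝ} (sb : IsSub Xb)
    (sr : IsSub Xr) (st : IsSub Xt) (sl : IsSub Xl) :
    ∃ R : Finset ℂ, (R : Set ℂ) = vq (q 0) (q 1) (q 2) (q 3) Xb Xr Xt Xl ∧ range q ⊆ (R : Set ℂ) ∧
      (R : Set ℂ) ⊆ polyCurve q := by
  classical
  refine ⟨Xb.image (lm (q 0) (q 1)) ∪ Xr.image (lm (q 1) (q 2)) ∪ Xt.image (lm (q 3) (q 2)) ∪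
    Xl.image (lm (q 0) (q 3)), by simp only [Finset.coe_union, Finset.coe_image]; rfl, ?_, ?_⟩
  · rintro _ ⟨i, rfl⟩
    simp only [Finset.coe_union, Finset.coe_image, mem_union, mem_image, Finset.mem_coe]
    fin_cases i
    · exact .inr ⟨0, sl.zero_mem, lm_zero _ _⟩
    · exact .inl (.inl (.inr ⟨0, sr.zero_mem, lm_zero _ _⟩))
    · exact .inl (.inr ⟨1, st.one_mem, lm_one _ _⟩)
    · exact .inr ⟨1, sl.one_mem, lm_one _ _⟩
  · have e : ∀ {p p' : ℂ} {X : Finset ℝ}, IsSub X → (X.image (lm p p') : Set ℂ) ⊆ segment ℝ p p' := by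
      intro p p' X hX
      have := pts_subset_segment p p' hX
      simpa [pts] using this
    rw [polyCurve_eq_iUnion]
    simp only [Finset.coe_union, union_subset_iff]
    refine ⟨⟨⟨(e sb).trans (subset_iUnion_of_subset 0 Subset.rfl), (e sr).trans (subset_iUnion_of_subset 1 Subset.rfl)⟩,
      (e st).trans (subset_iUnion_of_subset 2 ?_)⟩, (e sl).trans (subset_iUnion_of_subset 3 ?_)⟩
    · rw [segment_symm]; exact Subset.rfl
    · rw [segment_symm]; exact Subset.rfl

/-- The four side subdivisions of a finite set of boundary points. -/
lemma exists_sideSets {q : Fin 4 → ℂ} (h : Ccw (q 0) (q 1) (q 2) (q 3)) {R : Finset ℂ} (hq : range q ⊆ (R : Set ℂ)) :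
    ∃ Sb Sr St Sl : Finset ℝ, (IsSub Sb ∧ IsSub Sr ∧ IsSub St ∧ IsSub Sl) ∧
      ((∀ t, t ∈ Sb ↔ 0 ≤ t ∧ t ≤ 1 ∧ lm (q 0) (q 1) t ∈ R) ∧ (∀ t, t ∈ Sr ↔ 0 ≤ t ∧ t ≤ 1 ∧ lm (q 1) (q 2) t ∈ R) ∧
        (∀ t, t ∈ St ↔ 0 ≤ t ∧ t ≤ 1 ∧ lm (q 3) (q 2) t ∈ R) ∧ (∀ t, t ∈ Sl ↔ 0 ≤ t ∧ t ≤ 1 ∧ lm (q 0) (q 3) t ∈ R)) ∧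
      Sb.card = cnt q R 0 + 2 ∧ Sr.card = cnt q R 1 + 2 ∧ St.card = cnt q R 2 + 2 ∧ Sl.card = cnt q R 3 + 2 := by
  classical
  have hm : ∀ i, q i ∈ R := fun i => hq ⟨i, rfl⟩
  obtain ⟨Sb, b1, b2, b3⟩ := exists_sideSet h.ne (hm 0) (hm 1)
  obtain ⟨Sr, r1, r2, r3⟩ := exists_sideSet h.rot.ne (hm 1) (hm 2)
  obtain ⟨St, t1, t2, t3⟩ := exists_sideSet h.rot.rot.ne.symm (hm 3) (hm 2)
  obtain ⟨Sl, l1, l2, l3⟩ := exists_sideSet h.rot.rot.rot.ne.symm (hm 0) (hm 3)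
  rw [openSegment_symm] at t3 l3
  refine ⟨Sb, Sr, St, Sl, ⟨b1, r1, t1, l1⟩, ⟨b2, r2, t2, l2⟩, ?_⟩
  simp only [cnt, polyEdge_four]
  refine ⟨?_, ?_, ?_, ?_⟩
  · rw [b3]; rfl
  · rw [r3]; rfl
  · rw [t3]; rfl
  · rw [l3]; rfl

lemma mem_vq_iff {q : Fin 4 → ℂ} (h : Ccw (q 0) (q 1) (q 2) (q 3)) {R : Finset ℂ} {Sb Sr St Sl : Finset ℝ}
    (hR : (R : Set ℂ) ⊆ polyCurve q) (hb : ∀ t, t ∈ Sb ↔ 0 ≤ t ∧ t ≤ 1 ∧ lm (q 0) (q 1) t ∈ R)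
    (hr : ∀ t, t ∈ Sr ↔ 0 ≤ t ∧ t ≤ 1 ∧ lm (q 1) (q 2) t ∈ R)
    (ht : ∀ t, t ∈ St ↔ 0 ≤ t ∧ t ≤ 1 ∧ lm (q 3) (q 2) t ∈ R)
    (hl : ∀ t, t ∈ Sl ↔ 0 ≤ t ∧ t ≤ 1 ∧ lm (q 0) (q 3) t ∈ R) (z : ℂ) :
    z ∈ R ↔ z ∈ vq (q 0) (q 1) (q 2) (q 3) Sb Sr St Sl := by
  have key : ∀ {a b : ℂ} {S : Finset ℝ}, (∀ t, t ∈ S ↔ 0 ≤ t ∧ t ≤ 1 ∧ lm a b t ∈ R) →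
      (z ∈ pts a b S ↔ z ∈ R ∧ z ∈ segment ℝ a b) := by
    intro a b S hS
    constructor
    · rintro ⟨t, ht, rfl⟩
      obtain ⟨h0, h1, h2⟩ := (hS t).1 ht
      exact ⟨h2, lm_mem_segment h0 h1⟩
    · rintro ⟨h1, h2⟩
      rw [segment_eq_image_lineMap] at h2
      obtain ⟨t, ht, rfl⟩ := h2
      have e : lm a b t = AffineMap.lineMap a b t := by simp [lm, AffineMap.lineMap_apply]; ring
      exact ⟨t, (hS t).2 ⟨ht.1, ht.2, by rwa [e]⟩, e⟩
  simp only [vq, mem_union]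
  rw [key hb, key hr, key ht, key hl]
  constructor
  · intro hz
    have := hR hz
    rw [polyCurve_eq_frontier h, tile, frontier_quad h, segment_symm ℝ (q 2), segment_symm ℝ (q 3) (q 0)] at this
    rcases this with ((h | h) | h) | h
    exacts [.inl (.inl (.inl ⟨hz, h⟩)), .inl (.inl (.inr ⟨hz, h⟩)), .inl (.inr ⟨hz, h⟩), .inr ⟨hz, h⟩]
  · rintro (((h | h) | h) | h) <;> exact h.1

end SinkMesh

/-! ### Boundary points that make a nice quadrilateral a sink. -/

namespace SinkMesh

lemma mem_pts_of_vq {p₀ p₁ p₂ p₃ z : ℂ} {Sb Sr St Sl : Finset ℝ} (h : Ccw p₀ p₁ p₂ p₃) (sb : IsSub Sb)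
    (sr : IsSub Sr) (st : IsSub St) (sl : IsSub Sl) (hz : z ∈ vq p₀ p₁ p₂ p₃ Sb Sr St Sl) :
    (el p₀ p₁ z ≤ 0 → z ∈ pts p₀ p₁ Sb) ∧ (el p₁ p₂ z ≤ 0 → z ∈ pts p₁ p₂ Sr) ∧
      (el p₂ p₃ z ≤ 0 → z ∈ pts p₃ p₂ St) ∧ (el p₃ p₀ z ≤ 0 → z ∈ pts p₀ p₃ Sl) := by
  have h1 := hz
  rw [← vq_rot] at h1
  have h2 := h1
  rw [← vq_rot] at h2
  have h3 := h2
  rw [← vq_rot] at h3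
  refine ⟨fun he => ?_, fun he => ?_, fun he => ?_, fun he => ?_⟩
  · have := mem_right_of_el h.rot.rot.rot sl.rev sb.rev.rev sr.rev st.rev.rev h3 he
    rwa [rev_rev] at this
  · exact mem_right_of_el h sb sr st sl hz he
  · have := mem_right_of_el h.rot sr st.rev sl sb.rev h1 he
    rwa [pts_rev] at this
  · have := mem_right_of_el h.rot.rot st.rev sl.rev sb.rev sr.rev h2 he
    rwa [pts_rev] at this

/-- A vertex on the line of a side already belongs to the list of that side, so nothing is
contributed by other sides. The difference of 2 comes from the corners. -/
lemma cnt_of_vq {q : Fin 4 → ℂ} (h : Ccw (q 0) (q 1) (q 2) (q 3)) {R : Finset ℂ} {Xb Xr Xt Xl : Finset ℝ}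
    (sb : IsSub Xb) (sr : IsSub Xr) (st : IsSub Xt) (sl : IsSub Xl)
    (hR : (R : Set ℂ) = vq (q 0) (q 1) (q 2) (q 3) Xb Xr Xt Xl) (hq : range q ⊆ (R : Set ℂ)) :
    Xb.card = cnt q R 0 + 2 ∧ Xr.card = cnt q R 1 + 2 ∧ Xt.card = cnt q R 2 + 2 ∧ Xl.card = cnt q R 3 + 2 := by
  obtain ⟨Sb, Sr, St, Sl, -, ⟨b, r, t, l⟩, cb, cr, ct, cl⟩ := exists_sideSets h hq
  have hRm : ∀ {z}, z ∈ R ↔ z ∈ vq (q 0) (q 1) (q 2) (q 3) Xb Xr Xt Xl := fun {z} => by rw [← hR]; rfl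
  have key : ∀ {a a' : ℂ} {X S : Finset ℝ}, a ≠ a' → IsSub X → (∀ t, t ∈ S ↔ 0 ≤ t ∧ t ≤ 1 ∧ lm a a' t ∈ R) →
      (∀ {t}, lm a a' t ∈ R → lm a a' t ∈ pts a a' X) → (∀ {t}, t ∈ X → lm a a' t ∈ R) → X = S := by
    intro a a' X S hne hX hS h1 h2
    ext t
    rw [hS]
    constructor
    · intro ht; exact ⟨hX.nonneg t ht, hX.le_one t ht, h2 ht⟩
    · rintro ⟨_, _, ht⟩
      obtain ⟨s, hs, hst⟩ := h1 ht
      rwa [← lm_injective hne hst]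
  have e : ∀ (a a' : ℂ) (t : ℝ), el a a' (lm a a' t) = 0 := fun a a' t => by
    rw [el_lm, el_self_left, el_self_right]; ring
  have e' : ∀ (a a' : ℂ) (t : ℝ), el a' a (lm a a' t) = 0 := fun a a' t => by rw [el_swap, e, neg_zero]
  have f1 : Xb = Sb := key h.ne sb b (fun ht => (mem_pts_of_vq h sb sr st sl (hRm.1 ht)).1 (e _ _ _).le)
    fun {t} ht => hRm.2 (.inl (.inl (.inl ⟨t, ht, rfl⟩)))
  have f2 : Xr = Sr := key h.rot.ne sr r (fun ht => (mem_pts_of_vq h sb sr st sl (hRm.1 ht)).2.1 (e _ _ _).le)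
    fun {t} ht => hRm.2 (.inl (.inl (.inr ⟨t, ht, rfl⟩)))
  have f3 : Xt = St := key h.rot.rot.ne.symm st t
    (fun ht => (mem_pts_of_vq h sb sr st sl (hRm.1 ht)).2.2.1 (e' _ _ _).le)
    fun {t} ht => hRm.2 (.inl (.inr ⟨t, ht, rfl⟩))
  have f4 : Xl = Sl := key h.rot.rot.rot.ne.symm sl l
    (fun ht => (mem_pts_of_vq h sb sr st sl (hRm.1 ht)).2.2.2 (e' _ _ _).le)
    fun {t} ht => hRm.2 (.inr ⟨t, ht, rfl⟩)
  rw [f1, f2, f3, f4]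
  exact ⟨cb, cr, ct, cl⟩

/-- As `j ≤ 2`, the product of `1 + a + j` and `2 * N₀ + b` is at most a constant times `(1 + a) *
(1 + b)`. -/
lemma chain_total {A N₀ n N a b j y : ℕ} (h₁ : n ≤ N) (h₂ : j ≤ 2) (h₃ : y ≤ 2 * N₀ + b) :
    A * (n + (a + j)) + A * (1 + (a + j)) * y ≤
      (3 * A * (1 + 2 * N₀) + 60 * (N₀ + 1)) * (N + (1 + a) * (1 + b)) := by
  have e1 : A * (n + (a + j)) ≤ A * N + A * (a + 3) * 1 := by
    rw [mul_one, ← mul_add]; exact Nat.mul_le_mul_left _ (by omega)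
  have e2 : A * (1 + (a + j)) * y ≤ A * (a + 3) * (2 * N₀ + b) :=
    Nat.mul_le_mul (Nat.mul_le_mul_left _ (by omega)) h₃
  have e3 : A * (a + 3) * (1 + (2 * N₀ + b)) ≤ A * (3 * (1 + a)) * ((1 + 2 * N₀) * (1 + b)) :=
    Nat.mul_le_mul (Nat.mul_le_mul_left _ (by omega)) (by
      rw [show (1 + 2 * N₀) * (1 + b) = 1 + (2 * N₀ + b) + 2 * (N₀ * b) by ring]; omega)
  have e4 : A * N ≤ 3 * A * (1 + 2 * N₀) * N := Nat.mul_le_mul_right _ (by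
    rw [show 3 * A * (1 + 2 * N₀) = A + (2 * A + 6 * (A * N₀)) by ring]; omega)
  rw [mul_add] at e3
  calc A * (n + (a + j)) + A * (1 + (a + j)) * y
      ≤ 3 * A * (1 + 2 * N₀) * N + A * (3 * (1 + a)) * ((1 + 2 * N₀) * (1 + b)) := by omega
    _ = (3 * A * (1 + 2 * N₀)) * (N + (1 + a) * (1 + b)) := by ring
    _ ≤ _ := Nat.mul_le_mul_right _ (Nat.le_add_right _ _)

/-- Nice quadrilaterals become sinks after adding boundary points; the sides are `q 0 q 1, …, q 3 q 0`
and the last one is the shortest. -/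
theorem exists_sink_points : ∃ C : ℕ, ∀ q : Fin 4 → ℂ, Nq (q 0) (q 1) (q 2) (q 3) →
    (∀ i, dist (q 3) (q 0) ≤ dist (q i) (q (i + 1))) →
    ∃ (R : Finset ℂ) (N : ℕ), range q ⊆ (R : Set ℂ) ∧ (R : Set ℂ) ⊆ polyCurve q ∧ R.card = 4 + N ∧ Even N ∧ 1 ≤ N ∧
      (N : ℝ) ≤ C * (dist (q 0) (q 1) / dist (q 3) (q 0)) ∧
      ∀ R' : Finset ℂ, R ⊆ R' → (R' : Set ℂ) ⊆ polyCurve q → Even R'.card → ∃ T, IsMesh T (tile q) R' ∧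
        T.card ≤ C * (N + (1 + (((R' : Set ℂ) \ R) ∩ (polyEdge q 0 ∪ polyEdge q 2)).ncard) *
          (1 + (((R' : Set ℂ) \ R) ∩ (polyEdge q 1 ∪ polyEdge q 3)).ncard)) := by
  obtain ⟨N₀, A, hchain⟩ := exists_chain
  refine ⟨3 * A * (1 + 2 * N₀) + 60 * (N₀ + 1), ?_⟩
  intro q h hs
  have hc := h.ccw
  have dn : ∀ x y : ℂ, ‖y - x‖ = dist x y := fun x y => by rw [dist_comm, dist_eq_norm]
  obtain ⟨n, hn, -, Xb, Xr, Xt, Xl, ⟨sb, sr, st, sl⟩, ⟨c1, c2, c3, c4⟩, hG⟩ := hchain (q 0) (q 1) (q 2) (q 3) h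
    (by rw [dn, dn, dist_comm (q 0) (q 3)]; exact hs 0) (by rw [dn, dn, dist_comm (q 0) (q 3)]; exact hs 1)
    (by rw [dn, dn, dist_comm (q 0) (q 3), dist_comm (q 3) (q 2)]; exact hs 2)
  rw [dn, dn, dist_comm (q 0) (q 3)] at hn
  have m1 := sb.one_lt_card; have m2 := sr.one_lt_card; have m3 := st.one_lt_card; have m4 := sl.one_lt_card
  -- One or two further points on the bottom make `N` even and positive. Evenness lets an even
  -- number of later points preserve the parity; positivity absorbs additive constants into `N`.
  obtain ⟨j, hj1, hj2, hj⟩ : ∃ j, 1 ≤ j ∧ j ≤ 2 ∧ Even (Xb.card + j + Xr.card + Xt.card + Xl.card) := by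
    rcases Nat.even_or_odd (Xb.card + Xr.card + Xt.card + Xl.card) with he | he
    · exact ⟨2, by norm_num, le_rfl, by rw [Nat.even_iff] at *; omega⟩
    · exact ⟨1, le_rfl, by norm_num, by rw [Nat.odd_iff] at he; rw [Nat.even_iff]; omega⟩
  obtain ⟨Yb, sY, hXY, hYc⟩ := sb.exists_card_eq j
  obtain ⟨R, hRv, hqR, hRq⟩ := exists_vertices q sY sr st sl
  obtain ⟨d1, d2, d3, d4⟩ := cnt_of_vq hc sY sr st sl hRv hqR
  have hRc := card_eq_sum_cnt hc.isSimplePolygon hqR hRq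
  simp only [Fin.sum_univ_four] at hRc
  refine ⟨R, Yb.card + Xr.card + Xt.card + Xl.card - 8, hqR, hRq, by omega, by rw [Nat.even_iff] at *; omega,
    by omega, ?_, ?_⟩
  · have pd : 0 < dist (q 3) (q 0) := dist_pos.2 hc.rot.rot.rot.ne
    have hx : 1 ≤ dist (q 0) (q 1) / dist (q 3) (q 0) := by rw [one_le_div pd]; exact hs 0
    generalize dist (q 0) (q 1) / dist (q 3) (q 0) = x at *
    have b1 : Yb.card + Xr.card + Xt.card + Xl.card - 8 ≤ 2 * N₀ * n + 2 * N₀ := by omega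
    have b2 : ((Yb.card + Xr.card + Xt.card + Xl.card - 8 : ℕ) : ℝ) ≤ 2 * N₀ * n + 2 * N₀ := by exact_mod_cast b1
    refine b2.trans ?_
    push_cast
    have b3 : (0 : ℝ) ≤ N₀ := Nat.cast_nonneg _
    have b4 : 2 * (N₀ : ℝ) * n ≤ 2 * N₀ * (28 * x + 1) := by gcongr
    have b5 : 0 ≤ 3 * (A : ℝ) * (1 + 2 * N₀) * x := by positivity
    nlinarith
  · intro R' hRR hR' hev
    have hqR' : range q ⊆ (R' : Set ℂ) := hqR.trans (by exact_mod_cast hRR)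
    obtain ⟨Sb, Sr, St, Sl, ⟨tb, tr, tt, tl⟩, ⟨gb, gr, gt, gl⟩, k1, k2, k3, k4⟩ := exists_sideSets hc hqR'
    have hRc' := card_eq_sum_cnt hc.isSimplePolygon hqR' hR'
    simp only [Fin.sum_univ_four] at hRc'
    have e1 := cnt_add_ncard hc.isSimplePolygon hRR (show (0 : Fin 4) ≠ 2 by decide)
    have e2 := cnt_add_ncard hc.isSimplePolygon hRR (show (1 : Fin 4) ≠ 3 by decide)
    generalize (((R' : Set ℂ) \ R) ∩ (polyEdge q 0 ∪ polyEdge q 2)).ncard = a at *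
    generalize (((R' : Set ℂ) \ R) ∩ (polyEdge q 1 ∪ polyEdge q 3)).ncard = b at *
    have hmem : ∀ {z}, z ∈ vq (q 0) (q 1) (q 2) (q 3) Yb Xr Xt Xl → z ∈ R' := fun {z} hz => hRR (by
      rw [← Finset.mem_coe, hRv]; exact hz)
    have q1 := hG Sb Sr St Sl (a + j) tb tr tt tl
      (fun t ht => (gb t).2 ⟨sb.nonneg t ht, sb.le_one t ht, hmem (.inl (.inl (.inl ⟨t, hXY ht, rfl⟩)))⟩)
      (fun t ht => (gr t).2 ⟨sr.nonneg t ht, sr.le_one t ht, hmem (.inl (.inl (.inr ⟨t, ht, rfl⟩)))⟩)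
      (fun t ht => (gt t).2 ⟨st.nonneg t ht, st.le_one t ht, hmem (.inl (.inr ⟨t, ht, rfl⟩))⟩)
      (fun t ht => (gl t).2 ⟨sl.nonneg t ht, sl.le_one t ht, hmem (.inr ⟨t, ht, rfl⟩)⟩)
      (by rw [Nat.even_iff] at *; omega) (by omega) (.inr rfl)
    obtain ⟨T, hT, hcard⟩ : Meshable (tile q) R' _ := Meshable.congr q1.qm fun z _ => mem_vq_iff hc hR' gb gr gt gl z
    refine ⟨T, hT, hcard.trans ?_⟩
    have g1 : n ≤ Yb.card + Xr.card + Xt.card + Xl.card - 8 := by omega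
    have g2 : 1 * Sl.card + Sr.card ≤ 2 * N₀ + b := by omega
    generalize Yb.card + Xr.card + Xt.card + Xl.card - 8 = N at *
    exact chain_total g1 hj2 g2

/-- `p` is a relabelling of the corners of `q` that respects the pairs of opposite sides. -/
structure Relabels (p q : Fin 4 → ℂ) : Prop where
  range_eq : range p = range q
  curve_eq : polyCurve p = polyCurve q
  dist_eq : ∀ i, ∃ j, dist (p i) (p (i + 1)) = dist (q j) (q (j + 1))
  sides : (polyEdge p 0 ∪ polyEdge p 2 = polyEdge q 0 ∪ polyEdge q 2 ∧
      polyEdge p 1 ∪ polyEdge p 3 = polyEdge q 1 ∪ polyEdge q 3) ∨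
    (polyEdge p 0 ∪ polyEdge p 2 = polyEdge q 1 ∪ polyEdge q 3 ∧
      polyEdge p 1 ∪ polyEdge p 3 = polyEdge q 0 ∪ polyEdge q 2)

lemma Relabels.refl (q : Fin 4 → ℂ) : Relabels q q := ⟨rfl, rfl, fun i => ⟨i, rfl⟩, .inl ⟨rfl, rfl⟩⟩

lemma Relabels.trans {p q r : Fin 4 → ℂ} (h : Relabels p q) (h' : Relabels q r) : Relabels p r where
  range_eq := h.range_eq.trans h'.range_eq
  curve_eq := h.curve_eq.trans h'.curve_eq
  dist_eq i := by
    obtain ⟨j, hj⟩ := h.dist_eq i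
    obtain ⟨k, hk⟩ := h'.dist_eq j
    exact ⟨k, hj.trans hk⟩
  sides := by
    rcases h.sides with ⟨a, b⟩ | ⟨a, b⟩ <;> rcases h'.sides with ⟨c, d⟩ | ⟨c, d⟩
    · exact .inl ⟨a.trans c, b.trans d⟩
    · exact .inr ⟨a.trans c, b.trans d⟩
    · exact .inr ⟨a.trans d, b.trans c⟩
    · exact .inl ⟨a.trans d, b.trans c⟩

lemma Relabels.shift (q : Fin 4 → ℂ) (c : Fin 4) : Relabels (fun i => q (i + c)) q where
  range_eq := range_shift (m := 3) q c
  curve_eq := polyCurve_shift (m := 3) q c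
  dist_eq i := ⟨i + c, by rw [add_right_comm]⟩
  sides := by
    simp only [polyEdge_shift (m := 3) q c]
    fin_cases c
    · exact .inl ⟨rfl, rfl⟩
    · exact .inr ⟨rfl, union_comm _ _⟩
    · exact .inl ⟨union_comm _ _, union_comm _ _⟩
    · exact .inr ⟨union_comm _ _, rfl⟩

lemma Relabels.reverse (q : Fin 4 → ℂ) : Relabels ![q 3, q 2, q 1, q 0] q := by
  have e0 : polyEdge ![q 3, q 2, q 1, q 0] 0 = polyEdge q 2 := by
    rw [polyEdge_four, polyEdge_four, openSegment_symm]; rfl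
  have e1 : polyEdge ![q 3, q 2, q 1, q 0] 1 = polyEdge q 1 := by
    rw [polyEdge_four, polyEdge_four, openSegment_symm]; rfl
  have e2 : polyEdge ![q 3, q 2, q 1, q 0] 2 = polyEdge q 0 := by
    rw [polyEdge_four, polyEdge_four, openSegment_symm]; rfl
  have e3 : polyEdge ![q 3, q 2, q 1, q 0] 3 = polyEdge q 3 := by
    rw [polyEdge_four, polyEdge_four, openSegment_symm]; rfl
  have hr : range ![q 3, q 2, q 1, q 0] = range q := by
    have : ![q 3, q 2, q 1, q 0] = q ∘ Fin.rev := by ext i; fin_cases i <;> rfl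
    rw [this]; exact Fin.rev_surjective.range_comp q
  refine ⟨hr, ?_, ?_, .inl ⟨by rw [e0, e2, union_comm], by rw [e1, e3]⟩⟩
  · rw [polyCurve, polyCurve, hr]
    congr 1
    ext z
    simp only [mem_iUnion, Fin.exists_fin_succ]
    simp [e0, e1, e2, e3]
    tauto
  · intro i
    refine ⟨2 - i, ?_⟩
    rw [dist_comm]
    fin_cases i <;> rfl

/-- Counterclockwise labelling of a nice quadrilateral with the last side the shortest one. -/
lemma IsNiceQuad.exists_relabelling {Q : Fin 4 → ℂ} (h : IsNiceQuad Q) : ∃ p : Fin 4 → ℂ,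
    Nq (p 0) (p 1) (p 2) (p 3) ∧ Relabels p Q ∧ (∀ i, dist (p 3) (p 0) ≤ dist (p i) (p (i + 1))) ∧
      dist (p 0) (p 1) / dist (p 3) (p 0) ≤ eccentricity Q := by
  obtain ⟨q, hq, hqQ⟩ : ∃ q : Fin 4 → ℂ, Nq (q 0) (q 1) (q 2) (q 3) ∧ Relabels q Q := by
    rcases h.nq_or_nq with h | h
    exacts [⟨Q, h, .refl Q⟩, ⟨![Q 3, Q 2, Q 1, Q 0], h, .reverse Q⟩]
  obtain ⟨j, hj⟩ := Finite.exists_min fun i => dist (q i) (q (i + 1))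
  -- Shifting the labels by `c` makes the shortest side the last one.
  have hc : ∃ c : Fin 4, 3 + c = j := ⟨j - 3, by abel⟩
  obtain ⟨c, rfl⟩ := hc
  have hR := (Relabels.shift q c).trans hqQ
  refine ⟨fun i => q (i + c), ?_, hR, ?_, ?_⟩
  · have := hq.cyc c
    simp only [add_comm _ c, add_zero]
    exact this
  · intro i
    have := hj (i + c)
    have e : 3 + c + 1 = 0 + c := by rw [add_right_comm]; rfl
    simp only [e] at this
    rwa [add_right_comm] at this
  · have hpos : 0 < ⨅ i, dist (Q i) (Q (i + 1)) := by
      obtain ⟨i, hi⟩ := exists_eq_ciInf_of_finite (f := fun i => dist (Q i) (Q (i + 1)))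
      rw [← hi]
      refine dist_pos.2 fun he => ?_
      have := h.simple.injective he
      revert this; clear * -; revert i; decide
    obtain ⟨k, hk⟩ := hR.dist_eq 0
    obtain ⟨l, hl⟩ := hR.dist_eq 3
    have hk' : dist (q (0 + c)) (q (1 + c)) = dist (Q k) (Q (k + 1)) := hk
    have hl' : dist (q (3 + c)) (q (0 + c)) = dist (Q l) (Q (l + 1)) := hl
    simp only [hk', hl']
    have s1 : dist (Q k) (Q (k + 1)) ≤ ⨆ i, dist (Q i) (Q (i + 1)) :=
      le_ciSup (f := fun i => dist (Q i) (Q (i + 1))) (Finite.bddAbove_range _) k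
    have s2 : ⨅ i, dist (Q i) (Q (i + 1)) ≤ dist (Q l) (Q (l + 1)) :=
      ciInf_le (f := fun i => dist (Q i) (Q (i + 1))) (Finite.bddBelow_range _) l
    exact div_le_div₀ (dist_nonneg.trans s1) s1 hpos s2

end SinkMesh

theorem mainTheorem3 :
    ∃ C : ℝ, 0 < C ∧ ∀ Q : Fin 4 → ℂ, IsNiceQuad Q →
      ∃ (N : ℕ) (Q' : Fin (4 + N) → ℂ),
        AddsVertices Q Q' ∧ (N : ℝ) ≤ C * eccentricity Q ∧ IsSink Q' ∧
        ∀ (M : ℕ) (Q'' : Fin (4 + N + M) → ℂ), Even M → AddsVertices Q' Q'' →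
          ∃ Γ : PSLG, Γ.IsNiceQuadMesh Q'' ∧ Γ.Extends Q'' ∧ Γ.faces.Finite ∧
            (Γ.faces.ncard : ℝ) ≤ C * ((N : ℝ) + (M : ℝ) ^ 2) ∧
            ∀ M₁ M₂ : ℕ, 1 ≤ M₁ → 1 ≤ M₂ →
              (addedOnSides Q Q' Q'' 0 2).ncard ≤ M₁ →
              (addedOnSides Q Q' Q'' 1 3).ncard ≤ M₂ →
              (Γ.faces.ncard : ℝ) ≤ C * ((N : ℝ) + (M₁ : ℝ) * (M₂ : ℝ)) := by
  classical
  obtain ⟨C, hC⟩ := exists_sink_points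
  -- The factor 4 covers the passage from `(1 + x) * (1 + y)` to `x * y`; the summand 1 makes the
  -- constant positive.
  refine ⟨4 * C + 1, by positivity, ?_⟩
  intro Q hQ
  obtain ⟨p, hp, hpQ, hmin, hecc⟩ := hQ.exists_relabelling
  obtain ⟨R, N, hpR, hRp, hRc, hNe, hN1, hNC, hmesh⟩ := hC p hp hmin
  obtain ⟨k, Q', hQ', hr⟩ := exists_addsVertices hQ.simple R (by rw [← hpQ.curve_eq]; exact hRp)
  rw [union_eq_self_of_subset_left (by rw [← hpQ.range_eq]; exact hpR)] at hr
  obtain rfl : k = N := by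
    have h1 : (range Q').ncard = 4 + k := by
      rw [← image_univ, ncard_image_of_injective _ hQ'.simple.injective, ncard_univ, Nat.card_fin]
    rw [hr, ncard_coe_finset] at h1
    omega
  have hecc' : (k : ℝ) ≤ C * eccentricity Q := hNC.trans (by gcongr)
  have hN1' : (1 : ℝ) ≤ k := by exact_mod_cast hN1
  have hC0 : (0 : ℝ) ≤ C := Nat.cast_nonneg _
  have main : ∀ (M : ℕ) (Q'' : Fin (4 + k + M) → ℂ), Even M → AddsVertices Q' Q'' →
      ∃ Γ : PSLG, Γ.IsNiceQuadMesh Q'' ∧ Γ.Extends Q'' ∧ Γ.faces.Finite ∧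
        (Γ.faces.ncard : ℝ) ≤ (4 * C + 1) * ((k : ℝ) + (M : ℝ) ^ 2) ∧
        ∀ M₁ M₂ : ℕ, 1 ≤ M₁ → 1 ≤ M₂ → (addedOnSides Q Q' Q'' 0 2).ncard ≤ M₁ →
          (addedOnSides Q Q' Q'' 1 3).ncard ≤ M₂ →
          (Γ.faces.ncard : ℝ) ≤ (4 * C + 1) * ((k : ℝ) + (M₁ : ℝ) * (M₂ : ℝ)) := by
    intro M Q'' hM hQ''
    obtain ⟨R', hR'⟩ : ∃ R' : Finset ℂ, (R' : Set ℂ) = range Q'' := ⟨Finset.univ.image Q'', by simp⟩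
    have hcard : R'.card = 4 + k + M := by
      rw [← ncard_coe_finset, hR', ← image_univ, ncard_image_of_injective _ hQ''.simple.injective, ncard_univ,
        Nat.card_fin]
    have hcurve : polyCurve Q'' = polyCurve p := by rw [hQ''.curve_eq, hQ'.curve_eq, hpQ.curve_eq]
    have hRR : R ⊆ R' := by
      rw [← Finset.coe_subset, hR', ← hr]; exact hQ''.subset
    obtain ⟨T, hT, hTc⟩ := hmesh R' hRR (by rw [hR', ← hcurve]; exact subset_union_left)
      (by rw [hcard]; exact (((by decide : Even 4).add hNe).add hM))
    obtain ⟨Γ, hΓ, hext, hfin, hnum⟩ := IsMesh.exists_isNiceQuadMesh (w := Q'') hT hp.ccw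
      (by rw [hcurve, polyCurve_eq_frontier hp.ccw]; rfl) hR'.symm
    have hsdiff : ∀ s : Set ℂ, (((R' : Set ℂ) \ R) ∩ s).ncard ≤ M := by
      intro s
      refine (ncard_le_ncard inter_subset_left (R'.finite_toSet.sdiff)).trans ?_
      rw [← Finset.coe_sdiff, ncard_coe_finset, Finset.card_sdiff_of_subset hRR]
      omega
    have bound : ∀ x y : ℕ, (((R' : Set ℂ) \ R) ∩ (polyEdge p 0 ∪ polyEdge p 2)).ncard ≤ x →
        (((R' : Set ℂ) \ R) ∩ (polyEdge p 1 ∪ polyEdge p 3)).ncard ≤ y →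
        (Γ.faces.ncard : ℝ) ≤ C * (k + (1 + x) * (1 + y)) := by
      intro x y hx hy
      have : Γ.faces.ncard ≤ C * (k + (1 + x) * (1 + y)) := hnum.trans (hTc.trans (by gcongr))
      exact_mod_cast this
    refine ⟨Γ, hΓ, hext, hfin, ?_, ?_⟩
    · refine (bound M M (hsdiff _) (hsdiff _)).trans ?_
      -- `(1 + M)²` is at most `2 + 2 * M²`, and the constant 2 is absorbed since `k ≥ 1`. This also
      -- covers `M = 0`.
      have h1 : (k : ℝ) + (1 + M) * (1 + M) ≤ 4 * (k + (M : ℝ) ^ 2) := by nlinarith [sq_nonneg ((M : ℝ) - 1)]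
      have h2 := mul_le_mul_of_nonneg_left h1 hC0
      have h3 : 0 ≤ (k : ℝ) + (M : ℝ) ^ 2 := by positivity
      linarith
    · intro M₁ M₂ h₁ h₂ a₁ a₂
      have f₁ : (1 : ℝ) ≤ M₁ := by exact_mod_cast h₁
      have f₂ : (1 : ℝ) ≤ M₂ := by exact_mod_cast h₂
      rw [addedOnSides, ← hR', hr] at a₁ a₂
      have h1 : (Γ.faces.ncard : ℝ) ≤ C * (k + (1 + M₁) * (1 + M₂)) := by
        -- The relabelling may have exchanged the two pairs of opposite sides; the bound is
        -- symmetric in them.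
        rcases hpQ.sides with ⟨s₁, s₂⟩ | ⟨s₁, s₂⟩
        · exact bound M₁ M₂ (by rw [s₁]; exact a₁) (by rw [s₂]; exact a₂)
        · rw [mul_comm (1 + (M₁ : ℝ))]
          exact bound M₂ M₁ (by rw [s₁]; exact a₂) (by rw [s₂]; exact a₁)
      have h2 : (k : ℝ) + (1 + M₁) * (1 + M₂) ≤ 4 * (k + (M₁ : ℝ) * M₂) := by nlinarith
      have h3 := mul_le_mul_of_nonneg_left h2 hC0
      have h4 : 0 ≤ (k : ℝ) + (M₁ : ℝ) * M₂ := by positivity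
      linarith
  refine ⟨k, Q', hQ', ?_, ⟨hQ'.simple, ?_⟩, main⟩
  · have : 0 ≤ eccentricity Q := le_trans (by positivity) hecc
    nlinarith
  · intro M w hM hw
    obtain ⟨Γ, h1, h2, -⟩ := main M w hM hw
    exact ⟨Γ, h1, h2⟩
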